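/- Let letters, variables and data values be named by natural numbers. Regular expressions with binding (REWBs) are given by $$r ::= \varepsilon \mid a \mid a[c] \mid r+r \mid r\cdot r \mid r^* \mid a{\downarrow_x}(r),$$ where $a$ is a letter, $x$ a variable, and $c$ a Boolean combination of atoms $x^{=}$, $x^{\neq}$. A data word is a finite sequence of pairs (letter, data value). For a partial valuation $\nu$ of the variables that is defined on the free variables of $r$, the language $L(r,\nu)$ of data words is defined inductively: $L(\varepsilon,\nu)=\{\varepsilon\}$; $L(a,\nu)$ is the set of all one-letter words $\binom{a}{d}$; $L(a[c],\nu)$ is the set of those $\binom{a}{d}$ with $d,\nu\models c$ (where $x^{=}$ means $\nu(x)=d$ and $x^{\neq}$ means $\nu(x)\neq d$); $+,\cdot,{}^*$ are union, concatenation and Kleene star; and $L(a{\downarrow_x}(r),\nu)=\bigcup_d \binom{a}{d}\cdot L(r,\nu[x\mapsto d])$. A data graph is a finite set of vertices with a finite set of directed edges, each labelled by a pair (letter, data value). An instance of REWB query evaluation consists of a data graph $G$, a REWB $e$, a finite partial valuation $\nu$ defined (at least) on the free variables of $e$, and two nodes $u,v$ of $G$; it is positive if some (possibly empty) directed path of $G$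 from $u$ to $v$ is labelled by a word of $L(e,\nu)$. Instances are encoded as words $x$ over a fixed finite alphabet: one mark per vertex, a listing of the edges, $e$ in prefix notation, a listing of the graph of $\nu$, then $u$ and $v$, where names of vertices, letters, variables and data values are written in binary. The size of $e$ is the number of nodes of its syntax tree, those of its conditions included. A parameterized problem $Q\subseteq A^*\times\mathbb{N}$ over a finite alphabet $A$ is in uniform-XNL if there are a computable function $f:\mathbb{N}\to\mathbb{N}$ and a single nondeterministic Turing machine, with a two-way read-only input tape holding $x$ and $k$ (the latter in unary) between end markers and finitely many work tapes, such that for every $(x,k)\in A^*\times\mathbb{N}$: every computation of the machine on $(x,k)$ halts; some computation accepts if and only if $(x,k)\in Q$; and in all computations at most $f(k)\cdot\log_2|x|$ work-tape cells are visited (the logarithm is rounded down, and read as $1$ if $|x|\le 1$). **Theorem.** Evaluation of (arbitrary) REWB queries, parameterized by the size of the query, is in uniform-XNL: the set of all pairs $(x,k)$ such that $x$ encodes a positive instance of REWB query evaluation whose query has size $k$ belongs to uniform-XNL. -/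

import Mathlib

open scoped Computability

/-! ### Regular expressions with binding (REWB)

Letters, variables and data values are named by natural numbers. An expression and a finite data
graph mention only finitely many letters, so every finite alphabet is covered at once. -/

namespace REWB

/-- Conditions: Boolean combinations of the atoms `x⁼` and `x^≠`. -/
inductive Cond : Type
  | eq (x : ℕ)
  | ne (x : ℕ)
  | and (c₁ c₂ : Cond)
  | or (c₁ c₂ : Cond)
  | not (c : Cond)

/-- A partial valuation of the variables. -/
abbrev Valuation : Type := ℕ → Option ℕ

/-- `c.Sat d ν` is `d, ν ⊨ c`. -/
def Cond.Sat (d : ℕ) (ν : Valuation) : Cond → Prop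
  | .eq x => ν x = some d
  | .ne x => ν x ≠ some d
  | .and c₁ c₂ => c₁.Sat d ν ∧ c₂.Sat d ν
  | .or c₁ c₂ => c₁.Sat d ν ∨ c₂.Sat d ν
  | .not c => ¬ c.Sat d ν

/-- The variables that occur in a condition. -/
def Cond.vars : Cond → Finset ℕ
  | .eq x => {x}
  | .ne x => {x}
  | .and c₁ c₂ => c₁.vars ∪ c₂.vars
  | .or c₁ c₂ => c₁.vars ∪ c₂.vars
  | .not c => c.vars

/-- Number of nodes of the syntax tree. -/
def Cond.size : Cond → ℕ
  | .eq _ => 1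
  | .ne _ => 1
  | .and c₁ c₂ => c₁.size + c₂.size + 1
  | .or c₁ c₂ => c₁.size + c₂.size + 1
  | .not c => c.size + 1

/-- `r ::= ε | a | a[c] | r + r | r · r | r* | a ↓ₓ (r)` -/
inductive Expr : Type
  | eps
  | letter (a : ℕ)
  | test (a : ℕ) (c : Cond)
  | plus (r₁ r₂ : Expr)
  | cat (r₁ r₂ : Expr)
  | star (r : Expr)
  | bind (a x : ℕ) (r : Expr)

/-- Free variables. -/
def Expr.fv : Expr → Finset ℕ
  | .eps => ∅
  | .letter _ => ∅
  | .test _ c => c.vars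
  | .plus r₁ r₂ => r₁.fv ∪ r₂.fv
  | .cat r₁ r₂ => r₁.fv ∪ r₂.fv
  | .star r => r.fv
  | .bind _ x r => r.fv.erase x

/-- Size of an expression: the number of nodes of its syntax tree. -/
def Expr.size : Expr → ℕ
  | .eps => 1
  | .letter _ => 1
  | .test _ c => c.size + 1
  | .plus r₁ r₂ => r₁.size + r₂.size + 1
  | .cat r₁ r₂ => r₁.size + r₂.size + 1
  | .star r => r.size + 1
  | .bind _ _ r => r.size + 1

/-- Data words: finite sequences of pairs (letter, data value). -/
abbrev DataWord : Type := List (ℕ × ℕ)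

/-- The data language `L(r, ν)`. -/
def Expr.lang : Expr → Valuation → Language (ℕ × ℕ)
  | .eps, _ => 1
  | .letter a, _ => {w : DataWord | ∃ d, w = [(a, d)]}
  | .test a c, ν => {w : DataWord | ∃ d, c.Sat d ν ∧ w = [(a, d)]}
  | .plus r₁ r₂, ν => r₁.lang ν + r₂.lang ν
  | .cat r₁ r₂, ν => r₁.lang ν * r₂.lang ν
  | .star r, ν => (r.lang ν)∗
  | .bind a x r, ν =>
      {w : DataWord | ∃ d, ∃ w' ∈ r.lang (Function.update ν x (some d)), w = (a, d) :: w'}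

/-! ### Data graphs and the query evaluation problem -/

/-- A finite data graph with vertex set `Fin n`; an edge is a tuple
(source, letter, data value, target). -/
structure DataGraph (n : ℕ) : Type where
  edges : Finset (Fin n × ℕ × ℕ × Fin n)

/-- `G.IsDataPath u w v`: some path of `G` from `u` to `v` carries the data word `w`. -/
inductive DataGraph.IsDataPath {n : ℕ} (G : DataGraph n) : Fin n → DataWord → Fin n → Prop
  | nil (u : Fin n) : G.IsDataPath u [] u
  | cons {u v t : Fin n} {a d : ℕ} {w : DataWord} :
      (u, a, d, v) ∈ G.edges → G.IsDataPath v w t → G.IsDataPath u ((a, d) :: w) t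

/-- Instances of query evaluation: a data graph, an expression, a valuation that is defined on
its free variables, and a pair of nodes. -/
structure Instance : Type where
  n : ℕ
  graph : DataGraph n
  query : Expr
  val : Valuation
  compatible : ∀ x ∈ query.fv, (val x).isSome
  src : Fin n
  tgt : Fin n

/-- The source is connected to the target by a data path in `L(query, val)`. -/
def Instance.IsYes (I : Instance) : Prop :=
  ∃ w ∈ I.query.lang I.val, I.graph.IsDataPath I.src w I.tgt

/-! ### Encoding of instances as words over a finite alphabet -/

/-- The symbols used to write down instances. -/
inductive Sym : Type
  | vertex | edge | entry
  | bit0 | bit1 | numEnd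
  | eps | letter | test | plus | cat | star | bind
  | eq | ne | and | or | not
  deriving DecidableEq

instance : Finite Sym :=
  Finite.of_surjective
    (fun i : Fin 18 => ([.vertex, .edge, .entry, .bit0, .bit1, .numEnd, .eps, .letter, .test, .plus,
      .cat, .star, .bind, .eq, .ne, .and, .or, .not] : List Sym)[i.1]'i.2)
    (fun s => by cases s <;> decide)

/-- Binary numeral (least significant digit first), closed by an end mark. -/
def encNat (m : ℕ) : List Sym :=
  m.bits.map (fun b => if b then Sym.bit1 else Sym.bit0) ++ [Sym.numEnd]

/-- Prefix notation. -/
def encCond : Cond → List Sym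
  | .eq x => Sym.eq :: encNat x
  | .ne x => Sym.ne :: encNat x
  | .and c₁ c₂ => Sym.and :: (encCond c₁ ++ encCond c₂)
  | .or c₁ c₂ => Sym.or :: (encCond c₁ ++ encCond c₂)
  | .not c => Sym.not :: encCond c

/-- Prefix notation. -/
def encExpr : Expr → List Sym
  | .eps => [Sym.eps]
  | .letter a => Sym.letter :: encNat a
  | .test a c => Sym.test :: (encNat a ++ encCond c)
  | .plus r₁ r₂ => Sym.plus :: (encExpr r₁ ++ encExpr r₂)
  | .cat r₁ r₂ => Sym.cat :: (encExpr r₁ ++ encExpr r₂)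
  | .star r => Sym.star :: encExpr r
  | .bind a x r => Sym.bind :: (encNat a ++ encNat x ++ encExpr r)

def encEdge {n : ℕ} (e : Fin n × ℕ × ℕ × Fin n) : List Sym :=
  Sym.edge :: (encNat e.1 ++ encNat e.2.1 ++ encNat e.2.2.1 ++ encNat e.2.2.2)

def encEntry (p : ℕ × ℕ) : List Sym :=
  Sym.entry :: (encNat p.1 ++ encNat p.2)

/-- `x` is an encoding of the instance `I`: one mark per vertex, a listing of the edges, the
expression, a listing of the graph of the valuation, the source and the target. -/
def Encodes (x : List Sym) (I : Instance) : Prop :=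
  ∃ (es : List (Fin I.n × ℕ × ℕ × Fin I.n)) (vs : List (ℕ × ℕ)),
    (∀ e, e ∈ es ↔ e ∈ I.graph.edges) ∧
    (∀ y d, (y, d) ∈ vs ↔ I.val y = some d) ∧
    x = List.replicate I.n Sym.vertex ++ es.flatMap encEdge ++ encExpr I.query ++
      vs.flatMap encEntry ++ encNat I.src ++ encNat I.tgt

end REWB

/-! ### Nondeterministic Turing machines with a read-only input tape -/

namespace XNL

inductive Move : Type
  | left | stay | right

/-- New head position on a tape with cells `0, 1, 2, …`; a left move from cell `0` has no
effect. -/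
def Move.apply : Move → ℕ → ℕ
  | .left, p => p - 1
  | .stay, p => p
  | .right, p => p + 1

/-- Symbols on the input tape: two end markers, the letters of the word `x`, and the strokes that
present the parameter. -/
inductive InSym (α : Type) : Type
  | leftEnd
  | sym (a : α)
  | stroke
  | rightEnd

/-- A nondeterministic Turing machine with a two-way read-only input tape and finitely many
work tapes. From the state, the input symbol and the work symbols that are scanned, `trans` gives
the set of allowed actions: a new state, a move of the input head, and for each work tape a symbol
to write and a move. -/
structure NTM (α : Type) : Type 1 where
  State : Type
  [finiteState : Finite State]
  Symbol : Type
  [finiteSymbol : Finite Symbol]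
  tapes : ℕ
  blank : Symbol
  start : State
  accept : State
  trans : State → InSym α → (Fin tapes → Symbol) →
    Set (State × Move × (Fin tapes → Symbol × Move))

/-- The input tape for the pair `(x, k)`, the parameter written in unary. -/
def inputTape {α : Type} (x : List α) (k : ℕ) : List (InSym α) :=
  InSym.leftEnd :: (x.map InSym.sym ++ List.replicate k InSym.stroke ++ [InSym.rightEnd])

namespace NTM

variable {α : Type}

/-- Configurations: state, input head, contents of the work tapes and positions of their heads. -/
structure Cfg (M : NTM α) : Type where
  state : M.State
  inHead : ℕ
  work : Fin M.tapes → ℕ → M.Symbol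
  head : Fin M.tapes → ℕ

def init (M : NTM α) : M.Cfg where
  state := M.start
  inHead := 0
  work := fun _ _ => M.blank
  head := fun _ => 0

/-- One step on the input tape `t`. The input head cannot move beyond the end markers. -/
def Step (M : NTM α) (t : List (InSym α)) (c c' : M.Cfg) : Prop :=
  ∃ act ∈ M.trans c.state (t.getD c.inHead InSym.rightEnd) (fun i => c.work i (c.head i)),
    c' =
      { state := act.1
        inHead := min (act.2.1.apply c.inHead) (t.length - 1)
        work := fun i => Function.update (c.work i) (c.head i) (act.2.2 i).1
        head := fun i => (act.2.2 i).2.apply (c.head i) }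

/-- Reachability from the initial configuration. -/
def Reachable (M : NTM α) (t : List (InSym α)) (c : M.Cfg) : Prop :=
  Relation.ReflTransGen (M.Step t) M.init c

def Accepts (M : NTM α) (t : List (InSym α)) : Prop :=
  ∃ c, M.Reachable t c ∧ c.state = M.accept

/-- Every computation is finite, whatever the nondeterministic choices. -/
def Halts (M : NTM α) (t : List (InSym α)) : Prop :=
  ¬ ∃ c : ℕ → M.Cfg, c 0 = M.init ∧ ∀ j, M.Step t (c j) (c (j + 1))

/-- Whatever the nondeterministic choices, the work heads only visit initial segments of their
tapes with at most `s` cells in total. -/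
def UsesSpace (M : NTM α) (t : List (InSym α)) (s : ℕ) : Prop :=
  ∃ b : Fin M.tapes → ℕ, ∑ i, b i ≤ s ∧ ∀ c, M.Reachable t c → ∀ i, c.head i < b i

end NTM

/-- The class uniform-XNL of parameterized problems `Q ⊆ α* × ℕ`: for some computable `f`, one
nondeterministic machine decides `(x, k) ∈ Q` in space `f(k) · log₂ |x|` (the logarithm read as `1`
when `|x| ≤ 1`). -/
def InUniformXNL {α : Type} [Finite α] (Q : Set (List α × ℕ)) : Prop :=
  ∃ (M : NTM α) (f : ℕ → ℕ), Computable f ∧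
    ∀ (x : List α) (k : ℕ),
      M.Halts (inputTape x k) ∧
      (M.Accepts (inputTape x k) ↔ (x, k) ∈ Q) ∧
      M.UsesSpace (inputTape x k) (f k * max 1 (Nat.log 2 x.length))

end XNL

/-- Evaluation of REWB queries, parameterized by the size of the query: the pairs `(x, k)` such
that `x` encodes a positive instance whose query has size `k`. -/
def REWB.evalProblem : Set (List REWB.Sym × ℕ) :=
  {p | ∃ I : REWB.Instance, REWB.Encodes p.1 I ∧ p.2 = I.query.size ∧ I.IsYes}

/-! A query of size `k` is evaluated by a nondeterministic machine that walks through the graph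
while taking the query apart on a stack. A configuration consists of the current vertex and a stack
of items: subexpressions still to be matched, conditions still to be tested for a data value, and
frames that record the binding of a variable. A star is replaced by its body on top of the same
star, so iteration is unbounded although `k` items always suffice (`reaches_iff`). The frame of a
binder lies under its body; hence the value of a variable is found by searching the stack downwards
for the innermost frame, and in the given valuation if there is none (`lookup_iff`). Every vertex,
data value, subexpression and condition that occurs is written somewhere in the input, so it can be
represented by a position of the input tape. The configuration then consists of O(k) numbers of
logarithmic length.

It remains to recognise well-formed inputs and single steps within this space. Both are expressed by
predicates built from successor, input symbols and array entries by conjunction, disjunction,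
bounded quantifiers and transitive closure (`Dfn`). Programs for pointer machines test such
predicates: an existential quantifier is a guess, a universal one a loop, and a transitive closure a
guessed path of which only two points are stored. Negation is not available, so each negative fact
that is needed, such as the difference of two numerals, gets a positive definition of its own.
Parsing, comparison and evaluation of numerals, and the scoping of variables are all transitive
closures or local conditions of this kind, because numerals and prefix notation are uniquely
readable from their first position.

Pointer programs are regular programs over a small set of instructions. Each instruction is replaced
by a program for two work tapes, one with the registers as parallel tracks and one with the rows of
the array (`sem_bind`, `sem_impl`), and the finite automaton of the resulting program becomes the
finite control (`auto_iff_sem`).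

The class demands that every computation halts and respects the space bound, not only the accepting
ones. For space, a deterministic preparation counts the input tape in binary and lays out end marks
that no later action moves or crosses. For termination, a third tape carries a counter that is
advanced with every step and blocks the machine when it has run down. Its base is so large that it
outlasts the number of configurations; a shortest accepting computation repeats no configuration, so
none is lost (`table_accepts`). -/

namespace XNL

/-! ### Regular programs: relational semantics, substitution and automata. -/

open Relation

/-! ### Regular programs -/

/-- Regular programs over a set of atomic actions. -/
inductive Prog (A : Type) : Type
  | act (a : A)
  | nil
  | seq (p q : Prog A)
  | alt (p q : Prog A)
  | star (p : Prog A)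

namespace Prog

variable {A B σ τ : Type}

/-- Input-output relation of a program, given those of the actions. -/
def Sem (E : A → σ → σ → Prop) : Prog A → σ → σ → Prop
  | act a => E a
  | nil => fun s s' => s' = s
  | seq p q => Comp (p.Sem E) (q.Sem E)
  | alt p q => fun s s' => p.Sem E s s' ∨ q.Sem E s s'
  | star p => ReflTransGen (p.Sem E)

/-- All actions of the program satisfy `P`. -/
def All (P : A → Prop) : Prog A → Prop
  | act a => P a
  | nil => True
  | seq p q => p.All P ∧ q.All P
  | alt p q => p.All P ∧ q.All P
  | star p => p.All P

theorem All.mono {P Q : A → Prop} (h : ∀ a, P a → Q a) : ∀ {p : Prog A}, p.All P → p.All Q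
  | act _, hp => h _ hp
  | nil, _ => trivial
  | seq _ _, hp => ⟨All.mono h hp.1, All.mono h hp.2⟩
  | alt _ _, hp => ⟨All.mono h hp.1, All.mono h hp.2⟩
  | star p, hp => All.mono (p := p) h hp

/-- A program contains only finitely many actions, so bounds for the single actions have a common
upper bound. It later fixes the number of tracks on the work tapes. -/
theorem exists_all (P : ℕ → A → Prop) (hmono : ∀ m n a, m ≤ n → P m a → P n a)
    (hex : ∀ a, ∃ m, P m a) : ∀ p : Prog A, ∃ m, p.All (P m)
  | act a => hex a
  | nil => ⟨0, trivial⟩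
  | seq p q => by
    obtain ⟨m, hm⟩ := exists_all P hmono hex p
    obtain ⟨n, hn⟩ := exists_all P hmono hex q
    exact ⟨max m n, hm.mono fun a => hmono _ _ a (le_max_left _ _),
      hn.mono fun a => hmono _ _ a (le_max_right _ _)⟩
  | alt p q => by
    obtain ⟨m, hm⟩ := exists_all P hmono hex p
    obtain ⟨n, hn⟩ := exists_all P hmono hex q
    exact ⟨max m n, hm.mono fun a => hmono _ _ a (le_max_left _ _),
      hn.mono fun a => hmono _ _ a (le_max_right _ _)⟩
  | star p => exists_all P hmono hex p

/-- Substitution of programs for actions. -/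
def bind (f : A → Prog B) : Prog A → Prog B
  | act a => f a
  | nil => nil
  | seq p q => seq (p.bind f) (q.bind f)
  | alt p q => alt (p.bind f) (q.bind f)
  | star p => star (p.bind f)

theorem sem_preserves {E : A → σ → σ → Prop} {V : σ → Prop}
    (hE : ∀ a s s', V s → E a s s' → V s') :
    ∀ (p : Prog A) {s s'}, V s → p.Sem E s s' → V s'
  | act a, _, _, hs, h => hE a _ _ hs h
  | nil, _, _, hs, h => by cases h; exact hs
  | seq p q, _, _, hs, ⟨_, h₁, h₂⟩ => sem_preserves hE q (sem_preserves hE p hs h₁) h₂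
  | alt p q, _, _, hs, h =>
    h.elim (fun h => sem_preserves hE p hs h) (fun h => sem_preserves hE q hs h)
  | star p, _, _, hs, h => by
    induction h with
    | refl => exact hs
    | tail _ h₂ ih => exact sem_preserves hE p ih h₂

/-- If the substituted programs simulate the actions along `rep`, then the substituted program
simulates the program. -/
theorem sem_bind {E : A → σ → σ → Prop} {E' : B → τ → τ → Prop} {V : σ → Prop} {rep : σ → τ}
    {P : A → Prop} {f : A → Prog B} (hV : ∀ a s s', V s → E a s s' → V s')
    (hf : ∀ a, P a → ∀ s, V s → ∀ t,
      (f a).Sem E' (rep s) t ↔ ∃ s', E a s s' ∧ t = rep s') :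
    ∀ (p : Prog A), p.All P → ∀ s, V s → ∀ t,
      (p.bind f).Sem E' (rep s) t ↔ ∃ s', p.Sem E s s' ∧ t = rep s'
  | act a, hp, s, hs, t => hf a hp s hs t
  | nil, _, s, _, t => by simp [bind, Sem]
  | seq p q, hp, s, hs, t => by
    constructor
    · rintro ⟨u, h₁, h₂⟩
      obtain ⟨s', h₃, rfl⟩ := (sem_bind hV hf p hp.1 s hs u).1 h₁
      obtain ⟨s'', h₄, rfl⟩ := (sem_bind hV hf q hp.2 s' (sem_preserves hV p hs h₃) t).1 h₂
      exact ⟨s'', ⟨s', h₃, h₄⟩, rfl⟩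
    · rintro ⟨s'', ⟨s', h₁, h₂⟩, rfl⟩
      exact ⟨rep s', (sem_bind hV hf p hp.1 s hs _).2 ⟨s', h₁, rfl⟩,
        (sem_bind hV hf q hp.2 s' (sem_preserves hV p hs h₁) _).2 ⟨s'', h₂, rfl⟩⟩
  | alt p q, hp, s, hs, t => by
    simp only [bind, Sem, sem_bind hV hf p hp.1 s hs t, sem_bind hV hf q hp.2 s hs t,
      or_and_right, exists_or]
  | star p, hp, s, hs, t => by
    constructor
    · intro h
      change ReflTransGen _ _ _ at h
      induction h with
      | refl => exact ⟨s, .refl, rfl⟩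
      | tail _ h₂ ih =>
        obtain ⟨s', h₁, rfl⟩ := ih
        -- The simulation is known at valid states only, so validity has to be carried along the
        -- iteration.
        have hs' := sem_preserves hV (star p) hs h₁
        obtain ⟨s'', h₃, rfl⟩ := (sem_bind hV hf p hp s' hs' _).1 h₂
        exact ⟨s'', ReflTransGen.tail h₁ h₃, rfl⟩
    · rintro ⟨s', h, rfl⟩
      change ReflTransGen _ _ _ at h
      induction h with
      | refl => exact .refl
      | @tail s₁ s₂ h₁ h₂ ih =>
        have hs' := sem_preserves hV (star p) hs h₁
        exact ReflTransGen.tail ih ((sem_bind hV hf p hp s₁ hs' _).2 ⟨s₂, h₂, rfl⟩)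

/-! The automaton of a program: its states are lists of programs still to be executed. -/

/-- Transitions of the automaton, labelled by an action or by nothing. -/
inductive Trans : List (Prog A) → Option A → List (Prog A) → Prop
  | act (a K) : Trans (act a :: K) (some a) K
  | nil (K) : Trans (nil :: K) none K
  | seq (p q K) : Trans (seq p q :: K) none (p :: q :: K)
  | altl (p q K) : Trans (alt p q :: K) none (p :: K)
  | altr (p q K) : Trans (alt p q :: K) none (q :: K)
  | finish (p K) : Trans (star p :: K) none K
  | iter (p K) : Trans (star p :: K) none (p :: star p :: K)

/-- The lists that occur during the execution of `p` before `K`. -/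
def conts : Prog A → List (Prog A) → Set (List (Prog A))
  | act a, K => {act a :: K, K}
  | nil, K => {nil :: K, K}
  | seq p q, K => {seq p q :: K} ∪ (p.conts (q :: K) ∪ q.conts K)
  | alt p q, K => {alt p q :: K} ∪ (p.conts K ∪ q.conts K)
  | star p, K => {K} ∪ p.conts (star p :: K)

theorem conts_finite : ∀ (p : Prog A) (K), (p.conts K).Finite
  | act _, _ => (Set.finite_singleton _).insert _
  | nil, _ => (Set.finite_singleton _).insert _
  | seq p q, _ => (Set.finite_singleton _).union ((conts_finite p _).union (conts_finite q _))
  | alt p q, _ => (Set.finite_singleton _).union ((conts_finite p _).union (conts_finite q _))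
  | star p, _ => (Set.finite_singleton _).union (conts_finite p _)

theorem end_mem_conts : ∀ (p : Prog A) (K), K ∈ p.conts K
  | act _, _ => by simp [conts]
  | nil, _ => by simp [conts]
  | seq p q, K => Or.inr (Or.inr (end_mem_conts q K))
  | alt p q, K => Or.inr (Or.inr (end_mem_conts q K))
  | star p, K => Or.inl rfl

theorem start_mem_conts : ∀ (p : Prog A) (K), p :: K ∈ p.conts K
  | act _, _ => by simp [conts]
  | nil, _ => by simp [conts]
  | seq p q, K => Or.inl rfl
  | alt p q, K => Or.inl rfl
  | star p, K => Or.inr (end_mem_conts p _)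

/-- The alternative `J = K` is needed: at `K` the execution of `p` is over, and transitions lead on
into whatever `K` contains. For `K = []` there are none, so the lists that arise from `[p]` form a
finite closed set and serve as states. -/
theorem conts_closed : ∀ (p : Prog A) (K) {J o J'}, J ∈ p.conts K → Trans J o J' →
    J' ∈ p.conts K ∨ J = K
  | act a, K, J, o, J', h, ht => by
    rcases h with rfl | rfl
    · cases ht; exact Or.inl (end_mem_conts _ _)
    · exact Or.inr rfl
  | nil, K, J, o, J', h, ht => by
    rcases h with rfl | rfl
    · cases ht; exact Or.inl (end_mem_conts _ _)
    · exact Or.inr rfl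
  | seq p q, K, J, o, J', h, ht => by
    have key : J ∈ q.conts K → J' ∈ (seq p q).conts K ∨ J = K := fun h =>
      (conts_closed q K h ht).imp_left fun h => Or.inr (Or.inr h)
    rcases h with rfl | h | h
    · cases ht; exact Or.inl (Or.inr (Or.inl (start_mem_conts _ _)))
    · rcases conts_closed p _ h ht with h | rfl
      · exact Or.inl (Or.inr (Or.inl h))
      · exact key (start_mem_conts _ _)
    · exact key h
  | alt p q, K, J, o, J', h, ht => by
    rcases h with rfl | h | h
    · cases ht
      · exact Or.inl (Or.inr (Or.inl (start_mem_conts _ _)))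
      · exact Or.inl (Or.inr (Or.inr (start_mem_conts _ _)))
    · exact (conts_closed p _ h ht).imp_left fun h => Or.inr (Or.inl h)
    · exact (conts_closed q _ h ht).imp_left fun h => Or.inr (Or.inr h)
  | star p, K, J, o, J', h, ht => by
    rcases h with rfl | h
    · exact Or.inr rfl
    · rcases conts_closed p _ h ht with h | rfl
      · exact Or.inl (Or.inr h)
      · cases ht
        · exact Or.inl (Or.inl rfl)
        · exact Or.inl (Or.inr (start_mem_conts _ _))

/-- States of the automaton of `p`. -/
def States (p : Prog A) : Type := {J : List (Prog A) // J ∈ p.conts []}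

instance (p : Prog A) : Finite p.States := (conts_finite p []).to_subtype

/-- Steps of the automaton on pairs of a state and a configuration. -/
inductive AutoStep (E : A → σ → σ → Prop) : List (Prog A) × σ → List (Prog A) × σ → Prop
  | act {J a J' s s'} : Trans J (some a) J' → E a s s' → AutoStep E (J, s) (J', s')
  | eps {J J' s} : Trans J none J' → AutoStep E (J, s) (J', s)

theorem auto_of_sem {E : A → σ → σ → Prop} : ∀ (p : Prog A) (K) {s s'}, p.Sem E s s' →
    ReflTransGen (AutoStep E) (p :: K, s) (K, s')
  | act a, K, s, s', h => .single (.act (.act a K) h)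
  | nil, K, s, s', h => by cases h; exact .single (.eps (.nil K))
  | seq p q, K, s, s', ⟨u, h₁, h₂⟩ =>
    .head (.eps (.seq p q K)) ((auto_of_sem p _ h₁).trans (auto_of_sem q _ h₂))
  | alt p q, K, s, s', h => h.elim
    (fun h => .head (.eps (.altl p q K)) (auto_of_sem p _ h))
    (fun h => .head (.eps (.altr p q K)) (auto_of_sem q _ h))
  | star p, K, s, s', h => by
    refine ReflTransGen.tail (b := (star p :: K, s')) ?_ (.eps (.finish p K))
    change ReflTransGen _ _ _ at h
    induction h with
    | refl => exact .refl
    | tail _ h₂ ih => exact ih.trans (.head (.eps (.iter p K)) (auto_of_sem p _ h₂))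

/-- Relation of a list of programs to be executed one after the other. -/
def SemList (E : A → σ → σ → Prop) : List (Prog A) → σ → σ → Prop
  | [] => fun s s' => s' = s
  | p :: K => Comp (p.Sem E) (SemList E K)

/-- Induction from the end of the run: undoing a transition regroups a relational composition, and
undoing an unfolding of a star prepends one more iteration. The statement concerns lists because
intermediate states hold several pending programs. -/
theorem semList_of_auto {E : A → σ → σ → Prop} {c : List (Prog A) × σ} {s' : σ}
    (h : ReflTransGen (AutoStep E) c ([], s')) : SemList E c.1 c.2 s' := by
  induction h using ReflTransGen.head_induction_on with
  | refl => rfl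
  | head h _ ih =>
    cases h with
    | act ht hE => cases ht; exact ⟨_, hE, ih⟩
    | eps ht =>
      cases ht with
      | nil => exact ⟨_, rfl, ih⟩
      | seq p q K =>
        obtain ⟨u, h₁, v, h₂, h₃⟩ := ih
        exact ⟨v, ⟨u, h₁, h₂⟩, h₃⟩
      | altl => obtain ⟨u, h₁, h₂⟩ := ih; exact ⟨u, Or.inl h₁, h₂⟩
      | altr => obtain ⟨u, h₁, h₂⟩ := ih; exact ⟨u, Or.inr h₁, h₂⟩
      | finish => exact ⟨_, ReflTransGen.refl, ih⟩
      | iter p K =>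
        obtain ⟨u, h₁, v, h₂, h₃⟩ := ih
        exact ⟨v, ReflTransGen.head h₁ h₂, h₃⟩

theorem auto_iff_sem {E : A → σ → σ → Prop} {p : Prog A} {s s' : σ} :
    ReflTransGen (AutoStep E) ([p], s) ([], s') ↔ p.Sem E s s' := by
  refine ⟨fun h => ?_, auto_of_sem p []⟩
  obtain ⟨u, h, h'⟩ := semList_of_auto h
  cases h'
  exact h

theorem auto_mem_conts {E : A → σ → σ → Prop} {p : Prog A} {c c' : List (Prog A) × σ}
    (hc : c.1 ∈ p.conts []) (h : AutoStep E c c') : c'.1 ∈ p.conts [] := by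
  cases h with
  | act ht _ =>
    rcases conts_closed p _ hc ht with h | h
    · exact h
    · cases ht; cases h
  | eps ht =>
    rcases conts_closed p _ hc ht with h | h
    · exact h
    · cases ht <;> cases h

end Prog

end XNL

/-! ### Pointer machines and their basic programs. -/

namespace XNL

open Relation Function

/-! ### Pointer machines

A pointer machine has a head on the input tape, registers, and an array of rows with a cursor.
Registers and the entries of the rows hold numbers below a bound that exceeds the length of the
input tape. -/

section PointerMachine

variable {α : Type}

abbrev Inp (α : Type) : Type := List α × ℕ

/-- The input tape. -/
def tp (I : Inp α) : List (InSym α) := inputTape I.1 I.2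

/-- Symbol at a position of the input tape. -/
def sy (I : Inp α) (p : ℕ) : InSym α := (tp I).getD p .rightEnd

/-- Number of bits of a register. -/
def wd (I : Inp α) : ℕ := (tp I).length.size

/-- Bound on the contents of the registers. -/
def bd (I : Inp α) : ℕ := 2 ^ wd I

/-- Number of rows of the array. -/
def rows (I : Inp α) : ℕ := I.2 + 1

theorem length_tp (I : Inp α) : (tp I).length = I.1.length + I.2 + 2 := by
  simp [tp, inputTape]; omega

theorem length_lt_bd (I : Inp α) : (tp I).length < bd I := Nat.lt_size_self _

theorem bd_pos (I : Inp α) : 0 < bd I := by unfold bd; positivity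

/-- Row numbers fit into registers, since the strokes that present the parameter are part of the
tape. The summand `1` in `rows` leaves a row for the cursor even if the parameter is zero. -/
theorem rows_lt_bd (I : Inp α) : rows I < bd I := by
  have := length_lt_bd I
  rw [length_tp] at this
  unfold rows
  omega

theorem sy_zero (I : Inp α) : sy I 0 = .leftEnd := rfl

theorem sy_sym {I : Inp α} {i : ℕ} (h : i < I.1.length) : sy I (i + 1) = .sym I.1[i] := by
  simp [sy, tp, inputTape, List.getElem?_append, h]

theorem sy_stroke {I : Inp α} {p : ℕ} (h : I.1.length < p) (h' : p ≤ I.1.length + I.2) :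
    sy I p = .stroke := by
  obtain ⟨i, rfl⟩ : ∃ i, p = i + 1 := ⟨p - 1, by omega⟩
  have h₁ : ¬ i < I.1.length := by omega
  have h₂ : i - I.1.length < I.2 := by omega
  simp [sy, tp, inputTape, List.getElem?_append, h₁, h₂]

theorem sy_rightEnd {I : Inp α} {p : ℕ} (h : I.1.length + I.2 < p) : sy I p = .rightEnd := by
  obtain ⟨i, rfl⟩ : ∃ i, p = i + 1 := ⟨p - 1, by omega⟩
  have h₁ : ¬ i < I.1.length := by omega
  have h₂ : ¬ i - I.1.length < I.2 := by omega
  simp only [sy, tp, inputTape, List.getD_eq_getElem?_getD, List.getElem?_cons_succ,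
    List.append_assoc, List.getElem?_append, List.length_map, h₁, if_false,
    List.length_replicate, h₂]
  cases i - I.1.length - I.2 <;> simp

theorem sy_eq_leftEnd {I : Inp α} {p : ℕ} : sy I p = .leftEnd ↔ p = 0 := by
  refine ⟨fun h => ?_, fun h => h ▸ sy_zero I⟩
  by_contra hp
  rcases le_or_gt p I.1.length with h₁ | h₁
  · obtain ⟨i, rfl⟩ : ∃ i, p = i + 1 := ⟨p - 1, by omega⟩
    rw [sy_sym (by omega)] at h
    cases h
  · rcases le_or_gt p (I.1.length + I.2) with h₂ | h₂
    · rw [sy_stroke h₁ h₂] at h; cases h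
    · rw [sy_rightEnd h₂] at h; cases h

/-- The head is stopped at the right end marker, and positions beyond the tape read as this marker
by default; hence a register that exceeds the tape still addresses a definite symbol. -/
theorem sy_min (I : Inp α) (p : ℕ) : sy I (min p ((tp I).length - 1)) = sy I p := by
  rcases le_or_gt p ((tp I).length - 1) with h | h
  · rw [min_eq_left h]
  · rw [min_eq_right h.le]
    rw [length_tp] at *
    rw [sy_rightEnd (by omega), sy_rightEnd (by omega)]

/-- Configurations of pointer machines. -/
structure PM : Type where
  h : ℕ
  reg : ℕ → ℕ
  arr : ℕ → ℕ → ℕ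
  c : ℕ

/-- Instructions of pointer machines. -/
inductive Op (α : Type) : Type
  | right
  | left
  | scan (S : Set (InSym α))
  | havoc (i : ℕ)
  | bits (b : Bool) (i : ℕ)
  | eq (i j : ℕ)
  | succ (i j : ℕ)
  | cright
  | cleft
  | ceq (i j : ℕ)
  | chavoc

def Op.Step (I : Inp α) : Op α → PM → PM → Prop
  | right => fun s s' => s' = { s with h := min (s.h + 1) ((tp I).length - 1) }
  | left => fun s s' => s' = { s with h := min (s.h - 1) ((tp I).length - 1) }
  | scan S => fun s s' => s' = s ∧ sy I s.h ∈ S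
  | havoc i => fun s s' => ∃ v, v < bd I ∧ s' = { s with reg := update s.reg i v }
  | bits b i => fun s s' => s' = s ∧ s.reg i = if b then bd I - 1 else 0
  | eq i j => fun s s' => s' = s ∧ s.reg i = s.reg j
  | succ i j => fun s s' => s' = s ∧ s.reg j = s.reg i + 1
  | cright => fun s s' => s.c + 1 < rows I ∧ s' = { s with c := s.c + 1 }
  | cleft => fun s s' => s' = { s with c := s.c - 1 }
  | ceq i j => fun s s' => s' = s ∧ s.reg i = s.arr s.c j
  | chavoc => fun s s' => ∃ g : ℕ → ℕ, (∀ j, g j < bd I) ∧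
      s' = { s with arr := update s.arr s.c g }

/-- All stored numbers respect the bounds. -/
structure PM.Valid (I : Inp α) (s : PM) : Prop where
  reg : ∀ i, s.reg i < bd I
  arr : ∀ i j, s.arr i j < bd I
  c : s.c < rows I

theorem PM.Valid.step {I : Inp α} (a : Op α) (s s' : PM) (hs : s.Valid I) (h : a.Step I s s') :
    s'.Valid I := by
  obtain ⟨h₁, h₂, h₃⟩ := hs
  cases a with
  | right => cases h; exact ⟨h₁, h₂, h₃⟩
  | left => cases h; exact ⟨h₁, h₂, h₃⟩
  | scan => cases h.1; exact ⟨h₁, h₂, h₃⟩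
  | havoc i =>
    obtain ⟨v, hv, rfl⟩ := h
    refine ⟨fun j => ?_, h₂, h₃⟩
    by_cases hj : j = i
    · subst hj; simpa using hv
    · simpa [hj] using h₁ j
  | bits => cases h.1; exact ⟨h₁, h₂, h₃⟩
  | eq => cases h.1; exact ⟨h₁, h₂, h₃⟩
  | succ => cases h.1; exact ⟨h₁, h₂, h₃⟩
  | cright => obtain ⟨h, rfl⟩ := h; exact ⟨h₁, h₂, h⟩
  | cleft => cases h; exact ⟨h₁, h₂, (Nat.sub_le _ _).trans_lt h₃⟩
  | ceq => cases h.1; exact ⟨h₁, h₂, h₃⟩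
  | chavoc =>
    obtain ⟨g, hg, rfl⟩ := h
    refine ⟨h₁, fun j => ?_, h₃⟩
    by_cases hj : j = s.c
    · subst hj; simpa using hg
    · simpa [hj] using h₂ j

/-- The configurations in which tests of predicates on the first `n` registers are started: heads
in their initial positions, and all other registers zero. -/
structure PM.Clean (I : Inp α) (n : ℕ) (s : PM) : Prop where
  valid : s.Valid I
  h : s.h = 0
  c : s.c = 0
  zero : ∀ i, n ≤ i → s.reg i = 0

/-! #### Basic programs -/

abbrev Code (α : Type) : Type := Prog (Op α)

namespace Code

open Prog

/-- `reg i := 0` -/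
def clear (i : ℕ) : Code α := seq (act (.havoc i)) (act (.bits false i))

theorem run_clear {I : Inp α} {i : ℕ} {s s' : PM} :
    Sem (Op.Step I) (clear i) s s' ↔ s' = { s with reg := update s.reg i 0 } := by
  constructor
  · rintro ⟨_, ⟨v, hv, rfl⟩, rfl, h⟩
    have : v = 0 := by simpa using h
    rw [this]
  · rintro rfl
    exact ⟨_, ⟨0, bd_pos I, rfl⟩, rfl, by simp⟩

/-- `reg i := reg i + 1`, with `reg (i + 1)` as a scratch register -/
def incr (i : ℕ) : Code α :=
  seq (act (.havoc (i + 1))) (seq (act (.succ i (i + 1))) (seq (act (.havoc i))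
    (seq (act (.eq i (i + 1))) (clear (i + 1)))))

/-- `reg i := reg i - 1`, with `reg (i + 1)` as a scratch register -/
def decr (i : ℕ) : Code α :=
  seq (act (.havoc (i + 1))) (seq (act (.succ (i + 1) i)) (seq (act (.havoc i))
    (seq (act (.eq i (i + 1))) (clear (i + 1)))))

theorem update_scratch {ρ : ℕ → ℕ} {i v w : ℕ} (h : ρ (i + 1) = 0) :
    update (update (update ρ (i + 1) v) i w) (i + 1) 0 = update ρ i w := by
  funext j
  simp only [update_apply]
  split_ifs <;> simp_all

/-- Instructions can only guess and compare: the successor is guessed in the scratch register,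
checked, and copied by a second guess. If the successor is out of range there is no run at all. -/
theorem run_incr {I : Inp α} {i : ℕ} {s s' : PM} (h0 : s.reg (i + 1) = 0) :
    Sem (Op.Step I) (incr i) s s' ↔
      s.reg i + 1 < bd I ∧ s' = { s with reg := update s.reg i (s.reg i + 1) } := by
  constructor
  · rintro ⟨_, ⟨v, hv, rfl⟩, _, ⟨rfl, h₁⟩, _, ⟨w, hw, rfl⟩, _, ⟨rfl, h₂⟩, h₃⟩
    rw [run_clear] at h₃
    have h₁ : v = s.reg i + 1 := by simpa using h₁
    have h₂ : w = v := by simpa using h₂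
    subst h₁ h₂
    exact ⟨hv, by rw [h₃]; simp only [update_scratch h0]⟩
  · rintro ⟨h, rfl⟩
    refine ⟨_, ⟨_, h, rfl⟩, _, ⟨rfl, by simp⟩, _, ⟨_, h, rfl⟩, _, ⟨rfl, by simp⟩, ?_⟩
    rw [run_clear]
    simp only [update_scratch h0]

theorem run_decr {I : Inp α} {i : ℕ} {s s' : PM} (h0 : s.reg (i + 1) = 0) (hs : s.Valid I) :
    Sem (Op.Step I) (decr i) s s' ↔
      0 < s.reg i ∧ s' = { s with reg := update s.reg i (s.reg i - 1) } := by
  constructor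
  · rintro ⟨_, ⟨v, hv, rfl⟩, _, ⟨rfl, h₁⟩, _, ⟨w, hw, rfl⟩, _, ⟨rfl, h₂⟩, h₃⟩
    rw [run_clear] at h₃
    have h₁ : s.reg i = v + 1 := by simpa using h₁
    have h₂ : w = v := by simpa using h₂
    subst h₂
    exact ⟨by omega, by rw [h₃]; simp only [update_scratch h0, h₁, Nat.add_sub_cancel]⟩
  · rintro ⟨h, rfl⟩
    have := hs.reg i
    refine ⟨_, ⟨s.reg i - 1, by omega, rfl⟩, _, ⟨rfl, by simp; omega⟩, _,
      ⟨s.reg i - 1, by omega, rfl⟩, _, ⟨rfl, by simp⟩, ?_⟩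
    rw [run_clear]
    simp only [update_scratch h0]

/-! Blocks of registers. -/

/-- `ρ` with the registers `n, …, n + a - 1` replaced by `u`. -/
def blk (ρ : ℕ → ℕ) (n a : ℕ) (u : ℕ → ℕ) : ℕ → ℕ :=
  fun i => if n ≤ i ∧ i < n + a then u (i - n) else ρ i

theorem blk_of_lt {ρ : ℕ → ℕ} {n a : ℕ} {u : ℕ → ℕ} {i : ℕ} (h : i < n) :
    blk ρ n a u i = ρ i := if_neg (by omega)

theorem blk_of_ge {ρ : ℕ → ℕ} {n a : ℕ} {u : ℕ → ℕ} {i : ℕ} (h : n + a ≤ i) :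
    blk ρ n a u i = ρ i := if_neg (by omega)

theorem blk_add {ρ : ℕ → ℕ} {n a : ℕ} {u : ℕ → ℕ} {i : ℕ} (h : i < a) :
    blk ρ n a u (n + i) = u i := by
  rw [blk, if_pos (by omega), Nat.add_sub_cancel_left]

theorem blk_blk (ρ : ℕ → ℕ) (n a : ℕ) (u v : ℕ → ℕ) :
    blk (blk ρ n a u) n a v = blk ρ n a v := by
  funext i; simp only [blk]; split_ifs <;> rfl

theorem blk_self {ρ : ℕ → ℕ} {n a : ℕ} (h : ∀ i, n ≤ i → ρ i = 0) :
    blk ρ n a (fun _ => 0) = ρ := by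
  funext i; simp only [blk]; split_ifs with hi
  · rw [h i hi.1]
  · rfl

theorem blk_congr {ρ : ℕ → ℕ} {n a : ℕ} {u v : ℕ → ℕ} (h : ∀ i, i < a → u i = v i) :
    blk ρ n a u = blk ρ n a v := by
  funext i; simp only [blk]; split_ifs with hi
  · exact h _ (by omega)
  · rfl

/-- Arbitrary new contents for the registers `n, …, n + a - 1`. -/
def havocs (n : ℕ) : ℕ → Code α
  | 0 => nil
  | a + 1 => seq (havocs n a) (act (.havoc (n + a)))

theorem run_havocs {I : Inp α} {n : ℕ} : ∀ {a : ℕ} {s s' : PM}, Sem (Op.Step I) (havocs n a) s s' ↔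
    ∃ u : ℕ → ℕ, (∀ i, i < a → u i < bd I) ∧ s' = { s with reg := blk s.reg n a u }
  | 0, s, s' => by
    have : ∀ u, blk s.reg n 0 u = s.reg := fun u => by
      funext i; exact if_neg (by omega)
    simp [this, havocs, Sem]
  | a + 1, s, s' => by
    constructor
    · rintro ⟨t, ht, v, hv, rfl⟩
      obtain ⟨u, hu, rfl⟩ := run_havocs.1 ht
      refine ⟨fun i => if i < a then u i else v, fun i hi => ?_, ?_⟩
      · dsimp only; split_ifs with h
        · exact hu i h
        · exact hv
      · congr 1
        funext i
        simp only [blk, update_apply]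
        split_ifs <;> first | rfl | omega
    · rintro ⟨u, hu, rfl⟩
      refine ⟨_, run_havocs.2 ⟨u, fun i hi => hu i (by omega), rfl⟩, u a, hu a (by omega), ?_⟩
      congr 1
      funext i
      simp only [blk, update_apply]
      split_ifs <;> first | rfl | omega | (congr 1; omega)

/-- Test whether register `n + i` equals register `g i` for all `i < a`. -/
def tests (n : ℕ) (g : ℕ → ℕ) : ℕ → Code α
  | 0 => nil
  | a + 1 => seq (tests n g a) (act (.eq (n + a) (g a)))

theorem run_tests {I : Inp α} {n : ℕ} {g : ℕ → ℕ} : ∀ {a : ℕ} {s s' : PM},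
    Sem (Op.Step I) (tests n g a) s s' ↔ s' = s ∧ ∀ i, i < a → s.reg (n + i) = s.reg (g i)
  | 0, s, s' => by simp [tests, Sem]
  | a + 1, s, s' => by
    constructor
    · rintro ⟨t, ht, rfl, h⟩
      obtain ⟨rfl, h'⟩ := run_tests.1 ht
      refine ⟨rfl, fun i hi => ?_⟩
      rcases Nat.lt_succ_iff_lt_or_eq.1 hi with hi | rfl
      · exact h' i hi
      · exact h
    · rintro ⟨rfl, h⟩
      exact ⟨s', run_tests.2 ⟨rfl, fun i hi => h i (by omega)⟩, rfl, h a (by omega)⟩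

/-- Copy the registers `g 0, …, g (a - 1)` to the registers from `n` on. -/
def load (n : ℕ) (g : ℕ → ℕ) (a : ℕ) : Code α := seq (havocs n a) (tests n g a)

theorem run_load {I : Inp α} {n a : ℕ} {g : ℕ → ℕ} (hg : ∀ i, i < a → g i < n ∨ n + a ≤ g i)
    {s s' : PM} (hs : s.Valid I) : Sem (Op.Step I) (load n g a) s s' ↔
      s' = { s with reg := blk s.reg n a (fun i => s.reg (g i)) } := by
  have key : ∀ u i, i < a → blk s.reg n a u (g i) = s.reg (g i) := fun u i hi =>
    (hg i hi).elim blk_of_lt blk_of_ge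
  constructor
  · rintro ⟨t, ht, h⟩
    obtain ⟨u, hu, rfl⟩ := run_havocs.1 ht
    obtain ⟨rfl, h'⟩ := run_tests.1 h
    congr 1
    refine blk_congr fun i hi => ?_
    have := h' i hi
    dsimp only at this
    rwa [blk_add hi, key u i hi] at this
  · rintro rfl
    refine ⟨_, run_havocs.2 ⟨fun i => s.reg (g i), fun i _ => hs.reg _, rfl⟩,
      run_tests.2 ⟨rfl, fun i hi => ?_⟩⟩
    dsimp only
    rw [blk_add hi, key _ i hi]

def zeros (n : ℕ) : ℕ → Code α
  | 0 => nil
  | a + 1 => seq (zeros n a) (act (.bits false (n + a)))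

theorem run_zeros {I : Inp α} {n : ℕ} : ∀ {a : ℕ} {s s' : PM},
    Sem (Op.Step I) (zeros n a) s s' ↔ s' = s ∧ ∀ i, i < a → s.reg (n + i) = 0
  | 0, s, s' => by simp [zeros, Sem]
  | a + 1, s, s' => by
    constructor
    · rintro ⟨t, ht, rfl, h⟩
      obtain ⟨rfl, h'⟩ := run_zeros.1 ht
      refine ⟨rfl, fun i hi => ?_⟩
      rcases Nat.lt_succ_iff_lt_or_eq.1 hi with hi | rfl
      · exact h' i hi
      · simpa using h
    · rintro ⟨rfl, h⟩
      exact ⟨s', run_zeros.2 ⟨rfl, fun i hi => h i (by omega)⟩, rfl, by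
        simpa using h a (by omega)⟩

/-- Set the registers `n, …, n + a - 1` to zero. -/
def clears (n a : ℕ) : Code α := seq (havocs n a) (zeros n a)

theorem run_clears {I : Inp α} {n a : ℕ} {s s' : PM} : Sem (Op.Step I) (clears n a) s s' ↔
      s' = { s with reg := blk s.reg n a (fun _ => 0) } := by
  constructor
  · rintro ⟨t, ht, h⟩
    obtain ⟨u, hu, rfl⟩ := run_havocs.1 ht
    obtain ⟨rfl, h'⟩ := run_zeros.1 h
    congr 1
    refine blk_congr fun i hi => ?_
    have := h' i hi
    dsimp only at this
    rwa [blk_add hi] at this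
  · rintro rfl
    exact ⟨_, run_havocs.2 ⟨fun _ => 0, fun i _ => bd_pos I, rfl⟩,
      run_zeros.2 ⟨rfl, fun i hi => by dsimp only; rw [blk_add hi]⟩⟩

/-! Moving the cursor to the row whose number is stored in a register, and back. -/

/-- Move the cursor from row `0` to row `reg i`, and count in `reg n`. -/
def goRow (n i : ℕ) : Code α := seq (star (seq (act .cright) (incr n))) (act (.eq i n))

/-- Move the cursor back to row `0`. -/
def backRow (n : ℕ) : Code α := seq (star (seq (act .cleft) (decr n))) (act (.bits false n))

/-- The cursor does not reveal the number of its row, so the scratch register counts its moves, and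
the guessed number of moves is compared with register `i` at the end. -/
theorem run_goRow {I : Inp α} {n i : ℕ} (hi : i < n) {s s' : PM} (hs : s.Clean I n) :
    Sem (Op.Step I) (goRow n i) s s' ↔
      s.reg i < rows I ∧ s' = { s with c := s.reg i, reg := update s.reg n (s.reg i) } := by
  have up : ∀ t, ReflTransGen (Sem (Op.Step I) (seq (act .cright) (incr n))) s t ↔
      ∃ v, v < rows I ∧ t = { s with c := v, reg := update s.reg n v } := by
    intro t
    constructor
    · intro h
      induction h with
      | refl =>
        refine ⟨0, Nat.succ_pos _, ?_⟩
        have h₁ := hs.zero n le_rfl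
        have h₂ := hs.c
        rw [← h₂, update_eq_self_iff.2 (h₁ ▸ h₂)]
      | tail _ h ih =>
        obtain ⟨v, hv, rfl⟩ := ih
        obtain ⟨_, ⟨h₁, rfl⟩, h₂⟩ := h
        rw [run_incr (by simpa using hs.zero (n + 1) (by omega))] at h₂
        obtain ⟨_, rfl⟩ := h₂
        exact ⟨v + 1, h₁, by simp⟩
    · rintro ⟨v, hv, rfl⟩
      induction v with
      | zero =>
        convert ReflTransGen.refl
        · exact update_eq_self_iff.2 (hs.zero n le_rfl).symm
        · exact hs.c.symm
      | succ v ih =>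
        refine ReflTransGen.tail (ih (by omega)) ⟨_, ⟨hv, rfl⟩, ?_⟩
        rw [run_incr (by simpa using hs.zero (n + 1) (by omega))]
        have := rows_lt_bd I
        exact ⟨by simp; omega, by simp⟩
  constructor
  · rintro ⟨t, ht, rfl, h⟩
    obtain ⟨v, hv, rfl⟩ := (up _).1 ht
    have h : s.reg i = v := by simpa [hi.ne] using h
    subst h
    exact ⟨hv, rfl⟩
  · rintro ⟨h, rfl⟩
    exact ⟨_, (up _).2 ⟨_, h, rfl⟩, rfl, by simp [hi.ne]⟩

/-- Cursor and counter go down together. In row `0` a further move of the cursor would have no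
effect, but then the counter is zero too and cannot be decreased; and the final test discards runs
that stop too early. -/
theorem run_backRow {I : Inp α} {n : ℕ} {s s' : PM} (hv : s.Valid I) (hc : s.reg n = s.c)
    (h0 : s.reg (n + 1) = 0) : Sem (Op.Step I) (backRow n) s s' ↔
      s' = { s with c := 0, reg := update s.reg n 0 } := by
  have down : ∀ t, ReflTransGen (Sem (Op.Step I) (seq (act .cleft) (decr n))) s t ↔
      ∃ v, v ≤ s.c ∧ t = { s with c := s.c - v, reg := update s.reg n (s.c - v) } := by
    intro t
    constructor
    · intro h
      induction h with
      | refl => exact ⟨0, Nat.zero_le _, by rw [Nat.sub_zero, ← hc, update_eq_self, hc]⟩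
      | @tail t t' ht h ih =>
        have hval := Prog.sem_preserves PM.Valid.step (star (seq (act .cleft) (decr n))) hv ht
        obtain ⟨v, hv, rfl⟩ := ih
        obtain ⟨_, rfl, h₂⟩ := h
        have hval := PM.Valid.step .cleft _ _ hval rfl
        rw [run_decr (by simpa using h0) hval] at h₂
        obtain ⟨h₃, rfl⟩ := h₂
        have h₃ : 0 < s.c - v := by simpa using h₃
        exact ⟨v + 1, by omega, by simp [Nat.sub_sub]⟩
    · rintro ⟨v, hvc, rfl⟩
      induction v with
      | zero =>
        convert ReflTransGen.refl
        · simp [← hc]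
        · exact Nat.sub_zero _
      | succ v ih =>
        have ht := ih (by omega)
        have hval := Prog.sem_preserves PM.Valid.step (star (seq (act .cleft) (decr n))) hv ht
        refine ReflTransGen.tail ht ⟨_, rfl, ?_⟩
        have hval := PM.Valid.step .cleft _ _ hval rfl
        rw [run_decr (by simpa using h0) hval]
        exact ⟨by simp; omega, by simp [Nat.sub_sub]⟩
  constructor
  · rintro ⟨t, ht, rfl, h⟩
    obtain ⟨v, hv, rfl⟩ := (down _).1 ht
    have h : s.c - v = 0 := by simpa using h
    rw [h]
  · rintro rfl
    exact ⟨_, (down _).2 ⟨s.c, le_rfl, rfl⟩, by simp, by simp⟩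

/-- Move the input head from position `0` to position `reg i`, and count in `reg n`. -/
def goPos (n i : ℕ) : Code α := seq (star (seq (act .right) (incr n))) (act (.eq i n))

/-- Unlike the cursor, the head may already be stopped at the right end while the counter still
grows up to register `i`; hence the minimum. -/
theorem run_goPos {I : Inp α} {n i : ℕ} (hi : i < n) {s s' : PM} (hs : s.Clean I n) :
    Sem (Op.Step I) (goPos n i) s s' ↔ s' = { s with
        h := min (s.reg i) ((tp I).length - 1)
        reg := update s.reg n (s.reg i) } := by
  have up : ∀ t, ReflTransGen (Sem (Op.Step I) (seq (act .right) (incr n))) s t ↔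
      ∃ v, v < bd I ∧ t = { s with
        h := min v ((tp I).length - 1)
        reg := update s.reg n v } := by
    intro t
    constructor
    · intro h
      induction h with
      | refl =>
        refine ⟨0, bd_pos I, ?_⟩
        have h₁ := hs.zero n le_rfl
        have h₂ := hs.h
        rw [Nat.zero_min, ← h₂, update_eq_self_iff.2 (h₁ ▸ h₂)]
      | tail _ h ih =>
        obtain ⟨v, hv, rfl⟩ := ih
        obtain ⟨_, rfl, h₂⟩ := h
        rw [run_incr (by simpa using hs.zero (n + 1) (by omega))] at h₂
        obtain ⟨h₁, rfl⟩ := h₂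
        exact ⟨v + 1, by simpa using h₁, by simp; omega⟩
    · rintro ⟨v, hv, rfl⟩
      induction v with
      | zero =>
        convert ReflTransGen.refl
        · simp [hs.h]
        · exact update_eq_self_iff.2 (hs.zero n le_rfl).symm
      | succ v ih =>
        refine ReflTransGen.tail (ih (by omega)) ⟨_, rfl, ?_⟩
        rw [run_incr (by simpa using hs.zero (n + 1) (by omega))]
        exact ⟨by simp; omega, by simp; omega⟩
  constructor
  · rintro ⟨t, ht, rfl, h⟩
    obtain ⟨v, hv, rfl⟩ := (up _).1 ht
    have h : s.reg i = v := by simpa [hi.ne] using h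
    subst h
    rfl
  · rintro rfl
    exact ⟨_, (up _).2 ⟨_, hs.valid.reg i, rfl⟩, rfl, by simp [hi.ne]⟩

/-- Move the input head to position `0`. -/
def backPos : Code α := seq (star (act .left)) (act (.scan {.leftEnd}))

/-- No counter is needed here, because position `0` is the only one with the left end marker. -/
theorem run_backPos {I : Inp α} {s s' : PM} (hh : s.h ≤ (tp I).length - 1) :
    Sem (Op.Step I) backPos s s' ↔ s' = { s with h := 0 } := by
  have down : ∀ t, ReflTransGen (Sem (Op.Step I) (act .left)) s t ↔
      ∃ v, t = { s with h := s.h - v } := by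
    intro t
    constructor
    · intro h
      induction h with
      | refl => exact ⟨0, rfl⟩
      | tail _ h ih =>
        obtain ⟨v, rfl⟩ := ih
        cases h
        refine ⟨v + 1, ?_⟩
        congr 1
        change min (s.h - v - 1) _ = _
        omega
    · rintro ⟨v, rfl⟩
      induction v with
      | zero => exact .refl
      | succ v ih =>
        refine ih.tail ?_
        change _ = _
        congr 1
        change _ = min (s.h - v - 1) _
        omega
  constructor
  · rintro ⟨t, ht, rfl, h⟩
    obtain ⟨v, rfl⟩ := (down _).1 ht
    have h' : s.h - v = 0 := sy_eq_leftEnd.1 h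
    rw [h']
  · rintro rfl
    exact ⟨_, (down _).2 ⟨s.h, rfl⟩, by simp, by simp [sy_zero]⟩

end Code

end PointerMachine

end XNL

/-! ### Positive first-order logic with transitive closure, tested by pointer programs. -/

namespace XNL

open Relation Function

section Definable

variable {α : Type}

/-! ### Predicates that can be tested by pointer machines -/

/-- `p` tests the predicate `P` of the input, the array and the first `n` registers. -/
def Code.Tests {n : ℕ} (p : Code α)
    (P : Inp α → (ℕ → ℕ → ℕ) → (Fin n → ℕ) → Prop) : Prop :=
  ∀ I s, s.Clean I n → ∀ s',
    p.Sem (Op.Step I) s s' ↔ s' = s ∧ P I s.arr (fun i => s.reg i)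

/-- Predicates that some program tests. -/
def Dfn {n : ℕ} (P : Inp α → (ℕ → ℕ → ℕ) → (Fin n → ℕ) → Prop) : Prop :=
  ∃ p : Code α, p.Tests P

/-- Projections. -/
def Var {n : ℕ} (f : (Fin n → ℕ) → ℕ) : Prop := ∃ i, ∀ ρ, f ρ = ρ i

variable {n a : ℕ}

/-- The first block of registers. -/
def lo (ρ : Fin (n + a + a) → ℕ) : Fin n → ℕ := fun i => ρ (Fin.castAdd a (Fin.castAdd a i))

/-- The second block of registers. -/
def mid (ρ : Fin (n + a + a) → ℕ) : Fin a → ℕ := fun i => ρ (Fin.castAdd a (Fin.natAdd n i))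

/-- The third block of registers. -/
def hi (ρ : Fin (n + a + a) → ℕ) : Fin a → ℕ := fun i => ρ (Fin.natAdd (n + a) i)

theorem Var.proj (i : Fin n) : Var (fun ρ : Fin n → ℕ => ρ i) := ⟨i, fun _ => rfl⟩

theorem Var.init {f : (Fin n → ℕ) → ℕ} (h : Var f) :
    Var (fun ρ : Fin (n + 1) → ℕ => f (Fin.init ρ)) :=
  h.elim fun i hi => ⟨i.castSucc, fun _ => hi _⟩

theorem Var.last : Var (fun ρ : Fin (n + 1) → ℕ => ρ (Fin.last n)) := ⟨_, fun _ => rfl⟩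

namespace Dfn

open Code Prog

variable {P Q : Inp α → (ℕ → ℕ → ℕ) → (Fin n → ℕ) → Prop} {f g : (Fin n → ℕ) → ℕ}

/-- A successful test restores the whole configuration, so tests can be run one after the other and
nested in each other. -/
theorem and (hP : Dfn P) (hQ : Dfn Q) : Dfn (fun I A ρ => P I A ρ ∧ Q I A ρ) := by
  obtain ⟨p, hp⟩ := hP
  obtain ⟨q, hq⟩ := hQ
  refine ⟨seq p q, fun I s hs s' => ?_⟩
  constructor
  · rintro ⟨t, h₁, h₂⟩
    obtain ⟨rfl, h₃⟩ := (hp I s hs t).1 h₁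
    obtain ⟨rfl, h₄⟩ := (hq I t hs s').1 h₂
    exact ⟨rfl, h₃, h₄⟩
  · rintro ⟨rfl, h₁, h₂⟩
    exact ⟨s', (hp I _ hs _).2 ⟨rfl, h₁⟩, (hq I _ hs _).2 ⟨rfl, h₂⟩⟩

theorem or (hP : Dfn P) (hQ : Dfn Q) : Dfn (fun I A ρ => P I A ρ ∨ Q I A ρ) := by
  obtain ⟨p, hp⟩ := hP
  obtain ⟨q, hq⟩ := hQ
  refine ⟨alt p q, fun I s hs s' => ?_⟩
  change _ ∨ _ ↔ _
  rw [hp I s hs s', hq I s hs s', ← and_or_left]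

theorem eq (hf : Var f) (hg : Var g) : Dfn (α := α) (fun _ _ ρ => f ρ = g ρ) := by
  obtain ⟨i, hi⟩ := hf
  obtain ⟨j, hj⟩ := hg
  refine ⟨act (.eq i j), fun I s hs s' => ?_⟩
  simp only [hi, hj]
  rfl

theorem succ (hf : Var f) (hg : Var g) : Dfn (α := α) (fun _ _ ρ => f ρ = g ρ + 1) := by
  obtain ⟨i, hi⟩ := hf
  obtain ⟨j, hj⟩ := hg
  refine ⟨act (.succ j i), fun I s hs s' => ?_⟩
  simp only [hi, hj]
  rfl

theorem sym (S : Set (InSym α)) (hf : Var f) : Dfn (fun I _ ρ => sy I (f ρ) ∈ S) := by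
  obtain ⟨i, hi⟩ := hf
  refine ⟨seq (goPos n i) (seq (act (.scan S)) (seq backPos (clear n))), fun I s hs s' => ?_⟩
  simp only [hi]
  have key : ({ s with h := 0, reg := update (update s.reg n (s.reg i)) n 0 } : PM) = s := by
    rw [update_idem, update_eq_self_iff.2 (hs.zero n le_rfl).symm, ← hs.h]
  constructor
  · rintro ⟨t, h₁, _, ⟨rfl, h₂⟩, _, h₃, h₄⟩
    rw [run_goPos i.2 hs] at h₁
    subst h₁
    rw [run_backPos (min_le_right _ _)] at h₃
    subst h₃
    rw [run_clear] at h₄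
    rw [h₄, sy_min] at *
    exact ⟨key, h₂⟩
  · rintro ⟨rfl, h⟩
    refine ⟨_, (run_goPos i.2 hs).2 rfl, _, ⟨rfl, ?_⟩, _,
      (run_backPos (min_le_right _ _)).2 rfl, run_clear.2 key.symm⟩
    dsimp only
    rwa [sy_min]

/-- The column is part of the program, the row is an argument. Entries of the array can only be
compared with registers, so the predicate relates an address to a proposed value. -/
theorem arr (j : ℕ) (hf : Var f) (hg : Var g) :
    Dfn (fun (I : Inp α) A ρ => f ρ < rows I ∧ g ρ = A (f ρ) j) := by
  obtain ⟨i, hi⟩ := hf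
  obtain ⟨i', hi'⟩ := hg
  refine ⟨seq (goRow n i) (seq (act (.ceq i' j)) (backRow n)), fun I s hs s' => ?_⟩
  simp only [hi, hi']
  have key : ({ s with c := 0, reg := update (update s.reg n (s.reg i)) n 0 } : PM) = s := by
    rw [update_idem, update_eq_self_iff.2 (hs.zero n le_rfl).symm, ← hs.c]
  have hval : s.reg i < rows I →
      PM.Valid I { s with c := s.reg i, reg := update s.reg n (s.reg i) } := fun h =>
    Prog.sem_preserves PM.Valid.step _ hs.valid ((run_goRow i.2 hs).2 ⟨h, rfl⟩)
  have h0 : update s.reg n (s.reg i) (n + 1) = 0 := by simpa using hs.zero (n + 1) (by omega)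
  have hi'n : update s.reg n (s.reg i) i' = s.reg i' := by simp [i'.2.ne]
  constructor
  · rintro ⟨t, h₁, _, ⟨rfl, h₂⟩, h₃⟩
    obtain ⟨h₄, rfl⟩ := (run_goRow i.2 hs).1 h₁
    rw [run_backRow (hval h₄) (by simp) h0] at h₃
    rw [h₃]
    exact ⟨key, h₄, hi'n ▸ h₂⟩
  · rintro ⟨rfl, h₁, h₂⟩
    exact ⟨_, (run_goRow i.2 hs).2 ⟨h₁, rfl⟩, _, ⟨rfl, hi'n.trans h₂⟩,
      (run_backRow (hval h₁) (by simp) h0).2 key.symm⟩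

theorem clean_update {I : Inp α} {s : PM} (hs : s.Clean I n) {v : ℕ} (hv : v < bd I) :
    PM.Clean I (n + 1) { s with reg := update s.reg n v } where
  valid := PM.Valid.step (.havoc n) _ _ hs.valid ⟨v, hv, rfl⟩
  h := hs.h
  c := hs.c
  zero i hi := by simpa [show i ≠ n by omega] using hs.zero i (by omega)

/-- A witness is guessed in the first free register and erased after the test. The bound on `v`
reflects the range of registers. -/
theorem ex {Q : Inp α → (ℕ → ℕ → ℕ) → (Fin n → ℕ) → ℕ → Prop}
    (h : Dfn (n := n + 1) (fun I A ρ => Q I A (Fin.init ρ) (ρ (Fin.last n)))) :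
    Dfn (fun I A ρ => ∃ v, v < bd I ∧ Q I A ρ v) := by
  obtain ⟨p, hp⟩ := h
  refine ⟨seq (act (.havoc n)) (seq p (clear n)), fun I s hs s' => ?_⟩
  have hinit : ∀ v, Fin.init (fun i : Fin (n + 1) => update s.reg n v i) =
      fun i : Fin n => s.reg i := fun v => by
    funext i; simp [Fin.init, i.2.ne]
  have key : ∀ v, ({ s with reg := update (update s.reg n v) n 0 } : PM) = s := fun v => by
    rw [update_idem, update_eq_self_iff.2 (hs.zero n le_rfl).symm]
  constructor
  · rintro ⟨_, ⟨v, hv, rfl⟩, t, h₁, h₂⟩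
    obtain ⟨rfl, h₃⟩ := (hp I _ (clean_update hs hv) _).1 h₁
    rw [run_clear] at h₂
    refine ⟨h₂.trans (key v), v, hv, ?_⟩
    simpa [hinit] using h₃
  · rintro ⟨rfl, v, hv, h⟩
    refine ⟨_, ⟨v, hv, rfl⟩, _, (hp I _ (clean_update hs hv) _).2 ⟨rfl, ?_⟩,
      run_clear.2 (key v).symm⟩
    simpa [hinit] using h

/-- Nondeterministic tests cannot be complemented, but a universal quantifier over a bounded range
is a loop in which the test is passed once for every value. -/
theorem all {Q : Inp α → (ℕ → ℕ → ℕ) → (Fin n → ℕ) → ℕ → Prop}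
    (h : Dfn (n := n + 1) (fun I A ρ => Q I A (Fin.init ρ) (ρ (Fin.last n)))) :
    Dfn (fun I A ρ => ∀ v, v < bd I → Q I A ρ v) := by
  obtain ⟨p, hp⟩ := h
  -- The loop may be left at any value, but the test for a register full of ones succeeds only at
  -- `bd I - 1`. This last value, at which `incr` would block, is tested by the second copy of `p`.
  refine ⟨seq (star (seq p (incr n))) (seq p (seq (act (.bits true n)) (clear n))),
    fun I s hs s' => ?_⟩
  have hinit : ∀ v, Fin.init (fun i : Fin (n + 1) => update s.reg n v i) =
      fun i : Fin n => s.reg i := fun v => by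
    funext i; simp [Fin.init, i.2.ne]
  have hp' : ∀ v, v < bd I → ∀ t, p.Sem (Op.Step I) { s with reg := update s.reg n v } t ↔
      t = { s with reg := update s.reg n v } ∧ Q I s.arr (fun i => s.reg i) v := by
    intro v hv t
    rw [hp I _ (clean_update hs hv)]
    simp [hinit]
  have key : ∀ v, ({ s with reg := update (update s.reg n v) n 0 } : PM) = s := fun v => by
    rw [update_idem, update_eq_self_iff.2 (hs.zero n le_rfl).symm]
  have h0 : ({ s with reg := update s.reg n 0 } : PM) = s := by
    rw [update_eq_self_iff.2 (hs.zero n le_rfl).symm]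
  have hn : ∀ v, update s.reg n v (n + 1) = 0 := fun v => by
    simpa using hs.zero (n + 1) (by omega)
  have loop : ∀ t, ReflTransGen ((seq p (incr n)).Sem (Op.Step I)) s t ↔
      ∃ v, v < bd I ∧ t = { s with reg := update s.reg n v } ∧
        ∀ w, w < v → Q I s.arr (fun i => s.reg i) w := by
    intro t
    constructor
    · intro h
      induction h with
      | refl => exact ⟨0, bd_pos I, h0.symm, fun w hw => absurd hw (Nat.not_lt_zero _)⟩
      | tail _ h ih =>
        obtain ⟨v, hv, rfl, hQ⟩ := ih
        obtain ⟨u, h₁, h₂⟩ := h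
        obtain ⟨rfl, h₃⟩ := (hp' v hv _).1 h₁
        obtain ⟨h₄, rfl⟩ := (run_incr (hn v)).1 h₂
        refine ⟨v + 1, by simpa using h₄, by simp, fun w hw => ?_⟩
        rcases Nat.lt_succ_iff_lt_or_eq.1 hw with hw | rfl
        · exact hQ w hw
        · exact h₃
    · rintro ⟨v, hv, rfl, hQ⟩
      induction v with
      | zero => rw [h0]
      | succ v ih =>
        refine ReflTransGen.tail (ih (by omega) fun w hw => hQ w (by omega))
          ⟨_, (hp' v (by omega) _).2 ⟨rfl, hQ v (by omega)⟩, (run_incr (hn v)).2 ?_⟩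
        exact ⟨by simpa using hv, by simp⟩
  constructor
  · rintro ⟨t, h₁, u, h₂, _, ⟨rfl, h₃⟩, h₄⟩
    obtain ⟨v, hv, rfl, hQ⟩ := (loop t).1 h₁
    obtain ⟨rfl, h₅⟩ := (hp' v hv _).1 h₂
    have h₃ : v = bd I - 1 := by simpa using h₃
    rw [run_clear] at h₄
    refine ⟨h₄.trans (key v), fun w hw => ?_⟩
    rcases lt_or_eq_of_le (show w ≤ v by omega) with hw | rfl
    · exact hQ w hw
    · exact h₅
  · rintro ⟨rfl, h⟩
    have hb : bd I - 1 < bd I := Nat.sub_lt (bd_pos I) Nat.one_pos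
    exact ⟨_, (loop _).2 ⟨bd I - 1, hb, rfl, fun w hw => h w (by omega)⟩, _,
      (hp' _ hb _).2 ⟨rfl, h _ hb⟩, _, ⟨rfl, by simp⟩, run_clear.2 (key _).symm⟩

/-- Transitive closure of a relation between tuples. -/
theorem tc {Q : Inp α → (ℕ → ℕ → ℕ) → (Fin n → ℕ) → (Fin a → ℕ) → (Fin a → ℕ) → Prop}
    (h : Dfn (n := n + a + a) (fun I A ρ => Q I A (lo ρ) (mid ρ) (hi ρ)))
    {src tgt : (Fin n → ℕ) → Fin a → ℕ} (hsrc : ∀ i, Var (fun ρ => src ρ i))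
    (htgt : ∀ i, Var (fun ρ => tgt ρ i)) :
    Dfn (fun I A ρ => ReflTransGen (fun u v => (∀ i, v i < bd I) ∧ Q I A ρ u v)
      (src ρ) (tgt ρ)) := by
  obtain ⟨p, hp⟩ := h
  choose gs hgs using hsrc
  choose gt hgt using htgt
  let ex (u : Fin a → ℕ) (i : ℕ) : ℕ := if h : i < a then u ⟨i, h⟩ else 0
  let nat (u : Fin a → Fin n) (i : ℕ) : ℕ := if h : i < a then u ⟨i, h⟩ else 0
  -- The current tuple sits in the registers from `n` on; a successor is guessed behind it, checked
  -- by `p`, and then moved forward. However long the path is, only two of its points are stored.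
  let body : Code α := seq (havocs (n + a) a) (seq p (seq (load n (fun i => n + a + i) a)
    (clears (n + a) a)))
  refine ⟨seq (load n (nat gs) a) (seq (star body) (seq (tests n (nat gt) a) (clears n a))),
    fun I s hs s' => ?_⟩
  let st (u : Fin a → ℕ) : PM := { s with reg := blk s.reg n a (ex u) }
  let σ : Fin n → ℕ := fun i => s.reg i
  have hex : ∀ u : Fin a → ℕ, (∀ i, u i < bd I) → ∀ i, ex u i < bd I := by
    intro u hu i
    simp only [ex]
    split_ifs
    · exact hu _
    · exact bd_pos I
  have hst : ∀ u : Fin a → ℕ, (∀ i, u i < bd I) → (st u).Clean I (n + a) := by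
    intro u hu
    refine ⟨⟨fun i => ?_, hs.valid.arr, hs.valid.c⟩, hs.h, hs.c, fun i hi => ?_⟩
    · simp only [st, blk]
      split_ifs
      · exact hex u hu _
      · exact hs.valid.reg _
    · simp only [st]
      rw [blk_of_ge hi, hs.zero i (by omega)]
  have hst2 : ∀ u : Fin a → ℕ, (∀ i, u i < bd I) → ∀ v : ℕ → ℕ, (∀ i, i < a → v i < bd I) →
      PM.Clean I (n + a + a) { s with reg := blk (blk s.reg n a (ex u)) (n + a) a v } := by
    intro u hu v hv
    refine ⟨⟨fun i => ?_, hs.valid.arr, hs.valid.c⟩, hs.h, hs.c, fun i hi => ?_⟩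
    · simp only [blk]
      split_ifs
      · exact hv _ (by omega)
      · exact hex u hu _
      · exact hs.valid.reg _
    · exact (blk_of_ge hi).trans ((hst u hu).zero i (by omega))
  have hlo : ∀ u v, lo (fun i : Fin (n + a + a) => blk (blk s.reg n a u) (n + a) a v i) = σ := by
    intro u v
    funext i
    have := i.2
    simp only [lo, Fin.val_castAdd]
    rw [blk_of_lt (by omega), blk_of_lt this]
  have hmid : ∀ u v, mid (fun i : Fin (n + a + a) => blk (blk s.reg n a (ex u)) (n + a) a v i)
      = u := by
    intro u v
    funext i
    have := i.2
    simp only [mid, Fin.val_castAdd, Fin.val_natAdd]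
    rw [blk_of_lt (by omega), blk_add this]
    simp [ex]
  have hhi : ∀ u v, hi (fun i : Fin (n + a + a) => blk (blk s.reg n a u) (n + a) a v i)
      = fun i : Fin a => v i := by
    intro u v
    funext i
    simp only [hi, Fin.val_natAdd]
    rw [blk_add i.2]
  have hfin : ∀ u v : ℕ → ℕ, blk (blk (blk (blk s.reg n a u) (n + a) a v) n a
      (fun i => blk (blk s.reg n a u) (n + a) a v (n + a + i))) (n + a) a (fun _ => 0) =
      blk s.reg n a v := by
    intro u v
    funext i
    by_cases h₁ : n + a ≤ i ∧ i < n + a + a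
    · rw [blk, if_pos h₁, blk_of_ge h₁.1, hs.zero i (by omega)]
    · rw [blk, if_neg h₁]
      by_cases h₂ : n ≤ i ∧ i < n + a
      · rw [blk, if_pos h₂, blk_add (by omega), blk, if_pos h₂]
      · rw [blk, if_neg h₂, blk, if_neg h₁, blk, if_neg h₂, blk, if_neg h₂]
  have hexr : ∀ v : ℕ → ℕ, blk s.reg n a (ex fun i => v i) = blk s.reg n a v := fun v =>
    blk_congr fun i hi => by simp [ex, hi]
  have hbody : ∀ u : Fin a → ℕ, (∀ i, u i < bd I) → ∀ t, body.Sem (Op.Step I) (st u) t ↔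
      ∃ v : Fin a → ℕ, ((∀ i, v i < bd I) ∧ Q I s.arr σ u v) ∧ t = st v := by
    intro u hu t
    constructor
    · rintro ⟨_, h₁, _, h₂, _, h₃, h₄⟩
      obtain ⟨v, hv, rfl⟩ := run_havocs.1 h₁
      have hc := hst2 u hu v hv
      obtain ⟨rfl, h₅⟩ := (hp I _ hc _).1 h₂
      rw [run_load (fun i hi => Or.inr (by omega)) hc.valid] at h₃
      subst h₃
      rw [run_clears] at h₄
      dsimp only at h₅ h₄
      rw [hlo, hmid, hhi] at h₅
      refine ⟨fun i => v i, ⟨fun i => hv i i.2, h₅⟩, ?_⟩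
      rw [h₄]
      change PM.mk _ _ _ _ = PM.mk _ _ _ _
      congr 1
      rw [hfin, hexr]
    · rintro ⟨v, ⟨hv, hQ⟩, rfl⟩
      have hc := hst2 u hu (ex v) (fun i _ => hex v hv i)
      refine ⟨_, run_havocs.2 ⟨ex v, fun i _ => hex v hv i, rfl⟩, _,
        (hp I _ hc _).2 ⟨rfl, ?_⟩, _, (run_load (fun i hi => Or.inr (by omega)) hc.valid).2 rfl,
        run_clears.2 ?_⟩
      · dsimp only
        rw [hlo, hmid, hhi]
        convert hQ using 2
        simp [ex]
      · change PM.mk _ _ _ _ = PM.mk _ _ _ _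
        congr 1
        exact (hfin _ _).symm
  have hsb : ∀ i, src σ i < bd I := fun i => by
    have := hgs i σ
    dsimp only at this
    rw [this]
    exact hs.valid.reg _
  have hstar : ∀ t, ReflTransGen (body.Sem (Op.Step I)) (st (src σ)) t ↔
      ∃ v, ReflTransGen (fun u v => (∀ i, v i < bd I) ∧ Q I s.arr σ u v) (src σ) v ∧
        (∀ i, v i < bd I) ∧ t = st v := by
    intro t
    constructor
    · intro h
      induction h with
      | refl => exact ⟨_, .refl, hsb, rfl⟩
      | tail _ h ih =>
        obtain ⟨v, h₁, h₂, rfl⟩ := ih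
        obtain ⟨w, h₃, rfl⟩ := (hbody v h₂ _).1 h
        exact ⟨w, h₁.tail h₃, h₃.1, rfl⟩
    · rintro ⟨v, h₁, hv, rfl⟩
      clear hv
      suffices h : ReflTransGen (body.Sem (Op.Step I)) (st (src σ)) (st v) ∧ ∀ i, v i < bd I from
        h.1
      induction h₁ with
      | refl => exact ⟨.refl, hsb⟩
      | tail _ h ih => exact ⟨ih.1.tail ((hbody _ ih.2 _).2 ⟨_, h, rfl⟩), h.1⟩
  have hload : ∀ t, (load n (nat gs) a).Sem (Op.Step I) s t ↔ t = st (src σ) := by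
    intro t
    rw [run_load (fun i hi => Or.inl (by simp [nat, hi])) hs.valid]
    have : blk s.reg n a (fun i => s.reg (nat gs i)) = blk s.reg n a (ex (src σ)) :=
      blk_congr fun i hi => by simp [nat, ex, hi, hgs, σ]
    rw [this]
  have hclear : ∀ v, ({ s with reg := blk (blk s.reg n a v) n a fun _ => 0 } : PM) = s := by
    intro v
    rw [blk_blk, blk_self hs.zero]
  have htests : ∀ v : Fin a → ℕ, (∀ i, i < a → (st v).reg (n + i) = (st v).reg (nat gt i)) ↔
      v = tgt σ := by
    intro v
    have h₁ : ∀ i (hi : i < a), (st v).reg (n + i) = v ⟨i, hi⟩ := fun i hi => by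
      simp only [st]; rw [blk_add hi]; simp [ex, hi]
    have h₂ : ∀ i (hi : i < a), (st v).reg (nat gt i) = tgt σ ⟨i, hi⟩ := fun i hi => by
      simp only [st, hgt, σ, nat, hi, dif_pos]; rw [blk_of_lt (by simp)]
    constructor
    · intro h
      funext i
      rw [← h₁ i i.2, ← h₂ i i.2, h i i.2]
    · rintro h i hi
      rw [h₁ i hi, h₂ i hi, h]
  constructor
  · rintro ⟨_, h₁, _, h₂, _, h₃, h₄⟩
    rw [hload] at h₁
    subst h₁
    obtain ⟨v, h₆, _, rfl⟩ := (hstar _).1 h₂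
    obtain ⟨rfl, h₅⟩ := run_tests.1 h₃
    rw [htests] at h₅
    subst h₅
    rw [run_clears] at h₄
    exact ⟨h₄.trans (hclear (ex (tgt σ))), h₆⟩
  · rintro ⟨rfl, h⟩
    refine ⟨_, (hload _).2 rfl, _, (hstar _).2 ⟨_, h, fun i => ?_, rfl⟩, _,
      run_tests.2 ⟨rfl, (htests _).2 rfl⟩, run_clears.2 (hclear (ex (tgt σ))).symm⟩
    have := hgt i σ
    dsimp only at this
    rw [this]
    exact hs.valid.reg _

theorem tc_one {Q : Inp α → (ℕ → ℕ → ℕ) → (Fin n → ℕ) → ℕ → ℕ → Prop}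
    (h : Dfn (n := n + 1 + 1) (fun I A ρ => Q I A (lo ρ) (mid ρ 0) (hi ρ 0)))
    {src tgt : (Fin n → ℕ) → ℕ} (hsrc : Var src) (htgt : Var tgt) :
    Dfn (fun I A ρ => ReflTransGen (fun u v => v < bd I ∧ Q I A ρ u v) (src ρ) (tgt ρ)) := by
  obtain ⟨p, hp⟩ := tc (Q := fun I A ρ u v => Q I A ρ (u 0) (v 0)) h
    (src := fun ρ _ => src ρ) (tgt := fun ρ _ => tgt ρ) (fun _ => hsrc) (fun _ => htgt)
  refine ⟨p, fun I s hs s' => (hp I s hs s').trans (and_congr_right fun _ => ?_)⟩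
  constructor
  · exact fun h => ReflTransGen.lift (fun u : Fin 1 → ℕ => u 0)
      (fun u v (h : _ ∧ _) => ⟨h.1 0, h.2⟩) _ _ h
  · exact fun h => ReflTransGen.lift (fun (u : ℕ) (_ : Fin 1) => u)
      (fun u v (h : _ ∧ _) => ⟨fun _ => h.1, h.2⟩) _ _ h

end Dfn

end Definable

end XNL

/-! ### The main loop of the decision procedure. -/

namespace XNL

open Relation Function

section Loop

variable {α : Type}

/-! ### A program scheme: one loop that updates two registers and two rows of the array -/

open Code Prog

/-- Overwrite row `reg i` by a row that starts with the registers `j`, `j + 1`, `j + 2`. -/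
def Code.putRow (n i j : ℕ) : Code α :=
  seq (goRow n i) (seq (act .chavoc) (seq (act (.ceq j 0)) (seq (act (.ceq (j + 1) 1))
    (seq (act (.ceq (j + 2) 2)) (backRow n)))))

/-- `g` is a row of numbers in range that starts with `x`, `y`, `z`. -/
structure IsRow (I : Inp α) (x y z : ℕ) (g : ℕ → ℕ) : Prop where
  lt : ∀ i, g i < bd I
  zero : x = g 0
  one : y = g 1
  two : z = g 2

/-- The row is overwritten by arbitrary contents that are then compared with the three registers.
Its further entries stay unspecified. -/
theorem Code.run_putRow {I : Inp α} {n i j : ℕ} (hi : i < n) (hj : j + 2 < n) {s s' : PM}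
    (hs : s.Clean I n) : (putRow n i j).Sem (Op.Step I) s s' ↔
      s.reg i < rows I ∧ ∃ g, IsRow I (s.reg j) (s.reg (j + 1)) (s.reg (j + 2)) g ∧
        s' = { s with arr := update s.arr (s.reg i) g } := by
  have h0 : update s.reg n (s.reg i) (n + 1) = 0 := by simpa using hs.zero (n + 1) (by omega)
  have hjn : ∀ k, k < n → update s.reg n (s.reg i) k = s.reg k := fun k hk => by simp [hk.ne]
  have hval : s.reg i < rows I → ∀ g : ℕ → ℕ, (∀ j, g j < bd I) → 
      PM.Valid I ⟨s.h, update s.reg n (s.reg i), update s.arr (s.reg i) g, s.reg i⟩ := by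
    intro h g hg
    refine ⟨fun k => ?_, fun k => ?_, h⟩
    · simp only [update_apply]; split_ifs <;> exact hs.valid.reg _
    · simp only [update_apply]; split_ifs
      · exact hg
      · exact hs.valid.arr _
  have key : ∀ g : ℕ → ℕ, PM.mk s.h (update (update s.reg n (s.reg i)) n 0)
      (update s.arr (s.reg i) g) 0 = { s with arr := update s.arr (s.reg i) g } := fun g => by
    rw [update_idem, update_eq_self_iff.2 (hs.zero n le_rfl).symm, ← hs.c]
  constructor
  · rintro ⟨_, h₁, _, ⟨g, hg, rfl⟩, _, ⟨rfl, e₀⟩, _, ⟨rfl, e₁⟩, _, ⟨rfl, e₂⟩, h₂⟩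
    obtain ⟨h₃, rfl⟩ := (run_goRow hi hs).1 h₁
    dsimp only at *
    rw [run_backRow (hval h₃ g hg) (by simp) h0] at h₂
    rw [hjn _ (by omega), update_self] at e₀ e₁ e₂
    exact ⟨h₃, g, ⟨hg, e₀, e₁, e₂⟩, h₂.trans (key g)⟩
  · rintro ⟨h, g, ⟨hg, e₀, e₁, e₂⟩, rfl⟩
    refine ⟨_, (run_goRow hi hs).2 ⟨h, rfl⟩, _, ⟨g, hg, rfl⟩, _, ⟨rfl, ?_⟩, _, ⟨rfl, ?_⟩, _,
      ⟨rfl, ?_⟩, (run_backRow (hval h g hg) (by simp) h0).2 (key g).symm⟩ <;>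
    · dsimp only
      rw [hjn _ (by omega), update_self]
      assumption

/-- One round: new values `w 0`, `w 1` for the last two registers, and new rows number `w 2` and
`w 6`, subject to the predicate `P`. -/
def Round (P : Inp α → (ℕ → ℕ → ℕ) → (Fin (7 + 10) → ℕ) → Prop) (I : Inp α)
    (y y' : (Fin 7 → ℕ) × (ℕ → ℕ → ℕ)) : Prop :=
  ∃ w : Fin 10 → ℕ, (∀ i, w i < bd I) ∧ P I y.2 (Fin.append y.1 w) ∧
    w 2 < rows I ∧ w 6 < rows I ∧ ∃ g g', IsRow I (w 3) (w 4) (w 5) g ∧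
      IsRow I (w 7) (w 8) (w 9) g' ∧
      y' = (update (update y.1 5 (w 0)) 6 (w 1), update (update y.2 (w 2) g) (w 6) g')

/-- The configuration with given registers and array. -/
def PM.ofPair (y : (Fin 7 → ℕ) × (ℕ → ℕ → ℕ)) : PM where
  h := 0
  reg := fun i => if h : i < 7 then y.1 ⟨i, h⟩ else 0
  arr := y.2
  c := 0

/-- All numbers are in range. -/
def InRange (I : Inp α) (y : (Fin 7 → ℕ) × (ℕ → ℕ → ℕ)) : Prop :=
  (∀ i, y.1 i < bd I) ∧ ∀ i j, y.2 i j < bd I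

theorem InRange.clean {I : Inp α} {y : (Fin 7 → ℕ) × (ℕ → ℕ → ℕ)} (h : InRange I y) :
    (PM.ofPair y).Clean I 7 where
  valid := by
    refine ⟨fun i => ?_, h.2, Nat.succ_pos _⟩
    simp only [PM.ofPair]
    split_ifs
    · exact h.1 _
    · exact bd_pos I
  h := rfl
  c := rfl
  zero i hi := dif_neg (by omega)

theorem Round.inRange {P : Inp α → (ℕ → ℕ → ℕ) → (Fin (7 + 10) → ℕ) → Prop} {I : Inp α}
    {y y' : (Fin 7 → ℕ) × (ℕ → ℕ → ℕ)} (hy : InRange I y) (h : Round P I y y') :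
    InRange I y' := by
  obtain ⟨w, hw, -, -, -, g, g', hg, hg', rfl⟩ := h
  constructor
  · intro i
    simp only [update_apply]
    split_ifs
    · exact hw _
    · exact hw _
    · exact hy.1 _
  · intro i
    simp only [update_apply]
    split_ifs
    · exact hg'.lt
    · exact hg.lt
    · exact hy.2 _

/-- All new values are guessed first and judged by one predicate that sees the old configuration;
only then are they written. Thus a transition is described by a mere test. -/
theorem exists_round {P : Inp α → (ℕ → ℕ → ℕ) → (Fin (7 + 10) → ℕ) → Prop} (hP : Dfn P) :
    ∃ q : Code α, ∀ I y, InRange I y → ∀ s', q.Sem (Op.Step I) (PM.ofPair y) s' ↔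
      ∃ y', Round P I y y' ∧ s' = PM.ofPair y' := by
  obtain ⟨p, hp⟩ := hP
  -- The guesses occupy the registers `7` to `16`, and `17` is the first scratch register. So `9`
  -- and `13` hold the row numbers `w 2` and `w 6`, the contents follow directly behind them, and `w
  -- 0`, `w 1` are copied from `7`, `8` to `5`, `6`.
  refine ⟨seq (havocs 7 10) (seq p (seq (putRow 17 9 10) (seq (putRow 17 13 14)
    (seq (load 5 (fun i => 7 + i) 2) (clears 7 10))))), fun I y hy s' => ?_⟩
  have hs := hy.clean
  let st (w : ℕ → ℕ) (A : ℕ → ℕ → ℕ) : PM := ⟨0, blk (PM.ofPair y).reg 7 10 w, A, 0⟩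
  have hst : ∀ w A, (∀ i, i < 10 → w i < bd I) → (∀ i j, A i j < bd I) →
      (st w A).Clean I (7 + 10) := by
    intro w A hw hA
    refine ⟨⟨fun i => ?_, hA, Nat.succ_pos _⟩, rfl, rfl, fun i hi => ?_⟩
    · simp only [st, blk]
      split_ifs
      · exact hw _ (by omega)
      · exact hs.valid.reg _
    · exact (blk_of_ge (ρ := (PM.ofPair y).reg) hi).trans (hs.zero i (by omega))
  have hargs : ∀ w A, (fun i : Fin (7 + 10) => (st w A).reg i) =
      Fin.append y.1 (fun i : Fin 10 => w i) := by
    intro w A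
    funext i
    refine Fin.addCases (fun i => ?_) (fun i => ?_) i
    · simp only [st, Fin.append_left, Fin.val_castAdd]
      rw [blk_of_lt i.2]
      simp [PM.ofPair]
    · simp only [st, Fin.append_right, Fin.val_natAdd]
      exact blk_add i.2
  have hA2 : ∀ (A : ℕ → ℕ → ℕ) (k : ℕ) (g : ℕ → ℕ), (∀ i j, A i j < bd I) → (∀ i, g i < bd I) →
      ∀ i j, update A k g i j < bd I := by
    intro A k g hA hg i
    simp only [update_apply]
    split_ifs
    · exact hg
    · exact hA _
  have hreg : ∀ w A i, i < 10 → (st w A).reg (7 + i) = w i := fun w A i hi => blk_add hi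
  have hend : ∀ w A, (∀ i, i < 10 → w i < bd I) → (∀ i j, A i j < bd I) →
      ((seq (load 5 (fun i => 7 + i) 2) (clears 7 10)).Sem (Op.Step I) (st w A) s' ↔
        s' = PM.ofPair (update (update y.1 5 (w 0)) 6 (w 1), A)) := by
    intro w A hw hA
    have hfin : PM.mk 0 (blk (blk (st w A).reg 5 2 (fun i => (st w A).reg (7 + i))) 7 10
        fun _ => 0) A 0 = PM.ofPair (update (update y.1 5 (w 0)) 6 (w 1), A) := by
      change PM.mk _ _ _ _ = PM.mk _ _ _ _
      congr 1
      funext i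
      by_cases h₁ : i < 7
      · rw [dif_pos h₁, blk_of_lt h₁]
        interval_cases i <;> simp [blk, st, PM.ofPair, Fin.ext_iff]
      · rw [dif_neg h₁]
        by_cases h₂ : i < 17
        · rw [blk, if_pos (by omega)]
        · rw [blk_of_ge (by omega), blk_of_ge (by omega)]
          exact (hst w A hw hA).zero i (by omega)
    constructor
    · rintro ⟨t, h₁, h₂⟩
      rw [run_load (fun i hi => Or.inr (by omega)) (hst w A hw hA).valid] at h₁
      subst h₁
      rw [run_clears] at h₂
      rw [h₂]
      exact hfin
    · rintro rfl
      exact ⟨_, (run_load (fun i hi => Or.inr (by omega)) (hst w A hw hA).valid).2 rfl,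
        run_clears.2 hfin.symm⟩
  constructor
  · rintro ⟨_, h₁, _, h₂, _, h₃, _, h₄, h₅⟩
    obtain ⟨w, hw, rfl⟩ := run_havocs.1 h₁
    have hc := hst w y.2 hw hy.2
    obtain ⟨rfl, hP⟩ := (hp I _ hc _).1 h₂
    change P I y.2 (fun i => (st w y.2).reg i) at hP
    rw [hargs] at hP
    change (putRow 17 9 10).Sem _ (st w y.2) _ at h₃
    obtain ⟨hr, g, hg, rfl⟩ := (run_putRow (by omega) (by omega) hc).1 h₃
    have hA := hA2 y.2 ((st w y.2).reg 9) g hy.2 hg.lt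
    have hc' := hst w _ hw hA
    change (putRow 17 13 14).Sem _ (st w _) _ at h₄
    obtain ⟨hr', g', hg', rfl⟩ := (run_putRow (by omega) (by omega) hc').1 h₄
    have hA' := hA2 _ ((st w y.2).reg 13) g' hA hg'.lt
    exact ⟨_, ⟨fun i => w i, fun i => hw i i.2, hP, hr, hr', g, g', hg, hg', rfl⟩,
      (hend w _ hw hA').1 h₅⟩
  · rintro ⟨_, ⟨w, hw, hP, hr, hr', g, g', hg, hg', rfl⟩, rfl⟩
    let w' : ℕ → ℕ := fun i => if h : i < 10 then w ⟨i, h⟩ else 0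
    have hw' : ∀ i, i < 10 → w' i < bd I := fun i hi => by simpa [w', hi] using hw _
    have hA := hA2 y.2 (w 2) g hy.2 hg.lt
    have hA' := hA2 _ (w 6) g' hA hg'.lt
    refine ⟨_, run_havocs.2 ⟨w', hw', rfl⟩, _, (hp I _ (hst w' y.2 hw' hy.2) _).2 ⟨rfl, ?_⟩, _,
      (run_putRow (by omega) (by omega) (hst w' y.2 hw' hy.2)).2 ⟨hr, g, hg, rfl⟩, _,
      (run_putRow (by omega) (by omega) (hst w' _ hw' hA)).2 ⟨hr', g', hg', rfl⟩,
      (hend w' _ hw' hA').2 rfl⟩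
    change P I y.2 (fun i => (st w' y.2).reg i)
    rw [hargs]
    convert hP using 2
    simp [w']

/-- The initial configuration. -/
def PM.zero : PM := ⟨0, fun _ => 0, fun _ _ => 0, 0⟩

theorem PM.valid_zero (I : Inp α) : PM.zero.Valid I :=
  ⟨fun _ => bd_pos I, fun _ _ => bd_pos I, Nat.succ_pos _⟩

/-- Guess the registers, do one round of the first kind, any number of rounds of the second kind,
and a final test. -/
theorem exists_loop {P₀ P₁ : Inp α → (ℕ → ℕ → ℕ) → (Fin (7 + 10) → ℕ) → Prop}
    {P₂ : Inp α → (ℕ → ℕ → ℕ) → (Fin 7 → ℕ) → Prop} (h₀ : Dfn P₀) (h₁ : Dfn P₁) (h₂ : Dfn P₂) :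
    ∃ q : Code α, ∀ I, (∃ s', q.Sem (Op.Step I) PM.zero s') ↔
      ∃ r y y', (∀ i, r i < bd I) ∧ Round P₀ I (r, fun _ _ => 0) y ∧
        ReflTransGen (Round P₁ I) y y' ∧ P₂ I y'.2 y'.1 := by
  obtain ⟨q₀, h₀⟩ := exists_round h₀
  obtain ⟨q₁, h₁⟩ := exists_round h₁
  obtain ⟨q₂, h₂⟩ := h₂
  refine ⟨seq (havocs 0 7) (seq q₀ (seq (star q₁) q₂)), fun I => ?_⟩
  have hstar : ∀ y, InRange I y → ∀ t, ReflTransGen (q₁.Sem (Op.Step I)) (PM.ofPair y) t ↔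
      ∃ y', ReflTransGen (Round P₁ I) y y' ∧ InRange I y' ∧ t = PM.ofPair y' := by
    intro y hy t
    constructor
    · intro h
      induction h with
      | refl => exact ⟨y, .refl, hy, rfl⟩
      | tail _ h ih =>
        obtain ⟨z, h₃, h₄, rfl⟩ := ih
        obtain ⟨z', h₅, rfl⟩ := (h₁ I z h₄ _).1 h
        exact ⟨z', h₃.tail h₅, h₅.inRange h₄, rfl⟩
    · rintro ⟨y', h, -, rfl⟩
      suffices h : ReflTransGen (q₁.Sem (Op.Step I)) (PM.ofPair y) (PM.ofPair y') ∧
        InRange I y' from h.1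
      induction h with
      | refl => exact ⟨.refl, hy⟩
      | tail _ h ih => exact ⟨ih.1.tail ((h₁ I _ ih.2 _).2 ⟨_, h, rfl⟩), h.inRange ih.2⟩
  have hpair : ∀ u : ℕ → ℕ, PM.mk 0 (blk (fun _ => 0) 0 7 u) (fun _ _ => 0) 0 =
      PM.ofPair (fun i => u i, fun _ _ => 0) := fun u => by
    simp only [PM.ofPair, PM.mk.injEq, true_and, and_true]
    funext i
    simp [blk]
  have hargs : ∀ y : (Fin 7 → ℕ) × (ℕ → ℕ → ℕ), (fun i : Fin 7 => (PM.ofPair y).reg i) = y.1 :=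
    fun y => by funext i; simp [PM.ofPair]
  constructor
  · rintro ⟨s', _, h₃, _, h₄, _, h₅, h₆⟩
    obtain ⟨u, hu, rfl⟩ := run_havocs.1 h₃
    simp only [PM.zero, hpair] at h₄
    have hr : InRange I (fun i : Fin 7 => u i, fun _ _ => 0) :=
      ⟨fun i => hu i i.2, fun _ _ => bd_pos I⟩
    obtain ⟨y, h₇, rfl⟩ := (h₀ I _ hr _).1 h₄
    obtain ⟨y', h₈, hy', rfl⟩ := (hstar y (h₇.inRange hr) _).1 h₅
    obtain ⟨rfl, h₉⟩ := (h₂ I _ hy'.clean _).1 h₆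
    rw [hargs] at h₉
    exact ⟨_, y, y', hr.1, h₇, h₈, h₉⟩
  · rintro ⟨r, y, y', hr, h₃, h₄, h₅⟩
    have hr' : InRange I (r, fun _ _ => 0) := ⟨hr, fun _ _ => bd_pos I⟩
    have hy := h₃.inRange hr'
    have h₆ := (hstar y hy _).2 ⟨y', h₄, by
      clear h₅
      induction h₄ with
      | refl => exact hy
      | tail _ h ih => exact h.inRange ih, rfl⟩
    obtain ⟨z, -, hz, h₇⟩ := (hstar y hy _).1 h₆
    refine ⟨_, _, run_havocs.2 ⟨fun i => if h : i < 7 then r ⟨i, h⟩ else 0, fun i hi => ?_, rfl⟩,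
      _, (h₀ I _ hr' _ ).2 ⟨y, h₃, rfl⟩ |> cast ?_, _, h₆, (h₂ I _ ?_ _).2 ⟨rfl, ?_⟩⟩
    · simpa [hi] using hr _
    · simp [PM.zero, hpair]
    · rw [h₇]; exact hz.clean
    · rw [hargs]; exact h₅

end Loop

end XNL

/-! ### Registers and array on two work tapes. -/

namespace XNL

open Relation Function

section Tapes

variable {α : Type} {m : ℕ}

/-! ### Two work tapes that realise a pointer machine

The first tape stores the registers, one track for each, between two end marks; the second tape
stores the rows of the array one after the other. -/

inductive Cell (m : ℕ) : Type
  | blank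
  | left
  | right
  | bits (v : Fin m → Bool)

/-- The bit on track `i`. -/
def bitAt (v : Fin m → Bool) (i : ℕ) : Bool := if h : i < m then v ⟨i, h⟩ else false

/-- Configurations with the input head and two work tapes. -/
structure Duo (m : ℕ) : Type where
  h : ℕ
  t₀ : ℕ → Cell m
  t₁ : ℕ → Cell m
  p₀ : ℕ
  p₁ : ℕ

/-- Local actions: from the scanned symbols, the allowed moves of the input head and the allowed
writes and moves on the two tapes. -/
abbrev Act (α : Type) (m : ℕ) : Type :=
  InSym α → Cell m → Cell m → Set (Move × (Cell m × Move) × (Cell m × Move))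

/-- The right end mark is neither overwritten nor crossed. -/
def Safe (c : Cell m) (x : Cell m × Move) : Prop :=
  c = .right → x.1 = .right ∧ x.2 ≠ .right

def Act.Exec (I : Inp α) (a : Act α m) (C C' : Duo m) : Prop :=
  ∃ x ∈ a (sy I C.h) (C.t₀ C.p₀) (C.t₁ C.p₁), Safe (C.t₀ C.p₀) x.2.1 ∧ Safe (C.t₁ C.p₁) x.2.2 ∧
    C' = ⟨min (x.1.apply C.h) ((tp I).length - 1), update C.t₀ C.p₀ x.2.1.1,
      update C.t₁ C.p₁ x.2.2.1, x.2.1.2.apply C.p₀, x.2.2.2.apply C.p₁⟩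

/-- The least significant bit comes first. The number of tracks is fixed by the program, whereas the
number of cells between the end marks depends on the input. -/
def regTape (m : ℕ) (I : Inp α) (ρ : ℕ → ℕ) (p : ℕ) : Cell m :=
  if p = 0 then .left else if p ≤ wd I then .bits (fun i => (ρ i).testBit (p - 1))
  else if p = wd I + 1 then .right else .blank

def arrTape (m : ℕ) (I : Inp α) (A : ℕ → ℕ → ℕ) (p : ℕ) : Cell m :=
  if p = 0 then .left
  else if p ≤ rows I * wd I then
    .bits (fun i => (A ((p - 1) / wd I) i).testBit ((p - 1) % wd I))
  else if p = rows I * wd I + 1 then .right else .blank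

/-- The tapes that represent `s`, with heads at given positions. -/
def duo (m : ℕ) (I : Inp α) (s : PM) (p₀ p₁ : ℕ) : Duo m :=
  ⟨s.h, regTape m I s.reg, arrTape m I s.arr, p₀, p₁⟩

/-- The configuration that represents `s`. -/
def rep (m : ℕ) (I : Inp α) (s : PM) : Duo m := duo m I s 1 (1 + s.c * wd I)

theorem wd_pos (I : Inp α) : 0 < wd I := by
  have := length_lt_bd I
  rw [length_tp] at this
  unfold bd at this
  by_contra h
  have : wd I = 0 := by omega
  simp_all

theorem regTape_zero (I : Inp α) (ρ : ℕ → ℕ) : regTape m I ρ 0 = .left := rfl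

theorem regTape_cell {I : Inp α} {ρ : ℕ → ℕ} {i : ℕ} (hi : i < wd I) :
    regTape m I ρ (1 + i) = .bits (fun j => (ρ j).testBit i) := by
  rw [regTape, if_neg (by omega), if_pos (by omega), Nat.add_sub_cancel_left]

theorem regTape_end {I : Inp α} {ρ : ℕ → ℕ} : regTape m I ρ (1 + wd I) = .right := by
  rw [regTape, if_neg (by omega), if_neg (by omega), if_pos (by omega)]

theorem regTape_ne_left {I : Inp α} {ρ : ℕ → ℕ} {p : ℕ} (hp : p ≠ 0) :
    regTape m I ρ p ≠ .left := by
  unfold regTape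
  rw [if_neg hp]
  split_ifs <;> simp

theorem row_lt {I : Inp α} {c i : ℕ} (hc : c < rows I) (hi : i < wd I) :
    c * wd I + i < rows I * wd I := by
  have : (c + 1) * wd I ≤ rows I * wd I := Nat.mul_le_mul_right _ hc
  rw [Nat.succ_mul] at this
  omega

theorem arrTape_cell {I : Inp α} {A : ℕ → ℕ → ℕ} {c i : ℕ} (hc : c < rows I) (hi : i < wd I) :
    arrTape m I A (1 + c * wd I + i) = .bits (fun j => (A c j).testBit i) := by
  have := row_lt hc hi
  have h₁ : (c * wd I + i) / wd I = c := by
    rw [Nat.mul_comm, Nat.mul_add_div (wd_pos I), Nat.div_eq_of_lt hi, Nat.add_zero]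
  have h₂ : (c * wd I + i) % wd I = i := by
    rw [Nat.mul_comm, Nat.mul_add_mod, Nat.mod_eq_of_lt hi]
  rw [arrTape, if_neg (by omega), if_pos (by omega),
    show 1 + c * wd I + i - 1 = c * wd I + i by omega, h₁, h₂]

theorem arrTape_eq_right {I : Inp α} {A : ℕ → ℕ → ℕ} {p : ℕ} :
    arrTape m I A p = .right ↔ p = rows I * wd I + 1 := by
  unfold arrTape
  split_ifs <;> simp_all
  omega

theorem exists_bits (W : ℕ) (f : ℕ → Bool) : ∃ v, v < 2 ^ W ∧ ∀ k, k < W → v.testBit k = f k :=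
  ⟨Nat.ofBits (fun i : Fin W => f i), Nat.ofBits_lt_two_pow _,
    fun k hk => by rw [Nat.testBit_ofBits_lt _ _ hk]⟩

theorem eq_of_bits {W v w : ℕ} (hv : v < 2 ^ W) (hw : w < 2 ^ W)
    (h : ∀ k, k < W → v.testBit k = w.testBit k) : v = w := by
  refine Nat.eq_of_testBit_eq fun k => ?_
  rcases lt_or_ge k W with hk | hk
  · exact h k hk
  · have := Nat.pow_le_pow_right (n := 2) (by norm_num) hk
    rw [Nat.testBit_lt_two_pow (hv.trans_le this), Nat.testBit_lt_two_pow (hw.trans_le this)]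

/-- Addition of one with the least significant digit first: a block of ones becomes zeros, the next
zero becomes a one, and the rest is unchanged. A single pass with finite memory checks this pattern.
-/
theorem succ_iff_bits {W v w : ℕ} (hv : v < 2 ^ W) (hw : w < 2 ^ W) : w = v + 1 ↔
    ∃ k, k < W ∧ (∀ l, l < k → v.testBit l = true ∧ w.testBit l = false) ∧
      (v.testBit k = false ∧ w.testBit k = true) ∧
      ∀ l, k < l → l < W → v.testBit l = w.testBit l := by
  induction W generalizing v w with
  | zero =>
    rw [pow_zero, Nat.lt_one_iff] at hv hw
    subst hv hw
    simp
  | succ W ih =>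
    have hv' : v / 2 < 2 ^ W := by rw [pow_succ] at hv; omega
    have hw' : w / 2 < 2 ^ W := by rw [pow_succ] at hw; omega
    have ih := ih hv' hw'
    constructor
    · intro h
      -- If the lowest digit of `v` is zero, the carry ends there; otherwise it goes on to the
      -- halves.
      rcases Nat.mod_two_eq_zero_or_one v with h₀ | h₀
      · refine ⟨0, by omega, by simp, ⟨by simp [h₀], by simp; omega⟩, fun l hl _ => ?_⟩
        obtain ⟨l, rfl⟩ : ∃ l', l = l' + 1 := ⟨l - 1, by omega⟩
        rw [Nat.testBit_succ, Nat.testBit_succ, show w / 2 = v / 2 by omega]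
      · obtain ⟨k, hk, h₁, h₂, h₃⟩ := ih.1 (by omega)
        refine ⟨k + 1, by omega, fun l hl => ?_, ?_, fun l hl hl' => ?_⟩
        · cases l with
          | zero => exact ⟨by simp [h₀], by simp; omega⟩
          | succ l => simpa only [Nat.testBit_succ] using h₁ l (by omega)
        · simpa only [Nat.testBit_succ] using h₂
        · obtain ⟨l, rfl⟩ : ∃ l', l = l' + 1 := ⟨l - 1, by omega⟩
          simpa only [Nat.testBit_succ] using h₃ l (by omega) (by omega)
    · rintro ⟨k, hk, h₁, h₂, h₃⟩
      cases k with
      | zero =>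
        have : v / 2 = w / 2 := eq_of_bits hv' hw' fun l hl => by
          simpa only [Nat.testBit_succ] using h₃ (l + 1) (by omega) (by omega)
        simp only [Nat.testBit_zero, decide_eq_false_iff_not, decide_eq_true_eq] at h₂
        omega
      | succ k =>
        have := ih.2 ⟨k, by omega, fun l hl => by
            simpa only [Nat.testBit_succ] using h₁ (l + 1) (by omega),
          by simpa only [Nat.testBit_succ] using h₂, fun l hl hl' => by
            simpa only [Nat.testBit_succ] using h₃ (l + 1) (by omega) (by omega)⟩
        have h₀ := h₁ 0 (by omega)
        simp only [Nat.testBit_zero, decide_eq_false_iff_not, decide_eq_true_eq] at h₀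
        omega

namespace Act

open Prog

/-- Leave everything as it is, provided that the scanned symbols satisfy `φ`. -/
def chk (φ : InSym α → Cell m → Cell m → Prop) : Act α m := fun σ u w =>
  {x | φ σ u w ∧ x = (.stay, (u, .stay), (w, .stay))}

/-- Move the input head. -/
def hmove (d : Move) : Act α m := fun _ u w => {(d, (u, .stay), (w, .stay))}

/-- Move both work heads to the right over bits with property `φ`. -/
def fwd (φ : (Fin m → Bool) → (Fin m → Bool) → Prop) : Act α m := fun _ u w =>
  {x | ∃ a b, u = .bits a ∧ w = .bits b ∧ φ a b ∧ x = (.stay, (u, .right), (w, .right))}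

/-- Move both work heads to the right and overwrite bits as allowed by `φ`. -/
def wr (φ : (Fin m → Bool) → (Fin m → Bool) → (Fin m → Bool) → (Fin m → Bool) → Prop) :
    Act α m := fun _ u w =>
  {x | ∃ a b a' b', u = .bits a ∧ w = .bits b ∧ φ a b a' b' ∧
    x = (.stay, (.bits a', .right), (.bits b', .right))}

/-- Move the head of the first tape to the right, over bits. -/
def fwdReg : Act α m := fun _ u w =>
  {x | (∃ a, u = .bits a) ∧ x = (.stay, (u, .right), (w, .stay))}

/-- Move the head of the first tape to the left, and that of the second in direction `d`, unless
the left end is reached. -/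
def back (d : Move) : Act α m := fun _ u w =>
  {x | u ≠ .left ∧ x = (.stay, (u, .left), (w, d))}

/-- Leave the left end. -/
def turn (d : Move) : Act α m := fun _ u w =>
  {x | u = .left ∧ x = (.stay, (u, .right), (w, d))}

variable {I : Inp α} {s : PM} {p₀ p₁ : ℕ} {C : Duo m}

theorem exec_chk {φ} (hh : s.h ≤ (tp I).length - 1) :
    (chk φ).Exec I (duo m I s p₀ p₁) C ↔
      φ (sy I s.h) (regTape m I s.reg p₀) (arrTape m I s.arr p₁) ∧ C = duo m I s p₀ p₁ := by
  constructor
  · rintro ⟨_, ⟨h, rfl⟩, -, -, rfl⟩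
    refine ⟨h, ?_⟩
    simp [duo, hh, Move.apply]
  · rintro ⟨h, rfl⟩
    refine ⟨_, ⟨h, rfl⟩, fun h => ⟨h, by simp⟩, fun h => ⟨h, by simp⟩, ?_⟩
    simp [duo, hh, Move.apply]

theorem exec_hmove {d : Move} : (hmove d).Exec I (duo m I s p₀ p₁) C ↔
    C = duo m I { s with h := min (d.apply s.h) ((tp I).length - 1) } p₀ p₁ := by
  constructor
  · rintro ⟨_, rfl, -, -, rfl⟩
    simp [duo, Move.apply]
  · rintro rfl
    refine ⟨_, rfl, fun h => ⟨h, by simp⟩, fun h => ⟨h, by simp⟩, ?_⟩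
    simp [duo, Move.apply]

theorem exec_fwd {φ} (hh : s.h ≤ (tp I).length - 1) :
    (fwd φ).Exec I (duo m I s p₀ p₁) C ↔
      ∃ a b, regTape m I s.reg p₀ = .bits a ∧ arrTape m I s.arr p₁ = .bits b ∧ φ a b ∧
        C = duo m I s (p₀ + 1) (p₁ + 1) := by
  constructor
  · rintro ⟨_, ⟨a, b, h₁, h₂, h₃, rfl⟩, -, -, rfl⟩
    refine ⟨a, b, h₁, h₂, h₃, ?_⟩
    simp [duo, hh, Move.apply]
  · rintro ⟨a, b, h₁, h₂, h₃, rfl⟩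
    refine ⟨_, ⟨a, b, h₁, h₂, h₃, rfl⟩, fun h => ?_, fun h => ?_, ?_⟩
    · simp [duo, h₁] at h
    · simp [duo, h₂] at h
    · simp [duo, hh, Move.apply]

/-- In the middle of a pass over the registers and the row at the cursor. -/
def mdl (m : ℕ) (I : Inp α) (s : PM) (i : ℕ) : Duo m := duo m I s (1 + i) (1 + s.c * wd I + i)

/-- The property `φ` of the bits number `i`. -/
def Bits (m : ℕ) (s : PM) (φ : (Fin m → Bool) → (Fin m → Bool) → Prop) (i : ℕ) : Prop :=
  φ (fun j => (s.reg j).testBit i) (fun j => (s.arr s.c j).testBit i)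

theorem exec_fwd_iff {φ} (hh : s.h ≤ (tp I).length - 1) (hc : s.c < rows I) {i : ℕ}
    (hi : i ≤ wd I) : (fwd φ).Exec I (mdl m I s i) C ↔
      i < wd I ∧ Bits m s φ i ∧ C = mdl m I s (i + 1) := by
  rcases lt_or_eq_of_le hi with hi | rfl
  · rw [mdl, exec_fwd hh, regTape_cell hi, arrTape_cell hc hi]
    simp only [Cell.bits.injEq, exists_and_left, ↓existsAndEq, true_and, hi]
    rfl
  · rw [mdl, exec_fwd hh, regTape_end]
    simp

theorem sem_star_fwd {φ} (hh : s.h ≤ (tp I).length - 1) (hc : s.c < rows I) {i : ℕ}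
    (hi : i ≤ wd I) : (star (act (fwd φ))).Sem (Exec I) (mdl m I s i) C ↔
      ∃ j, i ≤ j ∧ j ≤ wd I ∧ (∀ k, i ≤ k → k < j → Bits m s φ k) ∧ C = mdl m I s j := by
  constructor
  · intro h
    change ReflTransGen _ _ _ at h
    induction h with
    | refl => exact ⟨i, le_rfl, hi, fun k h h' => by omega, rfl⟩
    | tail _ h ih =>
      obtain ⟨j, h₁, h₂, h₃, rfl⟩ := ih
      obtain ⟨h₄, h₅, rfl⟩ := (exec_fwd_iff hh hc h₂).1 h
      refine ⟨j + 1, by omega, h₄, fun k hk hk' => ?_, rfl⟩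
      rcases Nat.lt_succ_iff_lt_or_eq.1 hk' with hk' | rfl
      · exact h₃ k hk hk'
      · exact h₅
  · rintro ⟨j, h₁, h₂, h₃, rfl⟩
    change ReflTransGen _ _ _
    induction j, h₁ using Nat.le_induction with
    | base => exact .refl
    | succ j hj ih =>
      exact (ih (by omega) fun k hk hk' => h₃ k hk (by omega)).tail
        ((exec_fwd_iff hh hc (by omega)).2 ⟨h₂, h₃ j hj (by omega), rfl⟩)

/-- Check that the head of the first tape is at the right end. -/
def atEnd : Prog (Act α m) := act (chk fun _ u _ => u = .right)

/-- Move back to the left end. -/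
def rewind (d d' : Move) : Prog (Act α m) := seq (star (act (back d))) (act (turn d'))

theorem sem_atEnd (hh : s.h ≤ (tp I).length - 1) : atEnd.Sem (Exec I) (duo m I s p₀ p₁) C ↔
    p₀ = 1 + wd I ∧ C = duo m I s p₀ p₁ := by
  refine (exec_chk hh).trans (and_congr_left fun _ => ?_)
  unfold regTape
  split_ifs <;> simp_all <;> omega

/-- The first tape is the ruler: its left end mark decides how far both heads go back, and truncated
subtraction agrees with a second head that is stopped at cell `0`. The hypothesis on `p₁` keeps the
second head off its right end mark, where the closing move to the right would not be `Safe`. -/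
theorem sem_rewind_left (hh : s.h ≤ (tp I).length - 1)
    (h₁ : p₁ ≤ rows I * wd I + p₀) : (rewind .left .right).Sem (Exec I) (duo m I s p₀ p₁) C ↔
      C = duo m I s 1 (p₁ - p₀ + 1) := by
  have loop : ∀ C, ReflTransGen ((act (back .left)).Sem (Exec I)) (duo m I s p₀ p₁) C ↔
      ∃ j, j ≤ p₀ ∧ C = duo m I s (p₀ - j) (p₁ - j) := by
    intro C
    constructor
    · intro h
      induction h with
      | refl => exact ⟨0, Nat.zero_le _, rfl⟩
      | tail _ h ih =>
        obtain ⟨j, hj, rfl⟩ := ih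
        obtain ⟨_, ⟨h, rfl⟩, -, -, rfl⟩ := h
        have : p₀ - j ≠ 0 := fun h' => h (by simp [duo, h', regTape_zero])
        refine ⟨j + 1, by omega, ?_⟩
        simp [duo, hh, Move.apply, Nat.sub_sub]
    · rintro ⟨j, hj, rfl⟩
      induction j with
      | zero => exact .refl
      | succ j ih =>
        refine (ih (by omega)).tail ⟨_, ⟨regTape_ne_left (by simp [duo]; omega), rfl⟩,
          fun h => ⟨h, by simp⟩, fun h => ⟨h, by simp⟩, ?_⟩
        simp [duo, hh, Move.apply, Nat.sub_sub]
  constructor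
  · rintro ⟨_, h₂, _, ⟨h₃, rfl⟩, -, -, rfl⟩
    obtain ⟨j, hj, rfl⟩ := (loop _).1 h₂
    have : p₀ - j = 0 := by
      by_contra h
      exact regTape_ne_left h h₃
    obtain rfl : p₀ = j := by omega
    simp [duo, hh, Move.apply]
  · rintro rfl
    refine ⟨_, (loop _).2 ⟨p₀, le_rfl, rfl⟩, _, ⟨by simp [duo, regTape_zero], rfl⟩, fun h => ?_,
      fun h => ?_, ?_⟩
    · simp [duo, regTape_zero] at h
    · simp only [duo] at h
      rw [arrTape_eq_right] at h
      omega
    · simp [duo, hh, Move.apply]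

theorem sem_rewind_stay (hh : s.h ≤ (tp I).length - 1) :
    (rewind .stay .stay).Sem (Exec I) (duo m I s p₀ p₁) C ↔ C = duo m I s 1 p₁ := by
  have loop : ∀ C, ReflTransGen ((act (back .stay)).Sem (Exec I)) (duo m I s p₀ p₁) C ↔
      ∃ j, j ≤ p₀ ∧ C = duo m I s (p₀ - j) p₁ := by
    intro C
    constructor
    · intro h
      induction h with
      | refl => exact ⟨0, Nat.zero_le _, rfl⟩
      | tail _ h ih =>
        obtain ⟨j, hj, rfl⟩ := ih
        obtain ⟨_, ⟨h, rfl⟩, -, -, rfl⟩ := h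
        have : p₀ - j ≠ 0 := fun h' => h (by simp [duo, h', regTape_zero])
        refine ⟨j + 1, by omega, ?_⟩
        simp [duo, hh, Move.apply, Nat.sub_sub]
    · rintro ⟨j, hj, rfl⟩
      induction j with
      | zero => exact .refl
      | succ j ih =>
        refine (ih (by omega)).tail ⟨_, ⟨regTape_ne_left (by simp [duo]; omega), rfl⟩,
          fun h => ⟨h, by simp⟩, fun h => ⟨h, by simp⟩, ?_⟩
        simp [duo, hh, Move.apply, Nat.sub_sub]
  constructor
  · rintro ⟨_, h₂, _, ⟨h₃, rfl⟩, -, -, rfl⟩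
    obtain ⟨j, hj, rfl⟩ := (loop _).1 h₂
    have : p₀ - j = 0 := by
      by_contra h
      exact regTape_ne_left h h₃
    obtain rfl : p₀ = j := by omega
    simp [duo, hh, Move.apply]
  · rintro rfl
    refine ⟨_, (loop _).2 ⟨p₀, le_rfl, rfl⟩, _, ⟨by simp [duo, regTape_zero], rfl⟩, fun h => ?_,
      fun h => ⟨h, by simp⟩, ?_⟩
    · simp [duo, regTape_zero] at h
    · simp [duo, hh, Move.apply]

/-- A pass forth and back. -/
def pass (p : Prog (Act α m)) : Prog (Act α m) := seq p (seq atEnd (rewind .left .right))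

/-- `R s' j` describes what `p` may have achieved after `j` bits. The check for the right end
discards all runs that stop before the last bit. -/
theorem sem_pass {p : Prog (Act α m)} (hh : s.h ≤ (tp I).length - 1) (R : PM → ℕ → Prop)
    (hR : ∀ s' j, R s' j → s'.h = s.h ∧ s'.c < rows I)
    (hp : ∀ C, p.Sem (Exec I) (rep m I s) C ↔ ∃ s' j, R s' j ∧ C = mdl m I s' j) :
    (pass p).Sem (Exec I) (rep m I s) C ↔ ∃ s', R s' (wd I) ∧ C = rep m I s' := by
  have key : ∀ s', R s' (wd I) → ∀ C, (rewind .left .right).Sem (Exec I) (mdl m I s' (wd I)) C ↔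
      C = rep m I s' := by
    intro s' h C
    obtain ⟨h₁, h₂⟩ := hR s' _ h
    have := Nat.mul_le_mul_right (wd I) h₂.le
    rw [mdl, sem_rewind_left (h₁ ▸ hh) (by omega), rep,
      show 1 + s'.c * wd I + wd I - (1 + wd I) + 1 = 1 + s'.c * wd I by omega]
  constructor
  · rintro ⟨_, h₁, _, h₂, h₃⟩
    obtain ⟨s', j, h₄, rfl⟩ := (hp _).1 h₁
    have h₅ := hR s' j h₄
    obtain ⟨h₆, rfl⟩ := (sem_atEnd (h₅.1 ▸ hh)).1 h₂
    obtain rfl : j = wd I := by omega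
    exact ⟨s', h₄, (key s' h₄ C).1 h₃⟩
  · rintro ⟨s', h, rfl⟩
    exact ⟨_, (hp _).2 ⟨s', _, h, rfl⟩, _, (sem_atEnd ((hR s' _ h).1 ▸ hh)).2 ⟨rfl, rfl⟩,
      (key s' h _).2 rfl⟩

/-- Passes that test all bits. -/
theorem sem_pass_star {φ} (hh : s.h ≤ (tp I).length - 1) (hc : s.c < rows I) :
    (pass (star (act (fwd φ)))).Sem (Exec I) (rep m I s) C ↔
      (∀ k, k < wd I → Bits m s φ k) ∧ C = rep m I s := by
  rw [sem_pass hh (fun s' j => s' = s ∧ j ≤ wd I ∧ ∀ k, k < j → Bits m s φ k)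
    (by rintro _ _ ⟨rfl, -⟩; exact ⟨rfl, hc⟩)]
  · simp
  · intro C
    refine (sem_star_fwd (i := 0) hh hc (Nat.zero_le _)).trans ?_
    simp [and_assoc]

end Act

end Tapes

end XNL

namespace XNL

open Relation Function

section Implementation

variable {α : Type} {m : ℕ}

theorem regTape_update {I : Inp α} {ρ ρ' : ℕ → ℕ} {j : ℕ} (hj : j < wd I) {a : Fin m → Bool}
    (ha : ∀ k : Fin m, (ρ' k).testBit j = a k)
    (h : ∀ (k : Fin m) p, p < wd I → p ≠ j → (ρ' k).testBit p = (ρ k).testBit p) :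
    update (regTape m I ρ) (1 + j) (.bits a) = regTape m I ρ' := by
  funext p
  rcases eq_or_ne p (1 + j) with rfl | hp
  · rw [update_self, regTape_cell hj]
    exact congrArg _ (funext fun k => (ha k).symm)
  · rw [update_of_ne hp]
    unfold regTape
    split_ifs with h₁ h₂
    · rfl
    · exact congrArg _ (funext fun k => (h k (p - 1) (by omega) (by omega)).symm)
    · rfl
    · rfl

theorem arrTape_update {I : Inp α} {A A' : ℕ → ℕ → ℕ} {c j : ℕ} (hc : c < rows I)
    (hj : j < wd I) {b : Fin m → Bool} (hb : ∀ k : Fin m, (A' c k).testBit j = b k)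
    (h : ∀ (k : Fin m) p, p < wd I → p ≠ j → (A' c k).testBit p = (A c k).testBit p)
    (hA : ∀ c', c' ≠ c → A' c' = A c') :
    update (arrTape m I A) (1 + c * wd I + j) (.bits b) = arrTape m I A' := by
  have hw := wd_pos I
  funext p
  rcases eq_or_ne p (1 + c * wd I + j) with rfl | hp
  · rw [update_self, arrTape_cell hc hj]
    exact congrArg _ (funext fun k => (hb k).symm)
  · rw [update_of_ne hp]
    unfold arrTape
    split_ifs with h₁ h₂
    · rfl
    · refine congrArg _ (funext fun k => ?_)
      by_cases h₃ : (p - 1) / wd I = c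
      · rw [h₃]
        refine (h k _ (Nat.mod_lt _ hw) fun h₄ => hp ?_).symm
        have := Nat.div_add_mod (p - 1) (wd I)
        rw [h₃, h₄, Nat.mul_comm] at this
        omega
      · rw [hA _ h₃]
    · rfl
    · rfl

/-- All registers and tracks mentioned have numbers below `m`. -/
def Op.Below (m : ℕ) : Op α → Prop
  | havoc i => i < m
  | bits _ i => i < m
  | eq i j => i < m ∧ j < m
  | succ i j => i < m ∧ j < m
  | ceq i j => i < m ∧ j < m
  | _ => True

theorem Op.Below.mono {m n : ℕ} (h : m ≤ n) {a : Op α} (ha : a.Below m) : a.Below n := by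
  cases a <;> simp only [Op.Below] at * <;> omega

theorem Op.exists_below : ∀ a : Op α, ∃ m, a.Below m
  | right => ⟨0, trivial⟩
  | left => ⟨0, trivial⟩
  | scan _ => ⟨0, trivial⟩
  | havoc i => ⟨i + 1, Nat.lt_succ_self _⟩
  | bits _ i => ⟨i + 1, Nat.lt_succ_self _⟩
  | eq i j => ⟨i + j + 1, by simp only [Op.Below]; omega⟩
  | succ i j => ⟨i + j + 1, by simp only [Op.Below]; omega⟩
  | cright => ⟨0, trivial⟩
  | cleft => ⟨0, trivial⟩
  | ceq i j => ⟨i + j + 1, by simp only [Op.Below]; omega⟩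
  | chavoc => ⟨0, trivial⟩

open Prog Act

/-- The instructions as programs for two tapes. -/
def Op.impl (m : ℕ) : Op α → Prog (Act α m)
  | right => act (hmove .right)
  | left => act (hmove .left)
  | scan S => act (chk fun σ _ _ => σ ∈ S)
  | havoc i => pass (star (act (wr fun a b a' b' => b' = b ∧ ∀ k, k.val ≠ i → a' k = a k)))
  | bits b i => pass (star (act (fwd fun u _ => bitAt u i = b)))
  | eq i j => pass (star (act (fwd fun u _ => bitAt u i = bitAt u j)))
  | succ i j => pass (seq (star (act (fwd fun u _ => bitAt u i = true ∧ bitAt u j = false)))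
      (seq (act (fwd fun u _ => bitAt u i = false ∧ bitAt u j = true))
        (star (act (fwd fun u _ => bitAt u i = bitAt u j)))))
  | cright => seq (star (act (fwd fun _ _ => True))) (seq atEnd
      (seq (act (chk fun _ _ w => w ≠ .right)) (rewind .stay .stay)))
  | cleft => seq (star (act fwdReg)) (seq atEnd (rewind .left .right))
  | ceq i j => pass (star (act (fwd fun u w => bitAt u i = bitAt w j)))
  | chavoc => pass (star (act (wr fun a _ a' _ => a' = a)))

variable {I : Inp α} {s : PM} {C : Duo m}

theorem exec_wr_iff {φ} (hh : s.h ≤ (tp I).length - 1) (hc : s.c < rows I) {i : ℕ}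
    (hi : i ≤ wd I) : (wr φ).Exec I (mdl m I s i) C ↔
      i < wd I ∧ ∃ a' b', φ (fun j => (s.reg j).testBit i) (fun j => (s.arr s.c j).testBit i) a' b' ∧
        C = ⟨s.h, update (regTape m I s.reg) (1 + i) (.bits a'),
          update (arrTape m I s.arr) (1 + s.c * wd I + i) (.bits b'),
          1 + (i + 1), 1 + s.c * wd I + (i + 1)⟩ := by
  constructor
  · rintro ⟨_, ⟨a, b, a', b', h₁, h₂, h₃, rfl⟩, -, -, rfl⟩
    simp only [mdl, duo] at h₁ h₂
    rcases lt_or_eq_of_le hi with hi | rfl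
    · rw [regTape_cell hi, Cell.bits.injEq] at h₁
      rw [arrTape_cell hc hi, Cell.bits.injEq] at h₂
      subst h₁ h₂
      refine ⟨hi, a', b', h₃, ?_⟩
      simp [mdl, duo, Move.apply, hh]
      omega
    · rw [regTape_end] at h₁
      cases h₁
  · rintro ⟨hi, a', b', h, rfl⟩
    have h₁ := regTape_cell (m := m) (ρ := s.reg) hi
    have h₂ := arrTape_cell (m := m) (A := s.arr) hc hi
    refine ⟨_, ⟨_, _, a', b', h₁, h₂, h, rfl⟩, fun h => ?_, fun h => ?_, ?_⟩
    · simp [mdl, duo, h₁] at h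
    · simp [mdl, duo, h₂] at h
    · simp [mdl, duo, Move.apply, hh]
      omega

/-- Splice the low bits of `v` and the other bits of `w`. -/
theorem exists_splice (W v w j : ℕ) : ∃ u, u < 2 ^ W ∧
    (∀ k, k < W → k < j → u.testBit k = v.testBit k) ∧
    (∀ k, k < W → j ≤ k → u.testBit k = w.testBit k) := by
  obtain ⟨u, hu, h⟩ := exists_bits W fun k => if k < j then v.testBit k else w.testBit k
  exact ⟨u, hu, fun k hk hj => by rw [h k hk, if_pos hj],
    fun k hk hj => by rw [h k hk, if_neg (by omega)]⟩

/-- Invariant of the pass: after `j` bits, register `i` holds some number that agrees with the old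
one from bit `j` on, and the bits already passed are arbitrary. -/
theorem sem_impl_havoc (hs : s.Valid I) (hh : s.h ≤ (tp I).length - 1) {i : ℕ} (hi : i < m) :
    ((Op.havoc i).impl m).Sem (Exec I) (rep m I s) C ↔
      ∃ s', (Op.havoc i).Step I s s' ∧ C = rep m I s' := by
  let st (v : ℕ) : PM := { s with reg := update s.reg i v }
  have hst : st (s.reg i) = s := by simp [st]
  refine (sem_pass hh (fun s' j => j ≤ wd I ∧ ∃ v, v < bd I ∧
    (∀ k, k < wd I → j ≤ k → v.testBit k = (s.reg i).testBit k) ∧ s' = st v) ?_ ?_).trans ?_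
  · rintro _ _ ⟨-, v, -, -, rfl⟩
    exact ⟨rfl, hs.c⟩
  · intro C
    constructor
    · intro h
      change ReflTransGen _ _ _ at h
      induction h with
      | refl => exact ⟨_, 0, ⟨Nat.zero_le _, s.reg i, hs.reg i, fun _ _ _ => rfl, rfl⟩,
          by rw [hst]; rfl⟩
      | tail _ h ih =>
        obtain ⟨_, j, ⟨hj, v, hv, hvk, rfl⟩, rfl⟩ := ih
        obtain ⟨hj', a', b', ⟨rfl, ha'⟩, rfl⟩ := (exec_wr_iff (s := st v) hh hs.c hj).1 h
        -- The bit that was written on track `i` belongs to a number that differs from `v` at most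
        -- in bit `j`.
        obtain ⟨u, hu, huk⟩ := exists_bits (wd I)
          fun k => if k = j then a' ⟨i, hi⟩ else v.testBit k
        refine ⟨_, j + 1, ⟨hj', u, hu, fun k hk hjk => ?_, rfl⟩, ?_⟩
        · rw [huk k hk, if_neg (by omega)]
          exact hvk k hk (by omega)
        · simp only [mdl, duo, Duo.mk.injEq, true_and]
          refine ⟨rfl, regTape_update hj' (fun k => ?_) fun k p hp hpj => ?_,
            arrTape_update hs.c hj' (fun _ => rfl) (fun _ _ _ _ => rfl) (fun _ _ => rfl), rfl⟩
          · by_cases hk : k.val = i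
            · obtain rfl : k = ⟨i, hi⟩ := Fin.ext hk
              simp [st, huk j hj']
            · rw [ha' k hk]
              simp [st, hk]
          · by_cases hk : k.val = i
            · simp [st, hk, huk p hp, hpj]
            · simp [st, hk]
    · rintro ⟨_, j, ⟨hj, v, hv, hvk, rfl⟩, rfl⟩
      change ReflTransGen _ _ _
      induction j generalizing v with
      | zero =>
        have : v = s.reg i := eq_of_bits hv (hs.reg i) fun k hk => hvk k hk (Nat.zero_le _)
        rw [this, hst]
        exact .refl
      | succ j ih =>
        -- One step before `v` is reached, the bits from `j` on must still be the old ones.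
        obtain ⟨u, hu, h₁, h₂⟩ := exists_splice (wd I) v (s.reg i) j
        refine (ih (by omega) u hu h₂).tail ((exec_wr_iff (s := st u) hh hs.c (by omega)).2
          ⟨hj, fun k => ((st v).reg k).testBit j, _, ⟨rfl, fun k hk => by simp [st, hk]⟩, ?_⟩)
        simp only [mdl, duo, Duo.mk.injEq, true_and]
        refine ⟨rfl, (regTape_update hj (fun _ => rfl) fun k p hp hpj => ?_).symm,
            (arrTape_update hs.c hj (fun _ => rfl) (fun _ _ _ _ => rfl) (fun _ _ => rfl)).symm, rfl⟩
        by_cases hk : k.val = i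
        · simp only [st, hk, update_self]
          rcases lt_or_gt_of_ne hpj with h | h
          · exact (h₁ p hp h).symm
          · rw [hvk p hp h, h₂ p hp h.le]
        · simp [st, hk]
  · constructor
    · rintro ⟨_, ⟨-, v, hv, -, rfl⟩, rfl⟩
      exact ⟨_, ⟨v, hv, rfl⟩, rfl⟩
    · rintro ⟨_, ⟨v, hv, rfl⟩, rfl⟩
      exact ⟨_, ⟨le_rfl, v, hv, fun k hk hk' => by omega, rfl⟩, rfl⟩

/-- The argument of `sem_impl_havoc` for all tracks of a row at once. Tracks from number `m` on do
not appear on the tape, and `bitAt` supplies zeros for them. -/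
theorem sem_impl_chavoc (hs : s.Valid I) (hh : s.h ≤ (tp I).length - 1) :
    (Op.chavoc.impl m).Sem (Exec I) (rep m I s) C ↔
      ∃ s', Op.chavoc.Step I s s' ∧ C = rep m I s' := by
  let st (g : ℕ → ℕ) : PM := { s with arr := update s.arr s.c g }
  have hst : st (s.arr s.c) = s := by simp [st]
  refine (sem_pass hh (fun s' j => j ≤ wd I ∧ ∃ g, (∀ t, g t < bd I) ∧
    (∀ t k, k < wd I → j ≤ k → (g t).testBit k = (s.arr s.c t).testBit k) ∧ s' = st g)
      ?_ ?_).trans ?_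
  · rintro _ _ ⟨-, v, -, -, rfl⟩
    exact ⟨rfl, hs.c⟩
  · intro C
    constructor
    · intro h
      change ReflTransGen _ _ _ at h
      induction h with
      | refl => exact ⟨_, 0, ⟨Nat.zero_le _, s.arr s.c, hs.arr _, fun _ _ _ _ => rfl, rfl⟩,
          by rw [hst]; rfl⟩
      | tail _ h ih =>
        obtain ⟨_, j, ⟨hj, g, hg, hgk, rfl⟩, rfl⟩ := ih
        obtain ⟨hj', a', b', rfl, rfl⟩ := (exec_wr_iff (s := st g) hh hs.c hj).1 h
        choose u hu huk using fun t => exists_bits (wd I)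
          fun k => if k = j then bitAt b' t else (g t).testBit k
        refine ⟨_, j + 1, ⟨hj', u, hu, fun t k hk hjk => ?_, rfl⟩, ?_⟩
        · rw [huk t k hk, if_neg (by omega)]
          exact hgk t k hk (by omega)
        · simp only [mdl, duo, Duo.mk.injEq, true_and]
          refine ⟨rfl, regTape_update hj' (fun _ => rfl) (fun _ _ _ _ => rfl),
            arrTape_update hs.c hj' (fun k => ?_) (fun k p hp hpj => ?_) (fun c' hc' => ?_), rfl⟩
          · simp [st, huk _ j hj', bitAt]
          · simp [st, huk _ p hp, hpj]
          · simp [st, hc']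
    · rintro ⟨_, j, ⟨hj, g, hg, hgk, rfl⟩, rfl⟩
      change ReflTransGen _ _ _
      induction j generalizing g with
      | zero =>
        have : g = s.arr s.c := funext fun t =>
          eq_of_bits (hg t) (hs.arr _ t) fun k hk => hgk t k hk (Nat.zero_le _)
        rw [this, hst]
        exact .refl
      | succ j ih =>
        choose u hu h₁ h₂ using fun t => exists_splice (wd I) (g t) (s.arr s.c t) j
        refine (ih (by omega) u hu h₂).tail ((exec_wr_iff (s := st u) hh hs.c (by omega)).2
          ⟨hj, _, fun k => (g k).testBit j, rfl, ?_⟩)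
        simp only [mdl, duo, Duo.mk.injEq, true_and]
        refine ⟨rfl, (regTape_update hj (fun _ => rfl) (fun _ _ _ _ => rfl)).symm,
          (arrTape_update hs.c hj (fun k => ?_) (fun k p hp hpj => ?_) fun c' hc' => ?_).symm, rfl⟩
        · simp [st]
        · simp only [st, update_self]
          rcases lt_or_gt_of_ne hpj with h | h
          · exact (h₁ k p hp h).symm
          · rw [hgk k p hp h, h₂ k p hp h.le]
        · simp [st, hc']
  · constructor
    · rintro ⟨_, ⟨-, v, hv, -, rfl⟩, rfl⟩
      exact ⟨_, ⟨v, hv, rfl⟩, rfl⟩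
    · rintro ⟨_, ⟨v, hv, rfl⟩, rfl⟩
      exact ⟨_, ⟨le_rfl, v, hv, fun t k hk hk' => by omega, rfl⟩, rfl⟩

theorem sem_impl_succ (hs : s.Valid I) (hh : s.h ≤ (tp I).length - 1) {i j : ℕ} (hi : i < m)
    (hj : j < m) : ((Op.succ i j).impl m).Sem (Exec I) (rep m I s) C ↔
      s.reg j = s.reg i + 1 ∧ C = rep m I s := by
  refine (sem_pass hh (fun s' l => s' = s ∧ l ≤ wd I ∧ ∃ k, k < l ∧
    (∀ p, p < k → (s.reg i).testBit p = true ∧ (s.reg j).testBit p = false) ∧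
    ((s.reg i).testBit k = false ∧ (s.reg j).testBit k = true) ∧
    ∀ p, k < p → p < l → (s.reg i).testBit p = (s.reg j).testBit p) ?_ ?_).trans ?_
  · rintro _ _ ⟨rfl, -⟩
    exact ⟨rfl, hs.c⟩
  · intro C
    constructor
    · rintro ⟨_, h₁, _, h₂, h₃⟩
      obtain ⟨k, -, hk, h₄, rfl⟩ := (sem_star_fwd (i := 0) hh hs.c (Nat.zero_le _)).1 h₁
      obtain ⟨hk', h₅, rfl⟩ := (exec_fwd_iff hh hs.c hk).1 h₂
      obtain ⟨l, hl, hl', h₆, rfl⟩ := (sem_star_fwd hh hs.c hk').1 h₃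
      refine ⟨s, l, ⟨rfl, hl', k, hl, fun p hp => ?_, ?_, fun p hp hp' => ?_⟩, rfl⟩
      · simpa [Bits, bitAt, hi, hj] using h₄ p (Nat.zero_le _) hp
      · simpa [Bits, bitAt, hi, hj] using h₅
      · simpa [Bits, bitAt, hi, hj] using h₆ p hp hp'
    · rintro ⟨_, l, ⟨h₀, hl', k, hl, h₄, h₅, h₆⟩, rfl⟩
      rw [h₀]
      refine ⟨mdl m I s k, (sem_star_fwd (i := 0) hh hs.c (Nat.zero_le _)).2
        ⟨k, Nat.zero_le _, by omega, fun p _ hp => ?_, rfl⟩, mdl m I s (k + 1),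
        (exec_fwd_iff hh hs.c (by omega)).2 ⟨by omega, ?_, rfl⟩,
        (sem_star_fwd hh hs.c (by omega)).2 ⟨l, hl, hl', fun p hp hp' => ?_, rfl⟩⟩
      · simpa [Bits, bitAt, hi, hj] using h₄ p hp
      · simpa [Bits, bitAt, hi, hj] using h₅
      · simpa [Bits, bitAt, hi, hj] using h₆ p hp hp'
  · rw [succ_iff_bits (hs.reg i) (hs.reg j)]
    constructor
    · rintro ⟨_, ⟨rfl, -, h⟩, rfl⟩
      exact ⟨h, rfl⟩
    · rintro ⟨h, rfl⟩
      exact ⟨s, ⟨rfl, le_rfl, h⟩, rfl⟩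

/-- The first tape measures the length of a row. After a pass forward the second head is on the
first cell of the next row, or on the right end mark if the row was the last one. -/
theorem sem_impl_cright (hs : s.Valid I) (hh : s.h ≤ (tp I).length - 1) :
    (Op.cright.impl m).Sem (Exec I) (rep m I s) C ↔
      s.c + 1 < rows I ∧ C = rep m I { s with c := s.c + 1 } := by
  have hw := wd_pos I
  have hiff : 1 + s.c * wd I + wd I = rows I * wd I + 1 ↔ ¬ s.c + 1 < rows I := by
    have h₁ := Nat.add_one_mul s.c (wd I)
    have h₂ := hs.c
    rw [show 1 + s.c * wd I + wd I = (s.c + 1) * wd I + 1 by omega, Nat.add_right_cancel_iff,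
      Nat.mul_left_inj hw.ne']
    omega
  have hrep : duo m I s 1 (1 + s.c * wd I + wd I) = rep m I { s with c := s.c + 1 } := by
    have h₁ := Nat.add_one_mul s.c (wd I)
    simp only [rep, duo, Duo.mk.injEq, true_and]
    omega
  constructor
  · rintro ⟨_, h₁, _, h₂, _, h₃, h₄⟩
    obtain ⟨j, -, hj, -, rfl⟩ := (sem_star_fwd (i := 0) hh hs.c (Nat.zero_le _)).1 h₁
    obtain ⟨h₅, rfl⟩ := (sem_atEnd hh).1 h₂
    obtain rfl : j = wd I := by omega
    obtain ⟨h₆, rfl⟩ := (exec_chk hh).1 h₃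
    rw [sem_rewind_stay hh] at h₄
    rw [Ne, arrTape_eq_right, hiff, not_not] at h₆
    exact ⟨h₆, h₄.trans hrep⟩
  · rintro ⟨h, rfl⟩
    refine ⟨_, (sem_star_fwd (i := 0) hh hs.c (Nat.zero_le _)).2
      ⟨wd I, Nat.zero_le _, le_rfl, fun _ _ _ => trivial, rfl⟩, _, (sem_atEnd hh).2 ⟨rfl, rfl⟩, _,
      (exec_chk hh).2 ⟨?_, rfl⟩, (sem_rewind_stay hh).2 hrep.symm⟩
    rwa [Ne, arrTape_eq_right, hiff, not_not]

/-- The first head goes to its right end alone; the common way back then takes the second head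
across one row. In row `0` it is stopped at the left end, in accordance with truncated subtraction.
-/
theorem sem_impl_cleft (hs : s.Valid I) (hh : s.h ≤ (tp I).length - 1) :
    (Op.cleft.impl m).Sem (Exec I) (rep m I s) C ↔ C = rep m I { s with c := s.c - 1 } := by
  have hw := wd_pos I
  have loop : ∀ C, ReflTransGen ((act fwdReg).Sem (Exec I)) (rep m I s) C ↔
      ∃ j, j ≤ wd I ∧ C = duo m I s (1 + j) (1 + s.c * wd I) := by
    intro C
    constructor
    · intro h
      induction h with
      | refl => exact ⟨0, Nat.zero_le _, rfl⟩
      | tail _ h ih =>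
        obtain ⟨j, hj, rfl⟩ := ih
        obtain ⟨_, ⟨⟨a, ha⟩, rfl⟩, -, -, rfl⟩ := h
        have : j ≠ wd I := by
          rintro rfl
          simp [duo, regTape_end] at ha
        refine ⟨j + 1, by omega, ?_⟩
        simp [duo, hh, Move.apply]
        omega
    · rintro ⟨j, hj, rfl⟩
      induction j with
      | zero => exact .refl
      | succ j ih =>
        have h₁ := regTape_cell (m := m) (ρ := s.reg) (show j < wd I by omega)
        refine (ih (by omega)).tail ⟨_, ⟨⟨_, h₁⟩, rfl⟩, fun h => ?_, fun h => ⟨h, by simp⟩, ?_⟩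
        · simp [duo, h₁] at h
        · simp [duo, hh, Move.apply]
          omega
  have hle := Nat.mul_le_mul_right (wd I) hs.c.le
  have hrep : duo m I s 1 (1 + s.c * wd I - (1 + wd I) + 1) =
      rep m I { s with c := s.c - 1 } := by
    have h₁ := Nat.sub_mul s.c 1 (wd I)
    simp only [rep, duo, Duo.mk.injEq, true_and]
    omega
  constructor
  · rintro ⟨_, h₁, _, h₂, h₃⟩
    obtain ⟨j, hj, rfl⟩ := (loop _).1 h₁
    obtain ⟨h₅, rfl⟩ := (sem_atEnd hh).1 h₂
    obtain rfl : j = wd I := by omega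
    rw [sem_rewind_left hh (by omega)] at h₃
    exact h₃.trans hrep
  · rintro rfl
    exact ⟨_, (loop _).2 ⟨_, le_rfl, rfl⟩, _, (sem_atEnd hh).2 ⟨rfl, rfl⟩,
      (sem_rewind_left hh (by omega)).2 hrep.symm⟩

/-- The validity of a configuration with its input head on the tape. -/
def PM.Ok (I : Inp α) (s : PM) : Prop := s.Valid I ∧ s.h ≤ (tp I).length - 1

theorem PM.Ok.step (a : Op α) (s s' : PM) (hs : s.Ok I) (h : a.Step I s s') : s'.Ok I := by
  refine ⟨hs.1.step a s s' h, ?_⟩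
  have := hs.2
  cases a with
  | right => cases h; exact min_le_right _ _
  | left => cases h; exact min_le_right _ _
  | scan => cases h.1; exact this
  | havoc i => obtain ⟨v, hv, rfl⟩ := h; exact this
  | bits => cases h.1; exact this
  | eq => cases h.1; exact this
  | succ => cases h.1; exact this
  | cright => obtain ⟨h, rfl⟩ := h; exact this
  | cleft => cases h; exact this
  | ceq => cases h.1; exact this
  | chavoc => obtain ⟨g, hg, rfl⟩ := h; exact this

theorem sem_impl (a : Op α) (ha : a.Below m) (s : PM) (hs : s.Ok I) (C : Duo m) :
    (a.impl m).Sem (Exec I) (rep m I s) C ↔ ∃ s', a.Step I s s' ∧ C = rep m I s' := by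
  obtain ⟨hv, hh⟩ := hs
  have test : ∀ (φ : (Fin m → Bool) → (Fin m → Bool) → Prop) (P : Prop),
      ((∀ k, k < wd I → Bits m s φ k) ↔ P) →
      ((pass (star (act (fwd φ)))).Sem (Exec I) (rep m I s) C ↔
        ∃ s', (s' = s ∧ P) ∧ C = rep m I s') := by
    intro φ P h
    rw [sem_pass_star hh hv.c, h]
    simp
  -- Comparing `wd I` bits decides equality only for numbers in range, which is what validity
  -- provides.
  have bits_iff : ∀ v w : ℕ, v < bd I → w < bd I →
      ((∀ k, k < wd I → v.testBit k = w.testBit k) ↔ v = w) := fun v w h₁ h₂ =>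
    ⟨eq_of_bits h₁ h₂, fun h _ _ => h ▸ rfl⟩
  cases a with
  | right => exact exec_hmove.trans (by simp [Op.Step, Move.apply, rep])
  | left => exact exec_hmove.trans (by simp [Op.Step, Move.apply, rep])
  | scan S => exact (exec_chk hh).trans (by simp [Op.Step, rep, and_assoc])
  | havoc i => exact sem_impl_havoc hv hh ha
  | bits b i =>
    refine test _ _ ?_
    change i < m at ha
    have hb : (if b then bd I - 1 else 0) < bd I := by
      have := bd_pos I
      split_ifs <;> omega
    rw [← bits_iff _ _ (hv.reg i) hb]
    refine forall₂_congr fun k hk => ?_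
    cases b <;> simp [Bits, bitAt, ha, bd, hk]
  | eq i j =>
    refine test _ _ ?_
    rw [← bits_iff _ _ (hv.reg i) (hv.reg j)]
    simp [Bits, bitAt, ha.1, ha.2]
  | succ i j =>
    rw [sem_impl_succ hv hh ha.1 ha.2]
    simp [Op.Step, and_assoc]
  | cright =>
    rw [sem_impl_cright hv hh]
    simp [Op.Step, and_assoc]
  | cleft =>
    rw [sem_impl_cleft hv hh]
    simp [Op.Step]
  | ceq i j =>
    refine test _ _ ?_
    rw [← bits_iff _ _ (hv.reg i) (hv.arr _ j)]
    simp [Bits, bitAt, ha.1, ha.2]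
  | chavoc => exact sem_impl_chavoc hv hh

/-- Every program for pointer machines can be executed on two tapes. -/
theorem exists_two_tape_program (q : Code α) : ∃ (m : ℕ) (p : Prog (Act α m)), ∀ I,
    (∃ C, p.Sem (Exec I) (rep m I PM.zero) C) ↔ ∃ s', q.Sem (Op.Step I) PM.zero s' := by
  obtain ⟨m, hm⟩ := Prog.exists_all (fun m (a : Op α) => a.Below m)
    (fun _ _ _ h => Op.Below.mono h) Op.exists_below q
  refine ⟨m, q.bind (Op.impl m), fun I => ?_⟩
  have key := sem_bind (V := PM.Ok I) (rep := rep m I) (P := fun a => a.Below m) (f := Op.impl m)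
    PM.Ok.step sem_impl q hm PM.zero ⟨PM.valid_zero I, Nat.zero_le _⟩
  constructor
  · rintro ⟨C, h⟩
    obtain ⟨s', h, -⟩ := (key C).1 h
    exact ⟨s', h⟩
  · rintro ⟨s', h⟩
    exact ⟨_, (key _).2 ⟨s', h, rfl⟩⟩

end Implementation

end XNL

/-! ### The clock, shortest paths and deterministic runs. -/

namespace XNL

open Relation Function

section Clock

/-! ### A clock -/

abbrev TSym (m b : ℕ) : Type := Cell m ⊕ Fin (b + 2)

variable {m b : ℕ}

/-- One step of the clock: the counter is a sequence of digits to base `b + 2`. In mode `false` the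
head looks for a nonzero digit to the left, decreases it, and changes to mode `true`, in which it
resets the digits to the right. -/
def clk : Bool → TSym m b → Option (Bool × TSym m b × Move)
  | true, .inr _ => some (true, .inr (Fin.last _), .right)
  | true, .inl .right => some (false, .inl .right, .left)
  | false, .inr d =>
    if h : d = 0 then some (false, .inr d, .left) else some (true, .inr (d.pred h).castSucc, .right)
  | _, _ => none

/-- Mode, tape and head position of the clock. -/
structure Clk (m b : ℕ) : Type where
  up : Bool
  tape : ℕ → TSym m b
  pos : ℕ

def Clk.next (κ : Clk m b) : Option (Clk m b) :=
  (clk κ.up (κ.tape κ.pos)).map fun x => ⟨x.1, update κ.tape κ.pos x.2.1, x.2.2.apply κ.pos⟩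

/-- `n` steps of the clock during which the head stays below `B`. -/
inductive Clk.Run (B : ℕ) : ℕ → Clk m b → Clk m b → Prop
  | nil {κ} : κ.pos < B → Run B 0 κ κ
  | cons {n κ κ' κ''} : κ.pos < B → κ.next = some κ' → Run B n κ' κ'' → Run B (n + 1) κ κ''

theorem Clk.Run.trans {B n n' : ℕ} {κ κ' κ'' : Clk m b} (h : Run B n κ κ') (h' : Run B n' κ' κ'') :
    Run B (n + n') κ κ'' := by
  induction h with
  | nil => rwa [Nat.zero_add]
  | cons h₁ h₂ _ ih =>
    rw [Nat.add_right_comm]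
    exact .cons h₁ h₂ (ih h')

/-- A tape with `T` digits between its end marks. -/
structure Clk.Digits (T : ℕ) (τ : ℕ → TSym m b) : Prop where
  left : τ 0 = .inl .left
  digit : ∀ p, 1 ≤ p → p ≤ T → ∃ d, τ p = .inr d
  right : τ (T + 1) = .inl .right

theorem Clk.Digits.update {T : ℕ} {τ : ℕ → TSym m b} (h : Digits T τ) {p : ℕ} (hp : 1 ≤ p)
    (hp' : p ≤ T) (d) : Digits T (update τ p (.inr d)) where
  left := by rw [update_of_ne (by omega), h.left]
  digit q hq hq' := by
    by_cases hqp : q = p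
    · exact ⟨d, by rw [hqp, update_self]⟩
    · rw [update_of_ne hqp]; exact h.digit q hq hq'
  right := by rw [update_of_ne (by omega), h.right]

/-- The last `j` digits are entered from the left in mode `true` and left to the left in mode
`false` after a complete countdown. Digit `T - j` is first set to `b + 1` and then decreased `b + 1`
times, each time followed by a countdown of the `j` digits behind it; these `b + 2` rounds give the
power. That the digits further left are untouched is what lets the rounds be chained. -/
theorem Clk.count {T : ℕ} : ∀ (j : ℕ), j ≤ T → ∀ τ : ℕ → TSym m b, Digits T τ →
    ∃ n τ', (b + 2) ^ j ≤ n ∧ Digits T τ' ∧ (∀ p, p ≤ T - j → τ' p = τ p) ∧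
      Run (T + 2) n ⟨true, τ, T + 1 - j⟩ ⟨false, τ', T - j⟩ := by
  intro j
  induction j with
  | zero =>
    intro _ τ hτ
    refine ⟨1, τ, by simp, hτ, fun _ _ => rfl, .cons (by simp) ?_ (.nil (by simp))⟩
    simp [next, clk, hτ.right, Move.apply]
  | succ j ih =>
    intro hj τ hτ
    -- With `d` in position `T - j` there remain `d` decrements, each followed by a countdown to its
    -- right.
    have inner : ∀ (d : ℕ) (hd : d < b + 2) (τ : ℕ → TSym m b), Digits T τ →
        τ (T - j) = .inr ⟨d, hd⟩ → ∃ n τ', d * (b + 2) ^ j ≤ n ∧ Digits T τ' ∧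
          (∀ p, p ≤ T - (j + 1) → τ' p = τ p) ∧
          Run (T + 2) n ⟨false, τ, T - j⟩ ⟨false, τ', T - (j + 1)⟩ := by
      intro d
      induction d with
      | zero =>
        intro hd τ hτ h0
        refine ⟨1, τ, by simp, hτ, fun _ _ => rfl, .cons (by simp; omega) ?_
          (.nil (by simp; omega))⟩
        have : (⟨0, hd⟩ : Fin (b + 2)) = 0 := rfl
        simp [next, clk, h0, this, Move.apply, Nat.sub_sub]
      | succ d ihd =>
        intro hd τ hτ h0
        let τ₁ := Function.update τ (T - j) (.inr ⟨d, by omega⟩)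
        obtain ⟨n₁, τ₂, h₁, h₂, h₃, h₄⟩ := ih (by omega) τ₁ (hτ.update (by omega) (by omega) _)
        obtain ⟨n₂, τ₃, h₅, h₆, h₇, h₈⟩ := ihd (by omega) τ₂ h₂
          (by rw [h₃ _ le_rfl]; exact update_self ..)
        refine ⟨n₁ + n₂ + 1, τ₃, by rw [Nat.succ_mul]; omega, h₆, fun p hp => ?_,
          .cons (κ' := ⟨true, τ₁, T + 1 - j⟩) (by simp; omega) ?_ (h₄.trans h₈)⟩
        · rw [h₇ p hp, h₃ p (by omega)]
          exact update_of_ne (by omega) ..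
        · have : (⟨d + 1, hd⟩ : Fin (b + 2)) ≠ 0 := by simp [Fin.ext_iff]
          simp only [next, h0, clk, this, dif_neg, not_false_eq_true, Option.map_some,
            Option.some.injEq, Clk.mk.injEq, true_and, Move.apply]
          exact ⟨rfl, by omega⟩
    obtain ⟨d, hd⟩ := hτ.digit (T - j) (by omega) (by omega)
    let τ₁ := Function.update τ (T - j) (.inr (Fin.last (b + 1)))
    obtain ⟨n₁, τ₂, h₁, h₂, h₃, h₄⟩ := ih (by omega) τ₁ (hτ.update (by omega) (by omega) _)
    obtain ⟨n₂, τ₃, h₅, h₆, h₇, h₈⟩ := inner (b + 1) (by omega) τ₂ h₂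
      (by rw [h₃ _ le_rfl]; exact update_self ..)
    refine ⟨n₁ + n₂ + 1, τ₃, ?_, h₆, fun p hp => ?_,
      .cons (κ' := ⟨true, τ₁, T + 1 - j⟩) (by simp; omega) ?_ (h₄.trans h₈)⟩
    · rw [pow_succ, Nat.mul_comm, Nat.succ_mul]
      omega
    · rw [h₇ p hp, h₃ p (by omega)]
      exact update_of_ne (by omega) ..
    · rw [show T + 1 - (j + 1) = T - j by omega]
      simp only [next, hd, clk, Option.map_some, Option.some.injEq, Clk.mk.injEq, true_and,
        Move.apply]
      exact ⟨rfl, by omega⟩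

/-- Started in mode `true` on the first digit, the clock makes at least `(b + 2) ^ T` steps, and
then it stops. -/
theorem Clk.exists_run {T : ℕ} {τ : ℕ → TSym m b} (h : Digits T τ) :
    ∃ n κ, (b + 2) ^ T ≤ n ∧ Run (T + 2) n ⟨true, τ, 1⟩ κ ∧ κ.next = none := by
  obtain ⟨n, τ', h₁, h₂, -, h₃⟩ := count T le_rfl τ h
  refine ⟨n, _, h₁, by simpa using h₃, ?_⟩
  simp [next, clk, h₂.left]

end Clock

section Pigeonhole

variable {X : Type} {r : X → X → Prop}

/-- `n` steps along a relation. -/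
inductive Steps (r : X → X → Prop) : ℕ → X → X → Prop
  | nil (x) : Steps r 0 x x
  | tail {n x y z} : Steps r n x y → r y z → Steps r (n + 1) x z

theorem Steps.trans {n n' : ℕ} {x y z : X} (h : Steps r n x y) (h' : Steps r n' y z) :
    Steps r (n + n') x z := by
  induction h' with
  | nil => exact h
  | tail _ h₂ ih => exact (ih h).tail h₂

theorem Steps.toReflTransGen {n : ℕ} {x y : X} (h : Steps r n x y) : ReflTransGen r x y := by
  induction h with
  | nil => exact .refl
  | tail _ h₂ ih => exact ih.tail h₂

theorem exists_steps {x y : X} (h : ReflTransGen r x y) : ∃ n, Steps r n x y := by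
  induction h with
  | refl => exact ⟨0, .nil _⟩
  | tail _ h₂ ih => exact ih.elim fun n h => ⟨n + 1, h.tail h₂⟩

theorem Steps.split {n : ℕ} {x y : X} (h : Steps r n x y) {i : ℕ} (hi : i ≤ n) :
    ∃ z, Steps r i x z ∧ Steps r (n - i) z y := by
  induction h with
  | nil x =>
    obtain rfl := Nat.le_zero.1 hi
    exact ⟨x, Steps.nil x, Steps.nil x⟩
  | @tail n x y z h₁ h₂ ih =>
    rcases Nat.le_succ_iff.1 hi with hi | rfl
    · obtain ⟨w, h₃, h₄⟩ := ih hi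
      exact ⟨w, h₃, by rw [Nat.succ_sub hi]; exact h₄.tail h₂⟩
    · exact ⟨z, h₁.tail h₂, by simpa using Steps.nil z⟩

/-- A shortest path visits every point at most once. -/
theorem exists_short_path {F : Type} [Finite F] {V : X → Prop} (f : X → F)
    (hf : ∀ x y, V x → V y → f x = f y → x = y) (hV : ∀ x y, V x → r x y → V y) {x y : X}
    (hx : V x) (h : ReflTransGen r x y) : ∃ n, n < Nat.card F ∧ Steps r n x y := by
  classical
  have hex := exists_steps h
  let n := Nat.find hex
  have hn : Steps r n x y := Nat.find_spec hex
  refine ⟨n, ?_, hn⟩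
  -- `g i` is a point that the shortest path reaches after `i` steps. If two of these points
  -- coincided, the part between them could be cut out.
  choose g hg₁ hg₂ using fun i : Fin (n + 1) => hn.split (Nat.lt_succ_iff.1 i.2)
  have hVg : ∀ i, V (g i) := fun i => by
    have := (hg₁ i).toReflTransGen
    generalize g i = z at this
    induction this with
    | refl => exact hx
    | tail _ h₂ ih => exact hV _ _ ih h₂
  have hlt : ∀ i j : Fin (n + 1), i < j → g i ≠ g j := by
    intro i j hij h
    have h₁ : Steps r (i + (n - j)) x y := (hg₁ i).trans (h ▸ hg₂ j)
    have h₂ : n ≤ i + (n - j) := Nat.find_min' hex h₁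
    have := j.2
    have : (i : ℕ) < j := hij
    omega
  have hinj : Injective fun i => f (g i) := by
    intro i j h
    have h := hf _ _ (hVg i) (hVg j) h
    rcases lt_trichotomy i j with hij | hij | hij
    · exact absurd h (hlt i j hij)
    · exact hij
    · exact absurd h.symm (hlt j i hij)
  have := Nat.card_le_card_of_injective _ hinj
  simpa using this

end Pigeonhole

section Deterministic

variable {X : Type} {r : X → X → Prop} {G : X → Prop}

/-- A run without nondeterministic choices through points that satisfy `G`. -/
inductive DetRun (r : X → X → Prop) (G : X → Prop) : X → X → Prop
  | refl (c) : DetRun r G c c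
  | head {c c' c''} : G c → (∀ d, r c d ↔ d = c') → DetRun r G c' c'' → DetRun r G c c''

namespace DetRun

theorem trans {c c' c'' : X} (h : DetRun r G c c') (h' : DetRun r G c' c'') :
    DetRun r G c c'' := by
  induction h with
  | refl => exact h'
  | head h₁ h₂ _ ih => exact .head h₁ h₂ (ih h')

theorem single {c c' : X} (h₁ : G c) (h₂ : ∀ d, r c d ↔ d = c') : DetRun r G c c' :=
  .head h₁ h₂ (.refl _)

theorem toReflTransGen {c c' : X} (h : DetRun r G c c') : ReflTransGen r c c' := by
  induction h with
  | refl => exact .refl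
  | head _ h₂ _ ih => exact .head ((h₂ _).2 rfl) ih

/-- What is reachable is on the deterministic part or behind it. -/
theorem reachable {c c' d : X} (h : DetRun r G c c') (hd : ReflTransGen r c d) :
    (G d ∧ ∃ d', r d d') ∨ ReflTransGen r c' d := by
  induction h with
  | refl => exact Or.inr hd
  | head h₁ h₂ h₃ ih =>
    rcases hd.cases_head with rfl | ⟨e, he, hd⟩
    · exact Or.inl ⟨h₁, _, (h₂ _).2 rfl⟩
    · rw [h₂] at he
      subst he
      exact ih hd

/-- There is no choice before `c'`, so an infinite run from `c` passes through it. This reduces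
halting to the computation after the preparation. -/
theorem infinite {c c' : X} (h : DetRun r G c c') {f : ℕ → X} (h0 : f 0 = c)
    (hf : ∀ j, r (f j) (f (j + 1))) : ∃ i, f i = c' := by
  induction h generalizing f with
  | refl => exact ⟨0, h0⟩
  | head h₁ h₂ _ ih =>
    have := hf 0
    rw [h0, h₂] at this
    obtain ⟨i, hi⟩ := ih (f := fun j => f (j + 1)) this (fun j => hf (j + 1))
    exact ⟨i + 1, hi⟩

end DetRun

end Deterministic

end XNL

/-! ### Machines with three named tapes, and the preparation of the tapes. -/

namespace XNL

open Relation Function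

section ThreeTapes

variable {α Q S : Type}

/-! ### Machines with three work tapes -/

/-- Configurations of a machine with three work tapes. -/
structure Tri (Q S : Type) : Type where
  q : Q
  h : ℕ
  t₀ : ℕ → S
  t₁ : ℕ → S
  t₂ : ℕ → S
  p₀ : ℕ
  p₁ : ℕ
  p₂ : ℕ

abbrev TriAct (Q S : Type) : Type := Q × Move × (S × Move) × (S × Move) × (S × Move)

abbrev TriTable (α Q S : Type) : Type := Q → InSym α → S → S → S → Set (TriAct Q S)

def Tri.apply (I : Inp α) (c : Tri Q S) (x : TriAct Q S) : Tri Q S where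
  q := x.1
  h := min (x.2.1.apply c.h) ((tp I).length - 1)
  t₀ := update c.t₀ c.p₀ x.2.2.1.1
  t₁ := update c.t₁ c.p₁ x.2.2.2.1.1
  t₂ := update c.t₂ c.p₂ x.2.2.2.2.1
  p₀ := x.2.2.1.2.apply c.p₀
  p₁ := x.2.2.2.1.2.apply c.p₁
  p₂ := x.2.2.2.2.2.apply c.p₂

def TriTable.Step (δ : TriTable α Q S) (I : Inp α) (c c' : Tri Q S) : Prop :=
  ∃ x ∈ δ c.q (sy I c.h) (c.t₀ c.p₀) (c.t₁ c.p₁) (c.t₂ c.p₂), c' = c.apply I x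

/-- The machine with a given table. -/
def TriTable.toNTM [Finite Q] [Finite S] (δ : TriTable α Q S) (blank : S) (start accept : Q) :
    NTM α where
  State := Q
  Symbol := S
  tapes := 3
  blank := blank
  start := start
  accept := accept
  trans := fun q σ u => {x | (x.1, x.2.1, x.2.2 0, x.2.2 1, x.2.2 2) ∈ δ q σ (u 0) (u 1) (u 2)}

def Tri.start (q : Q) (b : S) : Tri Q S := ⟨q, 0, fun _ => b, fun _ => b, fun _ => b, 0, 0, 0⟩

variable [Finite Q] [Finite S] {δ : TriTable α Q S} {b : S} {s a : Q}

/-- Three named tapes are easier to compute with than functions on `Fin 3`; the two forms of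
configurations correspond one to one. -/
def toTri (c : (δ.toNTM b s a).Cfg) : Tri Q S :=
  ⟨c.state, c.inHead, c.work (0 : Fin 3), c.work (1 : Fin 3), c.work (2 : Fin 3),
    c.head (0 : Fin 3), c.head (1 : Fin 3), c.head (2 : Fin 3)⟩

def ofTri (c : Tri Q S) : (δ.toNTM b s a).Cfg :=
  ⟨c.q, c.h, (![c.t₀, c.t₁, c.t₂] : Fin 3 → ℕ → S), (![c.p₀, c.p₁, c.p₂] : Fin 3 → ℕ)⟩

theorem toTri_ofTri (c : Tri Q S) : toTri (ofTri c : (δ.toNTM b s a).Cfg) = c := rfl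

theorem toTri_init : toTri (δ.toNTM b s a).init = Tri.start s b := rfl

theorem ofTri_toTri (c : (δ.toNTM b s a).Cfg) : ofTri (toTri c) = c := by
  obtain ⟨q, h, w, p⟩ := c
  refine congrArg₂ (NTM.Cfg.mk (M := δ.toNTM b s a) q h) ?_ ?_
  · funext (i : Fin 3)
    fin_cases i <;> rfl
  · funext (i : Fin 3)
    fin_cases i <;> rfl

theorem step_toNTM {I : Inp α} {c c' : (δ.toNTM b s a).Cfg} :
    (δ.toNTM b s a).Step (inputTape I.1 I.2) c c' ↔ δ.Step I (toTri c) (toTri c') := by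
  constructor
  · rintro ⟨x, hx, rfl⟩
    exact ⟨_, hx, rfl⟩
  · rintro ⟨⟨q, d, x₀, x₁, x₂⟩, hx, h⟩
    refine ⟨(q, d, (![x₀, x₁, x₂] : Fin 3 → S × Move)), hx, ?_⟩
    rw [← ofTri_toTri c', h]
    refine congrArg₂ (NTM.Cfg.mk (M := δ.toNTM b s a) _ _) ?_ ?_
    · funext (i : Fin 3)
      fin_cases i <;> rfl
    · funext (i : Fin 3)
      fin_cases i <;> rfl

theorem reachable_toNTM {I : Inp α} {c : (δ.toNTM b s a).Cfg} :
    (δ.toNTM b s a).Reachable (inputTape I.1 I.2) c ↔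
      ReflTransGen (δ.Step I) (Tri.start s b) (toTri c) := by
  constructor
  · intro h
    induction h with
    | refl => exact .refl
    | tail _ h ih => exact ih.tail (step_toNTM.1 h)
  · intro h
    generalize hd : toTri c = d at h
    induction h generalizing c with
    | refl =>
      rw [← ofTri_toTri c, hd, ← toTri_init (δ := δ) (a := a), ofTri_toTri]
      exact .refl
    | @tail d e _ h ih =>
      exact (ih (c := ofTri d) (toTri_ofTri d)).tail
        (step_toNTM.2 (by rw [toTri_ofTri, hd]; exact h))

end ThreeTapes

end XNL

namespace XNL

open Relation Function

section Boot

variable {α : Type} {m b : ℕ}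

/-! ### The preparation of the tapes -/

inductive Phase : Type
  | mark
  | inc
  | ret
  | lay
  | back
  | next
  | close
  | rew
  | home

instance : Finite Phase :=
  Finite.of_surjective
    (fun i : Fin 9 => ([.mark, .inc, .ret, .lay, .back, .next, .close, .rew, .home] :
      List Phase)[i.1]'i.2)
    (fun s => by
      cases s
      exacts [⟨0, rfl⟩, ⟨1, rfl⟩, ⟨2, rfl⟩, ⟨3, rfl⟩, ⟨4, rfl⟩, ⟨5, rfl⟩, ⟨6, rfl⟩, ⟨7, rfl⟩,
        ⟨8, rfl⟩])

abbrev zeroCell : TSym m b := .inl (.bits fun _ => false)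

abbrev dig (d : Bool) : TSym m b := .inr (if d then 1 else 0)

abbrev endCell : TSym m b := .inl .right

open Classical in
/-- Counting the cells of the input tape in binary, and then laying out the work tapes. The
value `none` of the new phase stands for the end of the preparation. -/
noncomputable def bootStep : Phase → InSym α → TSym m b → TSym m b → TSym m b →
    Option (TriAct (Option Phase) (TSym m b))
  | .mark, _, _, _, _ => some (some .inc, .stay, (.inl .left, .right), (.inl .left, .right),
      (.inl .left, .right))
  | .inc, _, u, v, w =>
    if u = dig true then some (some .inc, .stay, (dig false, .right), (v, .stay), (w, .stay))
    else some (some .ret, .stay, (dig true, .stay), (v, .stay), (w, .stay))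
  | .ret, σ, u, v, w =>
    if u = .inl .left then
      if σ = .rightEnd then some (some .lay, .stay, (u, .right), (v, .stay), (w, .stay))
      else some (some .inc, .right, (u, .right), (v, .stay), (w, .stay))
    else some (some .ret, .stay, (u, .left), (v, .stay), (w, .stay))
  | .lay, _, u, v, w =>
    if u = .inl .blank ∨ u = endCell then
      some (some .back, .stay, (endCell, .left), (v, .stay), (w, .stay))
    else some (some .lay, .stay, (zeroCell, .right), (zeroCell, .right), (.inr 0, .right))
  | .back, _, u, v, w =>
    if u = .inl .left then some (some .next, .left, (u, .right), (v, .stay), (w, .stay))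
    else some (some .back, .stay, (u, .left), (v, .stay), (w, .stay))
  | .next, σ, u, v, w =>
    some (some (if σ = .stroke then .lay else .close), .stay, (u, .stay), (v, .stay), (w, .stay))
  | .close, _, u, _, _ =>
    some (some .rew, .stay, (u, .stay), (endCell, .left), (endCell, .left))
  | .rew, _, u, v, w =>
    if v = .inl .left then some (some .home, .stay, (u, .stay), (v, .right), (w, .right))
    else some (some .rew, .stay, (u, .stay), (v, .left), (w, .left))
  | .home, σ, u, v, w =>
    if σ = .leftEnd then some (none, .stay, (u, .stay), (v, .stay), (w, .stay))
    else some (some .home, .left, (u, .stay), (v, .stay), (w, .stay))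

/-- A binary numeral, least significant digit first. -/
def cntTape (n p : ℕ) : TSym m b :=
  if p = 0 then .inl .left else if 2 ^ (p - 1) ≤ n then dig (n.testBit (p - 1)) else .inl .blank

def layTape (a : TSym m b) (n p : ℕ) : TSym m b :=
  if p = 0 then .inl .left else if p ≤ n then a else .inl .blank

def endTape (a : TSym m b) (n p : ℕ) : TSym m b :=
  if p = 0 then .inl .left else if p ≤ n then a else if p = n + 1 then endCell else .inl .blank

/-- The table `δ` extends that of the preparation. -/
def Boots {Q : Type} (δ : TriTable α Q (TSym m b)) (e : Option Phase → Q) : Prop :=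
  ∀ ph σ u v w x, x ∈ δ (e (some ph)) σ u v w ↔
    ∃ y, bootStep ph σ u v w = some y ∧ x = (e y.1, y.2)

variable {Q : Type} {δ : TriTable α Q (TSym m b)} {e : Option Phase → Q} {I : Inp α}

/-- Positions of the work heads within the area that is used. -/
def InArea (I : Inp α) (c : Tri Q (TSym m b)) : Prop :=
  c.p₀ < wd I + 2 ∧ c.p₁ < rows I * wd I + 2 ∧ c.p₂ < rows I * wd I + 2

abbrev BootRun (δ : TriTable α Q (TSym m b)) (I : Inp α) :
    Tri Q (TSym m b) → Tri Q (TSym m b) → Prop := DetRun (δ.Step I) (InArea I)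

theorem Boots.single (hδ : Boots δ e) {ph : Phase} {h p₀ p₁ p₂ : ℕ} {t₀ t₁ t₂ : ℕ → TSym m b}
    {c' : Tri Q (TSym m b)} (h₀ : p₀ < wd I + 2) (h₁ : p₁ < rows I * wd I + 2)
    (h₂ : p₂ < rows I * wd I + 2)
    (y) (hy : bootStep ph (sy I h) (t₀ p₀) (t₁ p₁) (t₂ p₂) = some y)
    (hc : c' = Tri.apply I ⟨e (some ph), h, t₀, t₁, t₂, p₀, p₁, p₂⟩ (e y.1, y.2)) :
    BootRun δ I ⟨e (some ph), h, t₀, t₁, t₂, p₀, p₁, p₂⟩ c' := by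
  refine DetRun.single ⟨h₀, h₁, h₂⟩ fun d => ?_
  constructor
  · rintro ⟨x, hx, rfl⟩
    obtain ⟨z, hz, rfl⟩ := (hδ _ _ _ _ _ _).1 hx
    rw [hy, Option.some.injEq] at hz
    rw [hc, hz]
  · rintro rfl
    exact ⟨_, (hδ _ _ _ _ _ _).2 ⟨y, hy, rfl⟩, hc⟩

theorem wd_le_area (I : Inp α) : wd I ≤ rows I * wd I :=
  Nat.le_mul_of_pos_left _ (Nat.succ_pos _)

theorem exists_carry (n : ℕ) : ∃ k, (∀ l, l < k → n.testBit l = true ∧ (n + 1).testBit l = false) ∧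
    (n.testBit k = false ∧ (n + 1).testBit k = true) ∧
    ∀ l, k < l → n.testBit l = (n + 1).testBit l ∧ (2 ^ l ≤ n ↔ 2 ^ l ≤ n + 1) := by
  have hW : n + 1 < 2 ^ (n + 1) := Nat.lt_two_pow_self
  obtain ⟨k, -, h₁, h₂, h₃⟩ := (succ_iff_bits (by omega) hW).1 rfl
  refine ⟨k, h₁, h₂, fun l hl => ⟨?_, fun h => h.trans (Nat.le_succ _), fun h => ?_⟩⟩
  · rcases lt_or_ge l (n + 1) with h | h
    · exact h₃ l hl h
    · have := Nat.pow_le_pow_right (n := 2) (by norm_num) h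
      rw [Nat.testBit_lt_two_pow (by omega), Nat.testBit_lt_two_pow (by omega)]
  · by_contra h'
    obtain rfl : n = 2 ^ l - 1 := by omega
    have := h₂.1
    rw [Nat.testBit_two_pow_sub_one] at this
    simp [hl] at this

theorem cntTape_dig {n l : ℕ} (h : 2 ^ l ≤ n) :
    (cntTape n (l + 1) : TSym m b) = dig (n.testBit l) := by
  simp [cntTape, h]

theorem two_pow_le {n l : ℕ} (h : n.testBit l = true) : 2 ^ l ≤ n := Nat.ge_two_pow_of_testBit h

theorem two_pow_le_length {l : ℕ} (h : 2 ^ l ≤ (tp I).length) : l < wd I := by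
  have := h.trans_lt (length_lt_bd I)
  exact (Nat.pow_lt_pow_iff_right (by norm_num)).1 this

/-- Binary increment in place: ones become zeros up to the first cell that is not a one, possibly a
blank, which becomes a one. The carry stops within `wd I` cells because the new value is at most the
length of the tape. -/
theorem boot_inc (hδ : Boots δ e) {n : ℕ} (hn : n + 1 ≤ (tp I).length) {h : ℕ}
    (hh : h ≤ (tp I).length - 1)
    {t₁ t₂ : ℕ → TSym m b} {p₁ p₂ : ℕ} (h₁ : p₁ < rows I * wd I + 2)
    (h₂ : p₂ < rows I * wd I + 2) :
    BootRun δ I ⟨e (some .inc), h, cntTape n, t₁, t₂, 1, p₁, p₂⟩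
      ⟨e (some .ret), h, cntTape (n + 1), t₁, t₂, 0, p₁, p₂⟩ := by
  obtain ⟨k, hk₁, hk₂, hk₃⟩ := exists_carry n
  have hk : k < wd I := two_pow_le_length ((two_pow_le hk₂.2).trans hn)
  have forth : ∀ j, j ≤ k → ∃ t : ℕ → TSym m b, (∀ p, t p = if 1 ≤ p ∧ p ≤ j then dig false else
      cntTape n p) ∧ BootRun δ I ⟨e (some .inc), h, cntTape n, t₁, t₂, 1, p₁, p₂⟩
        ⟨e (some .inc), h, t, t₁, t₂, j + 1, p₁, p₂⟩ := by
    intro j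
    induction j with
    | zero => exact fun _ => ⟨_, fun p => by rw [if_neg (by omega)], .refl _⟩
    | succ j ih =>
      intro hj
      obtain ⟨t, ht, hr⟩ := ih (by omega)
      have hb := (hk₁ j hj).1
      have ht' : t (j + 1) = dig true := by
        rw [ht, if_neg (by omega), cntTape_dig (two_pow_le hb), hb]
      refine ⟨update t (j + 1) (dig false), fun p => ?_, hr.trans (hδ.single (by omega) h₁ h₂ _
        (by simp only [bootStep, ht']; exact if_pos trivial) ?_)⟩
      · by_cases hp : p = j + 1
        · subst hp; simp
        · rw [update_of_ne hp, ht]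
          congr 1
          simp only [eq_iff_iff]
          omega
      · simp [Tri.apply, Move.apply, hh]
  obtain ⟨t, ht, hr⟩ := forth k le_rfl
  have turn : BootRun δ I ⟨e (some .inc), h, t, t₁, t₂, k + 1, p₁, p₂⟩
      ⟨e (some .ret), h, cntTape (n + 1), t₁, t₂, k + 1, p₁, p₂⟩ := by
    refine hδ.single (by omega) h₁ h₂ _ (if_neg ?_) ?_
    · rw [ht, if_neg (by omega)]
      simp only [cntTape, Nat.add_sub_cancel, hk₂.1]
      split_ifs <;> simp [dig]
    · have : update t (k + 1) (dig true) = cntTape (n + 1) := by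
        funext p
        by_cases hp : p = k + 1
        · subst hp
          rw [update_self, cntTape_dig (two_pow_le hk₂.2), hk₂.2]
        · rw [update_of_ne hp, ht]
          split_ifs with hp'
          · obtain ⟨l, rfl⟩ : ∃ l, p = l + 1 := ⟨p - 1, by omega⟩
            have h₃ := two_pow_le hk₂.2
            have h₄ : 2 ^ l ≤ 2 ^ k := Nat.pow_le_pow_right (by norm_num) (by omega)
            rw [cntTape_dig (h₄.trans h₃), (hk₁ l (by omega)).2]
          · rcases Nat.eq_zero_or_pos p with rfl | hp₀
            · rfl
            · obtain ⟨h₃, h₄⟩ := hk₃ (p - 1) (by omega)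
              simp only [cntTape, h₃, h₄]
      simp [Tri.apply, Move.apply, hh, this]
  have ret : ∀ j, j ≤ k + 1 →
      BootRun δ I ⟨e (some .ret), h, cntTape (n + 1), t₁, t₂, j, p₁, p₂⟩
        ⟨e (some .ret), h, cntTape (n + 1), t₁, t₂, 0, p₁, p₂⟩ := by
    intro j
    induction j with
    | zero => exact fun _ => .refl _
    | succ j ih =>
      intro hj
      refine DetRun.trans (hδ.single (by omega) h₁ h₂ _ (if_neg ?_) ?_) (ih (by omega))
      · rw [cntTape_dig]
        · simp [dig]
        · exact (Nat.pow_le_pow_right (by norm_num) (by omega)).trans (two_pow_le hk₂.2)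
      · simp [Tri.apply, Move.apply, hh]
  exact hr.trans (turn.trans (ret _ le_rfl))

/-- The counter is increased before each move of the input head, so at the right end marker it holds
the length of the whole tape, markers included. This is the number whose binary length is `wd I`. -/
theorem boot_count (hδ : Boots δ e) {t₁ t₂ : ℕ → TSym m b} {p₁ p₂ : ℕ}
    (h₁ : p₁ < rows I * wd I + 2) (h₂ : p₂ < rows I * wd I + 2) :
    BootRun δ I ⟨e (some .inc), 0, cntTape 0, t₁, t₂, 1, p₁, p₂⟩
      ⟨e (some .lay), (tp I).length - 1, cntTape (tp I).length, t₁, t₂, 1, p₁, p₂⟩ := by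
  have hl := length_tp I
  have count : ∀ i, i < (tp I).length →
      BootRun δ I ⟨e (some .inc), 0, cntTape 0, t₁, t₂, 1, p₁, p₂⟩
        ⟨e (some .ret), i, cntTape (i + 1), t₁, t₂, 0, p₁, p₂⟩ := by
    intro i
    induction i with
    | zero => exact fun h => boot_inc hδ (by omega) (by omega) h₁ h₂
    | succ i ih =>
      intro hi
      have next : BootRun δ I ⟨e (some .ret), i, cntTape (i + 1), t₁, t₂, 0, p₁, p₂⟩
          ⟨e (some .inc), i + 1, cntTape (i + 1), t₁, t₂, 1, p₁, p₂⟩ := by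
        refine hδ.single (by omega) h₁ h₂ _ ((if_pos rfl).trans (if_neg ?_)) ?_
        · rcases lt_or_ge i (I.1.length + 1) with h | h
          · cases i with
            | zero => rw [sy_zero]; simp
            | succ i => rw [sy_sym (by omega)]; simp
          · rw [sy_stroke (by omega) (by omega)]; simp
        · simp [Tri.apply, Move.apply]
          omega
      exact (ih (by omega)).trans (next.trans (boot_inc hδ (by omega) (by omega) h₁ h₂))
  have := count ((tp I).length - 1) (by omega)
  rw [show (tp I).length - 1 + 1 = (tp I).length by omega] at this
  refine this.trans (hδ.single (by omega) h₁ h₂ _ ((if_pos rfl).trans (if_pos ?_)) ?_)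
  · exact sy_rightEnd (by omega)
  · simp [Tri.apply, Move.apply]

theorem update_layTape (a : TSym m b) (n : ℕ) :
    update (layTape a n) (n + 1) a = layTape a (n + 1) := by
  funext p
  by_cases hp : p = n + 1
  · subst hp; simp [layTape]
  · rw [update_of_ne hp]
    simp only [layTape]
    congr 2
    simp only [eq_iff_iff]
    omega

theorem update_layTape_end (a : TSym m b) (n : ℕ) :
    update (layTape a n) (n + 1) endCell = endTape a n := by
  funext p
  by_cases hp : p = n + 1
  · subst hp; simp [endTape]
  · rw [update_of_ne hp]
    simp [layTape, endTape, hp]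

/-- One block is laid out. -/
theorem boot_block (hδ : Boots δ e) {n h : ℕ} (hn : n + wd I ≤ rows I * wd I)
    (hh : h ≤ (tp I).length - 1) {t : ℕ → TSym m b} (ht₀ : t 0 = .inl .left)
    (ht₁ : ∀ p, 1 ≤ p → p ≤ wd I → t p ≠ .inl .blank ∧ t p ≠ endCell)
    (ht₂ : t (wd I + 1) = .inl .blank ∨ t (wd I + 1) = endCell)
    (ht₃ : ∀ p, wd I + 1 < p → t p = .inl .blank) :
    BootRun δ I ⟨e (some .lay), h, t, layTape zeroCell n, layTape (.inr 0) n, 1, n + 1, n + 1⟩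
      ⟨e (some .next), h - 1, endTape zeroCell (wd I), layTape zeroCell (n + wd I),
        layTape (.inr 0) (n + wd I), 1, n + wd I + 1, n + wd I + 1⟩ := by
  have forth : ∀ j, j ≤ wd I → ∃ t' : ℕ → TSym m b,
      (∀ p, t' p = if 1 ≤ p ∧ p ≤ j then zeroCell else t p) ∧
      BootRun δ I ⟨e (some .lay), h, t, layTape zeroCell n, layTape (.inr 0) n, 1, n + 1, n + 1⟩
        ⟨e (some .lay), h, t', layTape zeroCell (n + j), layTape (.inr 0) (n + j), j + 1,
          n + j + 1, n + j + 1⟩ := by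
    intro j
    induction j with
    | zero => exact fun _ => ⟨_, fun p => by rw [if_neg (by omega)], .refl _⟩
    | succ j ih =>
      intro hj
      obtain ⟨t', ht, hr⟩ := ih (by omega)
      refine ⟨update t' (j + 1) zeroCell, fun p => ?_, hr.trans (hδ.single (by omega) (by omega)
        (by omega) _ (if_neg ?_) ?_)⟩
      · by_cases hp : p = j + 1
        · subst hp; simp
        · rw [update_of_ne hp, ht]
          congr 1
          simp only [eq_iff_iff]
          omega
      · rw [ht, if_neg (by omega)]
        have := ht₁ (j + 1) (by omega) hj
        tauto
      · simp [Tri.apply, Move.apply, hh, ← update_layTape, ← Nat.add_assoc]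
  obtain ⟨t', ht', hr⟩ := forth (wd I) le_rfl
  have turn : BootRun δ I ⟨e (some .lay), h, t', layTape zeroCell (n + wd I),
        layTape (.inr 0) (n + wd I), wd I + 1, n + wd I + 1, n + wd I + 1⟩
      ⟨e (some .back), h, endTape zeroCell (wd I), layTape zeroCell (n + wd I),
        layTape (.inr 0) (n + wd I), wd I, n + wd I + 1, n + wd I + 1⟩ := by
    refine hδ.single (by omega) (by omega) (by omega) _ (if_pos ?_) ?_
    · rwa [ht', if_neg (by omega)]
    · have : update t' (wd I + 1) endCell = endTape zeroCell (wd I) := by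
        funext p
        by_cases hp : p = wd I + 1
        · subst hp; simp [endTape]
        · rw [update_of_ne hp, ht', endTape]
          rcases Nat.eq_zero_or_pos p with rfl | h₀
          · simp [ht₀]
          · rcases le_or_gt p (wd I) with h₁ | h₁
            · rw [if_pos ⟨h₀, h₁⟩, if_neg (by omega), if_pos h₁]
            · rw [if_neg (by omega), if_neg (by omega), if_neg (by omega), if_neg (by omega),
                ht₃ p (by omega)]
      simp [Tri.apply, Move.apply, hh, this]
  have ret : ∀ j, j ≤ wd I →
      BootRun δ I ⟨e (some .back), h, endTape zeroCell (wd I), layTape zeroCell (n + wd I),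
        layTape (.inr 0) (n + wd I), j, n + wd I + 1, n + wd I + 1⟩
        ⟨e (some .back), h, endTape zeroCell (wd I), layTape zeroCell (n + wd I),
          layTape (.inr 0) (n + wd I), 0, n + wd I + 1, n + wd I + 1⟩ := by
    intro j
    induction j with
    | zero => exact fun _ => .refl _
    | succ j ih =>
      intro hj
      refine DetRun.trans (hδ.single (by omega) (by omega) (by omega) _ (if_neg ?_) ?_) (ih (by omega))
      · simp [endTape, hj, zeroCell]
      · simp [Tri.apply, Move.apply, hh]
  refine hr.trans (turn.trans ((ret _ le_rfl).trans
    (hδ.single (by omega) (by omega) (by omega) _ (if_pos rfl) ?_)))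
  simp [Tri.apply, Move.apply]
  omega

/-- The first block is laid out at the right end marker, and one more for each stroke on the way
back: `I.2 + 1` blocks, one for each row. The first takes its length from the binary counter, the
others from the zeros and the end mark that have replaced it. -/
theorem boot_layout (hδ : Boots δ e) :
    BootRun δ I ⟨e (some .lay), (tp I).length - 1, cntTape (tp I).length, layTape zeroCell 0,
        layTape (.inr 0) 0, 1, 1, 1⟩
      ⟨e (some .close), I.1.length, endTape zeroCell (wd I), layTape zeroCell (rows I * wd I),
        layTape (.inr 0) (rows I * wd I), 1, rows I * wd I + 1, rows I * wd I + 1⟩ := by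
  have hl := length_tp I
  have blocks : ∀ i, i ≤ I.2 →
      BootRun δ I ⟨e (some .lay), (tp I).length - 1, cntTape (tp I).length, layTape zeroCell 0,
        layTape (.inr 0) 0, 1, 1, 1⟩
      ⟨e (some .next), (tp I).length - 1 - (i + 1), endTape zeroCell (wd I),
        layTape zeroCell ((i + 1) * wd I), layTape (.inr 0) ((i + 1) * wd I), 1,
        (i + 1) * wd I + 1, (i + 1) * wd I + 1⟩ := by
    intro i
    induction i with
    | zero =>
      intro _
      have := wd_le_area I
      have := boot_block (I := I) hδ (n := 0) (h := (tp I).length - 1) (by omega) le_rfl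
        (t := cntTape (tp I).length) rfl (fun p hp hp' => ?_) (Or.inl ?_) (fun p hp => ?_)
      · simpa using this
      · obtain ⟨l, rfl⟩ : ∃ l, p = l + 1 := ⟨p - 1, by omega⟩
        rw [cntTape_dig (Nat.lt_size.1 hp')]
        simp
      · have := length_lt_bd I
        unfold bd at this
        simp [cntTape, this]
      · obtain ⟨l, rfl⟩ : ∃ l, p = l + 1 := ⟨p - 1, by omega⟩
        have := length_lt_bd I
        unfold bd at this
        have h₃ : 2 ^ wd I ≤ 2 ^ l := Nat.pow_le_pow_right (by norm_num) (by omega)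
        simp only [cntTape, Nat.add_sub_cancel]
        rw [if_neg (by omega), if_neg (by omega)]
    | succ i ih =>
      intro hi
      have hm : (i + 1 + 1) * wd I ≤ rows I * wd I := Nat.mul_le_mul_right _ (by unfold rows; omega)
      have hm' := Nat.add_one_mul (i + 1) (wd I)
      refine (ih (by omega)).trans (.trans (hδ.single (by omega) (by omega) (by omega) _ rfl rfl) ?_)
      have := boot_block (I := I) hδ (n := (i + 1) * wd I) (h := (tp I).length - 1 - (i + 1))
        (by omega) (by omega) (t := endTape zeroCell (wd I)) rfl (fun p hp hp' => ?_) (Or.inr ?_)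
        (fun p hp => ?_)
      · rw [sy_stroke (by omega) (by omega)]
        convert this using 1
        · simp only [Tri.apply, Move.apply, if_true, update_eq_self, Tri.mk.injEq, true_and, and_true]
          omega
        · simp only [Tri.mk.injEq, true_and, hm', and_self, and_true]
          omega
      · rw [endTape, if_neg (by omega), if_pos hp']
        simp
      · simp [endTape]
      · rw [endTape, if_neg (by omega), if_neg (by omega), if_neg (by omega)]
  refine (blocks I.2 le_rfl).trans (hδ.single (by omega) ?_ ?_ _ rfl ?_)
  · exact Nat.lt_succ_self _
  · exact Nat.lt_succ_self _
  · have h₁ : (tp I).length - 1 - (I.2 + 1) = I.1.length := by omega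
    have h₂ : sy I I.1.length ≠ .stroke := by
      rcases Nat.eq_zero_or_pos I.1.length with h | h
      · rw [h, sy_zero]; simp
      · obtain ⟨l, hl⟩ : ∃ l, I.1.length = l + 1 := ⟨I.1.length - 1, by omega⟩
        rw [hl, sy_sym (by omega)]
        simp
    have h₃ : I.1.length ≤ (tp I).length - 1 := by omega
    simp [Tri.apply, Move.apply, h₁, h₂, h₃, rows]

theorem boot_finish (hδ : Boots δ e) {t₀ : ℕ → TSym m b} :
    BootRun δ I ⟨e (some .close), I.1.length, t₀, layTape zeroCell (rows I * wd I),
        layTape (.inr 0) (rows I * wd I), 1, rows I * wd I + 1, rows I * wd I + 1⟩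
      ⟨e none, 0, t₀, endTape zeroCell (rows I * wd I), endTape (.inr 0) (rows I * wd I), 1, 1, 1⟩ := by
  have hl := length_tp I
  have hw := wd_pos I
  have rew : ∀ j, j ≤ rows I * wd I →
      BootRun δ I ⟨e (some .rew), I.1.length, t₀, endTape zeroCell (rows I * wd I),
        endTape (.inr 0) (rows I * wd I), 1, j, j⟩
      ⟨e (some .rew), I.1.length, t₀, endTape zeroCell (rows I * wd I),
        endTape (.inr 0) (rows I * wd I), 1, 0, 0⟩ := by
    intro j
    induction j with
    | zero => exact fun _ => .refl _
    | succ j ih =>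
      intro hj
      refine DetRun.trans (hδ.single (by omega) (by omega) (by omega) _ (if_neg ?_) ?_) (ih (by omega))
      · simp [endTape, hj, zeroCell]
      · simp [Tri.apply, Move.apply]
        omega
  have home : ∀ j, j ≤ I.1.length →
      BootRun δ I ⟨e (some .home), j, t₀, endTape zeroCell (rows I * wd I),
        endTape (.inr 0) (rows I * wd I), 1, 1, 1⟩
      ⟨e (some .home), 0, t₀, endTape zeroCell (rows I * wd I),
        endTape (.inr 0) (rows I * wd I), 1, 1, 1⟩ := by
    intro j
    induction j with
    | zero => exact fun _ => .refl _
    | succ j ih =>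
      intro hj
      refine DetRun.trans (hδ.single (by omega) (by omega) (by omega) _ (if_neg ?_) ?_) (ih (by omega))
      · rw [sy_eq_leftEnd]; omega
      · simp [Tri.apply, Move.apply]
        omega
  refine .trans (hδ.single (by omega) (by omega) (by omega) _ rfl ?_) ((rew _ le_rfl).trans
    (.trans (hδ.single (by omega) (by omega) (by omega) _ (if_pos rfl) ?_) ((home _ le_rfl).trans
    (hδ.single (by omega) (by omega) (by omega) _ (if_pos (sy_zero I)) ?_))))
  · simp [Tri.apply, Move.apply, update_layTape_end]
    omega
  · simp [Tri.apply, Move.apply]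
    omega
  · simp [Tri.apply, Move.apply]

/-- The preparation. -/
theorem boot_run (hδ : Boots δ e) : BootRun δ I (Tri.start (e (some .mark)) (.inl .blank))
    ⟨e none, 0, endTape zeroCell (wd I), endTape zeroCell (rows I * wd I),
      endTape (.inr 0) (rows I * wd I), 1, 1, 1⟩ := by
  have h₀ : (update (fun _ => .inl .blank) 0 (.inl .left) : ℕ → TSym m b) = cntTape 0 := by
    funext p
    cases p <;> simp [cntTape]
  have h₁ : ∀ a, (update (fun _ => .inl .blank) 0 (.inl .left) : ℕ → TSym m b) = layTape a 0 := by
    intro a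
    funext p
    cases p <;> simp [layTape]
  refine .trans (hδ.single (by omega) (by omega) (by omega) _ rfl rfl) (.trans ?_
    ((boot_layout hδ).trans (boot_finish hδ)))
  simp only [Tri.apply, Move.apply, zero_add, Nat.zero_min]
  rw [h₀, ← h₁ zeroCell, ← h₁ (.inr 0), h₀]
  exact boot_count hδ (by omega) (by omega)

end Boot

end XNL

/-! ### The complete machine: halting, acceptance and space. -/

namespace XNL

open Relation Function

section Machine

variable {α : Type} {m b : ℕ}

/-! ### Running a program against the clock -/

instance : Finite (Cell m) :=
  Finite.of_surjective
    (fun i : Option (Option (Option (Fin m → Bool))) => match i with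
      | none => Cell.blank
      | some none => Cell.left
      | some (some none) => Cell.right
      | some (some (some v)) => Cell.bits v)
    (fun s => match s with
      | .blank => ⟨none, rfl⟩
      | .left => ⟨some none, rfl⟩
      | .right => ⟨some (some none), rfl⟩
      | .bits v => ⟨some (some (some v)), rfl⟩)

/-- States: the phases of the preparation, those of the program together with the mode of the
clock, and the accepting state. -/
abbrev MState (p : Prog (Act α m)) : Type := Phase ⊕ (p.States × Bool) ⊕ Unit

def startState (p : Prog (Act α m)) : p.States := ⟨[p], Prog.start_mem_conts p []⟩

def ofPhase (p : Prog (Act α m)) : Option Phase → MState p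
  | some ph => .inl ph
  | none => .inr (.inl (startState p, true))

/-- A step of the automaton of `p` together with a step of the clock. -/
def runTable (p : Prog (Act α m)) (b : ℕ) (J : List (Prog (Act α m))) (up : Bool) (σ : InSym α)
    (u v w : TSym m b) : Set (TriAct (MState p) (TSym m b)) :=
  {x | (J = [] ∧ x = (.inr (.inr ()), .stay, (u, .stay), (v, .stay), (w, .stay))) ∨
    ∃ (J' : p.States) (c : Bool × TSym m b × Move), clk up w = some c ∧
      ((∃ a, Prog.Trans J (some a) J'.1 ∧ ∃ u' v', u = .inl u' ∧ v = .inl v' ∧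
        ∃ y ∈ a σ u' v', Safe u' y.2.1 ∧ Safe v' y.2.2 ∧
          x = (.inr (.inl (J', c.1)), y.1, (.inl y.2.1.1, y.2.1.2), (.inl y.2.2.1, y.2.2.2), c.2)) ∨
      (Prog.Trans J none J'.1 ∧
          x = (.inr (.inl (J', c.1)), .stay, (u, .stay), (v, .stay), c.2)))}

def table (p : Prog (Act α m)) (b : ℕ) : TriTable α (MState p) (TSym m b)
  | .inl ph, σ, u, v, w =>
    {x | ∃ y, bootStep ph σ u v w = some y ∧ x = (ofPhase p y.1, y.2)}
  | .inr (.inl (J, up)), σ, u, v, w => runTable p b J.1 up σ u v w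
  | .inr (.inr ()), _, _, _, _ => ∅

theorem boots_table (p : Prog (Act α m)) (b : ℕ) : Boots (table p b) (ofPhase p) :=
  fun _ _ _ _ _ _ => Iff.rfl

variable {p : Prog (Act α m)} {I : Inp α}

/-- Configurations while the program is running. -/
def running (p : Prog (Act α m)) (J : p.States) (C : Duo m) (κ : Clk m b) :
    Tri (MState p) (TSym m b) :=
  ⟨.inr (.inl (J, κ.up)), C.h, fun i => .inl (C.t₀ i), fun i => .inl (C.t₁ i), κ.tape, C.p₀, C.p₁,
    κ.pos⟩

/-- The accepting configuration in which the running program ends. -/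
def accepting (p : Prog (Act α m)) (C : Duo m) (κ : Clk m b) : Tri (MState p) (TSym m b) :=
  { running p (startState p) C κ with q := .inr (.inr ()) }

theorem update_inl (t : ℕ → Cell m) (i : ℕ) (c : Cell m) :
    update (fun i => (.inl (t i) : TSym m b)) i (.inl c) = fun j => .inl (update t i c j) := by
  funext j
  simp only [update_apply]
  split_ifs <;> rfl

/-- Every step of the program takes a tick of the clock, and none is possible once the clock has
stopped. Only the transition to the accepting state is free. -/
theorem step_running {J : p.States} {C : Duo m} {κ : Clk m b} {d : Tri (MState p) (TSym m b)}
    (hC : C.h ≤ (tp I).length - 1) : (table p b).Step I (running p J C κ) d ↔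
      (J.1 = [] ∧ d = accepting p C κ) ∨ ∃ (J' : p.States) (C' : Duo m) (κ' : Clk m b),
        Prog.AutoStep (Act.Exec I) (J.1, C) (J'.1, C') ∧ κ.next = some κ' ∧
          d = running p J' C' κ' := by
  constructor
  · rintro ⟨_, ⟨hJ, rfl⟩ | ⟨J', c, hc, ⟨a, ht, u', v', hu, hv, y, hy, h₁, h₂, rfl⟩ | ⟨ht, rfl⟩⟩, rfl⟩
    · refine Or.inl ⟨hJ, ?_⟩
      simp [Tri.apply, Move.apply, accepting, running, hC]
    · simp only [running, Sum.inl.injEq] at hu hv hy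
      subst hu hv
      refine Or.inr ⟨J', _, _, .act ht ⟨y, hy, h₁, h₂, rfl⟩, congrArg (Option.map _) hc, ?_⟩
      simp [Tri.apply, running, update_inl]
    · refine Or.inr ⟨J', _, _, .eps ht, congrArg (Option.map _) hc, ?_⟩
      simp [Tri.apply, Move.apply, running, hC]
  · rintro (⟨hJ, rfl⟩ | ⟨J', C', κ', h, hκ, rfl⟩)
    · refine ⟨_, Or.inl ⟨hJ, rfl⟩, ?_⟩
      simp [Tri.apply, Move.apply, accepting, running, hC]
    · obtain ⟨c, hc, rfl⟩ := Option.map_eq_some_iff.1 hκ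
      cases h with
      | act ht he =>
        obtain ⟨y, hy, h₁, h₂, rfl⟩ := he
        refine ⟨_, Or.inr ⟨J', c, hc, Or.inl ⟨_, ht, _, _, rfl, rfl, y, hy, h₁, h₂, rfl⟩⟩, ?_⟩
        simp [Tri.apply, running, update_inl]
      | eps ht =>
        refine ⟨_, Or.inr ⟨J', c, hc, Or.inr ⟨ht, rfl⟩⟩, ?_⟩
        simp [Tri.apply, Move.apply, running, hC]

theorem not_step_accepting {C : Duo m} {κ : Clk m b} {d : Tri (MState p) (TSym m b)} :
    ¬ (table p b).Step I (accepting p C κ) d := by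
  rintro ⟨_, h, -⟩
  exact h

/-- Heads and marks are in the area that belongs to the input. -/
structure Duo.Fits (I : Inp α) (C : Duo m) : Prop where
  h : C.h ≤ (tp I).length - 1
  p₀ : C.p₀ ≤ wd I + 1
  p₁ : C.p₁ ≤ rows I * wd I + 1
  r₀ : C.t₀ (wd I + 1) = .right
  r₁ : C.t₁ (rows I * wd I + 1) = .right
  e₀ : ∀ i, wd I + 1 < i → C.t₀ i = .blank
  e₁ : ∀ i, rows I * wd I + 1 < i → C.t₁ i = .blank

/-- The right end mark is a barrier that no safe action shifts or passes, so the space bound holds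
in all computations, whether they accept or not. -/
theorem tape_fits {n i : ℕ} {t : ℕ → Cell m} {x : Cell m × Move} (hi : i ≤ n + 1)
    (hr : t (n + 1) = .right) (he : ∀ j, n + 1 < j → t j = .blank) (hx : Safe (t i) x) :
    x.2.apply i ≤ n + 1 ∧ update t i x.1 (n + 1) = .right ∧
      ∀ j, n + 1 < j → update t i x.1 j = .blank := by
  refine ⟨?_, ?_, fun j hj => ?_⟩
  · rcases hi.lt_or_eq with hi | rfl
    · cases x.2 <;> simp [Move.apply] <;> omega
    · have := (hx hr).2
      cases h : x.2 <;> simp_all [Move.apply]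
  · by_cases h : n + 1 = i
    · subst h; rw [update_self, (hx hr).1]
    · rw [update_of_ne h, hr]
  · rw [update_of_ne (by omega), he j hj]

theorem Duo.Fits.auto {x y : List (Prog (Act α m)) × Duo m} (h : x.2.Fits I)
    (hs : Prog.AutoStep (Act.Exec I) x y) : y.2.Fits I := by
  cases hs with
  | act _ he =>
    obtain ⟨z, -, h₁, h₂, rfl⟩ := he
    obtain ⟨h₃, h₄, h₅⟩ := tape_fits h.p₀ h.r₀ h.e₀ h₁
    obtain ⟨h₆, h₇, h₈⟩ := tape_fits h.p₁ h.r₁ h.e₁ h₂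
    exact ⟨min_le_right _ _, h₃, h₆, h₄, h₇, h₅, h₈⟩
  | eps _ => exact h

theorem fits_rep (m : ℕ) (I : Inp α) : (rep m I PM.zero).Fits I where
  h := Nat.zero_le _
  p₀ := by simp [rep, duo]
  p₁ := by simp [rep, duo, PM.zero]
  r₀ := by simp [rep, duo, regTape]
  r₁ := by simp [rep, duo, arrTape]
  e₀ i hi := by
    simp only [rep, duo, regTape]
    rw [if_neg (by omega), if_neg (by omega), if_neg (by omega)]
  e₁ i hi := by
    simp only [rep, duo, arrTape]
    rw [if_neg (by omega), if_neg (by omega), if_neg (by omega)]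

/-- The finitely many data that determine a configuration. -/
abbrev Snapshot (p : Prog (Act α m)) (I : Inp α) : Type :=
  p.States × Fin (tp I).length × (Fin (wd I + 2) × (Fin (wd I + 2) → Cell m)) ×
    (Fin (rows I * wd I + 2) × (Fin (rows I * wd I + 2) → Cell m))

theorem length_pos (I : Inp α) : 0 < (tp I).length := by rw [length_tp]; omega

open Classical in
noncomputable def toState (p : Prog (Act α m)) (J : List (Prog (Act α m))) : p.States :=
  if h : J ∈ p.conts [] then ⟨J, h⟩ else startState p

theorem toState_val {J : List (Prog (Act α m))} (h : J ∈ p.conts []) : (toState p J).1 = J :=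
  congrArg Subtype.val (dif_pos h : toState p J = ⟨J, h⟩)

noncomputable def snapshot (p : Prog (Act α m)) (I : Inp α) (x : List (Prog (Act α m)) × Duo m) :
    Snapshot p I :=
  (toState p x.1,
    ⟨x.2.h % (tp I).length, Nat.mod_lt _ (length_pos I)⟩,
    (Fin.ofNat _ x.2.p₀, fun i => x.2.t₀ i), (Fin.ofNat _ x.2.p₁, fun i => x.2.t₁ i))

/-- Cells behind the right end marks are blank by `Duo.Fits`, so the finitely many recorded cells
determine the tapes; and the remainders and truncations in `snapshot` lose nothing in the permitted
range. -/
theorem snapshot_injective {x y : List (Prog (Act α m)) × Duo m}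
    (hx : x.1 ∈ p.conts [] ∧ x.2.Fits I) (hy : y.1 ∈ p.conts [] ∧ y.2.Fits I)
    (h : snapshot p I x = snapshot p I y) : x = y := by
  obtain ⟨J, h', t₀, t₁, p₀, p₁⟩ := x
  obtain ⟨K, h'', u₀, u₁, q₀, q₁⟩ := y
  obtain ⟨hx₁, hx₂⟩ := hx
  obtain ⟨hy₁, hy₂⟩ := hy
  have hl := length_pos I
  have a₁ := hx₂.h
  have a₂ := hy₂.h
  have a₃ := hx₂.p₀
  have a₄ := hy₂.p₀
  have a₅ := hx₂.p₁
  have a₆ := hy₂.p₁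
  dsimp only at *
  simp only [snapshot, Prod.mk.injEq, Fin.ext_iff, Fin.val_ofNat] at h
  obtain ⟨h₀, h₁, ⟨h₂, h₃⟩, h₄, h₅⟩ := h
  obtain rfl : J = K := by rw [← toState_val hx₁, h₀, toState_val hy₁]
  rw [Nat.mod_eq_of_lt (by omega), Nat.mod_eq_of_lt (by omega)] at h₁ h₂ h₄
  subst h₁ h₂ h₄
  have h₆ : t₀ = u₀ := by
    funext i
    rcases lt_or_ge i (wd I + 2) with hi | hi
    · exact congrFun h₃ ⟨i, hi⟩
    · exact (hx₂.e₀ i (by omega)).trans (hy₂.e₀ i (by omega)).symm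
  have h₇ : t₁ = u₁ := by
    funext i
    rcases lt_or_ge i (rows I * wd I + 2) with hi | hi
    · exact congrFun h₅ ⟨i, hi⟩
    · exact (hx₂.e₁ i (by omega)).trans (hy₂.e₁ i (by omega)).symm
  rw [h₆, h₇]

/-- The base of the clock is chosen so large that it outlasts all repetition-free computations. -/
noncomputable def base (p : Prog (Act α m)) : ℕ :=
  Nat.card p.States * (2 * (3 * Nat.card (Cell m) ^ 3) * (3 * Nat.card (Cell m) ^ 3))

theorem two_add_le_three_pow {n : ℕ} (h : 1 ≤ n) : n + 2 ≤ 3 ^ n := by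
  induction n, h using Nat.le_induction with
  | base => norm_num
  | succ n _ ih => rw [pow_succ]; omega

/-- With `T = rows I * wd I`, the number of digits of the clock, each factor of the cardinality is
bounded by a `T`-th power, and the product of the bases is `base p`. For a tape with `n + 2`
relevant cells, `n + 2 ≤ 3 ^ n` handles the head position and `n + 2 ≤ 3 * T` the exponent of the
contents. -/
theorem card_snapshot_le (p : Prog (Act α m)) (I : Inp α) :
    Nat.card (Snapshot p I) ≤ (base p + 2) ^ (rows I * wd I) := by
  have hw := wd_pos I
  have hT := wd_le_area I
  have hl : (tp I).length ≤ 2 ^ (rows I * wd I) :=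
    (length_lt_bd I).le.trans (Nat.pow_le_pow_right (by norm_num) hT)
  have hc : 0 < Nat.card (Cell m) := Nat.card_pos_iff.2 ⟨⟨.blank⟩, inferInstance⟩
  have hq : 0 < Nat.card p.States := Nat.card_pos_iff.2 ⟨⟨startState p⟩, inferInstance⟩
  have tape : ∀ n, 1 ≤ n → n ≤ rows I * wd I → (n + 2) * Nat.card (Cell m) ^ (n + 2) ≤
      (3 * Nat.card (Cell m) ^ 3) ^ (rows I * wd I) := by
    intro n hn hn'
    rw [mul_pow, ← pow_mul]
    exact Nat.mul_le_mul ((two_add_le_three_pow hn).trans (Nat.pow_le_pow_right (by norm_num) hn'))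
      (Nat.pow_le_pow_right hc (by omega))
  refine le_trans ?_ (Nat.pow_le_pow_left (Nat.le_add_right _ 2) _)
  simp only [Nat.card_prod, Nat.card_fun, Nat.card_fin, base, mul_pow (Nat.card p.States),
    mul_pow (2 * _), mul_pow 2]
  rw [Nat.mul_assoc (2 ^ _)]
  exact Nat.mul_le_mul (Nat.le_self_pow (by omega) _) (Nat.mul_le_mul hl
    (Nat.mul_le_mul (tape _ hw hT) (tape _ (hw.trans_le hT) le_rfl)))

/-- The clock still runs, and stays within its tape. -/
def Ticks (I : Inp α) (n : ℕ) (κ : Clk m b) : Prop :=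
  ∃ κ', Clk.Run (rows I * wd I + 2) n κ κ' ∧ κ'.next = none

theorem Ticks.pos_lt {n : ℕ} {κ : Clk m b} (h : Ticks I n κ) : κ.pos < rows I * wd I + 2 := by
  obtain ⟨_, h, -⟩ := h
  cases h <;> assumption

theorem Ticks.next {n : ℕ} {κ κ' : Clk m b} (h : Ticks I n κ) (h' : κ.next = some κ') :
    ∃ n', n = n' + 1 ∧ Ticks I n' κ' := by
  obtain ⟨κ₁, h, h₁⟩ := h
  cases h with
  | nil => rw [h₁] at h'; cases h'
  | cons _ h₂ h₃ =>
    rw [h₂] at h'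
    cases h'
    exact ⟨_, rfl, κ₁, h₃, h₁⟩

/-- Configurations that can be reached after the preparation. -/
def Late (p : Prog (Act α m)) (I : Inp α) (d : Tri (MState p) (TSym m b)) : Prop :=
  ∃ (J : p.States) (C : Duo m) (κ : Clk m b) (n : ℕ), C.Fits I ∧ Ticks I n κ ∧
    ReflTransGen (Prog.AutoStep (Act.Exec I)) ([p], rep m I PM.zero) (J.1, C) ∧
    (d = running p J C κ ∨ J.1 = [] ∧ d = accepting p C κ)

theorem Late.step {d d' : Tri (MState p) (TSym m b)} (h : Late p I d)
    (hs : (table p b).Step I d d') : Late p I d' := by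
  obtain ⟨J, C, κ, n, hC, hκ, hr, rfl | ⟨-, rfl⟩⟩ := h
  · rcases (step_running hC.h).1 hs with ⟨hJ, rfl⟩ | ⟨J', C', κ', h₁, h₂, rfl⟩
    · exact ⟨J, C, κ, n, hC, hκ, hr, Or.inr ⟨hJ, rfl⟩⟩
    · obtain ⟨n', -, h₃⟩ := hκ.next h₂
      exact ⟨J', C', κ', n', hC.auto h₁, h₃, hr.tail h₁, Or.inl rfl⟩
  · exact absurd hs not_step_accepting

theorem Late.inArea {d : Tri (MState p) (TSym m b)} (h : Late p I d) : InArea I d := by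
  obtain ⟨J, C, κ, n, hC, hκ, -, rfl | ⟨-, rfl⟩⟩ := h <;>
  exact ⟨Nat.lt_succ_of_le hC.p₀, Nat.lt_succ_of_le hC.p₁, hκ.pos_lt⟩

/-- Induction on the ticks that are left. Acceptance is the only step without a tick, and nothing
follows it. -/
theorem running_halts : ∀ (n : ℕ) (J : p.States) (C : Duo m) (κ : Clk m b), C.Fits I →
    Ticks I n κ → ¬ ∃ f : ℕ → Tri (MState p) (TSym m b), f 0 = running p J C κ ∧
      ∀ j, (table p b).Step I (f j) (f (j + 1)) := by
  intro n
  induction n with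
  | zero =>
    rintro J C κ hC hκ ⟨f, h0, hf⟩
    have h1 := hf 0
    rw [h0, step_running hC.h] at h1
    rcases h1 with ⟨-, h1⟩ | ⟨J', C', κ', -, h2, -⟩
    · have h2 := hf 1
      rw [h1] at h2
      exact not_step_accepting h2
    · obtain ⟨n', h3, -⟩ := hκ.next h2
      omega
  | succ n ih =>
    rintro J C κ hC hκ ⟨f, h0, hf⟩
    have h1 := hf 0
    rw [h0, step_running hC.h] at h1
    rcases h1 with ⟨-, h1⟩ | ⟨J', C', κ', h1, h2, h3⟩
    · have h2 := hf 1
      rw [h1] at h2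
      exact not_step_accepting h2
    · obtain ⟨n', h4, h5⟩ := hκ.next h2
      obtain rfl : n = n' := by omega
      exact ih J' C' κ' (hC.auto h1) h5 ⟨fun j => f (j + 1), h3, fun j => hf (j + 1)⟩

/-- The clock only blocks when its ticks are used up, so a computation of the program that is no
longer than that can be carried out in full. -/
theorem run_of_steps {i n : ℕ} {κ : Clk m b} {J : p.States} {C : Duo m} (hC : C.Fits I)
    {y : List (Prog (Act α m)) × Duo m} (h : Steps (Prog.AutoStep (Act.Exec I)) i (J.1, C) y)
    (hκ : Ticks I n κ) (hi : i ≤ n) : ∃ (J' : p.States) (κ' : Clk m b), J'.1 = y.1 ∧ y.2.Fits I ∧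
      Ticks I (n - i) κ' ∧
      ReflTransGen ((table p b).Step I) (running p J C κ) (running p J' y.2 κ') := by
  generalize hx : (J.1, C) = x at h
  induction h with
  | nil => subst hx; exact ⟨J, κ, rfl, hC, hκ, .refl⟩
  | @tail i _ y z h₁ h₂ ih =>
    subst hx
    obtain ⟨J', κ₁, h₃, h₄, h₅, h₆⟩ := ih (by omega) rfl
    obtain ⟨κ', h₇, h₈⟩ := h₅
    obtain ⟨n', hn'⟩ : ∃ n', n - i = n' + 1 := ⟨n - i - 1, by omega⟩
    rw [hn'] at h₇
    cases h₇ with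
    | cons _ h₉ h₁₀ =>
      have hz := Prog.auto_mem_conts (p := p) (h₃ ▸ J'.2) h₂
      have hy : (J'.1, y.2) = y := by rw [h₃]
      exact ⟨⟨z.1, hz⟩, _, rfl, h₄.auto h₂, ⟨κ', by rwa [show n - (i + 1) = n' by omega], h₈⟩,
        h₆.tail ((step_running h₄.h).2 (Or.inr ⟨⟨z.1, hz⟩, z.2, _, by rw [hy]; exact h₂, h₉, rfl⟩))⟩

/-- Where the preparation ends. -/
theorem boot_running : ∃ (κ : Clk m b) (n : ℕ), (b + 2) ^ (rows I * wd I) ≤ n ∧ Ticks I n κ ∧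
    BootRun (table p b) I (Tri.start (.inl .mark) (.inl .blank))
      (running p (startState p) (rep m I PM.zero) κ) := by
  have hd : Clk.Digits (m := m) (b := b) (rows I * wd I) (endTape (.inr 0) (rows I * wd I)) :=
    ⟨rfl, fun i hi hi' => ⟨0, by rw [endTape, if_neg (by omega), if_pos hi']⟩, by simp [endTape]⟩
  obtain ⟨n, κ', h₁, h₂, h₃⟩ := Clk.exists_run hd
  refine ⟨_, n, h₁, ⟨κ', h₂, h₃⟩, ?_⟩
  have h₄ : (fun i => .inl (regTape m I (fun _ => 0) i) : ℕ → TSym m b) =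
      endTape zeroCell (wd I) := by
    funext i
    simp only [regTape, endTape, Nat.zero_testBit]
    split_ifs <;> rfl
  have h₅ : (fun i => .inl (arrTape m I (fun _ _ => 0) i) : ℕ → TSym m b) =
      endTape zeroCell (rows I * wd I) := by
    funext i
    simp only [arrTape, endTape, Nat.zero_testBit]
    split_ifs <;> rfl
  have h₆ := boot_run (I := I) (boots_table p b)
  rw [← h₄, ← h₅] at h₆
  have h₇ : 1 + PM.zero.c * wd I = 1 := by simp [PM.zero]
  rw [rep, h₇]
  exact h₆

theorem reachable_cases {d : Tri (MState p) (TSym m b)}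
    (h : ReflTransGen ((table p b).Step I) (Tri.start (.inl .mark) (.inl .blank)) d) :
    (InArea I d ∧ ∃ d', (table p b).Step I d d') ∨ Late p I d := by
  obtain ⟨κ, n, -, hκ, hr⟩ := boot_running (p := p) (I := I) (b := b)
  refine (hr.reachable h).imp_right fun h' => ?_
  clear h
  induction h' with
  | refl => exact ⟨_, _, κ, n, fits_rep m I, hκ, .refl, Or.inl rfl⟩
  | tail _ h₂ ih => exact ih.step h₂

/-- The clock loses no accepting computation: a shortest one visits each configuration at most once,
hence is shorter than the number of snapshots and than the number of ticks. Conversely, forgetting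
the clock yields a run of the automaton. -/
theorem table_accepts (p : Prog (Act α m)) (I : Inp α) :
    (∃ d, ReflTransGen ((table p (base p)).Step I) (Tri.start (.inl .mark) (.inl .blank)) d ∧
      d.q = .inr (.inr ())) ↔ ∃ C, p.Sem (Act.Exec I) (rep m I PM.zero) C := by
  constructor
  · rintro ⟨d, h, hd⟩
    -- During the preparation there is always a next step, whereas an accepting configuration has
    -- none.
    rcases reachable_cases h with ⟨-, d', ⟨_, h', -⟩⟩ | ⟨J, C, κ, n, -, -, hr, rfl | ⟨hJ, -⟩⟩
    · rw [hd] at h'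
      exact h'.elim
    · simp [running] at hd
    · rw [hJ] at hr
      exact ⟨C, Prog.auto_iff_sem.1 hr⟩
  · rintro ⟨C, h⟩
    obtain ⟨κ, n, hn, hκ, hr⟩ := boot_running (p := p) (I := I) (b := base p)
    obtain ⟨i, hi, hs⟩ := exists_short_path (V := fun x => x.1 ∈ p.conts [] ∧ x.2.Fits I)
      (snapshot p I) (fun x y hx hy => snapshot_injective hx hy)
      (fun x y hx hs => ⟨Prog.auto_mem_conts hx.1 hs, hx.2.auto hs⟩)
      ⟨Prog.start_mem_conts p [], fits_rep m I⟩ (Prog.auto_iff_sem.2 h)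
    obtain ⟨J', κ', h₁, h₂, -, h₃⟩ := run_of_steps (b := base p) (J := startState p) (fits_rep m I) hs
      hκ ((hi.le.trans (card_snapshot_le p I)).trans hn)
    exact ⟨_, (hr.toReflTransGen.trans h₃).tail ((step_running h₂.h).2 (Or.inl ⟨h₁, rfl⟩)), rfl⟩

theorem table_halts (p : Prog (Act α m)) (I : Inp α) :
    ¬ ∃ f : ℕ → Tri (MState p) (TSym m b), f 0 = Tri.start (.inl .mark) (.inl .blank) ∧
      ∀ j, (table p b).Step I (f j) (f (j + 1)) := by
  rintro ⟨f, h0, hf⟩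
  obtain ⟨κ, n, hn, hκ, hr⟩ := boot_running (p := p) (I := I) (b := b)
  obtain ⟨i, hi⟩ := hr.infinite h0 hf
  exact running_halts n _ _ κ (fits_rep m I) hκ
    ⟨fun j => f (i + j), hi, fun j => hf (i + j)⟩

/-- The tape has `|x| + k + 2` cells, fewer than `2 ^ (l + 1) * 2 ^ (k + 2)` for `l = log₂ |x|`. The
contribution of `k` is additive, and a factor depending on `k` absorbs it because the logarithm is
read as at least `1`. -/
theorem wd_le (I : Inp α) : wd I ≤ (I.2 + 4) * max 1 (Nat.log 2 I.1.length) := by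
  have h₁ : I.1.length < 2 ^ (Nat.log 2 I.1.length + 1) := Nat.lt_pow_succ_log_self (by norm_num) _
  have h₂ : I.2 + 2 < 2 ^ (I.2 + 2) := Nat.lt_two_pow_self
  set l := Nat.log 2 I.1.length
  have h₃ : wd I ≤ l + 1 + (I.2 + 2) := by
    refine Nat.size_le.2 ?_
    rw [length_tp, pow_add]
    have h₄ : 2 ≤ 2 ^ (l + 1) := by rw [pow_succ]; have := Nat.two_pow_pos l; omega
    have h₅ : 2 ≤ 2 ^ (I.2 + 2) := by omega
    nlinarith
  have h₄ : 1 ≤ max 1 l := le_max_left _ _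
  have h₅ : l ≤ max 1 l := le_max_right _ _
  nlinarith

/-- Programs for pointer machines can be executed in uniform-XNL. -/
theorem exists_machine (q : Code α) : ∃ (M : NTM α) (f : ℕ → ℕ), Computable f ∧
    ∀ (x : List α) (k : ℕ), M.Halts (inputTape x k) ∧
      (M.Accepts (inputTape x k) ↔ ∃ s', q.Sem (Op.Step (x, k)) PM.zero s') ∧
      M.UsesSpace (inputTape x k) (f k * max 1 (Nat.log 2 x.length)) := by
  obtain ⟨m, p, hp⟩ := exists_two_tape_program q
  -- One tape needs `wd + 2` cells and the two others `(k + 1) * wd + 2` each. Since `1 ≤ wd`, the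
  -- sum is at most `(1 + 2 + 6) * ((k + 1) * wd)`, whence the `9`; the factor `k + 4` comes from
  -- `wd_le`.
  refine ⟨(table p (base p)).toNTM (.inl .blank) (.inl .mark) (.inr (.inr ())),
    fun k => 9 * ((k + 1) * (k + 4)), ?_, fun x k => ⟨?_, ?_, ?_⟩⟩
  · refine Primrec.to_comp ?_
    exact Primrec.nat_mul.comp (.const 9) (Primrec.nat_mul.comp
      (Primrec.nat_add.comp .id (.const 1)) (Primrec.nat_add.comp .id (.const 4)))
  · rintro ⟨c, h0, hc⟩
    exact table_halts p (x, k) ⟨fun j => toTri (c j), by simp only [h0]; rfl,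
      fun j => (step_toNTM (I := (x, k))).1 (hc j)⟩
  · rw [← hp, ← table_accepts]
    constructor
    · rintro ⟨c, h, hc⟩
      exact ⟨toTri c, (reachable_toNTM (I := (x, k))).1 h, hc⟩
    · rintro ⟨d, h, hd⟩
      exact ⟨ofTri d, (reachable_toNTM (I := (x, k))).2 (by rwa [toTri_ofTri]), hd⟩
  · refine ⟨(![wd (x, k) + 2, rows (x, k) * wd (x, k) + 2, rows (x, k) * wd (x, k) + 2] :
      Fin 3 → ℕ), ?_, fun c hc => ?_⟩
    · change ∑ i : Fin 3, _ ≤ _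
      have h₁ := wd_le (x, k)
      have h₂ := wd_pos (x, k)
      simp only [Fin.sum_univ_three, Matrix.cons_val_zero, Matrix.cons_val_one, Matrix.cons_val,
        rows] at h₁ ⊢
      calc wd (x, k) + 2 + ((k + 1) * wd (x, k) + 2) + ((k + 1) * wd (x, k) + 2)
          ≤ 9 * ((k + 1) * wd (x, k)) := by nlinarith
        _ ≤ 9 * ((k + 1) * ((k + 4) * max 1 (Nat.log 2 x.length))) := by gcongr
        _ = _ := by ring
    · have h : InArea (x, k) (toTri c) := by
        rcases reachable_cases ((reachable_toNTM (I := (x, k))).1 hc) with h | h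
        · exact h.1
        · exact h.inArea
      obtain ⟨h₀, h₁, h₂⟩ := h
      intro (i : Fin 3)
      fin_cases i
      exacts [h₀, h₁, h₂]

end Machine

end XNL

/-! ### Words on the input tape, and first definable predicates. -/

namespace XNL

open Relation Function REWB

section Words

variable {α : Type} {I : Inp α}

/-! ### Words on the input tape -/

/-- The word `w` occupies the positions from `p` to `q` of the input tape. -/
def Seg (I : Inp α) : ℕ → List α → ℕ → Prop
  | p, [], q => p = q
  | p, s :: w, q => sy I p = .sym s ∧ Seg I (p + 1) w q

theorem seg_nil {p q : ℕ} : Seg I p [] q ↔ p = q := Iff.rfl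

theorem seg_cons {s : α} {w : List α} {p q : ℕ} :
    Seg I p (s :: w) q ↔ sy I p = .sym s ∧ Seg I (p + 1) w q := Iff.rfl

theorem seg_append {v : List α} : ∀ {u : List α} {p q : ℕ},
    Seg I p (u ++ v) q ↔ ∃ r, Seg I p u r ∧ Seg I r v q
  | [], p, q => by simp [seg_nil]
  | s :: u, p, q => by simp only [List.cons_append, seg_cons, seg_append (u := u), and_assoc,
      exists_and_left]

theorem Seg.length : ∀ {w : List α} {p q : ℕ}, Seg I p w q → q = p + w.length
  | [], p, q, h => by simpa [seg_nil, eq_comm] using h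
  | s :: w, p, q, h => by rw [h.2.length, List.length_cons]; omega

theorem Seg.word : ∀ {w w' : List α} {p q : ℕ}, Seg I p w q → Seg I p w' q → w = w'
  | [], [], _, _, _, _ => rfl
  | [], s :: w', p, q, h, h' => by
    have h₁ := h.length
    have h₂ := h'.length
    simp at h₁ h₂
    omega
  | s :: w, [], p, q, h, h' => by
    have h₁ := h.length
    have h₂ := h'.length
    simp at h₁ h₂
    omega
  | s :: w, s' :: w', p, q, h, h' => by
    have h₁ := h.1.symm.trans h'.1
    rw [InSym.sym.injEq] at h₁
    rw [h₁, h.2.word h'.2]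

theorem le_of_sym {p : ℕ} {s : α} (h : sy I p = .sym s) : 1 ≤ p ∧ p ≤ I.1.length := by
  constructor
  · rw [Nat.one_le_iff_ne_zero]
    rintro rfl
    rw [sy_zero] at h
    cases h
  · by_contra h'
    rcases le_or_gt p (I.1.length + I.2) with h₂ | h₂
    · rw [sy_stroke (by omega) h₂] at h; cases h
    · rw [sy_rightEnd h₂] at h; cases h

/-- Positions in the word and the one behind it are in the range of the registers. Most bounds on
quantified positions below come from this. -/
theorem lt_bd_of_sym {p : ℕ} {s : α} (h : sy I p = .sym s) : p + 1 < bd I := by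
  have := (le_of_sym h).2
  have := length_lt_bd I
  rw [length_tp] at this
  omega

theorem Seg.lt_bd : ∀ {w : List α} {p q : ℕ}, Seg I p w q → p < bd I → q < bd I
  | [], p, q, h, h' => by cases h; exact h'
  | s :: w, p, q, h, _ => h.2.lt_bd (lt_bd_of_sym h.1)

theorem Seg.end_le : ∀ {w : List α} {p q : ℕ}, Seg I p w q → w ≠ [] → q ≤ I.1.length + 1
  | [], _, _, _, h => absurd rfl h
  | [s], p, q, h, _ => by cases h.2; have := (le_of_sym h.1).2; omega
  | s :: s' :: w, p, q, h, _ => h.2.end_le (by simp)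

theorem seg_drop {i : ℕ} : ∀ {w : List α}, w = I.1.drop i → Seg I (i + 1) w (i + 1 + w.length)
  | [], _ => rfl
  | s :: w, h => by
    have hi : i < I.1.length := by
      by_contra h'
      rw [List.drop_eq_nil_of_le (by omega)] at h
      cases h
    rw [List.drop_eq_getElem_cons hi, List.cons.injEq] at h
    refine ⟨by rw [sy_sym hi, h.1], ?_⟩
    have := seg_drop h.2
    rwa [List.length_cons, show i + 1 + (w.length + 1) = i + 1 + 1 + w.length by omega]

theorem seg_input (I : Inp α) : Seg I 1 I.1 (I.1.length + 1) := by
  have := seg_drop (I := I) (i := 0) (w := I.1) rfl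
  rwa [Nat.zero_add, Nat.add_comm] at this

theorem Seg.mem : ∀ {w : List α} {p q r : ℕ}, Seg I p w q → p ≤ r → r < q →
    ∃ s ∈ w, sy I r = .sym s
  | [], p, q, r, h, h₁, h₂ => by cases h; omega
  | s :: w, p, q, r, h, h₁, h₂ => by
    rcases h₁.eq_or_lt with rfl | h₁
    · exact ⟨s, by simp, h.1⟩
    · obtain ⟨s', h₃, h₄⟩ := h.2.mem h₁ h₂
      exact ⟨s', List.mem_cons_of_mem _ h₃, h₄⟩

end Words

section Basics

variable {α : Type} {n : ℕ}

/-! ### Definability of some predicates -/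

namespace Dfn

/-- Only arguments in range matter, as registers hold no others. -/
theorem congr {P Q : Inp α → (ℕ → ℕ → ℕ) → (Fin n → ℕ) → Prop} (hP : Dfn P)
    (h : ∀ I A ρ, (∀ i, ρ i < bd I) → (P I A ρ ↔ Q I A ρ)) : Dfn Q := by
  obtain ⟨p, hp⟩ := hP
  exact ⟨p, fun I s hs s' => (hp I s hs s').trans
    (and_congr_right fun _ => h _ _ _ fun i => hs.valid.reg i)⟩

theorem eqv (i j : Fin n) : Dfn (α := α) fun _ _ ρ => ρ i = ρ j := .eq (.proj i) (.proj j)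

theorem suc (i j : Fin n) : Dfn (α := α) fun _ _ ρ => ρ i = ρ j + 1 := .succ (.proj i) (.proj j)

theorem isSym (s : InSym α) (i : Fin n) : Dfn fun I _ ρ => sy I (ρ i) = s :=
  .sym {s} (.proj i)

/-- Quantification over a variable that is bounded anyway. -/
theorem exb {Q : Inp α → (ℕ → ℕ → ℕ) → (Fin n → ℕ) → ℕ → Prop}
    (h : Dfn (n := n + 1) (fun I A ρ => Q I A (Fin.init ρ) (ρ (Fin.last n))))
    (hb : ∀ I A ρ v, (∀ i, ρ i < bd I) → Q I A ρ v → v < bd I) :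
    Dfn (fun I A ρ => ∃ v, Q I A ρ v) :=
  (ex h).congr fun I A ρ hρ => exists_congr fun v => and_iff_right_of_imp (hb I A ρ v hρ)

/-- Arguments are registers, not constants; zero is recognised as the position of the left end
marker. -/
theorem isZero (i : Fin n) : Dfn (α := α) fun _ _ ρ => ρ i = 0 :=
  (isSym .leftEnd i).congr fun _ _ _ _ => sy_eq_leftEnd

/-- Reachability in one variable. -/
theorem rtg {Q : Inp α → (ℕ → ℕ → ℕ) → (Fin n → ℕ) → ℕ → ℕ → Prop}
    (h : Dfn (n := n + 1 + 1) (fun I A ρ => Q I A (lo ρ) (mid ρ 0) (hi ρ 0)))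
    (hb : ∀ I A ρ u v, (∀ i, ρ i < bd I) → Q I A ρ u v → v < bd I) (i j : Fin n) :
    Dfn (fun I A ρ => ReflTransGen (Q I A ρ) (ρ i) (ρ j)) :=
  (tc_one h (.proj i) (.proj j)).congr fun I A ρ hρ => by
    have : (fun u v => v < bd I ∧ Q I A ρ u v) = Q I A ρ := by
      funext u v; exact propext (and_iff_right_of_imp (hb I A ρ u v hρ))
    rw [this]

/-- Reachability in two variables. -/
theorem rtg₂ {Q : Inp α → (ℕ → ℕ → ℕ) → (Fin n → ℕ) → ℕ × ℕ → ℕ × ℕ → Prop}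
    (h : Dfn (n := n + 2 + 2) (fun I A ρ => Q I A (lo ρ) (mid ρ 0, mid ρ 1) (hi ρ 0, hi ρ 1)))
    (hb : ∀ I A ρ u v, (∀ i, ρ i < bd I) → Q I A ρ u v → v.1 < bd I ∧ v.2 < bd I)
    (i j k l : Fin n) :
    Dfn (fun I A ρ => ReflTransGen (Q I A ρ) (ρ i, ρ j) (ρ k, ρ l)) :=
  (tc (Q := fun I A ρ u v => Q I A ρ (u 0, u 1) (v 0, v 1)) h (src := fun ρ => ![ρ i, ρ j])
    (tgt := fun ρ => ![ρ k, ρ l]) (by simp [Fin.forall_fin_two, Var.proj])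
    (by simp [Fin.forall_fin_two, Var.proj])).congr fun I A ρ hρ => by
      constructor
      · exact fun h => ReflTransGen.lift (fun u : Fin 2 → ℕ => (u 0, u 1)) (fun u v h => h.2) _ _ h
      · exact fun h => ReflTransGen.lift (fun u : ℕ × ℕ => ![u.1, u.2])
          (fun u v h => ⟨by simpa [Fin.forall_fin_two] using hb _ _ _ _ _ hρ h, h⟩) _ _ h

/-- Reachability in four variables. -/
theorem rtg₄ {Q : Inp α → (ℕ → ℕ → ℕ) → (Fin n → ℕ) → ℕ × ℕ × ℕ × ℕ → ℕ × ℕ × ℕ × ℕ → Prop}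
    (h : Dfn (n := n + 4 + 4) (fun I A ρ => Q I A (lo ρ) (mid ρ 0, mid ρ 1, mid ρ 2, mid ρ 3)
      (hi ρ 0, hi ρ 1, hi ρ 2, hi ρ 3))) (i : Fin 4 → Fin n) (j : Fin 4 → Fin n) :
    Dfn (fun I A ρ => ReflTransGen (fun u v => (v.1 < bd I ∧ v.2.1 < bd I ∧ v.2.2.1 < bd I ∧
        v.2.2.2 < bd I) ∧ Q I A ρ u v)
      (ρ (i 0), ρ (i 1), ρ (i 2), ρ (i 3)) (ρ (j 0), ρ (j 1), ρ (j 2), ρ (j 3))) :=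
  (tc (Q := fun I A ρ u v => Q I A ρ (u 0, u 1, u 2, u 3) (v 0, v 1, v 2, v 3)) h
    (src := fun ρ t => ρ (i t)) (tgt := fun ρ t => ρ (j t)) (fun _ => .proj _)
    (fun _ => .proj _)).congr fun I A ρ _ => by
      constructor
      · exact fun h => ReflTransGen.lift (fun u : Fin 4 → ℕ => (u 0, u 1, u 2, u 3))
          (fun u v h => ⟨⟨h.1 0, h.1 1, h.1 2, h.1 3⟩, h.2⟩) _ _ h
      · intro h
        have := ReflTransGen.lift (p := fun u v : Fin 4 → ℕ => (∀ i, v i < bd I) ∧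
            Q I A ρ (u 0, u 1, u 2, u 3) (v 0, v 1, v 2, v 3))
          (fun u : ℕ × ℕ × ℕ × ℕ => ![u.1, u.2.1, u.2.2.1, u.2.2.2])
          (fun u v h => ⟨fun t => by fin_cases t; exacts [h.1.1, h.1.2.1, h.1.2.2.1, h.1.2.2.2],
            h.2⟩) _ _ h
        convert this using 1 <;> funext t <;> fin_cases t <;> rfl

theorem le (i j : Fin n) : Dfn (α := α) fun _ _ ρ => ρ i ≤ ρ j :=
  (tc_one (Q := fun _ _ _ u v => v = u + 1) (suc _ _) (.proj i) (.proj j)).congr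
    fun I A ρ hρ => by
      constructor
      · intro h
        generalize ρ j = v at h
        induction h with
        | refl => exact le_rfl
        | tail _ h ih => omega
      · intro h
        have key : ∀ v, ρ i ≤ v → v < bd I →
            ReflTransGen (fun u v => v < bd I ∧ v = u + 1) (ρ i) v := by
          intro v h
          induction v, h using Nat.le_induction with
          | base => exact fun _ => .refl
          | succ v _ ih => exact fun hv => (ih (by omega)).tail ⟨hv, rfl⟩
        exact key _ h (hρ j)

theorem lt (i j : Fin n) : Dfn (α := α) fun _ _ ρ => ρ i < ρ j :=
  (ex (Q := fun _ _ ρ v => v = ρ i + 1 ∧ v ≤ ρ j) ((suc _ _).and (le _ _))).congr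
    fun I A ρ hρ => by
      constructor
      · rintro ⟨_, -, rfl, h⟩
        exact h
      · exact fun h => ⟨_, (Nat.succ_le_of_lt h).trans_lt (hρ j), rfl, h⟩

/-- Addition is simultaneous counting, from `ρ i` in one component and from zero up to `ρ j` in the
other. The upper bounds on both components keep the walk in range. -/
theorem add (i j k : Fin n) : Dfn (α := α) fun _ _ ρ => ρ k = ρ i + ρ j :=
  (ex (Q := fun I _ ρ z => z = 0 ∧ ReflTransGen (fun u v : ℕ × ℕ =>
      v.1 ≤ ρ k ∧ v.2 ≤ ρ j ∧ v.1 = u.1 + 1 ∧ v.2 = u.2 + 1) (ρ i, z) (ρ k, ρ j))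
    ((isZero _).and (rtg₂ ((le _ _).and ((le _ _).and ((suc _ _).and (suc _ _))))
      (fun I A ρ u v hρ h => ⟨h.1.trans_lt (hρ _), h.2.1.trans_lt (hρ _)⟩) _ _ _ _))).congr
    fun I A ρ hρ => by
      constructor
      · rintro ⟨_, -, rfl, h⟩
        have key : ∀ x, ReflTransGen (fun u v : ℕ × ℕ =>
            v.1 ≤ ρ k ∧ v.2 ≤ ρ j ∧ v.1 = u.1 + 1 ∧ v.2 = u.2 + 1) (ρ i, 0) x →
            x.1 = ρ i + x.2 := by
          intro x h
          induction h with
          | refl => rfl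
          | tail _ h ih => omega
        exact key _ h
      · intro h
        refine ⟨0, bd_pos I, rfl, ?_⟩
        rw [h]
        have key : ∀ d, d ≤ ρ j → ReflTransGen (fun u v : ℕ × ℕ =>
            v.1 ≤ ρ i + ρ j ∧ v.2 ≤ ρ j ∧ v.1 = u.1 + 1 ∧ v.2 = u.2 + 1) (ρ i, 0)
            (ρ i + d, d) := by
          intro d
          induction d with
          | zero => exact fun _ => .refl
          | succ d ih => exact fun hd => (ih (by omega)).tail ⟨by simp; omega, hd, rfl, rfl⟩
        exact key _ le_rfl

end Dfn

end Basics

end XNL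

/-! ### Numerals: recognition, comparison and evaluation. -/

namespace XNL

open Relation Function REWB

section Numerals

variable {I : Inp Sym} {n : ℕ}

/-! ### Numerals -/

def bitSym (b : Bool) : Sym := if b then .bit1 else .bit0

def encBits (l : List Bool) : List Sym := l.map bitSym ++ [.numEnd]

theorem encNat_eq (m : ℕ) : encNat m = encBits m.bits := rfl

theorem encBits_cons (b : Bool) (l : List Bool) : encBits (b :: l) = bitSym b :: encBits l := rfl

theorem encNat_bit {b : Bool} {m : ℕ} (h : m = 0 → b = true) :
    encNat (Nat.bit b m) = bitSym b :: encNat m := by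
  rw [encNat_eq, Nat.bits_append_bit m b h, encBits_cons, encNat_eq]

theorem encNat_zero : encNat 0 = [.numEnd] := by simp [encNat]

theorem Seg.lt_bd_of_encNat {m p q : ℕ} (h : Seg I p (encNat m) q) : p < bd I ∧ q < bd I := by
  have hp : p < bd I := by
    rw [encNat_eq] at h
    cases hb : m.bits with
    | nil => rw [hb] at h; have := lt_bd_of_sym h.1; omega
    | cons b l => rw [hb] at h; have := lt_bd_of_sym h.1; omega
  exact ⟨hp, h.lt_bd hp⟩

/-- The end mark makes numerals a prefix code, so the starting position determines the digits and
the end. The analogous facts for conditions and expressions are what allows all these objects to be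
represented by positions. -/
theorem encBits_prefix : ∀ {l l' : List Bool} {p q q' : ℕ}, Seg I p (encBits l) q →
    Seg I p (encBits l') q' → l = l' ∧ q = q'
  | [], [], _, _, _, h, h' => by
    cases h.2
    cases h'.2
    exact ⟨rfl, rfl⟩
  | [], b :: l', _, _, _, h, h' => by
    have := h.1.symm.trans h'.1
    cases b <;> simp [bitSym] at this
  | b :: l, [], _, _, _, h, h' => by
    have := h.1.symm.trans h'.1
    cases b <;> simp [bitSym] at this
  | b :: l, b' :: l', p, q, q', h, h' => by
    have h₁ := h.1.symm.trans h'.1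
    obtain ⟨h₂, h₃⟩ := encBits_prefix h.2 h'.2
    exact ⟨by cases b <;> cases b' <;> simp_all [bitSym], h₃⟩

/-- The value of a sequence of bits. -/
def bitsVal : List Bool → ℕ
  | [] => 0
  | b :: l => Nat.bit b (bitsVal l)

theorem bitsVal_bits (m : ℕ) : bitsVal m.bits = m := by
  induction m using Nat.binaryRec' with
  | zero => simp [bitsVal]
  | bit b m h ih => rw [Nat.bits_append_bit m b h, bitsVal, ih]

theorem encNat_prefix {m m' p q q' : ℕ} (h : Seg I p (encNat m) q) (h' : Seg I p (encNat m') q') :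
    m = m' ∧ q = q' := by
  obtain ⟨h₁, h₂⟩ := encBits_prefix h h'
  exact ⟨by rw [← bitsVal_bits m, h₁, bitsVal_bits], h₂⟩

/-- A step along a numeral whose most significant digit is not zero. -/
def BitStep (I : Inp Sym) (p p' : ℕ) : Prop :=
  p' = p + 1 ∧ (sy I p = .sym .bit1 ∨
    (sy I p = .sym .bit0 ∧ (sy I p' = .sym .bit0 ∨ sy I p' = .sym .bit1)))

def IsNum (I : Inp Sym) (p q : ℕ) : Prop := ∃ m, Seg I p (encNat m) q

/-- The most significant digit of `Nat.bits` is never zero. With this digit last, it means that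
every `bit0` is followed by another bit, a condition on neighbouring cells. -/
theorem isNum_iff {p q : ℕ} : IsNum I p q ↔
    ∃ u, ReflTransGen (BitStep I) p u ∧ sy I u = .sym .numEnd ∧ q = u + 1 := by
  constructor
  · rintro ⟨m, h⟩
    induction m using Nat.binaryRec' generalizing p with
    | zero =>
      rw [encNat_zero] at h
      exact ⟨p, .refl, h.1, h.2.symm⟩
    | bit b m hb ih =>
      rw [encNat_bit hb] at h
      obtain ⟨u, h₁, h₂⟩ := ih h.2
      refine ⟨u, .head ⟨rfl, ?_⟩ h₁, h₂⟩
      have h₃ := h.1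
      cases b
      · right
        refine ⟨h₃, ?_⟩
        have h₄ := h.2
        rw [encNat_eq] at h₄
        cases hm : m.bits with
        | nil =>
          have := bitsVal_bits m
          rw [hm] at this
          exact absurd (hb this.symm) (by simp)
        | cons b' l =>
          rw [hm] at h₄
          cases b'
          · exact Or.inl h₄.1
          · exact Or.inr h₄.1
      · exact Or.inl h₃
  · rintro ⟨u, h₁, h₂, rfl⟩
    induction h₁ using ReflTransGen.head_induction_on with
    | refl => exact ⟨0, by rw [encNat_zero]; exact ⟨h₂, rfl⟩⟩
    | @head a c h _ ih =>
      obtain ⟨m, hm⟩ := ih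
      obtain ⟨rfl, h | ⟨h, h'⟩⟩ := h
      · exact ⟨Nat.bit true m, by rw [encNat_bit fun _ => rfl]; exact ⟨h, hm⟩⟩
      · refine ⟨Nat.bit false m, ?_⟩
        rw [encNat_bit]
        · exact ⟨h, hm⟩
        · rintro rfl
          rw [encNat_zero] at hm
          rw [hm.1] at h'
          simp at h'

theorem dfn_isNum (i j : Fin n) : Dfn fun I _ ρ => IsNum I (ρ i) (ρ j) :=
  (Dfn.exb (Q := fun I _ ρ u => ReflTransGen (BitStep I) (ρ i) u ∧ sy I u = .sym .numEnd ∧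
      ρ j = u + 1)
    ((Dfn.rtg ((Dfn.suc _ _).and ((Dfn.isSym _ _).or ((Dfn.isSym _ _).and ((Dfn.isSym _ _).or
      (Dfn.isSym _ _))))) (by
        rintro I A ρ u v - ⟨rfl, h | ⟨h, -⟩⟩ <;> exact lt_bd_of_sym h) _ _).and
      ((Dfn.isSym _ _).and (Dfn.suc _ _)))
    (fun I A ρ v _ h => by have := lt_bd_of_sym h.2.1; omega)).congr fun I A ρ _ => isNum_iff.symm

/-- Pairs of symbols at which two numerals are found to be equal or different. -/
def SameStep (I : Inp Sym) (u v : ℕ × ℕ) : Prop :=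
  v.1 = u.1 + 1 ∧ v.2 = u.2 + 1 ∧ ((sy I u.1 = .sym .bit0 ∧ sy I u.2 = .sym .bit0) ∨
    (sy I u.1 = .sym .bit1 ∧ sy I u.2 = .sym .bit1))

def Ends (a b : InSym Sym) : Prop := a = .sym .numEnd ∧ b = .sym .numEnd

def Differ (a b : InSym Sym) : Prop :=
  (a = .sym .bit0 ∧ b = .sym .bit1) ∨ (a = .sym .bit1 ∧ b = .sym .bit0) ∨
  (a = .sym .numEnd ∧ (b = .sym .bit0 ∨ b = .sym .bit1)) ∨
  (b = .sym .numEnd ∧ (a = .sym .bit0 ∨ a = .sym .bit1))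

/-- A parallel walk over two numerals up to a place with property `R`. -/
def Walk (I : Inp Sym) (R : InSym Sym → InSym Sym → Prop) (p p' : ℕ) : Prop :=
  ∃ u u', ReflTransGen (SameStep I) (p, p') (u, u') ∧ R (sy I u) (sy I u')

theorem walk_iff {R : InSym Sym → InSym Sym → Prop} {p p' : ℕ} : Walk I R p p' ↔
    R (sy I p) (sy I p') ∨ (((sy I p = .sym .bit0 ∧ sy I p' = .sym .bit0) ∨
      (sy I p = .sym .bit1 ∧ sy I p' = .sym .bit1)) ∧ Walk I R (p + 1) (p' + 1)) := by
  constructor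
  · rintro ⟨u, u', h, hR⟩
    rcases h.cases_head with h | ⟨⟨v, v'⟩, ⟨h₁, h₂, h₃⟩, h₄⟩
    · cases h; exact Or.inl hR
    · dsimp only at h₁ h₂ h₃
      subst h₁ h₂
      exact Or.inr ⟨h₃, u, u', h₄, hR⟩
  · rintro (h | ⟨h, u, u', h₁, h₂⟩)
    · exact ⟨p, p', .refl, h⟩
    · exact ⟨u, u', .head ⟨rfl, rfl, h⟩ h₁, h₂⟩

/-- Equality and difference are witnessed by separate walks, one to a common end and one to a
visible difference, because neither can be obtained from the other by negation. -/
theorem walk_encBits : ∀ {l l' : List Bool} {p p' q q' : ℕ}, Seg I p (encBits l) q →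
    Seg I p' (encBits l') q' → (Walk I Ends p p' ↔ l = l') ∧ (Walk I Differ p p' ↔ l ≠ l')
  | [], [], _, _, _, _, h, h' => by
    have h₁ : sy I _ = _ := h.1
    have h₂ : sy I _ = _ := h'.1
    rw [walk_iff (R := Ends), walk_iff (R := Differ), h₁, h₂]
    simp [Ends, Differ]
  | [], b :: l', _, _, _, _, h, h' => by
    have h₁ : sy I _ = _ := h.1
    have h₂ : sy I _ = _ := h'.1
    rw [walk_iff (R := Ends), walk_iff (R := Differ), h₁, h₂]
    cases b <;> simp [Ends, Differ, bitSym]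
  | b :: l, [], _, _, _, _, h, h' => by
    have h₁ : sy I _ = _ := h.1
    have h₂ : sy I _ = _ := h'.1
    rw [walk_iff (R := Ends), walk_iff (R := Differ), h₁, h₂]
    cases b <;> simp [Ends, Differ, bitSym]
  | b :: l, b' :: l', p, p', _, _, h, h' => by
    have h₁ : sy I _ = _ := h.1
    have h₂ : sy I _ = _ := h'.1
    obtain ⟨h₃, h₄⟩ := walk_encBits h.2 h'.2
    rw [walk_iff (R := Ends), walk_iff (R := Differ), h₁, h₂]
    cases b <;> cases b' <;> simp [Ends, Differ, bitSym, h₃, h₄]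

def SameNum (I : Inp Sym) (p p' : ℕ) : Prop :=
  ∃ m q q', Seg I p (encNat m) q ∧ Seg I p' (encNat m) q'

def DiffNum (I : Inp Sym) (p p' : ℕ) : Prop :=
  ∃ m m' q q', m ≠ m' ∧ Seg I p (encNat m) q ∧ Seg I p' (encNat m') q'

theorem sameNum_iff {p p' : ℕ} :
    SameNum I p p' ↔ (∃ q, IsNum I p q) ∧ (∃ q, IsNum I p' q) ∧ Walk I Ends p p' := by
  constructor
  · rintro ⟨m, q, q', h, h'⟩
    exact ⟨⟨q, m, h⟩, ⟨q', m, h'⟩, (walk_encBits h h').1.2 rfl⟩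
  · rintro ⟨⟨q, m, h⟩, ⟨q', m', h'⟩, hw⟩
    have : m = m' := by rw [← bitsVal_bits m, (walk_encBits h h').1.1 hw, bitsVal_bits]
    exact ⟨m, q, q', h, this ▸ h'⟩

theorem diffNum_iff {p p' : ℕ} :
    DiffNum I p p' ↔ (∃ q, IsNum I p q) ∧ (∃ q, IsNum I p' q) ∧ Walk I Differ p p' := by
  constructor
  · rintro ⟨m, m', q, q', hm, h, h'⟩
    refine ⟨⟨q, m, h⟩, ⟨q', m', h'⟩, (walk_encBits h h').2.2 fun h => hm ?_⟩
    rw [← bitsVal_bits m, h, bitsVal_bits]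
  · rintro ⟨⟨q, m, h⟩, ⟨q', m', h'⟩, hw⟩
    exact ⟨m, m', q, q', fun hm => (walk_encBits h h').2.1 hw (by rw [hm]), h, h'⟩

theorem sameNum_iff_eq {p p' m m' q q' : ℕ} (h : Seg I p (encNat m) q)
    (h' : Seg I p' (encNat m') q') : SameNum I p p' ↔ m = m' := by
  constructor
  · rintro ⟨k, _, _, h₁, h₂⟩
    rw [(encNat_prefix h h₁).1, (encNat_prefix h' h₂).1]
  · rintro rfl
    exact ⟨m, q, q', h, h'⟩

theorem diffNum_iff_ne {p p' m m' q q' : ℕ} (h : Seg I p (encNat m) q)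
    (h' : Seg I p' (encNat m') q') : DiffNum I p p' ↔ m ≠ m' := by
  constructor
  · rintro ⟨k, k', _, _, hk, h₁, h₂⟩
    rwa [(encNat_prefix h h₁).1, (encNat_prefix h' h₂).1]
  · intro hm
    exact ⟨m, m', q, q', hm, h, h'⟩

theorem dfn_exists_isNum (i : Fin n) : Dfn fun I _ ρ => ∃ q, IsNum I (ρ i) q :=
  .exb (dfn_isNum _ _) fun _ _ _ _ _ ⟨_, h⟩ => h.lt_bd_of_encNat.2

theorem dfn_walk {R : InSym Sym → InSym Sym → Prop}
    (hR : ∀ {n : ℕ} (i j : Fin n), Dfn fun I _ ρ => R (sy I (ρ i)) (sy I (ρ j)))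
    (hs : ∀ a b, R a b → (∃ s, a = .sym s) ∧ ∃ s, b = .sym s) (i j : Fin n) :
    Dfn fun I _ ρ => Walk I R (ρ i) (ρ j) := by
  refine .exb (.exb (.and (.rtg₂ ?_ ?_ _ _ _ _) (hR _ _)) ?_) ?_
  · exact ((Dfn.suc _ _).and ((Dfn.suc _ _).and (((Dfn.isSym _ _).and (Dfn.isSym _ _)).or
      ((Dfn.isSym _ _).and (Dfn.isSym _ _)))))
  · rintro I A ρ u v - ⟨h₁, h₂, ⟨h₃, h₄⟩ | ⟨h₃, h₄⟩⟩ <;> rw [h₁, h₂] <;>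
    exact ⟨lt_bd_of_sym h₃, lt_bd_of_sym h₄⟩
  · rintro I A ρ v - ⟨-, h⟩
    obtain ⟨s, hs⟩ := (hs _ _ h).2
    have := lt_bd_of_sym hs
    omega
  · rintro I A ρ v - ⟨_, -, h⟩
    obtain ⟨s, hs⟩ := (hs _ _ h).1
    have := lt_bd_of_sym hs
    omega

theorem dfn_sameNum (i j : Fin n) : Dfn fun I _ ρ => SameNum I (ρ i) (ρ j) :=
  ((dfn_exists_isNum i).and ((dfn_exists_isNum j).and (dfn_walk
    (fun _ _ => (Dfn.isSym _ _).and (Dfn.isSym _ _)) (by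
      rintro a b ⟨rfl, rfl⟩
      exact ⟨⟨_, rfl⟩, ⟨_, rfl⟩⟩) i j))).congr fun _ _ _ _ => sameNum_iff.symm

theorem dfn_diffNum (i j : Fin n) : Dfn fun I _ ρ => DiffNum I (ρ i) (ρ j) :=
  ((dfn_exists_isNum i).and ((dfn_exists_isNum j).and (dfn_walk
    (fun _ _ => ((Dfn.isSym _ _).and (Dfn.isSym _ _)).or (((Dfn.isSym _ _).and (Dfn.isSym _ _)).or
      (((Dfn.isSym _ _).and ((Dfn.isSym _ _).or (Dfn.isSym _ _))).or
      ((Dfn.isSym _ _).and ((Dfn.isSym _ _).or (Dfn.isSym _ _)))))) (by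
      rintro a b (⟨rfl, rfl⟩ | ⟨rfl, rfl⟩ | ⟨rfl, rfl | rfl⟩ | ⟨rfl, rfl | rfl⟩) <;>
      exact ⟨⟨_, rfl⟩, ⟨_, rfl⟩⟩) i j))).congr fun _ _ _ _ => diffNum_iff.symm

/-- Evaluation of a numeral from its end, as long as the value is at most `N`. -/
def EvalStep (I : Inp Sym) (N : ℕ) (u v : ℕ × ℕ) : Prop :=
  v.2 ≤ N ∧ u.1 = v.1 + 1 ∧ ∃ d, d ≤ v.2 ∧ d = u.2 + u.2 ∧
    ((sy I v.1 = .sym .bit0 ∧ v.2 = d) ∨ (sy I v.1 = .sym .bit1 ∧ v.2 = d + 1))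

/-- Horner's scheme, starting at the most significant digit next to the end mark and moving left.
Intermediate values never decrease, so the bound `N` is respected on the way if it is respected at
the end; larger numerals, whose values might not fit into a register, are not evaluated at all. -/
theorem eval_encBits {N m : ℕ} : ∀ {l : List Bool} {p q : ℕ}, Seg I p (encBits l) q →
    ((∃ u, sy I u = .sym .numEnd ∧ ReflTransGen (EvalStep I N) (u, 0) (p, m)) ∧ m ≤ N ↔
      m = bitsVal l ∧ m ≤ N)
  | [], p, q, h => by
    have h₁ : sy I p = .sym .numEnd := h.1
    refine and_congr_left fun _ => ⟨?_, ?_⟩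
    · rintro ⟨u, hu, h⟩
      rcases h.cases_tail with h | ⟨_, _, -, -, _, _, _, ⟨h, -⟩ | ⟨h, -⟩⟩
      · cases h; rfl
      · rw [h₁] at h; cases h
      · rw [h₁] at h; cases h
    · rintro rfl
      exact ⟨p, h₁, .refl⟩
  | b :: l, p, q, h => by
    have h₁ : sy I p = .sym (bitSym b) := h.1
    have ih := fun m => eval_encBits (N := N) (m := m) (l := l) (p := p + 1) h.2
    constructor
    · rintro ⟨⟨u, hu, h⟩, hm⟩
      refine ⟨?_, hm⟩
      rcases h.cases_tail with h | ⟨⟨p', m'⟩, h, -, h₂, d, h₀, h₃, h₄⟩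
      · cases h
        rw [h₁] at hu
        cases b <;> cases hu
      · dsimp only at h₂ h₃ h₄ h₀
        subst h₂
        have h₅ := ((ih m').1 ⟨⟨u, hu, h⟩, by omega⟩).1
        rw [bitsVal, ← h₅, Nat.bit_val]
        rw [h₁] at h₄
        cases b <;> simp [bitSym] at h₄ ⊢ <;> omega
    · rintro ⟨rfl, hm⟩
      refine ⟨?_, hm⟩
      rw [bitsVal, Nat.bit_val] at hm ⊢
      obtain ⟨⟨u, hu, h⟩, -⟩ := (ih (bitsVal l)).2 ⟨rfl, by omega⟩
      refine ⟨u, hu, h.tail ⟨hm, rfl, _, ?_, rfl, ?_⟩⟩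
      · dsimp only; omega
      · cases b
        · exact Or.inl ⟨h₁, by simp; omega⟩
        · exact Or.inr ⟨h₁, by simp; omega⟩

/-- With the number of vertex marks for `N`, this checks that a numeral in an edge, or that of the
source or target, names a vertex. -/
def NumLt (I : Inp Sym) (p N : ℕ) : Prop := ∃ m q, Seg I p (encNat m) q ∧ m < N

theorem numLt_iff {p N : ℕ} : NumLt I p N ↔ ∃ m, (∃ v, v = 0 ∧ ∃ u, sy I u = .sym .numEnd ∧
    ReflTransGen (EvalStep I N) (u, v) (p, m)) ∧ m < N ∧ ∃ q, IsNum I p q := by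
  constructor
  · rintro ⟨m, q, h, hm⟩
    obtain ⟨⟨u, hu, hr⟩, -⟩ := (eval_encBits (N := N) (m := m) h).2 ⟨(bitsVal_bits m).symm, hm.le⟩
    exact ⟨m, ⟨0, rfl, u, hu, hr⟩, hm, q, m, h⟩
  · rintro ⟨m, ⟨_, rfl, u, hu, hr⟩, hm, q, m', h⟩
    have := ((eval_encBits (N := N) (m := m) h).1 ⟨⟨u, hu, hr⟩, hm.le⟩).1
    rw [bitsVal_bits] at this
    exact ⟨m', q, h, this ▸ hm⟩

theorem dfn_numLt (i j : Fin n) : Dfn fun I _ ρ => NumLt I (ρ i) (ρ j) := by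
  refine Dfn.congr (.exb (.and (.exb ((Dfn.isZero _).and (.exb ((Dfn.isSym _ _).and
    (.rtg₂ (Q := fun I _ ρ => EvalStep I (ρ ⟨j, by omega⟩)) ((Dfn.le _ _).and ((Dfn.suc _ _).and
    (.exb ((Dfn.le _ _).and ((Dfn.add _ _ _).and
      (((Dfn.isSym _ _).and (Dfn.eqv _ _)).or ((Dfn.isSym _ _).and (Dfn.suc _ _))))) ?_)))
      ?_ _ _ _ _)) ?_)) ?_) ((Dfn.lt _ _).and (dfn_exists_isNum _))) ?_)
    fun _ _ _ _ => numLt_iff.symm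
  · exact fun I A ρ v hρ h => h.1.trans_lt (hρ _)
  · rintro I A ρ u v hρ ⟨h₁, -, d, -, -, ⟨h, -⟩ | ⟨h, -⟩⟩ <;>
    exact ⟨(Nat.lt_succ_self _).trans (lt_bd_of_sym h), h₁.trans_lt (hρ _)⟩
  · exact fun I A ρ v _ h => (Nat.lt_succ_self _).trans (lt_bd_of_sym h.1)
  · exact fun I A ρ v _ h => h.1 ▸ bd_pos I
  · exact fun I A ρ v hρ h => h.2.1.trans (hρ _)

end Numerals

end XNL

/-! ### Prefix notation: unique readability, and parsing by counters. -/

namespace XNL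

open Relation Function REWB

section Parsing

variable {I : Inp Sym} {n : ℕ}

/-! ### Parsing -/

theorem encCond_prefix : ∀ {c c' : Cond} {p q q' : ℕ}, Seg I p (encCond c) q →
    Seg I p (encCond c') q' → c = c' ∧ q = q' := by
  intro c
  induction c with
  | eq x =>
    intro c' p q q' h h'
    cases c' <;> simp only [encCond, seg_cons] at h h' <;> rw [h.1] at h' <;> simp at h'
    obtain ⟨rfl, rfl⟩ := encNat_prefix h.2 h'
    exact ⟨rfl, rfl⟩
  | ne x =>
    intro c' p q q' h h'
    cases c' <;> simp only [encCond, seg_cons] at h h' <;> rw [h.1] at h' <;> simp at h'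
    obtain ⟨rfl, rfl⟩ := encNat_prefix h.2 h'
    exact ⟨rfl, rfl⟩
  | and c₁ c₂ ih₁ ih₂ =>
    intro c' p q q' h h'
    cases c' <;> simp only [encCond, seg_cons, seg_append] at h h' <;> rw [h.1] at h' <;>
      simp at h'
    obtain ⟨-, m, h₁, h₂⟩ := h
    obtain ⟨m', h₃, h₄⟩ := h'
    obtain ⟨rfl, rfl⟩ := ih₁ h₁ h₃
    obtain ⟨rfl, rfl⟩ := ih₂ h₂ h₄
    exact ⟨rfl, rfl⟩
  | or c₁ c₂ ih₁ ih₂ =>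
    intro c' p q q' h h'
    cases c' <;> simp only [encCond, seg_cons, seg_append] at h h' <;> rw [h.1] at h' <;>
      simp at h'
    obtain ⟨-, m, h₁, h₂⟩ := h
    obtain ⟨m', h₃, h₄⟩ := h'
    obtain ⟨rfl, rfl⟩ := ih₁ h₁ h₃
    obtain ⟨rfl, rfl⟩ := ih₂ h₂ h₄
    exact ⟨rfl, rfl⟩
  | not c ih =>
    intro c' p q q' h h'
    cases c' <;> simp only [encCond, seg_cons] at h h' <;> rw [h.1] at h' <;> simp at h'
    obtain ⟨rfl, rfl⟩ := ih h.2 h'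
    exact ⟨rfl, rfl⟩

theorem encExpr_prefix : ∀ {r r' : Expr} {p q q' : ℕ}, Seg I p (encExpr r) q →
    Seg I p (encExpr r') q' → r = r' ∧ q = q' := by
  intro r
  induction r with
  | eps =>
    intro r' p q q' h h'
    cases r' <;> simp only [encExpr, seg_cons] at h h' <;> rw [h.1] at h' <;> simp at h'
    exact ⟨rfl, h.2.symm.trans h'⟩
  | letter a =>
    intro r' p q q' h h'
    cases r' <;> simp only [encExpr, seg_cons] at h h' <;> rw [h.1] at h' <;> simp at h'
    obtain ⟨rfl, rfl⟩ := encNat_prefix h.2 h'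
    exact ⟨rfl, rfl⟩
  | test a c =>
    intro r' p q q' h h'
    cases r' <;> simp only [encExpr, seg_cons, seg_append] at h h' <;> rw [h.1] at h' <;>
      simp at h'
    obtain ⟨-, m, h₁, h₂⟩ := h
    obtain ⟨m', h₃, h₄⟩ := h'
    obtain ⟨rfl, rfl⟩ := encNat_prefix h₁ h₃
    obtain ⟨rfl, rfl⟩ := encCond_prefix h₂ h₄
    exact ⟨rfl, rfl⟩
  | plus r₁ r₂ ih₁ ih₂ =>
    intro r' p q q' h h'
    cases r' <;> simp only [encExpr, seg_cons, seg_append] at h h' <;> rw [h.1] at h' <;>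
      simp at h'
    obtain ⟨-, m, h₁, h₂⟩ := h
    obtain ⟨m', h₃, h₄⟩ := h'
    obtain ⟨rfl, rfl⟩ := ih₁ h₁ h₃
    obtain ⟨rfl, rfl⟩ := ih₂ h₂ h₄
    exact ⟨rfl, rfl⟩
  | cat r₁ r₂ ih₁ ih₂ =>
    intro r' p q q' h h'
    cases r' <;> simp only [encExpr, seg_cons, seg_append] at h h' <;> rw [h.1] at h' <;>
      simp at h'
    obtain ⟨-, m, h₁, h₂⟩ := h
    obtain ⟨m', h₃, h₄⟩ := h'
    obtain ⟨rfl, rfl⟩ := ih₁ h₁ h₃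
    obtain ⟨rfl, rfl⟩ := ih₂ h₂ h₄
    exact ⟨rfl, rfl⟩
  | star r ih =>
    intro r' p q q' h h'
    cases r' <;> simp only [encExpr, seg_cons] at h h' <;> rw [h.1] at h' <;> simp at h'
    obtain ⟨rfl, rfl⟩ := ih h.2 h'
    exact ⟨rfl, rfl⟩
  | bind a x r ih =>
    intro r' p q q' h h'
    cases r' <;> simp only [encExpr, seg_cons, seg_append] at h h' <;> rw [h.1] at h' <;>
      simp at h'
    obtain ⟨-, m, ⟨l, h₁, h₂⟩, h₃⟩ := h
    obtain ⟨m', ⟨l', h₄, h₅⟩, h₆⟩ := h'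
    obtain ⟨rfl, rfl⟩ := encNat_prefix h₁ h₄
    obtain ⟨rfl, rfl⟩ := encNat_prefix h₂ h₅
    obtain ⟨rfl, rfl⟩ := ih h₃ h₆
    exact ⟨rfl, rfl⟩

theorem encNat_length_pos (m : ℕ) : 0 < (encNat m).length := by simp [encNat]

theorem Cond.size_pos (c : Cond) : 0 < c.size := by cases c <;> simp [Cond.size]

theorem Expr.size_pos (r : Expr) : 0 < r.size := by cases r <;> simp [Expr.size]

theorem Cond.size_le (c : Cond) : c.size ≤ (encCond c).length := by
  induction c <;> simp [Cond.size, encCond] <;> omega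

theorem Expr.size_le (r : Expr) : r.size ≤ (encExpr r).length := by
  induction r with
  | test a c => have := Cond.size_le c; simp [Expr.size, encExpr]; omega
  | _ => simp [Expr.size, encExpr] <;> omega

def NumTo (I : Inp Sym) (p q : ℕ) : Prop := ∃ t, t = p + 1 ∧ IsNum I t q

theorem dfn_numTo (i j : Fin n) : Dfn fun I _ ρ => NumTo I (ρ i) (ρ j) :=
  .exb ((Dfn.suc _ _).and (dfn_isNum _ _)) fun _ _ _ _ _ ⟨_, _, h⟩ => h.lt_bd_of_encNat.1

theorem Dfn.pos {α : Type} (i : Fin n) : Dfn (α := α) fun _ _ ρ => 0 < ρ i :=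
  (exb (Q := fun _ _ ρ v => v = 0 ∧ v < ρ i) ((isZero _).and (lt _ _))
    fun I _ _ _ _ h => h.1 ▸ bd_pos I).congr fun _ _ _ _ => by simp

/-- Reading one symbol of an expression in prefix notation, and the numerals that belong to it.
The components are the position, the numbers of expressions and of conditions that are still
expected, and the number of nodes. -/
def ParseStep (I : Inp Sym) (u v : ℕ × ℕ × ℕ × ℕ) : Prop :=
  v.2.2.2 = u.2.2.2 + 1 ∧
  ((u.2.2.1 = 0 ∧
    ((sy I u.1 = .sym .eps ∧ v.1 = u.1 + 1 ∧ u.2.1 = v.2.1 + 1 ∧ v.2.2.1 = u.2.2.1) ∨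
    (sy I u.1 = .sym .letter ∧ NumTo I u.1 v.1 ∧ u.2.1 = v.2.1 + 1 ∧ v.2.2.1 = u.2.2.1) ∨
    (sy I u.1 = .sym .test ∧ NumTo I u.1 v.1 ∧ u.2.1 = v.2.1 + 1 ∧ v.2.2.1 = u.2.2.1 + 1) ∨
    ((sy I u.1 = .sym .plus ∨ sy I u.1 = .sym .cat) ∧ v.1 = u.1 + 1 ∧ v.2.1 = u.2.1 + 1 ∧
      0 < u.2.1 ∧ v.2.2.1 = u.2.2.1) ∨
    (sy I u.1 = .sym .star ∧ v.1 = u.1 + 1 ∧ v.2.1 = u.2.1 ∧ 0 < u.2.1 ∧ v.2.2.1 = u.2.2.1) ∨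
    (sy I u.1 = .sym .bind ∧ (∃ t, NumTo I u.1 t ∧ IsNum I t v.1) ∧ v.2.1 = u.2.1 ∧ 0 < u.2.1 ∧
      v.2.2.1 = u.2.2.1))) ∨
  (v.2.1 = u.2.1 ∧
    (((sy I u.1 = .sym .eq ∨ sy I u.1 = .sym .ne) ∧ NumTo I u.1 v.1 ∧ u.2.2.1 = v.2.2.1 + 1) ∨
    ((sy I u.1 = .sym .and ∨ sy I u.1 = .sym .or) ∧ v.1 = u.1 + 1 ∧ v.2.2.1 = u.2.2.1 + 1 ∧
      0 < u.2.2.1) ∨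
    (sy I u.1 = .sym .not ∧ v.1 = u.1 + 1 ∧ v.2.2.1 = u.2.2.1 ∧ 0 < u.2.2.1))))

def Parse (I : Inp Sym) : ℕ × ℕ × ℕ × ℕ → ℕ × ℕ × ℕ × ℕ → Prop :=
  ReflTransGen fun u v => (v.1 < bd I ∧ v.2.1 < bd I ∧ v.2.2.1 < bd I ∧ v.2.2.2 < bd I) ∧
    ParseStep I u v

theorem dfn_parse (i j : Fin 4 → Fin n) : Dfn fun I _ ρ =>
    Parse I (ρ (i 0), ρ (i 1), ρ (i 2), ρ (i 3)) (ρ (j 0), ρ (j 1), ρ (j 2), ρ (j 3)) := by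
  refine .rtg₄ (Q := fun I _ _ => ParseStep I) ((Dfn.suc _ _).and (.or ((Dfn.isZero _).and
    (.or ((Dfn.isSym _ _).and ((Dfn.suc _ _).and ((Dfn.suc _ _).and (Dfn.eqv _ _))))
    (.or ((Dfn.isSym _ _).and ((dfn_numTo _ _).and ((Dfn.suc _ _).and (Dfn.eqv _ _))))
    (.or ((Dfn.isSym _ _).and ((dfn_numTo _ _).and ((Dfn.suc _ _).and (Dfn.suc _ _))))
    (.or (((Dfn.isSym _ _).or (Dfn.isSym _ _)).and ((Dfn.suc _ _).and ((Dfn.suc _ _).and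
      ((Dfn.pos _).and (Dfn.eqv _ _)))))
    (.or ((Dfn.isSym _ _).and ((Dfn.suc _ _).and ((Dfn.eqv _ _).and
      ((Dfn.pos _).and (Dfn.eqv _ _)))))
    ((Dfn.isSym _ _).and (.and (.exb ((dfn_numTo _ _).and (dfn_isNum _ _)) ?_) ((Dfn.eqv _ _).and
      ((Dfn.pos _).and (Dfn.eqv _ _)))))))))))
    ((Dfn.eqv _ _).and
    (.or (((Dfn.isSym _ _).or (Dfn.isSym _ _)).and ((dfn_numTo _ _).and (Dfn.suc _ _)))
    (.or (((Dfn.isSym _ _).or (Dfn.isSym _ _)).and ((Dfn.suc _ _).and ((Dfn.suc _ _).and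
      (Dfn.pos _))))
    ((Dfn.isSym _ _).and ((Dfn.suc _ _).and ((Dfn.eqv _ _).and (Dfn.pos _))))))))) i j
  exact fun _ _ _ _ _ ⟨_, _, h⟩ => h.lt_bd_of_encNat.1

/-- Induction from the end of the word: the symbol read in a step combines pending items to its
right into a larger one. Pending conditions stand before pending expressions, because an expression
is read only when no condition is expected. -/
theorem parse_sound {u : ℕ × ℕ × ℕ × ℕ} {q s : ℕ} (h : Parse I u (q, 0, 0, s)) :
    ∃ (cs : List Cond) (es : List Expr), cs.length = u.2.2.1 ∧ es.length = u.2.1 ∧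
      Seg I u.1 (cs.flatMap encCond ++ es.flatMap encExpr) q ∧
      s = u.2.2.2 + (cs.map Cond.size).sum + (es.map Expr.size).sum := by
  unfold Parse at h
  induction h using ReflTransGen.head_induction_on with
  | refl => exact ⟨[], [], rfl, rfl, rfl, rfl⟩
  | @head u v h _ ih =>
    obtain ⟨p, e, c, s₁⟩ := u
    obtain ⟨p', e', c', s₁'⟩ := v
    obtain ⟨cs, es, h₁, h₂, h₃, h₄⟩ := ih
    obtain ⟨-, h₅, h⟩ := h
    dsimp only at h h₁ h₂ h₃ h₄ h₅ ⊢
    rcases h with ⟨rfl, h⟩ | ⟨rfl, h⟩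
    · rcases h with ⟨hs, rfl, rfl, rfl⟩ | ⟨hs, ⟨_, rfl, a, ha⟩, rfl, rfl⟩ |
        ⟨hs, ⟨_, rfl, a, ha⟩, rfl, rfl⟩ | ⟨hs, rfl, rfl, h₆, rfl⟩ | ⟨hs, rfl, rfl, h₆, rfl⟩ |
        ⟨hs, ⟨t, ⟨_, rfl, a, ha⟩, x, hx⟩, rfl, h₆, rfl⟩
      · obtain rfl := List.length_eq_zero_iff.1 h₁
        refine ⟨[], .eps :: es, rfl, by simp [h₂], by simpa [encExpr, encCond, seg_cons, hs] using h₃, ?_⟩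
        simp [Expr.size] at h₄ ⊢; omega
      · obtain rfl := List.length_eq_zero_iff.1 h₁
        refine ⟨[], .letter a :: es, rfl, by simp [h₂], ?_, ?_⟩
        · simp only [List.flatMap_nil, List.flatMap_cons, List.nil_append, encExpr,
            List.cons_append]
          exact ⟨hs, seg_append.2 ⟨_, ha, by simpa using h₃⟩⟩
        · simp [Expr.size] at h₄ ⊢; omega
      · obtain ⟨c, rfl⟩ := List.length_eq_one_iff.1 h₁
        refine ⟨[], .test a c :: es, rfl, by simp [h₂], ?_, ?_⟩
        · simp only [List.flatMap_nil, List.flatMap_cons, List.nil_append, encExpr,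
            List.cons_append, List.append_assoc]
          exact ⟨hs, seg_append.2 ⟨_, ha, by simpa using h₃⟩⟩
        · simp [Expr.size] at h₄ ⊢; omega
      · obtain rfl := List.length_eq_zero_iff.1 h₁
        -- An expression was expected before the operator, so at least two are pending after it.
        obtain ⟨r₁, r₂, es, rfl⟩ : ∃ r₁ r₂ es', es = r₁ :: r₂ :: es' := by
          match es, h₂ with
          | [_], h₂ => simp at h₂; omega
          | r₁ :: r₂ :: es, _ => exact ⟨_, _, _, rfl⟩
        rcases hs with hs | hs
        · refine ⟨[], .plus r₁ r₂ :: es, rfl, by simpa using h₂, by simpa [encExpr, encCond, seg_cons, hs] using h₃, ?_⟩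
          simp [Expr.size] at h₄ ⊢; omega
        · refine ⟨[], .cat r₁ r₂ :: es, rfl, by simpa using h₂, by simpa [encExpr, encCond, seg_cons, hs] using h₃, ?_⟩
          simp [Expr.size] at h₄ ⊢; omega
      · obtain rfl := List.length_eq_zero_iff.1 h₁
        obtain ⟨r, es, rfl⟩ := List.exists_cons_of_length_pos (h₂ ▸ h₆)
        refine ⟨[], .star r :: es, rfl, by simpa using h₂, by simpa [encExpr, encCond, seg_cons, hs] using h₃, ?_⟩
        simp [Expr.size] at h₄ ⊢; omega
      · obtain rfl := List.length_eq_zero_iff.1 h₁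
        obtain ⟨r, es, rfl⟩ := List.exists_cons_of_length_pos (h₂ ▸ h₆)
        refine ⟨[], .bind a x r :: es, rfl, by simpa using h₂, ?_, ?_⟩
        · simp only [List.flatMap_nil, List.flatMap_cons, List.nil_append, encExpr,
            List.cons_append, List.append_assoc]
          exact ⟨hs, seg_append.2 ⟨_, ha, seg_append.2 ⟨_, hx, by simpa using h₃⟩⟩⟩
        · simp [Expr.size] at h₄ ⊢; omega
    · rcases h with ⟨hs, ⟨_, rfl, x, hx⟩, rfl⟩ | ⟨hs, rfl, rfl, h₆⟩ | ⟨hs, rfl, rfl, h₆⟩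
      · rcases hs with hs | hs
        · refine ⟨.eq x :: cs, es, by simp [h₁], h₂, ?_, ?_⟩
          · simp only [List.flatMap_cons, encCond, List.cons_append, List.append_assoc]
            exact ⟨hs, seg_append.2 ⟨_, hx, h₃⟩⟩
          · simp [Cond.size] at h₄ ⊢; omega
        · refine ⟨.ne x :: cs, es, by simp [h₁], h₂, ?_, ?_⟩
          · simp only [List.flatMap_cons, encCond, List.cons_append, List.append_assoc]
            exact ⟨hs, seg_append.2 ⟨_, hx, h₃⟩⟩
          · simp [Cond.size] at h₄ ⊢; omega
      · obtain ⟨c₁, c₂, cs, rfl⟩ : ∃ c₁ c₂ cs', cs = c₁ :: c₂ :: cs' := by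
          match cs, h₁ with
          | [_], h₁ => simp at h₁; omega
          | c₁ :: c₂ :: cs, _ => exact ⟨_, _, _, rfl⟩
        rcases hs with hs | hs
        · refine ⟨.and c₁ c₂ :: cs, es, by simpa using h₁, h₂, by simpa [encExpr, encCond, seg_cons, hs] using h₃, ?_⟩
          simp [Cond.size] at h₄ ⊢; omega
        · refine ⟨.or c₁ c₂ :: cs, es, by simpa using h₁, h₂, by simpa [encExpr, encCond, seg_cons, hs] using h₃, ?_⟩
          simp [Cond.size] at h₄ ⊢; omega
      · obtain ⟨c, cs, rfl⟩ := List.exists_cons_of_length_pos (h₁ ▸ h₆)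
        refine ⟨.not c :: cs, es, by simpa using h₁, h₂, by simpa [encExpr, encCond, seg_cons, hs] using h₃, ?_⟩
        simp [Cond.size] at h₄ ⊢; omega

/-- The bounds on lengths keep the counters in range: each condition pending beyond the first `k`
still owns a symbol of the word, and each node counted beyond `s` has used one. -/
theorem parse_cond : ∀ {c : Cond} {p q e k s : ℕ}, Seg I p (encCond c) q → e < bd I →
    k + (encCond c).length < bd I → s + (encCond c).length < bd I →
    Parse I (p, e, k + 1, s) (q, e, k, s + c.size) := by
  intro c
  induction c with
  | eq x =>
    intro p q e k s h he hk hs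
    have hl := encNat_length_pos x
    simp only [encCond, List.length_cons] at hk hs
    exact .single ⟨⟨h.2.lt_bd_of_encNat.2, he, by dsimp only; omega, by simp [Cond.size]; omega⟩, rfl,
      Or.inr ⟨rfl, Or.inl ⟨Or.inl h.1, ⟨_, rfl, x, h.2⟩, rfl⟩⟩⟩
  | ne x =>
    intro p q e k s h he hk hs
    have hl := encNat_length_pos x
    simp only [encCond, List.length_cons] at hk hs
    exact .single ⟨⟨h.2.lt_bd_of_encNat.2, he, by dsimp only; omega, by simp [Cond.size]; omega⟩, rfl,
      Or.inr ⟨rfl, Or.inl ⟨Or.inr h.1, ⟨_, rfl, x, h.2⟩, rfl⟩⟩⟩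
  | and c₁ c₂ ih₁ ih₂ =>
    intro p q e k s h he hk hs
    obtain ⟨m, h₁, h₂⟩ := seg_append.1 h.2
    have := Cond.size_le c₁
    have := Cond.size_le c₂
    have := Cond.size_pos c₁
    have := Cond.size_pos c₂
    simp only [encCond, List.length_cons, List.length_append] at hk hs
    have := (ih₁ (k := k + 1) (s := s + 1) h₁ he (by omega) (by omega)).trans
      (ih₂ (k := k) h₂ he (by omega) (by omega))
    rw [Cond.size, show s + (c₁.size + c₂.size + 1) = s + 1 + c₁.size + c₂.size by omega]
    refine ReflTransGen.head ?_ this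
    exact ⟨⟨lt_bd_of_sym h.1, he, by dsimp only; omega, by dsimp only; omega⟩, rfl,
      Or.inr ⟨rfl, Or.inr (Or.inl ⟨Or.inl h.1, rfl, rfl, Nat.succ_pos _⟩)⟩⟩
  | or c₁ c₂ ih₁ ih₂ =>
    intro p q e k s h he hk hs
    obtain ⟨m, h₁, h₂⟩ := seg_append.1 h.2
    have := Cond.size_le c₁
    have := Cond.size_le c₂
    have := Cond.size_pos c₁
    have := Cond.size_pos c₂
    simp only [encCond, List.length_cons, List.length_append] at hk hs
    have := (ih₁ (k := k + 1) (s := s + 1) h₁ he (by omega) (by omega)).trans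
      (ih₂ (k := k) h₂ he (by omega) (by omega))
    rw [Cond.size, show s + (c₁.size + c₂.size + 1) = s + 1 + c₁.size + c₂.size by omega]
    refine ReflTransGen.head ?_ this
    exact ⟨⟨lt_bd_of_sym h.1, he, by dsimp only; omega, by dsimp only; omega⟩, rfl,
      Or.inr ⟨rfl, Or.inr (Or.inl ⟨Or.inr h.1, rfl, rfl, Nat.succ_pos _⟩)⟩⟩
  | not c ih =>
    intro p q e k s h he hk hs
    have := Cond.size_le c
    have := Cond.size_pos c
    simp only [encCond, List.length_cons] at hk hs
    have := ih (k := k) (s := s + 1) h.2 he (by omega) (by omega)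
    rw [Cond.size, show s + (c.size + 1) = s + 1 + c.size by omega]
    refine ReflTransGen.head ?_ this
    exact ⟨⟨lt_bd_of_sym h.1, he, by dsimp only; omega, by dsimp only; omega⟩, rfl,
      Or.inr ⟨rfl, Or.inr (Or.inr ⟨h.1, rfl, rfl, Nat.succ_pos _⟩)⟩⟩

theorem parse_expr : ∀ {r : Expr} {p q k s : ℕ}, Seg I p (encExpr r) q →
    k + (encExpr r).length < bd I → s + (encExpr r).length < bd I →
    Parse I (p, k + 1, 0, s) (q, k, 0, s + r.size) := by
  intro r
  induction r with
  | eps =>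
    intro p q k s h hk hs
    cases h.2
    simp only [encExpr, List.length_cons, List.length_nil] at hk hs
    exact .single ⟨⟨lt_bd_of_sym h.1, by dsimp only; omega, bd_pos I, hs⟩, rfl,
      Or.inl ⟨rfl, Or.inl ⟨h.1, rfl, rfl, rfl⟩⟩⟩
  | letter a =>
    intro p q k s h hk hs
    simp only [encExpr, List.length_cons] at hk hs
    exact .single ⟨⟨h.2.lt_bd_of_encNat.2, by dsimp only; omega, bd_pos I, by simp [Expr.size]; omega⟩,
      rfl, Or.inl ⟨rfl, Or.inr (Or.inl ⟨h.1, ⟨_, rfl, a, h.2⟩, rfl, rfl⟩)⟩⟩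
  | test a c =>
    intro p q k s h hk hs
    obtain ⟨m, h₁, h₂⟩ := seg_append.1 h.2
    have := Cond.size_le c
    have := Cond.size_pos c
    simp only [encExpr, List.length_cons, List.length_append] at hk hs
    have := parse_cond (e := k) (k := 0) (s := s + 1) h₂ (by omega) (by omega) (by omega)
    rw [Expr.size, show s + (c.size + 1) = s + 1 + c.size by omega]
    refine ReflTransGen.head ?_ this
    exact ⟨⟨h₁.lt_bd_of_encNat.2, by dsimp only; omega, by dsimp only; omega,
      by dsimp only; omega⟩, rfl,
      Or.inl ⟨rfl, Or.inr (Or.inr (Or.inl ⟨h.1, ⟨_, rfl, a, h₁⟩, rfl, rfl⟩))⟩⟩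
  | plus r₁ r₂ ih₁ ih₂ =>
    intro p q k s h hk hs
    obtain ⟨m, h₁, h₂⟩ := seg_append.1 h.2
    have := Expr.size_le r₁
    have := Expr.size_le r₂
    have := Expr.size_pos r₁
    have := Expr.size_pos r₂
    simp only [encExpr, List.length_cons, List.length_append] at hk hs
    have := (ih₁ (k := k + 1) (s := s + 1) h₁ (by omega) (by omega)).trans
      (ih₂ (k := k) h₂ (by omega) (by omega))
    rw [Expr.size, show s + (r₁.size + r₂.size + 1) = s + 1 + r₁.size + r₂.size by omega]
    refine ReflTransGen.head ?_ this
    exact ⟨⟨lt_bd_of_sym h.1, by dsimp only; omega, bd_pos I, by dsimp only; omega⟩, rfl,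
      Or.inl ⟨rfl, Or.inr (Or.inr (Or.inr (Or.inl ⟨Or.inl h.1, rfl, rfl, Nat.succ_pos _, rfl⟩)))⟩⟩
  | cat r₁ r₂ ih₁ ih₂ =>
    intro p q k s h hk hs
    obtain ⟨m, h₁, h₂⟩ := seg_append.1 h.2
    have := Expr.size_le r₁
    have := Expr.size_le r₂
    have := Expr.size_pos r₁
    have := Expr.size_pos r₂
    simp only [encExpr, List.length_cons, List.length_append] at hk hs
    have := (ih₁ (k := k + 1) (s := s + 1) h₁ (by omega) (by omega)).trans
      (ih₂ (k := k) h₂ (by omega) (by omega))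
    rw [Expr.size, show s + (r₁.size + r₂.size + 1) = s + 1 + r₁.size + r₂.size by omega]
    refine ReflTransGen.head ?_ this
    exact ⟨⟨lt_bd_of_sym h.1, by dsimp only; omega, bd_pos I, by dsimp only; omega⟩, rfl,
      Or.inl ⟨rfl, Or.inr (Or.inr (Or.inr (Or.inl ⟨Or.inr h.1, rfl, rfl, Nat.succ_pos _, rfl⟩)))⟩⟩
  | star r ih =>
    intro p q k s h hk hs
    have := Expr.size_le r
    have := Expr.size_pos r
    simp only [encExpr, List.length_cons] at hk hs
    have := ih (k := k) (s := s + 1) h.2 (by omega) (by omega)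
    rw [Expr.size, show s + (r.size + 1) = s + 1 + r.size by omega]
    refine ReflTransGen.head ?_ this
    exact ⟨⟨lt_bd_of_sym h.1, by dsimp only; omega, bd_pos I, by dsimp only; omega⟩, rfl,
      Or.inl ⟨rfl, Or.inr (Or.inr (Or.inr (Or.inr (Or.inl ⟨h.1, rfl, rfl, Nat.succ_pos _, rfl⟩))))⟩⟩
  | bind a x r ih =>
    intro p q k s h hk hs
    obtain ⟨m, h₁, h₂⟩ := seg_append.1 h.2
    obtain ⟨l, h₃, h₄⟩ := seg_append.1 h₁
    have := Expr.size_le r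
    have := Expr.size_pos r
    simp only [encExpr, List.length_cons, List.length_append] at hk hs
    have := ih (k := k) (s := s + 1) h₂ (by omega) (by omega)
    rw [Expr.size, show s + (r.size + 1) = s + 1 + r.size by omega]
    refine ReflTransGen.head ?_ this
    exact ⟨⟨h₄.lt_bd_of_encNat.2, by dsimp only; omega, bd_pos I, by dsimp only; omega⟩, rfl,
      Or.inl ⟨rfl, Or.inr (Or.inr (Or.inr (Or.inr (Or.inr ⟨h.1, ⟨l, ⟨_, rfl, a, h₃⟩, x, h₄⟩, rfl,
        Nat.succ_pos _, rfl⟩))))⟩⟩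

def ExprSize (I : Inp Sym) (p q s : ℕ) : Prop := ∃ r, Seg I p (encExpr r) q ∧ s = r.size

def ExprAt (I : Inp Sym) (p q : ℕ) : Prop := ∃ r, Seg I p (encExpr r) q

def CondAt (I : Inp Sym) (p q : ℕ) : Prop := ∃ c, Seg I p (encCond c) q

theorem seg_length_lt {w : List Sym} {p q : ℕ} (h : Seg I p w q) (hw : w ≠ []) :
    w.length + 1 < bd I := by
  have h₁ := h.length
  have h₂ := h.end_le hw
  have h₃ := length_lt_bd I
  have h₄ : 1 ≤ p := by
    cases w with
    | nil => exact absurd rfl hw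
    | cons s w => exact (le_of_sym h.1).1
  rw [length_tp] at h₃
  omega

theorem encExpr_ne_nil (r : Expr) : encExpr r ≠ [] := by cases r <;> simp [encExpr]

theorem encCond_ne_nil (c : Cond) : encCond c ≠ [] := by cases c <;> simp [encCond]

theorem one_lt_bd {α : Type} (I : Inp α) : 1 < bd I := by
  have := length_lt_bd I
  rw [length_tp] at this
  omega

theorem exprSize_iff {p q s : ℕ} : ExprSize I p q s ↔ Parse I (p, 1, 0, 0) (q, 0, 0, s) := by
  constructor
  · rintro ⟨r, h, rfl⟩
    have := seg_length_lt h (encExpr_ne_nil r)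
    have := parse_expr (k := 0) (s := 0) h (by omega) (by omega)
    simpa using this
  · intro h
    obtain ⟨cs, es, h₁, h₂, h₃, h₄⟩ := parse_sound h
    obtain rfl := List.length_eq_zero_iff.1 h₁
    obtain ⟨r, rfl⟩ := List.length_eq_one_iff.1 h₂
    exact ⟨r, by simpa using h₃, by simpa using h₄⟩

theorem condAt_iff {p q : ℕ} : CondAt I p q ↔ ∃ s, Parse I (p, 0, 1, 0) (q, 0, 0, s) := by
  constructor
  · rintro ⟨c, h⟩
    have := seg_length_lt h (encCond_ne_nil c)
    exact ⟨_, parse_cond (k := 0) h (bd_pos I) (by omega) (by omega)⟩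
  · rintro ⟨s, h⟩
    obtain ⟨cs, es, h₁, h₂, h₃, h₄⟩ := parse_sound h
    obtain rfl := List.length_eq_zero_iff.1 h₂
    obtain ⟨c, rfl⟩ := List.length_eq_one_iff.1 h₁
    exact ⟨c, by simpa using h₃⟩

theorem Parse.lt_bd {u v : ℕ × ℕ × ℕ × ℕ} (h : Parse I u v) (hu : u.2.2.2 < bd I) :
    v.2.2.2 < bd I := by
  cases h with
  | refl => exact hu
  | tail _ h => exact h.1.2.2.2

theorem dfn_exprSize (i j k : Fin n) : Dfn fun I _ ρ => ExprSize I (ρ i) (ρ j) (ρ k) := by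
  refine Dfn.congr (.exb (Q := fun I _ ρ z => z = 0 ∧ ∃ o, o < bd I ∧ o = z + 1 ∧
    Parse I (ρ i, o, z, z) (ρ j, z, z, ρ k)) ((Dfn.isZero _).and (.ex ((Dfn.suc _ _).and
    (dfn_parse ![i.castSucc.castSucc, Fin.last _, (Fin.last _).castSucc, (Fin.last _).castSucc]
    ![j.castSucc.castSucc, (Fin.last _).castSucc, (Fin.last _).castSucc, k.castSucc.castSucc]))
    )) ?_) fun I A ρ _ => ?_
  · exact fun I _ _ _ _ h => h.1 ▸ bd_pos I
  · simp [exprSize_iff, one_lt_bd]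

theorem dfn_exprAt (i j : Fin n) : Dfn fun I _ ρ => ExprAt I (ρ i) (ρ j) :=
  (Dfn.exb (dfn_exprSize (Fin.castSucc i) (Fin.castSucc j) (Fin.last _)) fun I _ _ _ _ h =>
    (exprSize_iff.1 h).lt_bd (bd_pos I)).congr fun _ _ _ _ =>
      ⟨fun ⟨_, r, h, _⟩ => ⟨r, h⟩, fun ⟨r, h⟩ => ⟨_, r, h, rfl⟩⟩

theorem dfn_condAt (i j : Fin n) : Dfn fun I _ ρ => CondAt I (ρ i) (ρ j) := by
  refine Dfn.congr (.exb (Q := fun I _ ρ s => ∃ z, z = 0 ∧ ∃ o, o < bd I ∧ o = z + 1 ∧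
    Parse I (ρ i, z, o, z) (ρ j, z, z, s)) (.exb ((Dfn.isZero _).and (.ex ((Dfn.suc _ _).and
    (dfn_parse ![i.castSucc.castSucc.castSucc, (Fin.last _).castSucc, Fin.last _,
      (Fin.last _).castSucc]
    ![j.castSucc.castSucc.castSucc, (Fin.last _).castSucc, (Fin.last _).castSucc,
      (Fin.last _).castSucc.castSucc])))) ?_) ?_) fun I A ρ _ => ?_
  · exact fun I _ _ _ _ h => h.1 ▸ bd_pos I
  · rintro I A ρ v _ ⟨_, rfl, _, -, rfl, h⟩
    exact h.lt_bd (bd_pos I)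
  · simp [condAt_iff, one_lt_bd]

end Parsing

end XNL

/-! ### Atoms, binders and scopes in the encoded query. -/

namespace XNL

open Relation Function REWB

section Occurrences

variable {I : Inp Sym}

/-! ### Occurrences of symbols in encodings -/

theorem mem_encNat {m : ℕ} {s : Sym} (h : s ∈ encNat m) : s = .bit0 ∨ s = .bit1 ∨ s = .numEnd := by
  simp only [encNat, List.mem_append, List.mem_map, List.mem_singleton] at h
  rcases h with ⟨b, -, rfl⟩ | rfl
  · cases b <;> simp
  · simp

theorem mem_encCond {c : Cond} {s : Sym} (h : s ∈ encCond c) :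
    s ≠ .vertex ∧ s ≠ .edge ∧ s ≠ .entry ∧ s ≠ .bind := by
  have num : ∀ {x}, s ∈ encNat x → s ≠ .vertex ∧ s ≠ .edge ∧ s ≠ .entry ∧ s ≠ .bind := by
    intro x h
    rcases mem_encNat h with rfl | rfl | rfl <;> simp
  induction c with
  | eq x =>
    rcases List.mem_cons.1 h with rfl | h
    · simp
    · exact num h
  | ne x =>
    rcases List.mem_cons.1 h with rfl | h
    · simp
    · exact num h
  | and c₁ c₂ ih₁ ih₂ =>
    rcases List.mem_cons.1 h with rfl | h
    · simp
    · exact (List.mem_append.1 h).elim ih₁ ih₂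
  | or c₁ c₂ ih₁ ih₂ =>
    rcases List.mem_cons.1 h with rfl | h
    · simp
    · exact (List.mem_append.1 h).elim ih₁ ih₂
  | not c ih =>
    rcases List.mem_cons.1 h with rfl | h
    · simp
    · exact ih h

theorem mem_encExpr {r : Expr} {s : Sym} (h : s ∈ encExpr r) :
    s ≠ .vertex ∧ s ≠ .edge ∧ s ≠ .entry := by
  have num : ∀ {x}, s ∈ encNat x → s ≠ .vertex ∧ s ≠ .edge ∧ s ≠ .entry := by
    intro x h
    rcases mem_encNat h with rfl | rfl | rfl <;> simp
  induction r with
  | eps => simp only [encExpr, List.mem_singleton] at h; subst h; simp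
  | letter a =>
    rcases List.mem_cons.1 h with rfl | h
    · simp
    · exact num h
  | test a c =>
    rcases List.mem_cons.1 h with rfl | h
    · simp
    · rcases List.mem_append.1 h with h | h
      · exact num h
      · have := mem_encCond h
        exact ⟨this.1, this.2.1, this.2.2.1⟩
  | plus r₁ r₂ ih₁ ih₂ =>
    rcases List.mem_cons.1 h with rfl | h
    · simp
    · exact (List.mem_append.1 h).elim ih₁ ih₂
  | cat r₁ r₂ ih₁ ih₂ =>
    rcases List.mem_cons.1 h with rfl | h
    · simp
    · exact (List.mem_append.1 h).elim ih₁ ih₂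
  | star r ih =>
    rcases List.mem_cons.1 h with rfl | h
    · simp
    · exact ih h
  | bind a x r ih =>
    rcases List.mem_cons.1 h with rfl | h
    · simp
    · rcases List.mem_append.1 h with h | h
      · exact (List.mem_append.1 h).elim num num
      · exact ih h

theorem Seg.encNat_sym {m p q g : ℕ} {s : Sym} (h : Seg I p (encNat m) q) (h₁ : p ≤ g) (h₂ : g < q)
    (hs : sy I g = .sym s) : s = .bit0 ∨ s = .bit1 ∨ s = .numEnd := by
  obtain ⟨s', h₃, h₄⟩ := h.mem h₁ h₂
  rw [hs, InSym.sym.injEq] at h₄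
  subst h₄
  exact mem_encNat h₃

theorem Seg.le {w : List Sym} {p q : ℕ} (h : Seg I p w q) : p ≤ q := by rw [h.length]; omega

section Blocks

variable {β : Type} {enc : β → List Sym} {tok : Sym}

/-- In a sequence of blocks that begin with a symbol which is used only there, this symbol is
found at the beginnings of the blocks. -/
theorem Seg.exists_block (henc : ∀ b, ∃ w, enc b = tok :: w ∧ tok ∉ w) :
    ∀ {l : List β} {p q g : ℕ}, Seg I p (l.flatMap enc) q → p ≤ g → g < q → sy I g = .sym tok →
      ∃ b ∈ l, ∃ q', Seg I g (enc b) q'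
  | [], p, q, g, h, h₁, h₂, _ => by cases h; omega
  | b₀ :: l, p, q, g, h, h₁, h₂, hg => by
    rw [List.flatMap_cons, seg_append] at h
    obtain ⟨m, h₃, h₄⟩ := h
    rcases h₁.eq_or_lt with rfl | h₁
    · exact ⟨b₀, by simp, m, h₃⟩
    · rcases lt_or_ge g m with h₅ | h₅
      · obtain ⟨w, hw, htok⟩ := henc b₀
        rw [hw] at h₃
        obtain ⟨s, h₆, h₇⟩ := h₃.2.mem h₁ h₅
        rw [hg, InSym.sym.injEq] at h₇
        exact absurd (h₇ ▸ h₆) htok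
      · obtain ⟨b, hb, h₆⟩ := h₄.exists_block henc h₅ h₂ hg
        exact ⟨b, List.mem_cons_of_mem _ hb, h₆⟩

theorem Seg.block : ∀ {l : List β} {p q : ℕ} {b : β}, Seg I p (l.flatMap enc) q → b ∈ l →
    ∃ g q', Seg I g (enc b) q'
  | b₀ :: l, p, q, b, h, hb => by
    rw [List.flatMap_cons, seg_append] at h
    obtain ⟨m, h₃, h₄⟩ := h
    rcases List.mem_cons.1 hb with rfl | hb
    · exact ⟨_, _, h₃⟩
    · exact h₄.block hb

end Blocks

/-! ### Free variables -/

/-- An atom with the variable `y`. -/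
def AtomAt (I : Inp Sym) (g y : ℕ) : Prop :=
  (sy I g = .sym .eq ∨ sy I g = .sym .ne) ∧ ∃ q, Seg I (g + 1) (encNat y) q

/-- An expression that binds the variable `y`. -/
def BindAt (I : Inp Sym) (g y q : ℕ) : Prop := ∃ a r, Seg I g (encExpr (.bind a y r)) q

theorem BindAt.sym {g y q : ℕ} (h : BindAt I g y q) : sy I g = .sym .bind := by
  obtain ⟨a, r, h⟩ := h
  exact h.1

theorem not_atomAt_of_encNat {m p q g y : ℕ} (h : Seg I p (encNat m) q) (h₁ : p ≤ g) (h₂ : g < q)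
    (hg : AtomAt I g y) : False := by
  rcases hg.1 with hs | hs <;> rcases h.encNat_sym h₁ h₂ hs with h | h | h <;> cases h

theorem not_bindAt_of_encNat {m p q g y q' : ℕ} (h : Seg I p (encNat m) q) (h₁ : p ≤ g)
    (h₂ : g < q) (hg : BindAt I g y q') : False := by
  rcases h.encNat_sym h₁ h₂ hg.sym with h | h | h <;> cases h

theorem not_bindAt_of_encCond {c : Cond} {p q g y q' : ℕ} (h : Seg I p (encCond c) q) (h₁ : p ≤ g)
    (h₂ : g < q) (hg : BindAt I g y q') : False := by
  obtain ⟨s, h₃, h₄⟩ := h.mem h₁ h₂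
  rw [hg.sym, InSym.sym.injEq] at h₄
  exact (mem_encCond h₃).2.2.2 h₄.symm

/-- By unique readability a binder symbol starts a node of the syntax tree, so scopes are properly
nested. -/
theorem BindAt.end_le : ∀ {r : Expr} {p q g y q' : ℕ}, Seg I p (encExpr r) q → p ≤ g → g < q →
    BindAt I g y q' → q' ≤ q := by
  intro r
  induction r with
  | eps =>
    intro p q g y q' h h₁ h₂ hb
    cases h.2
    obtain rfl : g = p := by omega
    have := hb.sym.symm.trans h.1
    cases this
  | letter a =>
    intro p q g y q' h h₁ h₂ hb
    rcases h₁.eq_or_lt with rfl | h₁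
    · have := hb.sym.symm.trans h.1
      cases this
    · exact (not_bindAt_of_encNat h.2 h₁ h₂ hb).elim
  | test a c =>
    intro p q g y q' h h₁ h₂ hb
    rcases h₁.eq_or_lt with rfl | h₁
    · have := hb.sym.symm.trans h.1
      cases this
    · obtain ⟨m, h₃, h₄⟩ := seg_append.1 h.2
      rcases lt_or_ge g m with h₅ | h₅
      · exact (not_bindAt_of_encNat h₃ h₁ h₅ hb).elim
      · exact (not_bindAt_of_encCond h₄ h₅ h₂ hb).elim
  | plus r₁ r₂ ih₁ ih₂ =>
    intro p q g y q' h h₁ h₂ hb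
    rcases h₁.eq_or_lt with rfl | h₁
    · have := hb.sym.symm.trans h.1
      cases this
    · obtain ⟨m, h₃, h₄⟩ := seg_append.1 h.2
      rcases lt_or_ge g m with h₅ | h₅
      · exact (ih₁ h₃ h₁ h₅ hb).trans h₄.le
      · exact ih₂ h₄ h₅ h₂ hb
  | cat r₁ r₂ ih₁ ih₂ =>
    intro p q g y q' h h₁ h₂ hb
    rcases h₁.eq_or_lt with rfl | h₁
    · have := hb.sym.symm.trans h.1
      cases this
    · obtain ⟨m, h₃, h₄⟩ := seg_append.1 h.2
      rcases lt_or_ge g m with h₅ | h₅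
      · exact (ih₁ h₃ h₁ h₅ hb).trans h₄.le
      · exact ih₂ h₄ h₅ h₂ hb
  | star r ih =>
    intro p q g y q' h h₁ h₂ hb
    rcases h₁.eq_or_lt with rfl | h₁
    · have := hb.sym.symm.trans h.1
      cases this
    · exact ih h.2 h₁ h₂ hb
  | bind a x r ih =>
    intro p q g y q' h h₁ h₂ hb
    rcases h₁.eq_or_lt with rfl | h₁
    · obtain ⟨a', r', hb⟩ := hb
      exact (encExpr_prefix h hb).2.ge
    · obtain ⟨m, h₃, h₄⟩ := seg_append.1 h.2
      obtain ⟨l, h₅, h₆⟩ := seg_append.1 h₃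
      rcases lt_or_ge g l with h₇ | h₇
      · exact (not_bindAt_of_encNat h₅ h₁ h₇ hb).elim
      · rcases lt_or_ge g m with h₈ | h₈
        · exact (not_bindAt_of_encNat h₆ h₇ h₈ hb).elim
        · exact ih h₄ h₈ h₂ hb

/-- The symbols of atoms do not occur inside numerals, so the occurrences of variables in a
condition are located by looking at single symbols. -/
theorem forall_vars_iff {D : ℕ → Prop} : ∀ {c : Cond} {p q : ℕ}, Seg I p (encCond c) q →
    ((∀ y ∈ c.vars, D y) ↔ ∀ g y, p ≤ g → g < q → AtomAt I g y → D y) := by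
  have atom : ∀ {s : Sym} {x p q : ℕ}, s = .eq ∨ s = .ne → Seg I p (s :: encNat x) q →
      (D x ↔ ∀ g y, p ≤ g → g < q → AtomAt I g y → D y) := by
    intro s x p q hs h
    constructor
    · intro hD g y h₁ h₂ hg
      rcases h₁.eq_or_lt with rfl | h₁
      · obtain ⟨-, _, hg⟩ := hg
        rwa [(encNat_prefix hg h.2).1]
      · exact (not_atomAt_of_encNat h.2 h₁ h₂ hg).elim
    · intro hD
      have := h.2.le
      refine hD p x le_rfl (by omega) ⟨?_, q, h.2⟩
      rw [h.1]
      rcases hs with rfl | rfl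
      · exact Or.inl rfl
      · exact Or.inr rfl
  have two : ∀ {s : Sym} {c₁ c₂ : Cond} {p q : ℕ}, s ≠ .eq → s ≠ .ne →
      Seg I p (s :: (encCond c₁ ++ encCond c₂)) q →
      (∀ {p q : ℕ}, Seg I p (encCond c₁) q →
        ((∀ y ∈ c₁.vars, D y) ↔ ∀ g y, p ≤ g → g < q → AtomAt I g y → D y)) →
      (∀ {p q : ℕ}, Seg I p (encCond c₂) q →
        ((∀ y ∈ c₂.vars, D y) ↔ ∀ g y, p ≤ g → g < q → AtomAt I g y → D y)) →
      ((∀ y ∈ c₁.vars ∪ c₂.vars, D y) ↔ ∀ g y, p ≤ g → g < q → AtomAt I g y → D y) := by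
    intro s c₁ c₂ p q hs hs' h ih₁ ih₂
    obtain ⟨m, h₃, h₄⟩ := seg_append.1 h.2
    have := h₃.le
    have := h₄.le
    simp only [Finset.mem_union, or_imp, forall_and, ih₁ h₃, ih₂ h₄]
    constructor
    · rintro ⟨h₅, h₆⟩ g y h₁ h₂ hg
      rcases h₁.eq_or_lt with rfl | h₁
      · rw [AtomAt, h.1] at hg
        simp [hs, hs'] at hg
      · rcases lt_or_ge g m with h₇ | h₇
        · exact h₅ g y h₁ h₇ hg
        · exact h₆ g y h₇ h₂ hg
    · exact fun h => ⟨fun g y h₁ h₂ => h g y (by omega) (by omega),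
        fun g y h₁ h₂ => h g y (by omega) h₂⟩
  intro c
  induction c with
  | eq x => exact fun h => by simpa [Cond.vars] using atom (Or.inl rfl) h
  | ne x => exact fun h => by simpa [Cond.vars] using atom (Or.inr rfl) h
  | and c₁ c₂ ih₁ ih₂ => exact fun h => two (by simp) (by simp) h ih₁ ih₂
  | or c₁ c₂ ih₁ ih₂ => exact fun h => two (by simp) (by simp) h ih₁ ih₂
  | not c ih =>
    intro p q h
    rw [Cond.vars, ih h.2]
    constructor
    · intro hD g y h₁ h₂ hg
      rcases h₁.eq_or_lt with rfl | h₁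
      · rw [AtomAt, h.1] at hg
        simp at hg
      · exact hD g y h₁ h₂ hg
    · exact fun hD g y h₁ h₂ => hD g y (by omega) h₂

theorem exists_atomAt_cond : ∀ {c : Cond} {p q g : ℕ}, Seg I p (encCond c) q → p ≤ g → g < q →
    (sy I g = .sym .eq ∨ sy I g = .sym .ne) → ∃ y, AtomAt I g y := by
  have num : ∀ {m p q g : ℕ}, Seg I p (encNat m) q → p ≤ g → g < q →
      (sy I g = .sym .eq ∨ sy I g = .sym .ne) → ∃ y, AtomAt I g y := by
    intro m p q g h h₁ h₂ hs
    rcases hs with hs | hs <;> rcases h.encNat_sym h₁ h₂ hs with h | h | h <;> cases h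
  intro c
  induction c with
  | eq x =>
    intro p q g h h₁ h₂ hs
    rcases h₁.eq_or_lt with rfl | h₁
    · exact ⟨x, hs, q, h.2⟩
    · exact num h.2 h₁ h₂ hs
  | ne x =>
    intro p q g h h₁ h₂ hs
    rcases h₁.eq_or_lt with rfl | h₁
    · exact ⟨x, hs, q, h.2⟩
    · exact num h.2 h₁ h₂ hs
  | and c₁ c₂ ih₁ ih₂ =>
    intro p q g h h₁ h₂ hs
    rcases h₁.eq_or_lt with rfl | h₁
    · rw [h.1] at hs; simp at hs
    · obtain ⟨m, h₃, h₄⟩ := seg_append.1 h.2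
      exact (lt_or_ge g m).elim (ih₁ h₃ h₁ · hs) (ih₂ h₄ · h₂ hs)
  | or c₁ c₂ ih₁ ih₂ =>
    intro p q g h h₁ h₂ hs
    rcases h₁.eq_or_lt with rfl | h₁
    · rw [h.1] at hs; simp at hs
    · obtain ⟨m, h₃, h₄⟩ := seg_append.1 h.2
      exact (lt_or_ge g m).elim (ih₁ h₃ h₁ · hs) (ih₂ h₄ · h₂ hs)
  | not c ih =>
    intro p q g h h₁ h₂ hs
    rcases h₁.eq_or_lt with rfl | h₁
    · rw [h.1] at hs; simp at hs
    · exact ih h.2 h₁ h₂ hs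

theorem exists_atomAt : ∀ {r : Expr} {p q g : ℕ}, Seg I p (encExpr r) q → p ≤ g → g < q →
    (sy I g = .sym .eq ∨ sy I g = .sym .ne) → ∃ y, AtomAt I g y := by
  have num : ∀ {m p q g : ℕ}, Seg I p (encNat m) q → p ≤ g → g < q →
      (sy I g = .sym .eq ∨ sy I g = .sym .ne) → ∃ y, AtomAt I g y := by
    intro m p q g h h₁ h₂ hs
    rcases hs with hs | hs <;> rcases h.encNat_sym h₁ h₂ hs with h | h | h <;> cases h
  intro r
  induction r with
  | eps =>
    intro p q g h h₁ h₂ hs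
    cases h.2
    obtain rfl : g = p := by omega
    rw [h.1] at hs; simp at hs
  | letter a =>
    intro p q g h h₁ h₂ hs
    rcases h₁.eq_or_lt with rfl | h₁
    · rw [h.1] at hs; simp at hs
    · exact num h.2 h₁ h₂ hs
  | test a c =>
    intro p q g h h₁ h₂ hs
    rcases h₁.eq_or_lt with rfl | h₁
    · rw [h.1] at hs; simp at hs
    · obtain ⟨m, h₃, h₄⟩ := seg_append.1 h.2
      exact (lt_or_ge g m).elim (num h₃ h₁ · hs) (exists_atomAt_cond h₄ · h₂ hs)
  | plus r₁ r₂ ih₁ ih₂ =>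
    intro p q g h h₁ h₂ hs
    rcases h₁.eq_or_lt with rfl | h₁
    · rw [h.1] at hs; simp at hs
    · obtain ⟨m, h₃, h₄⟩ := seg_append.1 h.2
      exact (lt_or_ge g m).elim (ih₁ h₃ h₁ · hs) (ih₂ h₄ · h₂ hs)
  | cat r₁ r₂ ih₁ ih₂ =>
    intro p q g h h₁ h₂ hs
    rcases h₁.eq_or_lt with rfl | h₁
    · rw [h.1] at hs; simp at hs
    · obtain ⟨m, h₃, h₄⟩ := seg_append.1 h.2
      exact (lt_or_ge g m).elim (ih₁ h₃ h₁ · hs) (ih₂ h₄ · h₂ hs)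
  | star r ih =>
    intro p q g h h₁ h₂ hs
    rcases h₁.eq_or_lt with rfl | h₁
    · rw [h.1] at hs; simp at hs
    · exact ih h.2 h₁ h₂ hs
  | bind a x r ih =>
    intro p q g h h₁ h₂ hs
    rcases h₁.eq_or_lt with rfl | h₁
    · rw [h.1] at hs; simp at hs
    · obtain ⟨m, h₃, h₄⟩ := seg_append.1 h.2
      obtain ⟨l, h₅, h₆⟩ := seg_append.1 h₃
      rcases lt_or_ge g l with h₇ | h₇
      · exact num h₅ h₁ h₇ hs
      · exact (lt_or_ge g m).elim (num h₆ h₇ · hs) (ih h₄ · h₂ hs)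

/-- Every occurrence of a variable in the given range is bound in this range, or satisfies `D`. -/
def Covered (I : Inp Sym) (D : ℕ → Prop) (p q : ℕ) : Prop :=
  ∀ g y, p ≤ g → g < q → AtomAt I g y →
    D y ∨ ∃ h q', p ≤ h ∧ h < g ∧ g < q' ∧ BindAt I h y q'

theorem covered_of_encNat {D : ℕ → Prop} {m p q : ℕ} (h : Seg I p (encNat m) q) :
    Covered I D p q := fun _ _ h₁ h₂ hg => (not_atomAt_of_encNat h h₁ h₂ hg).elim

/-- The first symbol is neither an atom nor a binder. -/
theorem covered_cons {D : ℕ → Prop} {s : Sym} {p q : ℕ} (hs : s ≠ .eq ∧ s ≠ .ne ∧ s ≠ .bind)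
    (h : sy I p = .sym s) : Covered I D p q ↔ Covered I D (p + 1) q := by
  constructor
  · intro hc g y h₁ h₂ hg
    rcases hc g y (by omega) h₂ hg with h₃ | ⟨g', q', h₄, h₅, h₆, h₇⟩
    · exact Or.inl h₃
    · refine Or.inr ⟨g', q', ?_, h₅, h₆, h₇⟩
      rcases h₄.eq_or_lt with rfl | h₄
      · have := h.symm.trans h₇.sym
        simp [hs.2.2] at this
      · exact h₄
  · intro hc g y h₁ h₂ hg
    rcases h₁.eq_or_lt with rfl | h₁
    · rw [AtomAt, h] at hg
      simp [hs.1, hs.2.1] at hg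
    · rcases hc g y h₁ h₂ hg with h₃ | ⟨g', q', h₄, h₅⟩
      · exact Or.inl h₃
      · exact Or.inr ⟨g', q', by omega, h₅⟩

/-- Two parts such that no binder in the first one has atoms of the second one in its scope. -/
theorem covered_append {D : ℕ → Prop} {p m q : ℕ} (h₁ : p ≤ m) (h₂ : m ≤ q)
    (hs : ∀ g y q', p ≤ g → g < m → BindAt I g y q' → q' ≤ m) :
    Covered I D p q ↔ Covered I D p m ∧ Covered I D m q := by
  constructor
  · refine fun hc => ⟨fun g y h₃ h₄ hg => hc g y h₃ (by omega) hg, fun g y h₃ h₄ hg => ?_⟩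
    rcases hc g y (by omega) h₄ hg with h₅ | ⟨g', q', h₅, h₆, h₇, h₈⟩
    · exact Or.inl h₅
    · refine Or.inr ⟨g', q', ?_, h₆, h₇, h₈⟩
      by_contra h
      have := hs g' y q' h₅ (by omega) h₈
      omega
  · rintro ⟨hc, hc'⟩ g y h₃ h₄ hg
    rcases lt_or_ge g m with h₅ | h₅
    · exact hc g y h₃ h₅ hg
    · rcases hc' g y h₅ h₄ hg with h₆ | ⟨g', q', h₆, h₇⟩
      · exact Or.inl h₆
      · exact Or.inr ⟨g', q', by omega, h₇⟩

/-- Freeness becomes a property of positions: an occurrence is bound if it lies in the range of a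
binder of the same variable. The predicate `D` varies in the induction, since the body of a binder
of `x` has to be treated with `D y ∨ y = x`. -/
theorem forall_fv_iff : ∀ {r : Expr} {D : ℕ → Prop} {p q : ℕ}, Seg I p (encExpr r) q →
    ((∀ y ∈ r.fv, D y) ↔ Covered I D p q) := by
  intro r
  induction r with
  | eps =>
    intro D p q h
    cases h.2
    rw [covered_cons (by simp) h.1]
    simp only [Expr.fv, Finset.notMem_empty, false_imp_iff, implies_true, true_iff]
    exact fun g y h₁ h₂ => by omega
  | letter a =>
    intro D p q h
    rw [covered_cons (by simp) h.1]
    simpa [Expr.fv] using covered_of_encNat h.2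
  | test a c =>
    intro D p q h
    obtain ⟨m, h₁, h₂⟩ := seg_append.1 h.2
    rw [covered_cons (by simp) h.1, covered_append h₁.le h₂.le
      (fun g y q' h₃ h₄ hb => (not_bindAt_of_encNat h₁ h₃ h₄ hb).elim),
      and_iff_right (covered_of_encNat h₁), Expr.fv, forall_vars_iff h₂]
    refine ⟨fun hD g y h₃ h₄ hg => Or.inl (hD g y h₃ h₄ hg), fun hD g y h₃ h₄ hg => ?_⟩
    rcases hD g y h₃ h₄ hg with h₅ | ⟨g', q', h₅, h₆, h₇, h₈⟩
    · exact h₅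
    · exact (not_bindAt_of_encCond h₂ h₅ (by omega) h₈).elim
  | plus r₁ r₂ ih₁ ih₂ =>
    intro D p q h
    obtain ⟨m, h₁, h₂⟩ := seg_append.1 h.2
    rw [covered_cons (by simp) h.1, covered_append h₁.le h₂.le
      (fun g y q' h₃ h₄ hb => hb.end_le h₁ h₃ h₄), ← ih₁ h₁, ← ih₂ h₂]
    simp only [Expr.fv, Finset.mem_union, or_imp, forall_and]
  | cat r₁ r₂ ih₁ ih₂ =>
    intro D p q h
    obtain ⟨m, h₁, h₂⟩ := seg_append.1 h.2
    rw [covered_cons (by simp) h.1, covered_append h₁.le h₂.le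
      (fun g y q' h₃ h₄ hb => hb.end_le h₁ h₃ h₄), ← ih₁ h₁, ← ih₂ h₂]
    simp only [Expr.fv, Finset.mem_union, or_imp, forall_and]
  | star r ih =>
    intro D p q h
    rw [covered_cons (by simp) h.1, ← ih h.2]
    rfl
  | bind a x r ih =>
    intro D p q h
    obtain ⟨m, h₁, h₂⟩ := seg_append.1 h.2
    obtain ⟨l, h₃, h₄⟩ := seg_append.1 h₁
    have hl := h₃.le
    have hm := h₄.le
    have hq := h₂.le
    have key : (∀ y ∈ (Expr.bind a x r).fv, D y) ↔ ∀ y ∈ r.fv, D y ∨ y = x := by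
      simp only [Expr.fv, Finset.mem_erase]
      exact forall_congr' fun y => by tauto
    rw [key, ih h₂]
    constructor
    · intro hc g y h₅ h₆ hg
      rcases h₅.eq_or_lt with rfl | h₅
      · rw [AtomAt, h.1] at hg
        simp at hg
      · rcases lt_or_ge g l with h₇ | h₇
        · exact (not_atomAt_of_encNat h₃ h₅ h₇ hg).elim
        · rcases lt_or_ge g m with h₈ | h₈
          · exact (not_atomAt_of_encNat h₄ h₇ h₈ hg).elim
          · rcases hc g y h₈ h₆ hg with (h₉ | rfl) | ⟨g', q', h₉, h'⟩
            · exact Or.inl h₉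
            · exact Or.inr ⟨p, q, le_rfl, h₅, h₆, a, r, h⟩
            · exact Or.inr ⟨g', q', by omega, h'⟩
    · intro hc g y h₅ h₆ hg
      rcases hc g y (by omega) h₆ hg with h₇ | ⟨g', q', h₇, h₈, h₉, hb⟩
      · exact Or.inl (Or.inl h₇)
      · rcases h₇.eq_or_lt with rfl | h₇
        · obtain ⟨a', r', hb⟩ := hb
          have := (encExpr_prefix h hb).1
          simp only [Expr.bind.injEq] at this
          exact Or.inl (Or.inr this.2.1.symm)
        · rcases lt_or_ge g' l with h' | h'
          · exact (not_bindAt_of_encNat h₃ h₇ h' hb).elim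
          · rcases lt_or_ge g' m with h'' | h''
            · exact (not_bindAt_of_encNat h₄ h' h'' hb).elim
            · exact Or.inr ⟨g', q', h'', h₈, h₉, hb⟩

end Occurrences

end XNL

/-! ### The parts of an encoding. -/

namespace XNL

open Relation Function REWB

section Layout

variable {I : Inp Sym} {n : ℕ}

/-! ### The parts of an encoding -/

/-- This is `encEdge` without the bound on the vertices, which is checked separately. -/
def encTuple (e : ℕ × ℕ × ℕ × ℕ) : List Sym :=
  .edge :: (encNat e.1 ++ encNat e.2.1 ++ encNat e.2.2.1 ++ encNat e.2.2.2)

theorem num_ne {m : ℕ} {s : Sym} (h : s ∈ encNat m) : s ≠ .vertex ∧ s ≠ .edge ∧ s ≠ .entry ∧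
    s ≠ .eq ∧ s ≠ .ne ∧ s ≠ .bind := by
  rcases mem_encNat h with rfl | rfl | rfl <;> simp

theorem encTuple_cons (e) : ∃ w, encTuple e = .edge :: w ∧ Sym.edge ∉ w := by
  refine ⟨_, rfl, fun h => ?_⟩
  simp only [List.mem_append] at h
  rcases h with ((h | h) | h) | h <;> exact (num_ne h).2.1 rfl

theorem encEntry_cons (e) : ∃ w, encEntry e = .entry :: w ∧ Sym.entry ∉ w := by
  refine ⟨_, rfl, fun h => ?_⟩
  rcases List.mem_append.1 h with h | h <;> exact (num_ne h).2.2.1 rfl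

theorem mem_encTuple {e} {s : Sym} (h : s ∈ encTuple e) :
    s = .edge ∨ (s ≠ .entry ∧ s ≠ .eq ∧ s ≠ .ne ∧ s ≠ .bind) := by
  rcases List.mem_cons.1 h with rfl | h
  · exact Or.inl rfl
  · simp only [List.mem_append] at h
    rcases h with ((h | h) | h) | h <;> exact Or.inr (num_ne h).2.2

theorem mem_encEntry {e} {s : Sym} (h : s ∈ encEntry e) :
    s = .entry ∨ (s ≠ .edge ∧ s ≠ .eq ∧ s ≠ .ne ∧ s ≠ .bind) := by
  rcases List.mem_cons.1 h with rfl | h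
  · exact Or.inl rfl
  · have : s ≠ .edge ∧ s ≠ .eq ∧ s ≠ .ne ∧ s ≠ .bind := by
      rcases List.mem_append.1 h with h | h <;> exact ⟨(num_ne h).2.1, (num_ne h).2.2.2⟩
    exact Or.inr this

/-- The data of an instance. -/
structure Data : Type where
  n : ℕ
  es : List (ℕ × ℕ × ℕ × ℕ)
  r : Expr
  vs : List (ℕ × ℕ)
  s : ℕ
  t : ℕ

/-- The input consists of the parts of `D`, with boundaries at the positions `p₁` to `p₅`. -/
structure Layout (I : Inp Sym) (p₁ p₂ p₃ p₄ p₅ : ℕ) (D : Data) : Prop where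
  verts : Seg I 1 (List.replicate D.n .vertex) p₁
  edges : Seg I p₁ (D.es.flatMap encTuple) p₂
  expr : Seg I p₂ (encExpr D.r) p₃
  entries : Seg I p₃ (D.vs.flatMap encEntry) p₄
  src : Seg I p₄ (encNat D.s) p₅
  tgt : Seg I p₅ (encNat D.t) (I.1.length + 1)

/-- The conditions on the data of an instance. -/
structure Data.Ok (D : Data) : Prop where
  edges : ∀ e ∈ D.es, e.1 < D.n ∧ e.2.2.2 < D.n
  src : D.s < D.n
  tgt : D.t < D.n
  functional : ∀ y d d', (y, d) ∈ D.vs → (y, d') ∈ D.vs → d = d'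
  fv : ∀ y ∈ D.r.fv, ∃ d, (y, d) ∈ D.vs

variable {p₁ p₂ p₃ p₄ p₅ : ℕ} {D : Data}

/-- Edge marks, entry marks, and the symbols of atoms and binders occur in one part of the input
each, so a single symbol tells where a position lies. Later predicates therefore need not mention
the boundaries. -/
theorem Layout.region (h : Layout I p₁ p₂ p₃ p₄ p₅ D) {g : ℕ} {a : Sym} (hg : sy I g = .sym a) :
    a = .vertex ∨ (p₁ ≤ g ∧ g < p₂ ∧ (a = .edge ∨ (a ≠ .entry ∧ a ≠ .eq ∧ a ≠ .ne ∧ a ≠ .bind))) ∨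
      (p₂ ≤ g ∧ g < p₃ ∧ a ≠ .edge ∧ a ≠ .entry) ∨
      (p₃ ≤ g ∧ g < p₄ ∧ (a = .entry ∨ (a ≠ .edge ∧ a ≠ .eq ∧ a ≠ .ne ∧ a ≠ .bind))) ∨
      (a = .bit0 ∨ a = .bit1 ∨ a = .numEnd) := by
  have hle := le_of_sym hg
  rcases lt_or_ge g p₁ with h₁ | h₁
  · obtain ⟨s, hs, h'⟩ := h.verts.mem hle.1 h₁
    rw [hg, InSym.sym.injEq] at h'
    exact Or.inl (h' ▸ List.eq_of_mem_replicate hs)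
  rcases lt_or_ge g p₂ with h₂ | h₂
  · obtain ⟨s, hs, h'⟩ := h.edges.mem h₁ h₂
    rw [hg, InSym.sym.injEq] at h'
    obtain ⟨e, -, he⟩ := List.mem_flatMap.1 hs
    exact Or.inr (Or.inl ⟨h₁, h₂, h' ▸ mem_encTuple he⟩)
  rcases lt_or_ge g p₃ with h₃ | h₃
  · obtain ⟨s, hs, h'⟩ := h.expr.mem h₂ h₃
    rw [hg, InSym.sym.injEq] at h'
    exact Or.inr (Or.inr (Or.inl ⟨h₂, h₃, h' ▸ (mem_encExpr hs).2⟩))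
  rcases lt_or_ge g p₄ with h₄ | h₄
  · obtain ⟨s, hs, h'⟩ := h.entries.mem h₃ h₄
    rw [hg, InSym.sym.injEq] at h'
    obtain ⟨e, -, he⟩ := List.mem_flatMap.1 hs
    exact Or.inr (Or.inr (Or.inr (Or.inl ⟨h₃, h₄, h' ▸ mem_encEntry he⟩)))
  rcases lt_or_ge g p₅ with h₅ | h₅
  · exact Or.inr (Or.inr (Or.inr (Or.inr (h.src.encNat_sym h₄ h₅ hg))))
  · exact Or.inr (Or.inr (Or.inr (Or.inr (h.tgt.encNat_sym h₅ (by omega) hg))))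

def NumAt (I : Inp Sym) (p m : ℕ) : Prop := ∃ q, Seg I p (encNat m) q

theorem NumAt.same_iff {p p' m m' : ℕ} (h : NumAt I p m) (h' : NumAt I p' m') :
    SameNum I p p' ↔ m = m' := h.elim fun _ h => h'.elim fun _ h' => sameNum_iff_eq h h'

theorem NumAt.diff_iff {p p' m m' : ℕ} (h : NumAt I p m) (h' : NumAt I p' m') :
    DiffNum I p p' ↔ m ≠ m' := h.elim fun _ h => h'.elim fun _ h' => diffNum_iff_ne h h'

theorem NumAt.lt_bd {p m : ℕ} (h : NumAt I p m) : p < bd I := h.elim fun _ h => h.lt_bd_of_encNat.1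

/-- The positions of the four components of an edge. -/
def EdgePos (I : Inp Sym) (u₁ u₂ u₃ u₄ : ℕ) : Prop :=
  (∃ h, sy I h = .sym .edge ∧ u₁ = h + 1) ∧ IsNum I u₁ u₂ ∧ IsNum I u₂ u₃ ∧ IsNum I u₃ u₄ ∧
    ∃ w, IsNum I u₄ w

/-- The positions of the two components of an entry that begins at `g`. -/
def EntryPos (I : Inp Sym) (g u v : ℕ) : Prop :=
  sy I g = .sym .entry ∧ u = g + 1 ∧ IsNum I u v ∧ ∃ w, IsNum I v w

/-- The edge mark before `u₁` opens one of the listed blocks, and the prefix property forces the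
guessed boundaries to be those of its four numerals. -/
theorem Layout.edgePos (h : Layout I p₁ p₂ p₃ p₄ p₅ D) {u₁ u₂ u₃ u₄ : ℕ}
    (hu : EdgePos I u₁ u₂ u₃ u₄) : ∃ e ∈ D.es, NumAt I u₁ e.1 ∧ NumAt I u₂ e.2.1 ∧
      NumAt I u₃ e.2.2.1 ∧ NumAt I u₄ e.2.2.2 := by
  obtain ⟨⟨g, hg, rfl⟩, ⟨a, ha⟩, ⟨b, hb⟩, ⟨c, hc⟩, _, d, hd⟩ := hu
  have hr : p₁ ≤ g ∧ g < p₂ := by have := h.region hg; simp at this; tauto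
  obtain ⟨e, he, q, h₁⟩ := h.edges.exists_block encTuple_cons hr.1 hr.2 hg
  have h₂ := h₁.2
  simp only [seg_append] at h₂
  obtain ⟨_, ⟨_, ⟨_, h₂, h₃⟩, h₄⟩, h₅⟩ := h₂
  obtain ⟨rfl, rfl⟩ := encNat_prefix ha h₂
  obtain ⟨rfl, rfl⟩ := encNat_prefix hb h₃
  obtain ⟨rfl, rfl⟩ := encNat_prefix hc h₄
  exact ⟨e, he, ⟨_, ha⟩, ⟨_, hb⟩, ⟨_, hc⟩, ⟨_, h₅⟩⟩

theorem Layout.exists_edgePos (h : Layout I p₁ p₂ p₃ p₄ p₅ D) {e} (he : e ∈ D.es) :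
    ∃ u₁ u₂ u₃ u₄, EdgePos I u₁ u₂ u₃ u₄ ∧ NumAt I u₁ e.1 ∧ NumAt I u₂ e.2.1 ∧
      NumAt I u₃ e.2.2.1 ∧ NumAt I u₄ e.2.2.2 := by
  obtain ⟨g, q, h₁⟩ := h.edges.block he
  have h₂ := h₁.2
  simp only [seg_append] at h₂
  obtain ⟨_, ⟨_, ⟨_, h₂, h₃⟩, h₄⟩, h₅⟩ := h₂
  exact ⟨_, _, _, _, ⟨⟨g, h₁.1, rfl⟩, ⟨_, h₂⟩, ⟨_, h₃⟩, ⟨_, h₄⟩, _, _, h₅⟩, ⟨_, h₂⟩, ⟨_, h₃⟩,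
    ⟨_, h₄⟩, ⟨_, h₅⟩⟩

theorem Layout.entryPos (h : Layout I p₁ p₂ p₃ p₄ p₅ D) {g : ℕ} (hg : sy I g = .sym .entry) :
    ∃ e ∈ D.vs, ∃ u v, EntryPos I g u v ∧ NumAt I u e.1 ∧ NumAt I v e.2 := by
  have hr : p₃ ≤ g ∧ g < p₄ := by have := h.region hg; simp at this; tauto
  obtain ⟨e, he, q, h₁⟩ := h.entries.exists_block encEntry_cons hr.1 hr.2 hg
  obtain ⟨_, h₂, h₃⟩ := seg_append.1 h₁.2
  exact ⟨e, he, _, _, ⟨hg, rfl, ⟨_, h₂⟩, _, _, h₃⟩, ⟨_, h₂⟩, ⟨_, h₃⟩⟩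

theorem EntryPos.unique {g u v u' v' : ℕ} (h : EntryPos I g u v) (h' : EntryPos I g u' v') :
    u = u' ∧ v = v' := by
  obtain ⟨-, rfl, ⟨_, h₁⟩, -⟩ := h
  obtain ⟨-, rfl, ⟨_, h₂⟩, -⟩ := h'
  exact ⟨rfl, (encNat_prefix h₁ h₂).2⟩

theorem Layout.entryPos_mem (h : Layout I p₁ p₂ p₃ p₄ p₅ D) {g u v : ℕ} (hg : EntryPos I g u v) :
    ∃ e ∈ D.vs, NumAt I u e.1 ∧ NumAt I v e.2 := by
  obtain ⟨e, he, u', v', h₁, h₂, h₃⟩ := h.entryPos hg.1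
  obtain ⟨rfl, rfl⟩ := hg.unique h₁
  exact ⟨e, he, h₂, h₃⟩

theorem Layout.exists_entryPos (h : Layout I p₁ p₂ p₃ p₄ p₅ D) {e} (he : e ∈ D.vs) :
    ∃ g u v, EntryPos I g u v ∧ NumAt I u e.1 ∧ NumAt I v e.2 := by
  obtain ⟨g, q, h₁⟩ := h.entries.block he
  obtain ⟨_, h₂, h₃⟩ := seg_append.1 h₁.2
  exact ⟨g, _, _, ⟨h₁.1, rfl, ⟨_, h₂⟩, _, _, h₃⟩, ⟨_, h₂⟩, ⟨_, h₃⟩⟩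

/-! The conditions as predicates on the input. -/

/-- The implication is spelled out positively: the complement of a set of symbols is again a set of
symbols, and `DiffNum` stands for the negation of `SameNum`. -/
def Functional (I : Inp Sym) : Prop :=
  ∀ g, g < bd I → ∀ g', g' < bd I → sy I g ∈ ({.sym .entry}ᶜ : Set (InSym Sym)) ∨
    sy I g' ∈ ({.sym .entry}ᶜ : Set (InSym Sym)) ∨ ∃ u v u' v', EntryPos I g u v ∧
      EntryPos I g' u' v' ∧ (DiffNum I u u' ∨ SameNum I v v')

theorem Layout.functional_iff (h : Layout I p₁ p₂ p₃ p₄ p₅ D) : Functional I ↔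
    ∀ y d d', (y, d) ∈ D.vs → (y, d') ∈ D.vs → d = d' := by
  constructor
  · intro hF y d d' h₁ h₂
    obtain ⟨g, u, v, h₃, h₄, h₅⟩ := h.exists_entryPos h₁
    obtain ⟨g', u', v', h₆, h₇, h₈⟩ := h.exists_entryPos h₂
    rcases hF g ((Nat.lt_succ_self _).trans (lt_bd_of_sym h₃.1)) g'
      ((Nat.lt_succ_self _).trans (lt_bd_of_sym h₆.1)) with h₉ | h₉ | ⟨_, _, _, _, h₉, h', h''⟩
    · exact absurd h₃.1 h₉
    · exact absurd h₆.1 h₉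
    · obtain ⟨rfl, rfl⟩ := h₃.unique h₉
      obtain ⟨rfl, rfl⟩ := h₆.unique h'
      rw [h₄.diff_iff h₇, h₅.same_iff h₈] at h''
      simpa using h''
  · intro hF g _ g' _
    by_cases hg : sy I g = .sym .entry
    · by_cases hg' : sy I g' = .sym .entry
      · obtain ⟨⟨y, d⟩, he, u, v, h₁, h₂, h₃⟩ := h.entryPos hg
        obtain ⟨⟨y', d'⟩, he', u', v', h₄, h₅, h₆⟩ := h.entryPos hg'
        refine Or.inr (Or.inr ⟨u, v, u', v', h₁, h₄, ?_⟩)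
        rw [h₂.diff_iff h₅, h₃.same_iff h₆]
        by_cases hy : y = y'
        · subst hy; exact Or.inr (hF _ _ _ he he')
        · exact Or.inl hy
      · exact Or.inr (Or.inl hg')
    · exact Or.inl hg

/-- The position of the variable of a binder at `g`, and the end of the expression. -/
def BindPos (I : Inp Sym) (g v q : ℕ) : Prop :=
  sy I g = .sym .bind ∧ ∃ u, u = g + 1 ∧ IsNum I u v ∧ ∃ w, IsNum I v w ∧ ExprAt I w q

theorem bindPos_iff {g y q : ℕ} : (∃ v, BindPos I g v q ∧ NumAt I v y) ↔ BindAt I g y q := by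
  constructor
  · rintro ⟨v, ⟨h, _, rfl, ⟨a, ha⟩, _, ⟨x, hx⟩, r, hr⟩, _, hy⟩
    obtain ⟨rfl, rfl⟩ := encNat_prefix hx hy
    exact ⟨a, r, h, seg_append.2 ⟨_, seg_append.2 ⟨_, ha, hx⟩, hr⟩⟩
  · rintro ⟨a, r, h⟩
    obtain ⟨m, h₁, h₂⟩ := seg_append.1 h.2
    obtain ⟨l, h₃, h₄⟩ := seg_append.1 h₁
    exact ⟨l, ⟨h.1, _, rfl, ⟨a, h₃⟩, m, ⟨y, h₄⟩, r, h₂⟩, m, h₄⟩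

def Closed (I : Inp Sym) : Prop :=
  ∀ g, g < bd I → sy I g ∈ ({.sym .eq, .sym .ne}ᶜ : Set (InSym Sym)) ∨
    (∃ z, z = g + 1 ∧ ((∃ h u, SameNum I u z ∧ ∃ v, EntryPos I h u v) ∨
      ∃ h v q, BindPos I h v q ∧ h < g ∧ g < q ∧ SameNum I v z))

/-- This is `forall_fv_iff`, with the domain of the listed valuation for `D`. A binder found
anywhere in the input belongs to the query, because its symbol occurs only there. -/
theorem Layout.closed_iff (h : Layout I p₁ p₂ p₃ p₄ p₅ D) : Closed I ↔
    ∀ y ∈ D.r.fv, ∃ d, (y, d) ∈ D.vs := by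
  rw [forall_fv_iff (D := fun y => ∃ d, (y, d) ∈ D.vs) h.expr]
  constructor
  · intro hC g y h₁ h₂ hg
    obtain ⟨hs, hy : NumAt I _ _⟩ := hg
    have hg : g < bd I := by
      rcases hs with hs | hs <;> exact (Nat.lt_succ_self _).trans (lt_bd_of_sym hs)
    rcases hC g hg with h₃ | ⟨_, rfl, ⟨h', u, h₃, v, h₄⟩ | ⟨h', v, q, h₃, h₄, h₅, h₆⟩⟩
    · exact absurd hs h₃
    · obtain ⟨e, he, h₅, h₆⟩ := h.entryPos_mem h₄
      rw [h₅.same_iff hy] at h₃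
      exact Or.inl ⟨e.2, h₃ ▸ he⟩
    · obtain ⟨m, _, _, h₇, h₈⟩ := id h₆
      have h₉ : NumAt I v m := ⟨_, h₇⟩
      rw [h₉.same_iff hy] at h₆
      subst h₆
      have hb := bindPos_iff.1 ⟨v, h₃, h₉⟩
      refine Or.inr ⟨h', q, ?_, h₄, h₅, hb⟩
      have := h.region hb.sym
      simp at this
      exact this.1
  · intro hC g _
    by_cases hs : sy I g = .sym .eq ∨ sy I g = .sym .ne
    · have hr : p₂ ≤ g ∧ g < p₃ := by
        rcases hs with hs | hs
        · have := h.region hs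
          simp at this
          tauto
        · have := h.region hs
          simp at this
          tauto
      obtain ⟨y, hy⟩ := exists_atomAt h.expr hr.1 hr.2 hs
      have hy' : NumAt I (g + 1) y := hy.2
      refine Or.inr ⟨_, rfl, ?_⟩
      rcases hC g y hr.1 hr.2 hy with ⟨d, hd⟩ | ⟨h', q, h₁, h₂, h₃, h₄⟩
      · obtain ⟨g', u, v, h₃, h₄, h₅⟩ := h.exists_entryPos hd
        exact Or.inl ⟨g', u, (h₄.same_iff hy').2 rfl, v, h₃⟩
      · obtain ⟨v, h₅, h₆⟩ := bindPos_iff.2 h₄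
        exact Or.inr ⟨h', v, q, h₅, h₂, h₃, (h₆.same_iff hy').2 rfl⟩
    · exact Or.inl hs

theorem dfn_edgePos (i j k l : Fin n) :
    Dfn fun I _ ρ => EdgePos I (ρ i) (ρ j) (ρ k) (ρ l) := by
  refine .and (.exb ((Dfn.isSym _ _).and (Dfn.suc _ _)) ?_) ((dfn_isNum _ _).and
    ((dfn_isNum _ _).and ((dfn_isNum _ _).and (dfn_exists_isNum _))))
  exact fun _ _ _ _ _ h => (Nat.lt_succ_self _).trans (lt_bd_of_sym h.1)

theorem dfn_entryPos (i j k : Fin n) : Dfn fun I _ ρ => EntryPos I (ρ i) (ρ j) (ρ k) :=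
  (Dfn.isSym _ _).and ((Dfn.suc _ _).and ((dfn_isNum _ _).and (dfn_exists_isNum _)))

theorem EntryPos.lt_bd {g u v : ℕ} (h : EntryPos I g u v) : g < bd I ∧ u < bd I ∧ v < bd I :=
  ⟨(Nat.lt_succ_self _).trans (lt_bd_of_sym h.1), h.2.2.1.elim fun _ h => h.lt_bd_of_encNat⟩

theorem dfn_functional : Dfn (n := n) fun I _ _ => Functional I := by
  refine .all (.all (.or (.sym _ (.proj _)) (.or (.sym _ (.proj _)) (.exb (.exb (.exb (.exb
    ((dfn_entryPos _ _ _).and ((dfn_entryPos _ _ _).and ((dfn_diffNum _ _).or (dfn_sameNum _ _))))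
    ?_) ?_) ?_) ?_))))
  · exact fun _ _ _ _ _ ⟨_, h, _⟩ => h.lt_bd.2.2
  · exact fun _ _ _ _ _ ⟨_, _, h, _⟩ => h.lt_bd.2.1
  · exact fun _ _ _ _ _ ⟨_, _, h, _⟩ => h.lt_bd.2.2
  · exact fun _ _ _ _ _ ⟨_, _, _, h, _⟩ => h.lt_bd.2.1

theorem ExprAt.lt_bd {p q : ℕ} (h : ExprAt I p q) : p < bd I ∧ q < bd I := by
  obtain ⟨r, h⟩ := h
  have hp : p < bd I := by
    cases r <;> exact (Nat.lt_succ_self _).trans (lt_bd_of_sym h.1)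
  exact ⟨hp, Seg.lt_bd h hp⟩

theorem dfn_bindPos (i j k : Fin n) : Dfn fun I _ ρ => BindPos I (ρ i) (ρ j) (ρ k) := by
  refine .and (Dfn.isSym _ _) (.exb ((Dfn.suc _ _).and ((dfn_isNum _ _).and (.exb
    ((dfn_isNum _ _).and (dfn_exprAt _ _)) ?_))) ?_)
  · exact fun _ _ _ _ _ h => h.2.lt_bd.1
  · exact fun _ _ _ _ _ ⟨_, ⟨_, h⟩, _⟩ => h.lt_bd_of_encNat.1

theorem dfn_closed : Dfn (n := n) fun I _ _ => Closed I := by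
  refine .all (.or (.sym _ (.proj _)) (.exb ((Dfn.suc _ _).and (.or (.exb (.exb
    ((dfn_sameNum _ _).and (.exb (dfn_entryPos _ _ _) ?_)) ?_) ?_) (.exb (.exb (.exb
    ((dfn_bindPos _ _ _).and ((Dfn.lt _ _).and ((Dfn.lt _ _).and (dfn_sameNum _ _)))) ?_) ?_) ?_)))
    ?_))
  · exact fun _ _ _ _ _ h => h.lt_bd.2.2
  · exact fun _ _ _ _ _ ⟨_, _, h⟩ => h.lt_bd.2.1
  · exact fun _ _ _ _ _ ⟨_, _, _, h⟩ => h.lt_bd.1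
  · exact fun _ _ _ _ _ ⟨⟨_, _, _, _, _, _, h⟩, _⟩ => h.lt_bd.2
  · exact fun _ _ _ _ _ ⟨_, ⟨_, _, _, ⟨_, h⟩, _⟩, _⟩ => h.lt_bd_of_encNat.2
  · exact fun _ _ _ _ _ ⟨_, _, ⟨h, _⟩, _⟩ => (Nat.lt_succ_self _).trans (lt_bd_of_sym h)
  · rintro I A ρ v - ⟨-, ⟨_, _, ⟨_, _, _, _, h⟩, _⟩ | ⟨_, _, _, _, _, _, _, _, _, _, h⟩⟩ <;>
    exact h.lt_bd_of_encNat.1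

end Layout

end XNL

/-! ### Recognition of well-formed inputs. -/

namespace XNL

open Relation Function REWB

section Shape

variable {I : Inp Sym} {n : ℕ}

/-! ### Recognizing encodings -/

theorem reflTransGen_block {β : Type} {enc : β → List Sym} {B : β → Prop} {p q : ℕ} :
    ReflTransGen (fun p q => ∃ b, B b ∧ Seg I p (enc b) q) p q ↔
      ∃ l : List β, (∀ b ∈ l, B b) ∧ Seg I p (l.flatMap enc) q := by
  constructor
  · intro h
    induction h using ReflTransGen.head_induction_on with
    | refl => exact ⟨[], by simp, rfl⟩
    | head h _ ih =>
      obtain ⟨b, hb, h₁⟩ := h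
      obtain ⟨l, hl, h₂⟩ := ih
      exact ⟨b :: l, List.forall_mem_cons.2 ⟨hb, hl⟩, by
        rw [List.flatMap_cons, seg_append]; exact ⟨_, h₁, h₂⟩⟩
  · rintro ⟨l, hl, h⟩
    induction l generalizing p with
    | nil => cases h; exact .refl
    | cons b l ih =>
      rw [List.flatMap_cons, seg_append] at h
      obtain ⟨m, h₁, h₂⟩ := h
      obtain ⟨hb, hl⟩ := List.forall_mem_cons.1 hl
      exact .head ⟨b, hb, h₁⟩ (ih hl h₂)

def VertStep (I : Inp Sym) (p q : ℕ) : Prop := sy I p = .sym .vertex ∧ q = p + 1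

def EdgeStep (I : Inp Sym) (N p q : ℕ) : Prop :=
  sy I p = .sym .edge ∧ ∃ u₁, u₁ = p + 1 ∧ NumLt I u₁ N ∧ ∃ u₂, IsNum I u₁ u₂ ∧
    ∃ u₃, IsNum I u₂ u₃ ∧ ∃ u₄, IsNum I u₃ u₄ ∧ NumLt I u₄ N ∧ IsNum I u₄ q

def EntryStep (I : Inp Sym) (p q : ℕ) : Prop :=
  sy I p = .sym .entry ∧ ∃ u, u = p + 1 ∧ ∃ v, IsNum I u v ∧ IsNum I v q

theorem numLt_iff_lt {p m q N : ℕ} (h : Seg I p (encNat m) q) : NumLt I p N ↔ m < N :=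
  ⟨fun ⟨_, _, h', hm⟩ => (encNat_prefix h h').1 ▸ hm, fun hm => ⟨m, q, h, hm⟩⟩

theorem vertStep_iff {p q : ℕ} : ReflTransGen (VertStep I) p q ↔
    ∃ m, Seg I p (List.replicate m .vertex) q := by
  have : VertStep I = fun p q => ∃ b : Unit, True ∧ Seg I p ((fun _ => [Sym.vertex]) b) q := by
    funext p q
    simp [VertStep, seg_cons, seg_nil, eq_comm]
  rw [this, reflTransGen_block (enc := fun _ => [Sym.vertex])]
  constructor
  · rintro ⟨l, -, h⟩
    exact ⟨l.length, by simpa [List.flatMap] using h⟩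
  · rintro ⟨m, h⟩
    exact ⟨List.replicate m (), by simp, by simpa [List.flatMap] using h⟩

theorem edgeStep_iff {N p q : ℕ} : EdgeStep I N p q ↔
    ∃ b : ℕ × ℕ × ℕ × ℕ, (b.1 < N ∧ b.2.2.2 < N) ∧ Seg I p (encTuple b) q := by
  constructor
  · rintro ⟨h, _, rfl, h₁, _, ⟨a, ha⟩, _, ⟨b, hb⟩, _, ⟨c, hc⟩, h₂, d, hd⟩
    exact ⟨(a, b, c, d), ⟨(numLt_iff_lt ha).1 h₁, (numLt_iff_lt hd).1 h₂⟩, h, seg_append.2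
      ⟨_, seg_append.2 ⟨_, seg_append.2 ⟨_, ha, hb⟩, hc⟩, hd⟩⟩
  · rintro ⟨b, hb, h⟩
    have h₂ := h.2
    simp only [seg_append] at h₂
    obtain ⟨_, ⟨_, ⟨_, h₂, h₃⟩, h₄⟩, h₅⟩ := h₂
    exact ⟨h.1, _, rfl, (numLt_iff_lt h₂).2 hb.1, _, ⟨_, h₂⟩, _, ⟨_, h₃⟩, _, ⟨_, h₄⟩,
      (numLt_iff_lt h₅).2 hb.2, _, h₅⟩

theorem entryStep_iff {p q : ℕ} : EntryStep I p q ↔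
    ∃ b : ℕ × ℕ, True ∧ Seg I p (encEntry b) q := by
  constructor
  · rintro ⟨h, _, rfl, _, ⟨a, ha⟩, b, hb⟩
    exact ⟨(a, b), trivial, h, seg_append.2 ⟨_, ha, hb⟩⟩
  · rintro ⟨b, -, h⟩
    obtain ⟨_, h₁, h₂⟩ := seg_append.1 h.2
    exact ⟨h.1, _, rfl, _, ⟨_, h₁⟩, _, h₂⟩

theorem sy_of_length_lt {α : Type} {I : Inp α} {p : ℕ} (h : I.1.length < p) :
    sy I p = if p ≤ I.1.length + I.2 then .stroke else .rightEnd := by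
  obtain ⟨j, rfl⟩ : ∃ j, p = I.1.length + 1 + j := ⟨p - (I.1.length + 1), by omega⟩
  have : I.1.length + 1 + j = I.1.length + j + 1 := by omega
  rw [this]
  simp only [sy, tp, inputTape, List.getD_cons_succ]
  rw [List.getD_eq_getElem?_getD, List.append_assoc,
    List.getElem?_append_right (by simp), List.length_map, Nat.add_sub_cancel_left]
  split_ifs with h'
  · rw [List.getElem?_append_left (by simp; omega)]
    simp [show j < I.2 by omega]
  · rw [List.getElem?_append_right (by simp; omega)]
    rcases hj : j - (List.replicate I.2 (InSym.stroke (α := α))).length with _ | i <;> simp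

theorem exists_sym {α : Type} {I : Inp α} {p : ℕ} (h : 0 < p) (h' : p ≤ I.1.length) :
    ∃ a, sy I p = .sym a := by
  obtain ⟨s, -, h⟩ := (seg_input I).mem h (Nat.lt_succ_of_le h')
  exact ⟨s, h⟩

theorem sy_eq_stroke {α : Type} {I : Inp α} {p : ℕ} : sy I p = .stroke ↔
    I.1.length < p ∧ p ≤ I.1.length + I.2 := by
  rcases lt_or_ge I.1.length p with h | h
  · rw [sy_of_length_lt h]
    split_ifs with h' <;> simp [h, h']
  · rcases p.eq_zero_or_pos with rfl | hp
    · simp [sy_eq_leftEnd.2 rfl]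
    · obtain ⟨a, ha⟩ := exists_sym hp h
      simp [ha, h.not_gt]

theorem sy_eq_rightEnd {α : Type} {I : Inp α} {p : ℕ} : sy I p = .rightEnd ↔
    I.1.length + I.2 < p := by
  rcases lt_or_ge I.1.length p with h | h
  · rw [sy_of_length_lt h]
    split_ifs with h' <;> simp [h']
    omega
  · rcases p.eq_zero_or_pos with rfl | hp
    · simp [sy_eq_leftEnd.2 rfl]
    · obtain ⟨a, ha⟩ := exists_sym hp h
      simp only [ha, reduceCtorEq, false_iff]
      omega

/-- The input is an encoding of an instance together with the size of its query, and the parts of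
the encoding have the given boundaries. -/
def Shape (I : Inp Sym) (p₁ p₂ p₃ p₄ p₅ : ℕ) : Prop :=
  (∃ z, z = 0 ∧ ∃ o, o = z + 1 ∧ ReflTransGen (VertStep I) o p₁) ∧
  (∃ N, p₁ = N + 1 ∧ ReflTransGen (EdgeStep I N) p₁ p₂ ∧ NumLt I p₄ N ∧ NumLt I p₅ N) ∧
  ReflTransGen (EntryStep I) p₃ p₄ ∧ IsNum I p₄ p₅ ∧
  (∃ q, IsNum I p₅ q ∧ sy I q = .stroke ∧ ∃ s, ExprSize I p₂ p₃ s ∧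
    ∃ e, sy I e = .rightEnd ∧ e = q + s ∧ ∃ e', e = e' + 1 ∧ sy I e' = .stroke) ∧
  Functional I ∧ Closed I

/-- The size of the query is compared with the parameter on the tape itself: as many cells behind
the end of the word as the query has nodes, there is the right end marker. Positions beyond the tape
read the same, so the preceding cell is required to be a stroke. A parameter zero is thereby
excluded, rightly so since every query has positive size. -/
theorem shape_iff {p₁ p₂ p₃ p₄ p₅ : ℕ} : Shape I p₁ p₂ p₃ p₄ p₅ ↔
    ∃ D, Layout I p₁ p₂ p₃ p₄ p₅ D ∧ D.Ok ∧ D.r.size = I.2 := by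
  have hE : ∀ N, EdgeStep I N = fun p q => ∃ b : ℕ × ℕ × ℕ × ℕ, (b.1 < N ∧ b.2.2.2 < N) ∧
      Seg I p (encTuple b) q := fun N => by funext p q; exact propext edgeStep_iff
  have hV : EntryStep I = fun p q => ∃ b : ℕ × ℕ, True ∧ Seg I p (encEntry b) q := by
    funext p q; exact propext entryStep_iff
  unfold Shape
  simp only [hE, hV, reflTransGen_block, vertStep_iff]
  constructor
  · rintro ⟨⟨_, rfl, _, rfl, m, h₁⟩, ⟨N, hN, ⟨es, hes, h₂⟩, h₃, h₄⟩, ⟨vs, -, h₅⟩, ⟨s, h₆⟩,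
      ⟨q, ⟨t, h₇⟩, h₈, k, ⟨r, h₉, rfl⟩, _, h₁₀, rfl, e, h₁₁, h₁₂⟩, hF, hC⟩
    have hm : m = N := by
      have := h₁.length
      simp at this
      omega
    subst hm
    rw [sy_eq_stroke] at h₈ h₁₂
    rw [sy_eq_rightEnd] at h₁₀
    -- The numeral of the target is followed by a stroke, so it ends exactly where the word ends.
    have hq : q = I.1.length + 1 := by
      have := h₇.end_le (by simp [encNat])
      omega
    have hL : Layout I p₁ p₂ p₃ p₄ p₅ ⟨m, es, r, vs, s, t⟩ := ⟨h₁, h₂, h₉, h₅, h₆, hq ▸ h₇⟩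
    refine ⟨_, hL, ⟨hes, (numLt_iff_lt h₆).1 h₃, (numLt_iff_lt h₇).1 h₄, hL.functional_iff.1 hF,
      hL.closed_iff.1 hC⟩, ?_⟩
    dsimp only
    omega
  · rintro ⟨D, h, hD, hs⟩
    have hp := Expr.size_pos D.r
    refine ⟨⟨_, rfl, _, rfl, _, h.verts⟩, ⟨D.n, ?_, ⟨_, hD.edges, h.edges⟩,
      (numLt_iff_lt h.src).2 hD.src, (numLt_iff_lt h.tgt).2 hD.tgt⟩, ⟨_, by simp, h.entries⟩,
      ⟨_, h.src⟩, ⟨_, ⟨_, h.tgt⟩, sy_eq_stroke.2 ?_, _, ⟨_, h.expr, rfl⟩, _,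
        sy_eq_rightEnd.2 ?_, rfl, I.1.length + I.2, ?_, sy_eq_stroke.2 ?_⟩,
      h.functional_iff.2 hD.functional, h.closed_iff.2 hD.fv⟩
    · have := h.verts.length
      simp at this
      omega
    all_goals omega

theorem lt_bd_of_stroke {α : Type} {I : Inp α} {p : ℕ} (h : sy I p = .stroke) : p + 1 < bd I := by
  have := length_lt_bd I
  rw [length_tp] at this
  rw [sy_eq_stroke] at h
  omega

theorem dfn_shape (i₁ i₂ i₃ i₄ i₅ : Fin n) :
    Dfn fun I _ ρ => Shape I (ρ i₁) (ρ i₂) (ρ i₃) (ρ i₄) (ρ i₅) := by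
  refine .and (.exb ((Dfn.isZero _).and (.exb ((Dfn.suc _ _).and (.rtg ((Dfn.isSym _ _).and
    (Dfn.suc _ _)) ?_ _ _)) ?_)) ?_) (.and (.exb ((Dfn.suc _ _).and ((Dfn.rtg ((Dfn.isSym _ _).and
    (.exb ((Dfn.suc _ _).and ((dfn_numLt _ _).and (.exb ((dfn_isNum _ _).and (.exb
    ((dfn_isNum _ _).and (.exb ((dfn_isNum _ _).and ((dfn_numLt _ _).and (dfn_isNum _ _))) ?_)) ?_))
    ?_))) ?_)) ?_ _ _).and ((dfn_numLt _ _).and (dfn_numLt _ _)))) ?_) (.and (.rtg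
    ((Dfn.isSym _ _).and (.exb ((Dfn.suc _ _).and (.exb ((dfn_isNum _ _).and (dfn_isNum _ _)) ?_))
    ?_)) ?_ _ _) ((dfn_isNum _ _).and (.and (.exb ((dfn_isNum _ _).and ((Dfn.isSym _ _).and (.exb
    ((dfn_exprSize _ _ _).and (.exb ((Dfn.isSym _ _).and ((Dfn.add _ _ _).and (.exb
    ((Dfn.suc _ _).and (Dfn.isSym _ _)) ?_))) ?_)) ?_))) ?_) (.and dfn_functional dfn_closed)))))
  · rintro I A ρ u v - ⟨h, rfl⟩
    exact lt_bd_of_sym h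
  · intro I A ρ v hρ h
    obtain ⟨m, hm⟩ := vertStep_iff.1 h.2
    exact hm.le.trans_lt (hρ _)
  · exact fun I _ _ _ _ h => h.1 ▸ bd_pos I
  · exact fun _ _ _ _ _ ⟨⟨_, h⟩, _⟩ => h.lt_bd_of_encNat.2
  · exact fun _ _ _ _ _ ⟨⟨_, h⟩, _⟩ => h.lt_bd_of_encNat.2
  · exact fun _ _ _ _ _ ⟨⟨_, h⟩, _⟩ => h.lt_bd_of_encNat.2
  · exact fun _ _ _ _ _ ⟨_, ⟨_, _, h, _⟩, _⟩ => h.lt_bd_of_encNat.1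
  · exact fun _ _ _ _ _ _ ⟨_, _, _, _, _, _, _, _, _, _, _, _, h⟩ => h.lt_bd_of_encNat.2
  · exact fun _ _ _ _ hρ h => (Nat.lt_succ_self _).trans (h.1.symm.trans_lt (hρ _))
  · exact fun _ _ _ _ _ ⟨⟨_, h⟩, _⟩ => h.lt_bd_of_encNat.2
  · exact fun _ _ _ _ _ ⟨_, _, ⟨_, h⟩, _⟩ => h.lt_bd_of_encNat.1
  · exact fun _ _ _ _ _ _ ⟨_, _, _, _, _, _, h⟩ => h.lt_bd_of_encNat.2
  · exact fun _ _ _ _ _ h => (Nat.lt_succ_self _).trans (lt_bd_of_stroke h.2)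
  · rintro I A ρ v - ⟨-, -, _, rfl, h⟩
    exact lt_bd_of_stroke h
  · exact fun I _ _ _ _ ⟨h, _⟩ => (exprSize_iff.1 h).lt_bd (bd_pos I)
  · exact fun _ _ _ _ _ ⟨⟨_, h⟩, _⟩ => h.lt_bd_of_encNat.2

end Shape

end XNL

/-! ### Evaluation of queries with a stack of bounded height. -/

namespace XNL

open Relation Function REWB

section StackMachine

/-! ### A stack machine that evaluates queries -/

variable (E : ℕ → ℕ → ℕ → ℕ → Prop)

/-- Paths in the graph with the labelled edges `E`. -/
def Path : ℕ → DataWord → ℕ → Prop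
  | u, [], v => u = v
  | u, (a, d) :: w, v => ∃ m, E u a d m ∧ Path m w v

theorem path_append {w w' : DataWord} : ∀ {u v : ℕ},
    Path E u (w ++ w') v ↔ ∃ m, Path E u w m ∧ Path E m w' v := by
  induction w with
  | nil => simp [Path]
  | cons s w ih =>
    obtain ⟨a, d⟩ := s
    simp only [List.cons_append, Path, ih]
    exact fun {u v} => ⟨fun ⟨m, h, m', h₁, h₂⟩ => ⟨m', ⟨m, h, h₁⟩, h₂⟩,
      fun ⟨m', ⟨m, h, h₁⟩, h₂⟩ => ⟨m, h, m', h₁, h₂⟩⟩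

/-- Stack items: an expression to be matched, a condition to be tested (positively or negatively)
for a data value, and a binding of a variable, valid for the items above it. -/
inductive Item : Type
  | ex (r : Expr)
  | cond (b : Bool) (d : ℕ) (c : Cond)
  | frame (x d : ℕ)

/-- The valuation in force on top of a stack. -/
def env (ν : Valuation) : List Item → Valuation
  | [] => ν
  | .frame x d :: K => update (env ν K) x (some d)
  | .ex _ :: K => env ν K
  | .cond _ _ _ :: K => env ν K

/-- `Rule E ν V it V' l`: under the valuation `ν` the item `it` on top of the stack can be replaced
by the items `l`, while the current vertex changes from `V` to `V'`. -/
inductive Rule (ν : Valuation) (V : ℕ) : Item → ℕ → List Item → Prop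
  | eps : Rule ν V (.ex .eps) V []
  | letter {a d V'} : E V a d V' → Rule ν V (.ex (.letter a)) V' []
  | test {a d V' c} : E V a d V' → Rule ν V (.ex (.test a c)) V' [.cond true d c]
  | plus_left {r₁ r₂} : Rule ν V (.ex (.plus r₁ r₂)) V [.ex r₁]
  | plus_right {r₁ r₂} : Rule ν V (.ex (.plus r₁ r₂)) V [.ex r₂]
  | cat {r₁ r₂} : Rule ν V (.ex (.cat r₁ r₂)) V [.ex r₁, .ex r₂]
  | star_nil {r} : Rule ν V (.ex (.star r)) V []
  | star_cons {r} : Rule ν V (.ex (.star r)) V [.ex r, .ex (.star r)]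
  | bind {a d V' x r} : E V a d V' → Rule ν V (.ex (.bind a x r)) V' [.ex r, .frame x d]
  | frame {x d} : Rule ν V (.frame x d) V []
  | eq {b d x} : (ν x = some d ↔ b = true) → Rule ν V (.cond b d (.eq x)) V []
  | ne {b d x} : (ν x ≠ some d ↔ b = true) → Rule ν V (.cond b d (.ne x)) V []
  | and_true {d c₁ c₂} :
      Rule ν V (.cond true d (.and c₁ c₂)) V [.cond true d c₁, .cond true d c₂]
  | and_left {d c₁ c₂} : Rule ν V (.cond false d (.and c₁ c₂)) V [.cond false d c₁]
  | and_right {d c₁ c₂} : Rule ν V (.cond false d (.and c₁ c₂)) V [.cond false d c₂]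
  | or_left {d c₁ c₂} : Rule ν V (.cond true d (.or c₁ c₂)) V [.cond true d c₁]
  | or_right {d c₁ c₂} : Rule ν V (.cond true d (.or c₁ c₂)) V [.cond true d c₂]
  | or_false {d c₁ c₂} :
      Rule ν V (.cond false d (.or c₁ c₂)) V [.cond false d c₁, .cond false d c₂]
  | not {b d c} : Rule ν V (.cond b d (.not c)) V [.cond (!b) d c]

/-- Steps that keep the height of the stack below a bound. -/
def StackStep (ν : Valuation) (N : ℕ) (s s' : ℕ × List Item) : Prop :=
  ∃ it K l, s.2 = it :: K ∧ Rule E (env ν K) s.1 it s'.1 l ∧ s'.2 = l ++ K ∧ s'.2.length ≤ N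

/-- The stack can be worked off along a path from `V` to `t`. -/
def Works (ν : Valuation) : List Item → ℕ → ℕ → Prop
  | [], V, t => V = t
  | .ex r :: K, V, t => ∃ w ∈ r.lang (env ν K), ∃ m, Path E V w m ∧ Works ν K m t
  | .cond b d c :: K, V, t => (c.Sat d (env ν K) ↔ b = true) ∧ Works ν K V t
  | .frame _ _ :: K, V, t => Works ν K V t

variable {E} {ν : Valuation} {N : ℕ}

/-- Read backwards, a rule assembles a word for the replaced item from words matched by the new
ones. The frame pushed by `bind` makes the body see the updated valuation, and everything below the
frame the old one. -/
theorem Rule.works {K : List Item} {V V' t : ℕ} {it : Item} {l : List Item}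
    (h : Rule E (env ν K) V it V' l) (hw : Works E ν (l ++ K) V' t) : Works E ν (it :: K) V t := by
  cases h with
  | eps => exact ⟨[], rfl, V, rfl, hw⟩
  | letter hE => exact ⟨[_], ⟨_, rfl⟩, _, ⟨_, hE, rfl⟩, hw⟩
  | test hE => exact ⟨[_], ⟨_, hw.1.2 rfl, rfl⟩, _, ⟨_, hE, rfl⟩, hw.2⟩
  | plus_left =>
    obtain ⟨w, hw, m, h⟩ := hw
    exact ⟨w, Or.inl hw, m, h⟩
  | plus_right =>
    obtain ⟨w, hw, m, h⟩ := hw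
    exact ⟨w, Or.inr hw, m, h⟩
  | cat =>
    obtain ⟨w₁, hw₁, m₁, h₁, w₂, hw₂, m₂, h₂, h⟩ := hw
    exact ⟨_, Language.append_mem_mul hw₁ hw₂, m₂, (path_append E).2 ⟨_, h₁, h₂⟩, h⟩
  | star_nil => exact ⟨[], Language.nil_mem_kstar _, V, rfl, hw⟩
  | star_cons =>
    obtain ⟨w₁, hw₁, m₁, h₁, w₂, hw₂, m₂, h₂, h⟩ := hw
    refine ⟨w₁ ++ w₂, ?_, m₂, (path_append E).2 ⟨_, h₁, h₂⟩, h⟩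
    obtain ⟨L, rfl, hL⟩ := Language.mem_kstar.1 hw₂
    exact Language.mem_kstar.2 ⟨w₁ :: L, rfl, List.forall_mem_cons.2 ⟨hw₁, hL⟩⟩
  | bind hE =>
    obtain ⟨w, hw, m, h₁, h₂⟩ := hw
    exact ⟨_ :: w, ⟨_, w, hw, rfl⟩, m, ⟨_, hE, h₁⟩, h₂⟩
  | frame => exact hw
  | eq hb => exact ⟨hb, hw⟩
  | ne hb => exact ⟨hb, hw⟩
  | and_true => exact ⟨iff_of_true ⟨hw.1.2 rfl, hw.2.1.2 rfl⟩ rfl, hw.2.2⟩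
  | and_left => exact ⟨iff_of_false (fun h => absurd (hw.1.1 h.1) (by simp)) (by simp), hw.2⟩
  | and_right => exact ⟨iff_of_false (fun h => absurd (hw.1.1 h.2) (by simp)) (by simp), hw.2⟩
  | or_left => exact ⟨iff_of_true (Or.inl (hw.1.2 rfl)) rfl, hw.2⟩
  | or_right => exact ⟨iff_of_true (Or.inr (hw.1.2 rfl)) rfl, hw.2⟩
  | or_false =>
    exact ⟨iff_of_false (fun h => h.elim (fun h => absurd (hw.1.1 h) (by simp))
      fun h => absurd (hw.2.1.1 h) (by simp)) (by simp), hw.2.2⟩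
  | @not b d c =>
    refine ⟨?_, hw.2⟩
    have := hw.1
    cases b <;> simpa [Cond.Sat] using this

theorem works_of_reflTransGen {s : ℕ × List Item} {t : ℕ}
    (h : ReflTransGen (StackStep E ν N) s (t, [])) : Works E ν s.2 s.1 t := by
  induction h using ReflTransGen.head_induction_on with
  | refl => rfl
  | head h _ ih =>
    obtain ⟨it, K, l, h₁, h₂, h₃, -⟩ := h
    rw [h₁]
    exact h₂.works (h₃ ▸ ih)

theorem StackStep.intro {K : List Item} {V V' : ℕ} {it : Item} {l : List Item}
    (h : Rule E (env ν K) V it V' l) (hN : l.length + K.length ≤ N) :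
    StackStep E ν N (V, it :: K) (V', l ++ K) :=
  ⟨it, K, l, rfl, h, rfl, by simpa using hN⟩

/-- While one part of a condition is tested, at most the other part waits below it, so the size of
the condition bounds the height. Refutation is a test with flag `false`, which follows the laws of
De Morgan. -/
theorem reaches_of_sat {V : ℕ} {d : ℕ} : ∀ {c : Cond} {b : Bool} {K : List Item},
    (c.Sat d (env ν K) ↔ b = true) → K.length + c.size ≤ N →
    ReflTransGen (StackStep E ν N) (V, .cond b d c :: K) (V, K) := by
  intro c
  induction c with
  | eq x => exact fun h hN => .single (.intro (.eq h) (by simp [Cond.size] at *; omega))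
  | ne x => exact fun h hN => .single (.intro (.ne h) (by simp [Cond.size] at *; omega))
  | not c ih =>
    intro b K h hN
    simp only [Cond.size] at hN
    have := Cond.size_pos c
    refine .head (.intro .not (by simp; omega)) (ih (K := K) ?_ (by omega))
    cases b <;> simpa [Cond.Sat] using h
  | and c₁ c₂ ih₁ ih₂ =>
    intro b K h hN
    simp only [Cond.size] at hN
    have := Cond.size_pos c₁
    have := Cond.size_pos c₂
    cases b
    · by_cases h₁ : c₁.Sat d (env ν K)
      · have h₂ : ¬ c₂.Sat d (env ν K) := fun h₂ => absurd (h.1 ⟨h₁, h₂⟩) (by simp)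
        exact .head (.intro .and_right (by simp; omega)) (ih₂ (K := K) (by simpa using h₂) (by omega))
      · exact .head (.intro .and_left (by simp; omega)) (ih₁ (K := K) (by simpa using h₁) (by omega))
    · have h := h.2 rfl
      refine .head (.intro .and_true (by simp; omega)) ((ih₁ (K := .cond true d c₂ :: K)
        (iff_of_true h.1 rfl) ?_).trans (ih₂ (iff_of_true h.2 rfl) (by omega)))
      simp only [List.length_cons]
      omega
  | or c₁ c₂ ih₁ ih₂ =>
    intro b K h hN
    simp only [Cond.size] at hN
    have := Cond.size_pos c₁
    have := Cond.size_pos c₂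
    cases b
    · have h₁ : ¬ c₁.Sat d (env ν K) := fun h₁ => absurd (h.1 (Or.inl h₁)) (by simp)
      have h₂ : ¬ c₂.Sat d (env ν K) := fun h₂ => absurd (h.1 (Or.inr h₂)) (by simp)
      refine .head (.intro .or_false (by simp; omega)) ((ih₁ (K := .cond false d c₂ :: K)
        (iff_of_false h₁ (by simp)) ?_).trans (ih₂ (iff_of_false h₂ (by simp)) (by omega)))
      simp only [List.length_cons]
      omega
    · rcases h.2 rfl with h | h
      · exact .head (.intro .or_left (by simp; omega)) (ih₁ (K := K) (iff_of_true h rfl) (by omega))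
      · exact .head (.intro .or_right (by simp; omega)) (ih₂ (K := K) (iff_of_true h rfl) (by omega))

/-- While a proper part of `r` is matched, a single item waits for it: the second factor, the star
itself, or a frame. So the height grows by at most the size of `r`, however often a star is
iterated. -/
theorem reaches_of_mem_lang : ∀ {r : Expr} {w : DataWord} {V U : ℕ} {K : List Item},
    w ∈ r.lang (env ν K) → Path E V w U → K.length + r.size ≤ N →
    ReflTransGen (StackStep E ν N) (V, .ex r :: K) (U, K) := by
  intro r
  induction r with
  | eps =>
    rintro w V U K rfl hp hN
    cases hp
    exact .single (.intro .eps (by simp [Expr.size] at *; omega))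
  | letter a =>
    rintro w V U K ⟨d, rfl⟩ ⟨m, hE, rfl⟩ hN
    exact .single (.intro (.letter hE) (by simp [Expr.size] at *; omega))
  | test a c =>
    rintro w V U K ⟨d, hs, rfl⟩ ⟨m, hE, rfl⟩ hN
    simp only [Expr.size] at hN
    have := Cond.size_pos c
    exact .head (.intro (.test hE) (by simp; omega)) (reaches_of_sat (K := K)
      (iff_of_true hs rfl) (by omega))
  | plus r₁ r₂ ih₁ ih₂ =>
    intro w V U K hw hp hN
    simp only [Expr.size] at hN
    rcases hw with hw | hw
    · exact .head (.intro .plus_left (by simp; omega)) (ih₁ (K := K) hw hp (by omega))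
    · exact .head (.intro .plus_right (by simp; omega)) (ih₂ (K := K) hw hp (by omega))
  | cat r₁ r₂ ih₁ ih₂ =>
    intro w V U K hw hp hN
    simp only [Expr.size] at hN
    have := Expr.size_pos r₁
    obtain ⟨w₁, hw₁, w₂, hw₂, rfl⟩ := Language.mem_mul.1 hw
    obtain ⟨m, hp₁, hp₂⟩ := (path_append E).1 hp
    refine .head (.intro .cat (by simp; omega)) ((ih₁ (K := .ex r₂ :: K) hw₁ hp₁ ?_).trans
      (ih₂ hw₂ hp₂ (by omega)))
    simp only [List.length_cons]
    omega
  | star r ih =>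
    intro w V U K hw hp hN
    simp only [Expr.size] at hN
    have := Expr.size_pos r
    obtain ⟨L, rfl, hL⟩ := Language.mem_kstar.1 hw
    clear hw
    -- After each factor the stack is again the star on top of `K`, so the same height serves for
    -- all iterations.
    induction L generalizing V with
    | nil =>
      cases hp
      exact .single (.intro .star_nil (by simp; omega))
    | cons w₁ L ihL =>
      obtain ⟨hw₁, hL⟩ := List.forall_mem_cons.1 hL
      obtain ⟨m, hp₁, hp₂⟩ := (path_append E).1 hp
      refine .head (.intro .star_cons (by simp; omega)) ((ih (K := .ex (.star r) :: K) hw₁ hp₁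
        ?_).trans (ihL hL hp₂))
      simp only [List.length_cons]
      omega
  | bind a x r ih =>
    rintro w V U K ⟨d, w', hw, rfl⟩ ⟨m, hE, hp⟩ hN
    simp only [Expr.size] at hN
    have := Expr.size_pos r
    refine .head (.intro (.bind hE) (by simp; omega)) (.tail (ih (K := .frame x d :: K) hw hp ?_)
      (.intro .frame (by simp; omega)))
    simp only [List.length_cons]
    omega

theorem reaches_iff {r : Expr} {V t : ℕ} :
    ReflTransGen (StackStep E ν r.size) (V, [.ex r]) (t, []) ↔ ∃ w ∈ r.lang ν, Path E V w t := by
  constructor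
  · intro h
    obtain ⟨w, hw, m, hp, rfl⟩ := works_of_reflTransGen h
    exact ⟨w, hw, hp⟩
  · rintro ⟨w, hw, h⟩
    exact reaches_of_mem_lang (K := []) hw h (by simp)

end StackMachine

end XNL

/-! ### Stacks in the array, and the lookup of variables. -/

namespace XNL

open Relation Function REWB

section Coding

variable {I : Inp Sym} {n : ℕ}

/-! ### Coding stacks by arrays -/

/-- Code of a stack item by positions of the input tape. -/
def ItemAt (I : Inp Sym) (p e f : ℕ) : Item → Prop
  | .ex r => ∃ q, Seg I p (encExpr r) q
  | .cond b d c => (∃ q, Seg I p (encCond c) q) ∧ NumAt I e d ∧ (f = 0 ↔ b = true)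
  | .frame x d => NumAt I p x ∧ NumAt I e d

/-- The rows of the array code the stack, with its bottom in row `0`. -/
def Stk (I : Inp Sym) (A : ℕ → ℕ → ℕ) : List Item → Prop
  | [] => True
  | it :: K => ItemAt I (A K.length 0) (A K.length 1) (A K.length 2) it ∧ Stk I A K

theorem Stk.congr {A A' : ℕ → ℕ → ℕ} : ∀ {K : List Item}, (∀ i, i < K.length → A' i = A i) →
    Stk I A K → Stk I A' K
  | [], _, _ => trivial
  | it :: K, h, hK => ⟨by rw [h _ (by simp)]; exact hK.1,
      hK.2.congr fun i hi => h i (by simp; omega)⟩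

/-- These are the symbols at which numerals can start. They distinguish frames, whose first entry is
the position of a variable, from all other items. -/
def digits : Set (InSym Sym) := {.sym .bit0, .sym .bit1, .sym .numEnd}

theorem NumAt.digit {p m : ℕ} (h : NumAt I p m) : sy I p ∈ digits := by
  obtain ⟨q, h⟩ := h
  rcases hw : encNat m with _ | ⟨s, w⟩
  · simp [encNat] at hw
  · have hs := mem_encNat (hw ▸ List.mem_cons_self : s ∈ encNat m)
    rw [hw] at h
    rw [h.1]
    simpa [digits] using hs

theorem SameNum.digit {p q : ℕ} (h : SameNum I p q) : sy I p ∈ digits :=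
  h.elim fun _ ⟨_, _, h, _⟩ => NumAt.digit ⟨_, h⟩

/-- Row `j` of the array does not bind the variable at `x`. -/
def Skip (I : Inp Sym) (A : ℕ → ℕ → ℕ) (x i j : ℕ) : Prop :=
  i = j + 1 ∧ ∃ q, (j < rows I ∧ q = A j 0) ∧ (sy I q ∈ digitsᶜ ∨ DiffNum I q x)

/-- Row `j` of the array binds the variable at `x` to a value that satisfies `R`. -/
def Hit (I : Inp Sym) (R : ℕ → Prop) (A : ℕ → ℕ → ℕ) (x i : ℕ) : Prop :=
  ∃ j, i = j + 1 ∧ ∃ q, (j < rows I ∧ q = A j 0) ∧ SameNum I q x ∧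
    ∃ d, (j < rows I ∧ d = A j 1) ∧ R d

/-- The last binding of the variable at `x` below row `i` is to a value that satisfies `R`, or `B`
holds and there is no such binding. -/
def Lookup (I : Inp Sym) (B : Prop) (R : ℕ → Prop) (A : ℕ → ℕ → ℕ) (x i : ℕ) : Prop :=
  ∃ j, ReflTransGen (Skip I A x) i j ∧ ((j = 0 ∧ B) ∨ Hit I R A x j)

theorem lookup_zero {B : Prop} {R : ℕ → Prop} {A : ℕ → ℕ → ℕ} {x : ℕ} :
    Lookup I B R A x 0 ↔ B := by
  constructor
  · rintro ⟨j, h, h'⟩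
    rcases h.cases_head with rfl | ⟨_, ⟨h, -⟩, -⟩
    · rcases h' with h' | ⟨_, h', -⟩
      · exact h'.2
      · omega
    · omega
  · exact fun h => ⟨0, .refl, Or.inl ⟨rfl, h⟩⟩

theorem lookup_succ {B : Prop} {R : ℕ → Prop} {A : ℕ → ℕ → ℕ} {x i : ℕ} (hi : i < rows I) :
    Lookup I B R A x (i + 1) ↔
      ((sy I (A i 0) ∈ digitsᶜ ∨ DiffNum I (A i 0) x) ∧ Lookup I B R A x i) ∨
      (SameNum I (A i 0) x ∧ R (A i 1)) := by
  constructor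
  · rintro ⟨j, h, h'⟩
    rcases h.cases_head with rfl | ⟨_, ⟨h₁, _, ⟨-, rfl⟩, h₂⟩, h₃⟩
    · rcases h' with h' | ⟨_, h₁, _, ⟨-, rfl⟩, h₂, _, ⟨-, rfl⟩, h₃⟩
      · omega
      · obtain rfl := Nat.succ.inj h₁
        exact Or.inr ⟨h₂, h₃⟩
    · obtain rfl := Nat.succ.inj h₁
      exact Or.inl ⟨h₂, j, h₃, h'⟩
  · rintro (⟨h, j, h₁, h₂⟩ | ⟨h₁, h₂⟩)
    · exact ⟨j, .head ⟨rfl, _, ⟨hi, rfl⟩, h⟩ h₁, h₂⟩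
    · exact ⟨_, .refl, Or.inr ⟨_, rfl, _, ⟨hi, rfl⟩, h₁, _, ⟨hi, rfl⟩, h₂⟩⟩

theorem not_digit_of_expr {p q : ℕ} {r : Expr} (h : Seg I p (encExpr r) q) :
    sy I p ∉ digits := by
  cases r <;> rw [h.1] <;> simp [digits]

theorem not_digit_of_cond {p q : ℕ} {c : Cond} (h : Seg I p (encCond c) q) :
    sy I p ∉ digits := by
  cases c <;> rw [h.1] <;> simp [digits]

/-- The search goes down from the top and so meets the innermost binding first, as `env` demands.
`T` is the property in question of the value; `B` decides it for the given valuation and `R` for a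
value bound in a frame. Two instances of `T`, equality with a value and difference from it, are
used. -/
theorem lookup_iff {B : Prop} {R : ℕ → Prop} {A : ℕ → ℕ → ℕ} {x m : ℕ} {ν : Valuation}
    {T : Option ℕ → Prop} (hx : NumAt I x m) (hB : B ↔ T (ν m))
    (hR : ∀ d y, NumAt I y d → (R y ↔ T (some d))) : ∀ {K : List Item}, Stk I A K →
      K.length ≤ rows I → (Lookup I B R A x K.length ↔ T (env ν K m))
  | [], _, _ => lookup_zero.trans hB
  | it :: K, hK, hr => by
    have hlt : K.length < rows I := hr
    have ih := lookup_iff hx hB hR hK.2 hlt.le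
    have hskip : sy I (A K.length 0) ∉ digits →
        (Lookup I B R A x (it :: K).length ↔ T (env ν K m)) := fun hd => by
      rw [List.length_cons, lookup_succ hlt, ih]
      exact ⟨fun h => h.elim (·.2) fun h => absurd h.1.digit hd, fun h => Or.inl ⟨Or.inl hd, h⟩⟩
    cases it with
    | ex r => exact hskip (hK.1.elim fun _ h => not_digit_of_expr h)
    | cond b d c => exact hskip (hK.1.1.elim fun _ h => not_digit_of_cond h)
    | frame y d =>
      obtain ⟨⟨h₁, h₂⟩, -⟩ := hK
      rw [List.length_cons, lookup_succ hlt, ih, h₁.same_iff hx, h₁.diff_iff hx, hR _ _ h₂]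
      by_cases hy : m = y
      · subst hy
        simp [env, h₁.digit]
      · simp [env, hy, Ne.symm hy]

def EnvIs (I : Inp Sym) (A : ℕ → ℕ → ℕ) (i x e : ℕ) : Prop :=
  Lookup I (∃ g u, SameNum I u x ∧ ∃ v, EntryPos I g u v ∧ SameNum I v e) (fun d => SameNum I d e)
    A x i

/-- On well-formed codes this complements `EnvIs`; it is defined independently because negation is
not available. -/
def EnvNot (I : Inp Sym) (A : ℕ → ℕ → ℕ) (i x e : ℕ) : Prop :=
  Lookup I (∀ g, g < bd I → sy I g ∈ ({.sym .entry}ᶜ : Set (InSym Sym)) ∨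
    ∃ u v, EntryPos I g u v ∧ (DiffNum I u x ∨ DiffNum I v e)) (fun d => DiffNum I d e) A x i

variable {p₁ p₂ p₃ p₄ p₅ : ℕ} {D : Data} {ν : Valuation} {A : ℕ → ℕ → ℕ} {K : List Item}

theorem envIs_iff (hL : Layout I p₁ p₂ p₃ p₄ p₅ D) (hν : ∀ y d, (y, d) ∈ D.vs ↔ ν y = some d)
    (hK : Stk I A K) (hr : K.length ≤ rows I) {x m e d : ℕ} (hx : NumAt I x m)
    (he : NumAt I e d) : EnvIs I A K.length x e ↔ env ν K m = some d := by
  refine lookup_iff (T := fun o => o = some d) hx ?_ (fun d' y hy => ?_) hK hr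
  · rw [← hν]
    constructor
    · rintro ⟨g, u, h₁, v, h₂, h₃⟩
      obtain ⟨⟨y, d'⟩, h₄, h₅, h₆⟩ := hL.entryPos_mem h₂
      rw [h₅.same_iff hx] at h₁
      rw [h₆.same_iff he] at h₃
      dsimp only at h₁ h₃
      exact h₁ ▸ h₃ ▸ h₄
    · intro h
      obtain ⟨g, u, v, h₁, h₂, h₃⟩ := hL.exists_entryPos h
      exact ⟨g, u, (h₂.same_iff hx).2 rfl, v, h₁, (h₃.same_iff he).2 rfl⟩
  · rw [hy.same_iff he, Option.some.injEq]

theorem envNot_iff (hL : Layout I p₁ p₂ p₃ p₄ p₅ D) (hν : ∀ y d, (y, d) ∈ D.vs ↔ ν y = some d)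
    (hK : Stk I A K) (hr : K.length ≤ rows I) {x m e d : ℕ} (hx : NumAt I x m)
    (he : NumAt I e d) : EnvNot I A K.length x e ↔ env ν K m ≠ some d := by
  refine lookup_iff (T := fun o => o ≠ some d) hx ?_ (fun d' y hy => ?_) hK hr
  · rw [ne_eq, ← hν]
    constructor
    · intro h hm
      obtain ⟨g, u, v, h₁, h₂, h₃⟩ := hL.exists_entryPos hm
      rcases h g h₁.lt_bd.1 with h | ⟨u', v', h₄, h₅⟩
      · exact h h₁.1
      · obtain ⟨rfl, rfl⟩ := h₁.unique h₄
        rw [h₂.diff_iff hx, h₃.diff_iff he] at h₅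
        simp at h₅
    · intro h g _
      by_cases hg : sy I g = .sym .entry
      · obtain ⟨⟨y, d'⟩, h₁, u, v, h₂, h₃, h₄⟩ := hL.entryPos hg
        refine Or.inr ⟨u, v, h₂, ?_⟩
        rw [h₃.diff_iff hx, h₄.diff_iff he, ← not_and_or]
        rintro ⟨rfl, rfl⟩
        exact h h₁
      · exact Or.inl hg
  · rw [hy.diff_iff he, ne_eq, ne_eq, Option.some.injEq]

theorem SameNum.lt_bd {p q : ℕ} (h : SameNum I p q) : p < bd I ∧ q < bd I :=
  h.elim fun _ ⟨_, _, h, h'⟩ => ⟨h.lt_bd_of_encNat.1, h'.lt_bd_of_encNat.1⟩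

end Coding

end XNL

/-! ### Steps of the stack machine as definable predicates. -/

namespace XNL

open Relation Function REWB

section StepFormula

variable {I : Inp Sym} {n : ℕ}

/-! ### One step of the stack machine as a predicate on the input and the array -/

/-- Quantification over an entry of the array. -/
theorem Dfn.exArr {α : Type} {Q : Inp α → (ℕ → ℕ → ℕ) → (Fin n → ℕ) → ℕ → Prop} (j : ℕ) (i : Fin n)
    (h : Dfn (n := n + 1) (fun I A ρ => Q I A (Fin.init ρ) (ρ (Fin.last n)))) :
    Dfn (fun I A ρ => ∃ v, (ρ i < rows I ∧ v = A (ρ i) j) ∧ Q I A ρ v) := by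
  obtain ⟨p, hp⟩ := Dfn.ex (Q := fun I A ρ v => (ρ i < rows I ∧ v = A (ρ i) j) ∧ Q I A ρ v)
    (.and (.arr j (Var.proj i).init .last) h)
  refine ⟨p, fun I s hs s' => (hp I s hs s').trans (and_congr_right fun _ => exists_congr
    fun v => and_iff_right_of_imp ?_)⟩
  rintro ⟨⟨-, rfl⟩, -⟩
  exact hs.valid.arr _ _

theorem dfn_lookup {R B : Inp Sym → ℕ → ℕ → Prop}
    (hR : ∀ {n} (i j : Fin n), Dfn fun I _ ρ => R I (ρ i) (ρ j))
    (hB : ∀ {n} (i j : Fin n), Dfn fun I _ ρ => B I (ρ i) (ρ j)) (i x e : Fin n) :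
    Dfn fun I A ρ => Lookup I (B I (ρ x) (ρ e)) (fun d => R I d (ρ e)) A (ρ x) (ρ i) := by
  refine .exb (.and (.rtg ((Dfn.suc _ _).and (.exArr 0 _ ((Dfn.sym _ (.proj _)).or
    (dfn_diffNum _ _)))) ?_ _ _) (.or ((Dfn.isZero _).and (hB _ _)) (.exb ((Dfn.suc _ _).and
    (.exArr 0 _ ((dfn_sameNum _ _).and (.exArr 1 _ (hR _ _))))) ?_))) ?_
  · exact fun I _ _ _ _ _ h => h.2.elim fun _ h => h.1.1.trans (rows_lt_bd I)
  · exact fun I _ _ _ _ h => h.2.elim fun _ h => h.1.1.trans (rows_lt_bd I)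
  · rintro I A ρ v - ⟨-, ⟨rfl, -⟩ | ⟨_, rfl, _, ⟨h, -⟩, -⟩⟩
    · exact bd_pos I
    · exact (Nat.succ_le_of_lt h).trans_lt (rows_lt_bd I)

/-- In this and the next two patterns `w 1` is the new height, and `w 2`, `w 6` are the rows to be
overwritten. After a pop, row `i` receives arbitrary contents; it is above the stack now. -/
def Pop (i : ℕ) (w : Fin 10 → ℕ) : Prop := w 1 = i ∧ w 2 = i ∧ w 6 = i

/-- Both writes go to row `i`, and the second one prevails, with the contents `w 7`, `w 8`, `w 9`.
-/
def One (i : ℕ) (w : Fin 10 → ℕ) (p e f : ℕ) : Prop :=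
  w 1 = i + 1 ∧ w 2 = i ∧ w 6 = i ∧ w 7 = p ∧ w 8 = e ∧ w 9 = f

/-- The unprimed item is the new top in row `i + 1`; the primed one takes row `i` below it. -/
def Two (i : ℕ) (w : Fin 10 → ℕ) (p e f p' e' f' : ℕ) : Prop :=
  w 6 = i + 1 ∧ w 1 = w 6 + 1 ∧ w 2 = i ∧ (w 7 = p ∧ w 8 = e ∧ w 9 = f) ∧
    w 3 = p' ∧ w 4 = e' ∧ w 5 = f'

/-- Steps that involve neither edges nor conditions. -/
def PlainStep (I : Inp Sym) (V i p e f : ℕ) (w : Fin 10 → ℕ) : Prop :=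
  w 0 = V ∧ (((sy I p = .sym .eps ∨ sy I p = .sym .star ∨ sy I p ∈ digits) ∧ Pop i w) ∨
    ∃ p', p' = p + 1 ∧ ((sy I p = .sym .star ∧ Two i w p' e f p e f) ∨
      (sy I p = .sym .plus ∧ (One i w p' e f ∨ ∃ q, ExprAt I p' q ∧ One i w q e f)) ∨
      (sy I p = .sym .cat ∧ ∃ q, ExprAt I p' q ∧ Two i w p' e f q e f)))

/-- Steps along an edge. -/
def EdgeMove (I : Inp Sym) (V i p e f : ℕ) (w : Fin 10 → ℕ) : Prop :=
  ∃ a, a = p + 1 ∧ ∃ u, SameNum I u V ∧ ∃ b, SameNum I b a ∧ ∃ d, EdgePos I u b d (w 0) ∧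
    ((sy I p = .sym .letter ∧ Pop i w) ∨
    (sy I p = .sym .test ∧ ∃ q, IsNum I a q ∧ ∃ z, z = 0 ∧ One i w q d z) ∨
    (sy I p = .sym .bind ∧ ∃ x, IsNum I a x ∧ ∃ q, IsNum I x q ∧ Two i w q e f x d f))

/-- Steps that process a condition. -/
def CondStep (I : Inp Sym) (A : ℕ → ℕ → ℕ) (V i p e f : ℕ) (w : Fin 10 → ℕ) : Prop :=
  w 0 = V ∧ ∃ p', p' = p + 1 ∧
    ((((sy I p = .sym .eq ∧ f = 0) ∨ (sy I p = .sym .ne ∧ 0 < f)) ∧ EnvIs I A i p' e ∧ Pop i w) ∨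
    (((sy I p = .sym .eq ∧ 0 < f) ∨ (sy I p = .sym .ne ∧ f = 0)) ∧ EnvNot I A i p' e ∧ Pop i w) ∨
    (((sy I p = .sym .and ∧ f = 0) ∨ (sy I p = .sym .or ∧ 0 < f)) ∧
      ∃ q, CondAt I p' q ∧ Two i w p' e f q e f) ∨
    (((sy I p = .sym .and ∧ 0 < f) ∨ (sy I p = .sym .or ∧ f = 0)) ∧
      (One i w p' e f ∨ ∃ q, CondAt I p' q ∧ One i w q e f)) ∨
    (sy I p = .sym .not ∧ ∃ f', ((f = 0 ∧ f' = f + 1) ∨ (0 < f ∧ f' = 0)) ∧ One i w p' e f'))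

def MachineStep (I : Inp Sym) (A : ℕ → ℕ → ℕ) (V i p e f : ℕ) (w : Fin 10 → ℕ) : Prop :=
  PlainStep I V i p e f w ∨ EdgeMove I V i p e f w ∨ CondStep I A V i p e f w

theorem CondAt.lt_bd {p q : ℕ} (h : CondAt I p q) : p < bd I ∧ q < bd I := by
  obtain ⟨c, h⟩ := h
  have hp : p < bd I := by
    cases c <;> exact (Nat.lt_succ_self _).trans (lt_bd_of_sym h.1)
  exact ⟨hp, Seg.lt_bd h hp⟩

theorem dfn_envIs (i x e : Fin n) : Dfn fun I A ρ => EnvIs I A (ρ i) (ρ x) (ρ e) := by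
  refine dfn_lookup (B := fun I x e => ∃ g u, SameNum I u x ∧ ∃ v, EntryPos I g u v ∧
    SameNum I v e) dfn_sameNum (fun i j => ?_) i x e
  refine .exb (.exb ((dfn_sameNum _ _).and (.exb ((dfn_entryPos _ _ _).and (dfn_sameNum _ _))
    ?_)) ?_) ?_
  · exact fun _ _ _ _ _ h => h.1.lt_bd.2.2
  · exact fun _ _ _ _ _ h => h.1.lt_bd.1
  · exact fun _ _ _ _ _ ⟨_, _, _, h, _⟩ => h.lt_bd.1

theorem dfn_envNot (i x e : Fin n) : Dfn fun I A ρ => EnvNot I A (ρ i) (ρ x) (ρ e) := by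
  refine dfn_lookup (B := fun I x e => ∀ g, g < bd I → sy I g ∈
    ({.sym .entry}ᶜ : Set (InSym Sym)) ∨ ∃ u v, EntryPos I g u v ∧ (DiffNum I u x ∨ DiffNum I v e))
    dfn_diffNum (fun i j => ?_) i x e
  refine .all (.or (.sym _ (.proj _)) (.exb (.exb ((dfn_entryPos _ _ _).and
    ((dfn_diffNum _ _).or (dfn_diffNum _ _))) ?_) ?_))
  · exact fun _ _ _ _ _ h => h.1.lt_bd.2.2
  · exact fun _ _ _ _ _ ⟨_, h, _⟩ => h.lt_bd.2.1

theorem dfn_pop (i : Fin n) (o : Fin 10 → Fin n) :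
    Dfn (α := Sym) fun _ _ ρ => Pop (ρ i) (fun t => ρ (o t)) :=
  (Dfn.eqv _ _).and ((Dfn.eqv _ _).and (Dfn.eqv _ _))

theorem dfn_one (i p e f : Fin n) (o : Fin 10 → Fin n) :
    Dfn (α := Sym) fun _ _ ρ => One (ρ i) (fun t => ρ (o t)) (ρ p) (ρ e) (ρ f) :=
  (Dfn.suc _ _).and ((Dfn.eqv _ _).and ((Dfn.eqv _ _).and ((Dfn.eqv _ _).and
    ((Dfn.eqv _ _).and (Dfn.eqv _ _)))))

theorem dfn_two (i p e f p' e' f' : Fin n) (o : Fin 10 → Fin n) : Dfn (α := Sym) fun _ _ ρ =>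
    Two (ρ i) (fun t => ρ (o t)) (ρ p) (ρ e) (ρ f) (ρ p') (ρ e') (ρ f') :=
  (Dfn.suc _ _).and ((Dfn.suc _ _).and ((Dfn.eqv _ _).and (.and ((Dfn.eqv _ _).and
    ((Dfn.eqv _ _).and (Dfn.eqv _ _))) ((Dfn.eqv _ _).and ((Dfn.eqv _ _).and (Dfn.eqv _ _))))))

theorem dfn_plainStep (v i p e f : Fin n) (o : Fin 10 → Fin n) : Dfn fun I _ ρ =>
    PlainStep I (ρ v) (ρ i) (ρ p) (ρ e) (ρ f) (fun t => ρ (o t)) := by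
  refine .and (Dfn.eqv _ _) (.or (.and (.or (.isSym _ _) (.or (.isSym _ _) (.sym _ (.proj _))))
    (dfn_pop _ _)) (.exb (.and (.suc _ _) (.or (.and (.isSym _ _) (dfn_two _ _ _ _ _ _ _ _)) (.or
    (.and (.isSym _ _) (.or (dfn_one _ _ _ _ _) (.exb (.and (dfn_exprAt _ _) (dfn_one _ _ _ _ _))
    ?_))) (.and (.isSym _ _) (.exb (.and (dfn_exprAt _ _) (dfn_two _ _ _ _ _ _ _ _)) ?_))))) ?_))
  · exact fun _ _ _ _ _ h => h.1.lt_bd.2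
  · exact fun _ _ _ _ _ h => h.1.lt_bd.2
  · rintro I A ρ v - ⟨rfl, h | h | h⟩ <;> exact lt_bd_of_sym h.1

theorem EdgePos.lt_bd {u₁ u₂ u₃ u₄ : ℕ} (h : EdgePos I u₁ u₂ u₃ u₄) : u₃ < bd I :=
  h.2.2.1.elim fun _ h => h.lt_bd_of_encNat.2

theorem dfn_edgeMove (v i p e f : Fin n) (o : Fin 10 → Fin n) : Dfn fun I _ ρ =>
    EdgeMove I (ρ v) (ρ i) (ρ p) (ρ e) (ρ f) (fun t => ρ (o t)) := by
  refine .exb (.and (.suc _ _) (.exb (.and (dfn_sameNum _ _) (.exb (.and (dfn_sameNum _ _) (.exb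
    (.and (dfn_edgePos _ _ _ _) (.or (.and (.isSym _ _) (dfn_pop _ _)) (.or (.and (.isSym _ _)
    (.exb (.and (dfn_isNum _ _) (.exb (.and (.isZero _) (dfn_one _ _ _ _ _)) ?_)) ?_)) (.and
    (.isSym _ _) (.exb (.and (dfn_isNum _ _) (.exb (.and (dfn_isNum _ _)
    (dfn_two _ _ _ _ _ _ _ _)) ?_)) ?_))))) ?_)) ?_)) ?_)) ?_
  · exact fun I _ _ _ _ h => h.1 ▸ bd_pos I
  · exact fun _ _ _ _ _ ⟨⟨_, h⟩, _⟩ => h.lt_bd_of_encNat.2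
  · exact fun _ _ _ _ _ ⟨⟨_, h⟩, _⟩ => h.lt_bd_of_encNat.2
  · exact fun _ _ _ _ _ ⟨⟨_, h⟩, _⟩ => h.lt_bd_of_encNat.2
  · exact fun _ _ _ _ _ h => h.1.lt_bd
  · exact fun _ _ _ _ _ h => h.1.lt_bd.1
  · exact fun _ _ _ _ _ h => h.1.lt_bd.1
  · exact fun _ _ _ _ _ ⟨_, _, _, _, h, _⟩ => h.lt_bd.2

theorem dfn_condStep (v i p e f : Fin n) (o : Fin 10 → Fin n) : Dfn fun I A ρ =>
    CondStep I A (ρ v) (ρ i) (ρ p) (ρ e) (ρ f) (fun t => ρ (o t)) := by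
  have hc : ∀ {n : ℕ} (s s' : Sym) (p f : Fin n), Dfn fun I _ ρ =>
      (sy I (ρ p) = .sym s ∧ ρ f = 0) ∨ (sy I (ρ p) = .sym s' ∧ 0 < ρ f) := fun s s' p f =>
    .or (.and (.isSym _ _) (.isZero _)) (.and (.isSym _ _) (.pos _))
  have hc' : ∀ {n : ℕ} (s s' : Sym) (p f : Fin n), Dfn fun I _ ρ =>
      (sy I (ρ p) = .sym s ∧ 0 < ρ f) ∨ (sy I (ρ p) = .sym s' ∧ ρ f = 0) := fun s s' p f =>
    .or (.and (.isSym _ _) (.pos _)) (.and (.isSym _ _) (.isZero _))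
  refine .and (.eqv _ _) (.exb (.and (.suc _ _) (.or (.and (hc _ _ _ _) (.and (dfn_envIs _ _ _)
    (dfn_pop _ _))) (.or (.and (hc' _ _ _ _) (.and (dfn_envNot _ _ _) (dfn_pop _ _))) (.or (.and
    (hc _ _ _ _) (.exb (.and (dfn_condAt _ _) (dfn_two _ _ _ _ _ _ _ _)) ?_)) (.or (.and
    (hc' _ _ _ _) (.or (dfn_one _ _ _ _ _) (.exb (.and (dfn_condAt _ _) (dfn_one _ _ _ _ _)) ?_)))
    (.and (.isSym _ _) (.exb (.and (.or (.and (.isZero _) (.suc _ _)) (.and (.pos _) (.isZero _)))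
    (dfn_one _ _ _ _ _)) ?_))))))) ?_)
  · exact fun _ _ _ _ _ h => h.1.lt_bd.2
  · exact fun _ _ _ _ _ h => h.1.lt_bd.2
  · exact fun _ _ _ _ hρ h => h.2.2.2.2.2.2.symm.trans_lt (hρ _)
  · rintro I A ρ v - ⟨rfl, ⟨h | h, -⟩ | ⟨h | h, -⟩ | ⟨h | h, -⟩ | ⟨h | h, -⟩ | h⟩ <;>
      exact lt_bd_of_sym h.1

theorem dfn_machineStep (v i p e f : Fin n) (o : Fin 10 → Fin n) : Dfn fun I A ρ =>
    MachineStep I A (ρ v) (ρ i) (ρ p) (ρ e) (ρ f) (fun t => ρ (o t)) :=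
  (dfn_plainStep _ _ _ _ _ _).or ((dfn_edgeMove _ _ _ _ _ _).or (dfn_condStep _ _ _ _ _ _))

end StepFormula

end XNL

/-! ### Correctness of the step predicate. -/

namespace XNL

open Relation Function REWB

section Simulation

variable {I : Inp Sym} {p₁ p₂ p₃ p₄ p₅ : ℕ} {D : Data} {ν : Valuation} {A : ℕ → ℕ → ℕ}
  {K : List Item}

/-! ### The simulation of the stack machine -/

theorem ExprAt.split {p m q : ℕ} {r : Expr} {w : List Sym} (h : ExprAt I p m)
    (hw : Seg I p (encExpr r ++ w) q) : Seg I p (encExpr r) m ∧ Seg I m w q := by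
  obtain ⟨m', h₁, h₂⟩ := seg_append.1 hw
  obtain ⟨r', h⟩ := h
  obtain rfl := (encExpr_prefix h h₁).2
  exact ⟨h₁, h₂⟩

theorem CondAt.split {p m q : ℕ} {c : Cond} {w : List Sym} (h : CondAt I p m)
    (hw : Seg I p (encCond c ++ w) q) : Seg I p (encCond c) m ∧ Seg I m w q := by
  obtain ⟨m', h₁, h₂⟩ := seg_append.1 hw
  obtain ⟨r', h⟩ := h
  obtain rfl := (encCond_prefix h h₁).2
  exact ⟨h₁, h₂⟩

theorem IsNum.split {p m q a : ℕ} {w : List Sym} (h : IsNum I p m)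
    (hw : Seg I p (encNat a ++ w) q) : Seg I p (encNat a) m ∧ Seg I m w q := by
  obtain ⟨m', h₁, h₂⟩ := seg_append.1 hw
  obtain ⟨r', h⟩ := h
  obtain rfl := (encNat_prefix h h₁).2
  exact ⟨h₁, h₂⟩

/-- The effect of a step on the stack, when the item in row `i` is replaced by the given items. -/
def Effect (I : Inp Sym) (i : ℕ) (w : Fin 10 → ℕ) : List Item → Prop
  | [] => Pop i w
  | [a] => ∃ p e f, One i w p e f ∧ ItemAt I p e f a
  | [a, b] => ∃ p e f p' e' f', Two i w p e f p' e' f' ∧ ItemAt I p e f a ∧ ItemAt I p' e' f' b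
  | _ => False

theorem edge_sound (hL : Layout I p₁ p₂ p₃ p₄ p₅ D) {u b d v pV pa V a : ℕ}
    (hV : NumAt I pV V) (ha : NumAt I pa a) (h₁ : SameNum I u pV) (h₂ : SameNum I b pa)
    (h : EdgePos I u b d v) : ∃ d' V', (V, a, d', V') ∈ D.es ∧ NumAt I d d' ∧ NumAt I v V' := by
  obtain ⟨⟨V₀, a₀, d', V'⟩, he, h₃, h₄, h₅, h₆⟩ := hL.edgePos h
  rw [h₃.same_iff hV] at h₁
  rw [h₄.same_iff ha] at h₂
  dsimp only at *
  exact ⟨d', V', h₁ ▸ h₂ ▸ he, h₅, h₆⟩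

/-- The symbol at the first entry of the coded item leaves only the matching alternatives of
`MachineStep`, and unique readability turns guessed boundaries into those of the actual parts. -/
theorem machineStep_sound (hL : Layout I p₁ p₂ p₃ p₄ p₅ D)
    (hν : ∀ y d, (y, d) ∈ D.vs ↔ ν y = some d) (hK : Stk I A K) (hr : K.length ≤ rows I)
    {pV V p e f : ℕ} {it : Item} {w : Fin 10 → ℕ} (hV : NumAt I pV V) (hit : ItemAt I p e f it)
    (h : MachineStep I A pV K.length p e f w) : ∃ V' l,
      Rule (fun V a d V' => (V, a, d, V') ∈ D.es) (env ν K) V it V' l ∧ NumAt I (w 0) V' ∧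
      Effect I K.length w l := by
  rcases it with (_ | a | ⟨a, c⟩ | ⟨r₁, r₂⟩ | ⟨r₁, r₂⟩ | r | ⟨a, x, r⟩) | ⟨b, d, c⟩ | ⟨x, d⟩
  · obtain ⟨q, hs, -⟩ := hit
    simp [MachineStep, PlainStep, EdgeMove, CondStep, hs, digits] at h
    exact ⟨_, _, .eps, h.1 ▸ hV, h.2⟩
  · obtain ⟨q, hs, ha⟩ := hit
    simp [MachineStep, PlainStep, EdgeMove, CondStep, hs, digits] at h
    obtain ⟨u, h₁, b, h₂, ⟨d, h₃⟩, h₄⟩ := h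
    obtain ⟨d', V', h₅, -, h₆⟩ := edge_sound hL hV ⟨_, ha⟩ h₁ h₂ h₃
    exact ⟨_, _, .letter h₅, h₆, h₄⟩
  · obtain ⟨q, hs, ha⟩ := hit
    simp [MachineStep, PlainStep, EdgeMove, CondStep, hs, digits] at h
    obtain ⟨u, h₁, b, h₂, d, h₃, m, h₄, h₅⟩ := h
    obtain ⟨ha, hc⟩ := h₄.split ha
    obtain ⟨d', V', h₅, h₆, h₇⟩ := edge_sound hL hV ⟨_, ha⟩ h₁ h₂ h₃
    exact ⟨_, _, .test h₅, h₇, _, _, _, ‹One _ _ _ _ _›, ⟨_, hc⟩, h₆, by simp⟩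
  · obtain ⟨q, hs, h₁⟩ := hit
    simp [MachineStep, PlainStep, EdgeMove, CondStep, hs, digits] at h
    obtain ⟨h₀, h | ⟨m, h₂, h⟩⟩ := h
    · obtain ⟨m, h₂, -⟩ := seg_append.1 h₁
      exact ⟨_, _, .plus_left, h₀ ▸ hV, _, _, _, h, _, h₂⟩
    · exact ⟨_, _, .plus_right, h₀ ▸ hV, _, _, _, h, _, (h₂.split h₁).2⟩
  · obtain ⟨q, hs, h₁⟩ := hit
    simp [MachineStep, PlainStep, EdgeMove, CondStep, hs, digits] at h
    obtain ⟨h₀, m, h₂, h⟩ := h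
    obtain ⟨h₃, h₄⟩ := h₂.split h₁
    exact ⟨_, _, .cat, h₀ ▸ hV, _, _, _, _, _, _, h, ⟨_, h₃⟩, _, h₄⟩
  · obtain ⟨q, hq⟩ := id hit
    simp [MachineStep, PlainStep, EdgeMove, CondStep, hq.1, digits] at h
    obtain ⟨h₀, h | h⟩ := h
    · exact ⟨_, _, .star_nil, h₀ ▸ hV, h⟩
    · exact ⟨_, _, .star_cons, h₀ ▸ hV, _, _, _, _, _, _, h, ⟨_, hq.2⟩, hit⟩
  · obtain ⟨q, hs, ha⟩ := hit
    simp [MachineStep, PlainStep, EdgeMove, CondStep, hs, digits] at h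
    obtain ⟨u, h₁, b, h₂, d, h₃, m, h₄, m', h₅, h⟩ := h
    rw [List.append_assoc] at ha
    obtain ⟨ha, hx⟩ := h₄.split ha
    obtain ⟨hx, hr⟩ := h₅.split hx
    obtain ⟨d', V', h₅, h₆, h₇⟩ := edge_sound hL hV ⟨_, ha⟩ h₁ h₂ h₃
    exact ⟨_, _, .bind h₅, h₇, _, _, _, _, _, _, h, ⟨_, hr⟩, ⟨_, hx⟩, h₆⟩
  · obtain ⟨⟨q, hq⟩, he, hf⟩ := hit
    rcases c with x | x | ⟨c₁, c₂⟩ | ⟨c₁, c₂⟩ | c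
    · simp [MachineStep, PlainStep, EdgeMove, CondStep, hq.1, digits] at h
      obtain ⟨h₀, ⟨h₁, h₂, h⟩ | ⟨h₁, h₂, h⟩⟩ := h
      · rw [envIs_iff hL hν hK hr ⟨_, hq.2⟩ he] at h₂
        exact ⟨_, _, .eq (iff_of_true h₂ (hf.1 h₁)), h₀ ▸ hV, h⟩
      · rw [envNot_iff hL hν hK hr ⟨_, hq.2⟩ he] at h₂
        exact ⟨_, _, .eq (iff_of_false h₂ fun h => h₁.ne' (hf.2 h)), h₀ ▸ hV, h⟩
    · simp [MachineStep, PlainStep, EdgeMove, CondStep, hq.1, digits] at h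
      obtain ⟨h₀, ⟨h₁, h₂, h⟩ | ⟨h₁, h₂, h⟩⟩ := h
      · rw [envIs_iff hL hν hK hr ⟨_, hq.2⟩ he] at h₂
        exact ⟨_, _, .ne (iff_of_false (not_not.2 h₂) fun h => h₁.ne' (hf.2 h)), h₀ ▸ hV, h⟩
      · rw [envNot_iff hL hν hK hr ⟨_, hq.2⟩ he] at h₂
        exact ⟨_, _, .ne (iff_of_true h₂ (hf.1 h₁)), h₀ ▸ hV, h⟩
    · simp [MachineStep, PlainStep, EdgeMove, CondStep, hq.1, digits] at h
      obtain ⟨h₀, ⟨h₁, m, h₂, h⟩ | ⟨h₁, h⟩⟩ := h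
      · obtain rfl := hf.1 h₁
        obtain ⟨h₃, h₄⟩ := h₂.split hq.2
        exact ⟨_, _, .and_true, h₀ ▸ hV, _, _, _, _, _, _, h, ⟨⟨_, h₃⟩, he, hf⟩, ⟨_, h₄⟩, he, hf⟩
      · obtain rfl : b = false := by simpa [h₁.ne'] using hf
        rcases h with h | ⟨m, h₂, h⟩
        · obtain ⟨m, h₂, -⟩ := seg_append.1 hq.2
          exact ⟨_, _, .and_left, h₀ ▸ hV, _, _, _, h, ⟨_, h₂⟩, he, hf⟩
        · exact ⟨_, _, .and_right, h₀ ▸ hV, _, _, _, h, ⟨_, (h₂.split hq.2).2⟩, he, hf⟩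
    · simp [MachineStep, PlainStep, EdgeMove, CondStep, hq.1, digits] at h
      obtain ⟨h₀, ⟨h₁, m, h₂, h⟩ | ⟨h₁, h⟩⟩ := h
      · obtain rfl : b = false := by simpa [h₁.ne'] using hf
        obtain ⟨h₃, h₄⟩ := h₂.split hq.2
        exact ⟨_, _, .or_false, h₀ ▸ hV, _, _, _, _, _, _, h, ⟨⟨_, h₃⟩, he, hf⟩, ⟨_, h₄⟩, he, hf⟩
      · obtain rfl := hf.1 h₁
        rcases h with h | ⟨m, h₂, h⟩
        · obtain ⟨m, h₂, -⟩ := seg_append.1 hq.2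
          exact ⟨_, _, .or_left, h₀ ▸ hV, _, _, _, h, ⟨_, h₂⟩, he, hf⟩
        · exact ⟨_, _, .or_right, h₀ ▸ hV, _, _, _, h, ⟨_, (h₂.split hq.2).2⟩, he, hf⟩
    · simp [MachineStep, PlainStep, EdgeMove, CondStep, hq.1, digits] at h
      obtain ⟨h₀, f', h₁, h⟩ := h
      refine ⟨_, _, .not, h₀ ▸ hV, _, _, _, h, ⟨_, hq.2⟩, he, ?_⟩
      rcases h₁ with ⟨h₁, rfl⟩ | ⟨h₁, rfl⟩
      · simp [hf.1 h₁]
      · have : b = false := by simpa [h₁.ne'] using hf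
        simp [this]
  · have hs : sy I p = .sym .bit0 ∨ sy I p = .sym .bit1 ∨ sy I p = .sym .numEnd := hit.1.digit
    rcases hs with hs | hs | hs <;>
    · simp [MachineStep, PlainStep, EdgeMove, CondStep, hs, digits] at h
      exact ⟨_, _, .frame, h.1 ▸ hV, h.2⟩

theorem length_le_bd (I : Inp Sym) : I.2 + 2 ≤ bd I := by
  have := length_lt_bd I
  rw [length_tp] at this
  omega

theorem exists_pop {v i : ℕ} (hv : v < bd I) (hi : i ≤ I.2) :
    ∃ w : Fin 10 → ℕ, (∀ t, w t < bd I) ∧ w 0 = v ∧ Pop i w := by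
  have := length_le_bd I
  refine ⟨![v, i, i, 0, 0, 0, i, 0, 0, 0], ?_, rfl, rfl, rfl, rfl⟩
  simp only [Fin.forall_fin_succ, Matrix.cons_val_zero, Matrix.cons_val_succ]
  simp [hv, bd_pos]
  omega

theorem exists_one {v i p e f : ℕ} (hv : v < bd I) (hi : i + 1 ≤ I.2) (hp : p < bd I)
    (he : e < bd I) (hf : f < bd I) :
    ∃ w : Fin 10 → ℕ, (∀ t, w t < bd I) ∧ w 0 = v ∧ One i w p e f := by
  have := length_le_bd I
  refine ⟨![v, i + 1, i, 0, 0, 0, i, p, e, f], ?_, rfl, rfl, rfl, rfl, rfl, rfl, rfl⟩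
  simp only [Fin.forall_fin_succ, Matrix.cons_val_zero, Matrix.cons_val_succ]
  simp [hv, hp, he, hf, bd_pos]
  omega

theorem exists_two {v i p e f p' e' f' : ℕ} (hv : v < bd I) (hi : i + 2 ≤ I.2) (hp : p < bd I)
    (he : e < bd I) (hf : f < bd I) (hp' : p' < bd I) (he' : e' < bd I) (hf' : f' < bd I) :
    ∃ w : Fin 10 → ℕ, (∀ t, w t < bd I) ∧ w 0 = v ∧ Two i w p e f p' e' f' := by
  have := length_le_bd I
  refine ⟨![v, i + 2, i, p', e', f', i + 1, p, e, f], ?_, rfl, rfl, rfl, rfl, ⟨rfl, rfl, rfl⟩, rfl,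
    rfl, rfl⟩
  simp only [Fin.forall_fin_succ, Matrix.cons_val_zero, Matrix.cons_val_succ]
  simp [hv, hp, he, hf, hp', he', hf']
  omega

theorem edge_complete (hL : Layout I p₁ p₂ p₃ p₄ p₅ D) {pV pa V a d V' : ℕ}
    (hV : NumAt I pV V) (ha : NumAt I pa a) (h : (V, a, d, V') ∈ D.es) :
    ∃ u, SameNum I u pV ∧ ∃ b, SameNum I b pa ∧ ∃ q v, EdgePos I u b q v ∧ NumAt I q d ∧
      NumAt I v V' := by
  obtain ⟨u₁, u₂, u₃, u₄, h₁, h₂, h₃, h₄, h₅⟩ := hL.exists_edgePos h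
  exact ⟨_, (h₂.same_iff hV).2 rfl, _, (h₃.same_iff ha).2 rfl, _, _, h₁, h₄, h₅⟩

/-- All numbers to be guessed are positions in the input, old entries of the array, flags, or row
numbers and heights limited by `hl`, hence in the range of the registers. -/
theorem machineStep_complete (hL : Layout I p₁ p₂ p₃ p₄ p₅ D)
    (hν : ∀ y d, (y, d) ∈ D.vs ↔ ν y = some d) (hK : Stk I A K) (hr : K.length ≤ rows I)
    {pV V V' p e f : ℕ} {it : Item} {l : List Item} (hV : NumAt I pV V) (hit : ItemAt I p e f it)
    (hp : p < bd I) (he : e < bd I) (hf : f < bd I) (hl : K.length + l.length ≤ I.2)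
    (h : Rule (fun V a d V' => (V, a, d, V') ∈ D.es) (env ν K) V it V' l) :
    ∃ w : Fin 10 → ℕ, (∀ t, w t < bd I) ∧ MachineStep I A pV K.length p e f w ∧
      NumAt I (w 0) V' ∧ Effect I K.length w l := by
  cases h with
  | eps =>
    obtain ⟨q, hs, -⟩ := hit
    obtain ⟨w, hw, h₀, h⟩ := exists_pop hV.lt_bd hl
    exact ⟨w, hw, Or.inl ⟨h₀, Or.inl ⟨Or.inl hs, h⟩⟩, h₀ ▸ hV, h⟩
  | letter hE =>
    obtain ⟨q, hs, ha⟩ := hit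
    obtain ⟨u, h₁, b, h₂, d, v, h₃, h₄, h₅⟩ := edge_complete hL hV ⟨_, ha⟩ hE
    obtain ⟨w, hw, rfl, h⟩ := exists_pop h₅.lt_bd hl
    exact ⟨w, hw, Or.inr (Or.inl ⟨_, rfl, u, h₁, b, h₂, d, h₃, Or.inl ⟨hs, h⟩⟩), h₅, h⟩
  | test hE =>
    obtain ⟨q, hs, ha⟩ := hit
    obtain ⟨m, ha, hc⟩ := seg_append.1 ha
    obtain ⟨u, h₁, b, h₂, d, v, h₃, h₄, h₅⟩ := edge_complete hL hV ⟨_, ha⟩ hE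
    obtain ⟨w, hw, rfl, h⟩ := exists_one h₅.lt_bd hl ha.lt_bd_of_encNat.2 h₄.lt_bd (bd_pos I)
    exact ⟨w, hw, Or.inr (Or.inl ⟨_, rfl, u, h₁, b, h₂, d, h₃, Or.inr (Or.inl
      ⟨hs, m, ⟨_, ha⟩, _, rfl, h⟩)⟩), h₅, _, _, _, h, ⟨_, hc⟩, h₄, by simp⟩
  | plus_left =>
    obtain ⟨q, hs, h₁⟩ := hit
    obtain ⟨m, h₁, -⟩ := seg_append.1 h₁
    obtain ⟨w, hw, h₀, h⟩ := exists_one hV.lt_bd hl (ExprAt.lt_bd ⟨_, h₁⟩).1 he hf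
    exact ⟨w, hw, Or.inl ⟨h₀, Or.inr ⟨_, rfl, Or.inr (Or.inl ⟨hs, Or.inl h⟩)⟩⟩, h₀ ▸ hV, _, _, _, h,
      _, h₁⟩
  | plus_right =>
    obtain ⟨q, hs, h₁⟩ := hit
    obtain ⟨m, h₁, h₂⟩ := seg_append.1 h₁
    obtain ⟨w, hw, h₀, h⟩ := exists_one hV.lt_bd hl (ExprAt.lt_bd ⟨_, h₂⟩).1 he hf
    exact ⟨w, hw, Or.inl ⟨h₀, Or.inr ⟨_, rfl, Or.inr (Or.inl ⟨hs, Or.inr ⟨m, ⟨_, h₁⟩, h⟩⟩)⟩⟩,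
      h₀ ▸ hV, _, _, _, h, _, h₂⟩
  | cat =>
    obtain ⟨q, hs, h₁⟩ := hit
    obtain ⟨m, h₁, h₂⟩ := seg_append.1 h₁
    obtain ⟨w, hw, h₀, h⟩ := exists_two hV.lt_bd hl (ExprAt.lt_bd ⟨_, h₁⟩).1 he hf
      (ExprAt.lt_bd ⟨_, h₂⟩).1 he hf
    exact ⟨w, hw, Or.inl ⟨h₀, Or.inr ⟨_, rfl, Or.inr (Or.inr ⟨hs, m, ⟨_, h₁⟩, h⟩)⟩⟩,
      h₀ ▸ hV, _, _, _, _, _, _, h, ⟨_, h₁⟩, _, h₂⟩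
  | star_nil =>
    obtain ⟨q, hs, -⟩ := hit
    obtain ⟨w, hw, h₀, h⟩ := exists_pop hV.lt_bd hl
    exact ⟨w, hw, Or.inl ⟨h₀, Or.inl ⟨Or.inr (Or.inl hs), h⟩⟩, h₀ ▸ hV, h⟩
  | star_cons =>
    obtain ⟨q, hq⟩ := id hit
    obtain ⟨w, hw, h₀, h⟩ := exists_two hV.lt_bd hl (ExprAt.lt_bd ⟨_, hq.2⟩).1 he hf hp he hf
    exact ⟨w, hw, Or.inl ⟨h₀, Or.inr ⟨_, rfl, Or.inl ⟨hq.1, h⟩⟩⟩, h₀ ▸ hV, _, _, _, _, _, _, h,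
      ⟨_, hq.2⟩, hit⟩
  | bind hE =>
    obtain ⟨q, hs, h₁⟩ := hit
    obtain ⟨m, h₁, hr⟩ := seg_append.1 h₁
    obtain ⟨m', ha, hx⟩ := seg_append.1 h₁
    obtain ⟨u, h₁, b, h₂, d, v, h₃, h₄, h₅⟩ := edge_complete hL hV ⟨_, ha⟩ hE
    obtain ⟨w, hw, rfl, h⟩ := exists_two h₅.lt_bd hl (ExprAt.lt_bd ⟨_, hr⟩).1 he hf
      ha.lt_bd_of_encNat.2 h₄.lt_bd hf
    exact ⟨w, hw, Or.inr (Or.inl ⟨_, rfl, u, h₁, b, h₂, d, h₃, Or.inr (Or.inr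
      ⟨hs, _, ⟨_, ha⟩, _, ⟨_, hx⟩, h⟩)⟩), h₅, _, _, _, _, _, _, h, ⟨_, hr⟩, ⟨_, hx⟩, h₄⟩
  | frame =>
    obtain ⟨w, hw, h₀, h⟩ := exists_pop hV.lt_bd hl
    exact ⟨w, hw, Or.inl ⟨h₀, Or.inl ⟨Or.inr (Or.inr hit.1.digit), h⟩⟩, h₀ ▸ hV, h⟩
  | @eq b d x hb =>
    obtain ⟨⟨q, hs, hx⟩, he, hf⟩ := hit
    obtain ⟨w, hw, h₀, h⟩ := exists_pop (i := K.length) hV.lt_bd hl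
    refine ⟨w, hw, Or.inr (Or.inr ⟨h₀, _, rfl, ?_⟩), h₀ ▸ hV, h⟩
    rw [envIs_iff hL hν hK hr ⟨_, hx⟩ he, envNot_iff hL hν hK hr ⟨_, hx⟩ he, ne_eq, hb]
    -- A zero flag stands for `true`; it selects between the positive and the negative lookup.
    cases b <;> simp at hf <;> simp [hs, hf, h, Nat.pos_iff_ne_zero]
  | @ne b d x hb =>
    obtain ⟨⟨q, hs, hx⟩, he, hf⟩ := hit
    obtain ⟨w, hw, h₀, h⟩ := exists_pop (i := K.length) hV.lt_bd hl
    have hb' : env ν K x = some d ↔ b = false := by cases b <;> simpa using hb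
    refine ⟨w, hw, Or.inr (Or.inr ⟨h₀, _, rfl, ?_⟩), h₀ ▸ hV, h⟩
    rw [envIs_iff hL hν hK hr ⟨_, hx⟩ he, envNot_iff hL hν hK hr ⟨_, hx⟩ he, hb, hb']
    cases b <;> simp at hf <;> simp [hs, hf, h, Nat.pos_iff_ne_zero]
  | and_true =>
    obtain ⟨⟨q, hs, h₁⟩, he', hf'⟩ := hit
    obtain ⟨m, h₁, h₂⟩ := seg_append.1 h₁
    obtain ⟨w, hw, h₀, h⟩ := exists_two hV.lt_bd hl (CondAt.lt_bd ⟨_, h₁⟩).1 he hf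
      (CondAt.lt_bd ⟨_, h₂⟩).1 he hf
    exact ⟨w, hw, Or.inr (Or.inr ⟨h₀, _, rfl, Or.inr (Or.inr (Or.inl
      ⟨Or.inl ⟨hs, hf'.2 rfl⟩, m, ⟨_, h₁⟩, h⟩))⟩), h₀ ▸ hV, _, _, _, _, _, _, h,
      ⟨⟨_, h₁⟩, he', hf'⟩, ⟨_, h₂⟩, he', hf'⟩
  | and_left =>
    obtain ⟨⟨q, hs, h₁⟩, he', hf'⟩ := hit
    obtain ⟨m, h₁, h₂⟩ := seg_append.1 h₁
    obtain ⟨w, hw, h₀, h⟩ := exists_one hV.lt_bd hl (CondAt.lt_bd ⟨_, h₁⟩).1 he hf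
    exact ⟨w, hw, Or.inr (Or.inr ⟨h₀, _, rfl, Or.inr (Or.inr (Or.inr (Or.inl
      ⟨Or.inl ⟨hs, Nat.pos_of_ne_zero (by simpa using hf')⟩, Or.inl h⟩)))⟩), h₀ ▸ hV, _, _, _, h,
      ⟨_, h₁⟩, he', hf'⟩
  | and_right =>
    obtain ⟨⟨q, hs, h₁⟩, he', hf'⟩ := hit
    obtain ⟨m, h₁, h₂⟩ := seg_append.1 h₁
    obtain ⟨w, hw, h₀, h⟩ := exists_one hV.lt_bd hl (CondAt.lt_bd ⟨_, h₂⟩).1 he hf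
    exact ⟨w, hw, Or.inr (Or.inr ⟨h₀, _, rfl, Or.inr (Or.inr (Or.inr (Or.inl
      ⟨Or.inl ⟨hs, Nat.pos_of_ne_zero (by simpa using hf')⟩, Or.inr ⟨m, ⟨_, h₁⟩, h⟩⟩)))⟩),
      h₀ ▸ hV, _, _, _, h, ⟨_, h₂⟩, he', hf'⟩
  | or_left =>
    obtain ⟨⟨q, hs, h₁⟩, he', hf'⟩ := hit
    obtain ⟨m, h₁, h₂⟩ := seg_append.1 h₁
    obtain ⟨w, hw, h₀, h⟩ := exists_one hV.lt_bd hl (CondAt.lt_bd ⟨_, h₁⟩).1 he hf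
    exact ⟨w, hw, Or.inr (Or.inr ⟨h₀, _, rfl, Or.inr (Or.inr (Or.inr (Or.inl
      ⟨Or.inr ⟨hs, hf'.2 rfl⟩, Or.inl h⟩)))⟩), h₀ ▸ hV, _, _, _, h, ⟨_, h₁⟩, he', hf'⟩
  | or_right =>
    obtain ⟨⟨q, hs, h₁⟩, he', hf'⟩ := hit
    obtain ⟨m, h₁, h₂⟩ := seg_append.1 h₁
    obtain ⟨w, hw, h₀, h⟩ := exists_one hV.lt_bd hl (CondAt.lt_bd ⟨_, h₂⟩).1 he hf
    exact ⟨w, hw, Or.inr (Or.inr ⟨h₀, _, rfl, Or.inr (Or.inr (Or.inr (Or.inl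
      ⟨Or.inr ⟨hs, hf'.2 rfl⟩, Or.inr ⟨m, ⟨_, h₁⟩, h⟩⟩)))⟩), h₀ ▸ hV, _, _, _, h, ⟨_, h₂⟩, he', hf'⟩
  | or_false =>
    obtain ⟨⟨q, hs, h₁⟩, he', hf'⟩ := hit
    obtain ⟨m, h₁, h₂⟩ := seg_append.1 h₁
    obtain ⟨w, hw, h₀, h⟩ := exists_two hV.lt_bd hl (CondAt.lt_bd ⟨_, h₁⟩).1 he hf
      (CondAt.lt_bd ⟨_, h₂⟩).1 he hf
    exact ⟨w, hw, Or.inr (Or.inr ⟨h₀, _, rfl, Or.inr (Or.inr (Or.inl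
      ⟨Or.inr ⟨hs, Nat.pos_of_ne_zero (by simpa using hf')⟩, m, ⟨_, h₁⟩, h⟩))⟩), h₀ ▸ hV,
      _, _, _, _, _, _, h, ⟨⟨_, h₁⟩, he', hf'⟩, ⟨_, h₂⟩, he', hf'⟩
  | @not b d c =>
    obtain ⟨⟨q, hs, h₁⟩, he', hf'⟩ := hit
    obtain ⟨f', hb, hf''⟩ : ∃ f', f' < bd I ∧ ((f = 0 ∧ f' = f + 1) ∨ (0 < f ∧ f' = 0)) := by
      rcases f.eq_zero_or_pos with h | h
      · exact ⟨f + 1, h ▸ one_lt_bd I, Or.inl ⟨h, rfl⟩⟩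
      · exact ⟨0, bd_pos I, Or.inr ⟨h, rfl⟩⟩
    obtain ⟨w, hw, h₀, h⟩ := exists_one hV.lt_bd hl (CondAt.lt_bd ⟨_, h₁⟩).1 he hb
    refine ⟨w, hw, Or.inr (Or.inr ⟨h₀, _, rfl, Or.inr (Or.inr (Or.inr (Or.inr
      ⟨hs, f', hf'', h⟩)))⟩), h₀ ▸ hV, _, _, _, h, ⟨_, h₁⟩, he', ?_⟩
    rcases hf'' with ⟨h₂, rfl⟩ | ⟨h₂, rfl⟩
    · simp [hf'.1 h₂]
    · have : b = false := by simpa [h₂.ne'] using hf'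
      simp [this]

end Simulation

end XNL

/-! ### The decision procedure and its correctness. -/

namespace XNL

open Relation Function REWB

section Decision

variable {I : Inp Sym} {p₁ p₂ p₃ p₄ p₅ : ℕ} {D : Data} {ν : Valuation}

/-! ### The decision procedure -/

/-- The registers `0` to `4` hold the boundaries of the layout, `5` a position that names the
current vertex, and `6` the height of the stack; arguments from `7` on are the guesses of the round.
The walk starts at the source, whose numeral begins at `ρ 3`, with the query at `ρ 1` as the only
item. -/
def SetUp (I : Inp Sym) (_ : ℕ → ℕ → ℕ) (ρ : Fin (7 + 10) → ℕ) : Prop :=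
  Shape I (ρ 0) (ρ 1) (ρ 2) (ρ 3) (ρ 4) ∧ ρ 7 = ρ 3 ∧
    ∃ z, z = 0 ∧ One z (fun t => ρ (Fin.natAdd 7 t)) (ρ 1) z z

def Turn (I : Inp Sym) (A : ℕ → ℕ → ℕ) (ρ : Fin (7 + 10) → ℕ) : Prop :=
  ∃ i, ρ 6 = i + 1 ∧ ∃ p, (i < rows I ∧ p = A i 0) ∧ ∃ e, (i < rows I ∧ e = A i 1) ∧
    ∃ f, (i < rows I ∧ f = A i 2) ∧
      MachineStep I A (ρ 5) i p e f (fun t => ρ (Fin.natAdd 7 t))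

/-- Vertices are compared by name, because the same vertex may be written at many positions. -/
def Done (I : Inp Sym) (_ : ℕ → ℕ → ℕ) (ρ : Fin 7 → ℕ) : Prop :=
  ρ 6 = 0 ∧ SameNum I (ρ 5) (ρ 4)

theorem dfn_setUp : Dfn SetUp := by
  refine .and (dfn_shape _ _ _ _ _) (.and (.eqv _ _) (.exb (.and (.isZero _)
    (dfn_one _ _ _ _ fun t => (Fin.natAdd 7 t).castSucc)) ?_))
  exact fun I _ _ _ _ h => h.1 ▸ bd_pos I

theorem dfn_turn : Dfn Turn := by
  refine .exb (.and (.suc _ _) (.exArr 0 _ (.exArr 1 _ (.exArr 2 _ (dfn_machineStep _ _ _ _ _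
    fun t => (Fin.natAdd 7 t).castSucc.castSucc.castSucc.castSucc))))) ?_
  exact fun I _ _ _ _ ⟨_, _, h, _⟩ => h.1.trans (rows_lt_bd I)

theorem dfn_done : Dfn Done := .and (.isZero _) (dfn_sameNum _ _)

/-- The edges of the graph. -/
def Data.edge (D : Data) (V a d V' : ℕ) : Prop := (V, a, d, V') ∈ D.es

/-- The registers and the array represent a configuration of the stack machine. -/
structure Codes (I : Inp Sym) (y : (Fin 7 → ℕ) × (ℕ → ℕ → ℕ)) (s : ℕ × List Item) : Prop where
  vertex : NumAt I (y.1 5) s.1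
  top : y.1 6 = s.2.length
  le : s.2.length ≤ rows I
  stk : Stk I y.2 s.2
  inRange : InRange I y

theorem IsRow.itemAt {p e f : ℕ} {g : ℕ → ℕ} {it : Item} (hg : IsRow I p e f g)
    (h : ItemAt I p e f it) : ItemAt I (g 0) (g 1) (g 2) it := by
  rwa [← hg.zero, ← hg.one, ← hg.two]

/-- Rows below `K.length` are not written, so the rest of the stack keeps its code. -/
theorem Effect.stk {A : ℕ → ℕ → ℕ} {K l : List Item} {w : Fin 10 → ℕ} {g g' : ℕ → ℕ}
    (h : Effect I K.length w l) (hK : Stk I A K) (hw : w 2 < rows I) (hw' : w 6 < rows I)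
    (hg : IsRow I (w 3) (w 4) (w 5) g) (hg' : IsRow I (w 7) (w 8) (w 9) g') :
    Stk I (update (update A (w 2) g) (w 6) g') (l ++ K) ∧ w 1 = (l ++ K).length ∧
      (l ++ K).length ≤ rows I := by
  have hK' : ∀ j, K.length ≤ j → Stk I (update (update A K.length g) j g') K := fun j hj =>
    hK.congr fun i hi => by rw [update_of_ne (by omega), update_of_ne hi.ne]
  rcases l with _ | ⟨a, _ | ⟨b, _ | ⟨c, l⟩⟩⟩
  · obtain ⟨h₁, h₂, h₃⟩ := h
    rw [h₂, h₃]
    exact ⟨hK' _ le_rfl, h₁, by simpa using (h₂ ▸ hw).le⟩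
  · obtain ⟨p, e, f, ⟨h₁, h₂, h₃, rfl, rfl, rfl⟩, ha⟩ := h
    rw [h₂, h₃]
    refine ⟨⟨?_, hK' _ le_rfl⟩, by simpa using h₁, by simp; omega⟩
    simpa using hg'.itemAt ha
  · obtain ⟨p, e, f, p', e', f', ⟨h₁, h₂, h₃, ⟨rfl, rfl, rfl⟩, rfl, rfl, rfl⟩, ha, hb⟩ := h
    rw [h₁, h₃]
    refine ⟨⟨?_, ?_, hK' _ (Nat.le_succ _)⟩, by simp; omega, by simp; omega⟩
    · simpa using hg'.itemAt ha
    · simpa using hg.itemAt hb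
  · exact h.elim

theorem append_eval {v : Fin 7 → ℕ} {w : Fin 10 → ℕ} :
    (fun t : Fin 10 => Fin.append v w (Fin.natAdd 7 t)) = w := by
  funext t; simp

/-- The height is only limited by the number of rows, one more than the parameter. This is good
enough, since `works_of_reflTransGen` holds for every bound. -/
theorem Codes.turn_sound (hL : Layout I p₁ p₂ p₃ p₄ p₅ D)
    (hν : ∀ y d, (y, d) ∈ D.vs ↔ ν y = some d) {y y' : (Fin 7 → ℕ) × (ℕ → ℕ → ℕ)}
    {s : ℕ × List Item} (hs : Codes I y s) (h : Round Turn I y y') :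
    ∃ s', StackStep D.edge ν (rows I) s s' ∧ Codes I y' s' ∧ y'.1 4 = y.1 4 := by
  have hy' := h.inRange hs.inRange
  obtain ⟨w, hw, ⟨i, hi, _, ⟨hr, rfl⟩, _, ⟨-, rfl⟩, _, ⟨-, rfl⟩, hm⟩, h₂, h₆, g, g', hg, hg', rfl⟩ := h
  rw [append_eval] at hm
  change y.1 6 = i + 1 at hi
  change MachineStep I y.2 (y.1 5) _ _ _ _ _ at hm
  obtain ⟨V, K⟩ := s
  have ht := hs.top
  rw [hi] at ht
  rcases K with _ | ⟨it, K⟩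
  · simp at ht
  · obtain rfl : i = K.length := by simpa using ht
    obtain ⟨V', l, h₃, h₄, h₅⟩ := machineStep_sound hL hν hs.stk.2 hr.le hs.vertex hs.stk.1 hm
    obtain ⟨h₇, h₈, h₉⟩ := h₅.stk hs.stk.2 h₂ h₆ hg hg'
    exact ⟨(V', l ++ K), ⟨it, K, l, rfl, h₃, rfl, h₉⟩, ⟨h₄, h₈, h₉, h₇, hy'⟩, rfl⟩

theorem exists_isRow {α : Type} {I : Inp α} {p e f : ℕ} (hp : p < bd I) (he : e < bd I)
    (hf : f < bd I) : ∃ g, IsRow I p e f g :=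
  ⟨fun | 0 => p | 1 => e | 2 => f | _ => 0, fun
    | 0 => hp | 1 => he | 2 => hf | _ + 3 => bd_pos I, rfl, rfl, rfl⟩

theorem Effect.lt_rows {i : ℕ} {l : List Item} {w : Fin 10 → ℕ} (h : Effect I i w l)
    (hi : i ≤ I.2) (hl : i + l.length ≤ I.2) : w 2 < rows I ∧ w 6 < rows I := by
  unfold rows
  rcases l with _ | ⟨a, _ | ⟨b, _ | ⟨c, l⟩⟩⟩
  · obtain ⟨h₁, h₂, h₃⟩ := h
    omega
  · obtain ⟨p, e, f, ⟨h₁, h₂, h₃, -⟩, -⟩ := h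
    omega
  · obtain ⟨p, e, f, p', e', f', ⟨h₁, h₂, h₃, -⟩, -⟩ := h
    simp at hl
    omega
  · exact h.elim

theorem Codes.turn_complete (hL : Layout I p₁ p₂ p₃ p₄ p₅ D)
    (hν : ∀ y d, (y, d) ∈ D.vs ↔ ν y = some d) {y : (Fin 7 → ℕ) × (ℕ → ℕ → ℕ)}
    {s s' : ℕ × List Item} (hs : Codes I y s) (h : StackStep D.edge ν I.2 s s') :
    ∃ y', Round Turn I y y' ∧ Codes I y' s' ∧ y'.1 4 = y.1 4 := by
  obtain ⟨V, _⟩ := s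
  obtain ⟨V', _⟩ := s'
  obtain ⟨it, K, l, rfl, h₁, rfl, h₂⟩ := h
  have hlen : K.length < rows I := hs.le
  have hl : K.length + l.length ≤ I.2 := by simpa [add_comm] using h₂
  obtain ⟨w, hw, h₃, h₄, h₅⟩ := machineStep_complete hL hν hs.stk.2 hlen.le hs.vertex hs.stk.1
    (hs.inRange.2 _ _) (hs.inRange.2 _ _) (hs.inRange.2 _ _) hl h₁
  obtain ⟨h₆, h₇⟩ := h₅.lt_rows (by omega) hl
  obtain ⟨g, hg⟩ := exists_isRow (hw 3) (hw 4) (hw 5)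
  obtain ⟨g', hg'⟩ := exists_isRow (hw 7) (hw 8) (hw 9)
  have hR : Round Turn I y (update (update y.1 5 (w 0)) 6 (w 1),
      update (update y.2 (w 2) g) (w 6) g') := by
    refine ⟨w, hw, ⟨K.length, hs.top, _, ⟨hlen, rfl⟩, _, ⟨hlen, rfl⟩, _, ⟨hlen, rfl⟩, ?_⟩, h₆, h₇,
      g, g', hg, hg', rfl⟩
    rw [append_eval]
    exact h₃
  obtain ⟨h₈, h₉, h₁₀⟩ := h₅.stk hs.stk.2 h₆ h₇ hg hg'
  exact ⟨_, hR, ⟨h₄, h₉, h₁₀, h₈, hR.inRange hs.inRange⟩, rfl⟩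

theorem Data.Ok.exists_valuation (h : D.Ok) : ∃ ν : Valuation, ∀ y d, (y, d) ∈ D.vs ↔
    ν y = some d := by
  classical
  refine ⟨fun y => if h : ∃ d, (y, d) ∈ D.vs then some h.choose else none, fun y d => ?_⟩
  by_cases hy : ∃ d, (y, d) ∈ D.vs
  · simp only [hy, dite_true, Option.some.injEq]
    exact ⟨fun hd => h.functional _ _ _ hy.choose_spec hd, fun hd => hd ▸ hy.choose_spec⟩
  · simp only [hy, dite_false, reduceCtorEq, iff_false]
    exact fun hd => hy ⟨d, hd⟩

/-- `Codes` is carried along the loop in both directions, together with register `4`, the position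
of the target. From right to left, `reaches_iff` limits the stack to the size of the query, and this
is the parameter. -/
theorem loop_iff : (∃ r y y', (∀ i, r i < bd I) ∧ Round SetUp I (r, fun _ _ => 0) y ∧
    ReflTransGen (Round Turn I) y y' ∧ Done I y'.2 y'.1) ↔
    ∃ p₁ p₂ p₃ p₄ p₅ D ν, Layout I p₁ p₂ p₃ p₄ p₅ D ∧ D.Ok ∧ D.r.size = I.2 ∧
      (∀ y d, (y, d) ∈ D.vs ↔ ν y = some d) ∧ ∃ w ∈ D.r.lang ν, Path D.edge D.s w D.t := by
  constructor
  · rintro ⟨r, y, y', hr, h₁, h₂, h₃, h₄⟩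
    have hy := h₁.inRange ⟨hr, fun _ _ => bd_pos I⟩
    obtain ⟨w, hw, ⟨hS, hV, _, rfl, hO⟩, hw₂, hw₆, g, g', hg, hg', rfl⟩ := h₁
    rw [append_eval] at hO
    change w 0 = r 3 at hV
    change One 0 w (r 1) 0 0 at hO
    obtain ⟨D, hL, hD, hk⟩ := shape_iff.1 hS
    change Layout I (r 0) (r 1) (r 2) (r 3) (r 4) D at hL
    obtain ⟨ν, hν⟩ := hD.exists_valuation
    have hE : Effect I ([] : List Item).length w [.ex D.r] :=
      ⟨_, _, _, hO, _, hL.expr⟩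
    obtain ⟨h₅, h₆, h₇⟩ := hE.stk (A := fun _ _ => 0) trivial hw₂ hw₆ hg hg'
    have hC : Codes I (update (update r 5 (w 0)) 6 (w 1), update (update (fun _ _ => 0) (w 2) g)
        (w 6) g') (D.s, [.ex D.r]) :=
      ⟨by simpa [hV] using ⟨_, hL.src⟩, h₆, h₇, h₅, hy⟩
    refine ⟨_, _, _, _, _, D, ν, hL, hD, hk, hν, ?_⟩
    obtain ⟨s', hs, hC', ht⟩ : ∃ s', ReflTransGen (StackStep D.edge ν (rows I)) (D.s, [.ex D.r]) s' ∧
        Codes I y' s' ∧ y'.1 4 = r 4 := by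
      clear h₃ h₄
      induction h₂ with
      | refl => exact ⟨_, .refl, hC, rfl⟩
      | tail _ h ih =>
        obtain ⟨s', h₈, h₉, h₁₀⟩ := ih
        obtain ⟨s'', h₁₁, h₁₂, h₁₃⟩ := h₉.turn_sound hL hν h
        exact ⟨s'', h₈.tail h₁₁, h₁₂, h₁₃.trans h₁₀⟩
    obtain ⟨V, K⟩ := s'
    obtain rfl : K = [] := List.eq_nil_of_length_eq_zero (hC'.top.symm.trans h₃)
    rw [ht] at h₄
    have hV' : V = D.t := (hC'.vertex.same_iff ⟨_, hL.tgt⟩).1 h₄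
    obtain ⟨w, hw, m, hp, hm⟩ := works_of_reflTransGen hs
    exact ⟨w, hw, hV' ▸ hm ▸ hp⟩
  · rintro ⟨p₁, p₂, p₃, p₄, p₅, D, ν, hL, hD, hk, hν, hw⟩
    have hs : NumAt I p₄ D.s := ⟨_, hL.src⟩
    have ht : NumAt I p₅ D.t := ⟨_, hL.tgt⟩
    have he : p₂ < bd I ∧ p₃ < bd I := ExprAt.lt_bd ⟨_, hL.expr⟩
    have hpos := Expr.size_pos D.r
    -- There is room for the first item because the parameter, as the size of a query, is positive.
    obtain ⟨w, hw', hw₀, hO⟩ := exists_one (i := 0) hs.lt_bd (by omega) he.1 (bd_pos I) (bd_pos I)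
    have hE : Effect I ([] : List Item).length w [.ex D.r] := ⟨_, _, _, hO, _, hL.expr⟩
    obtain ⟨h₁, h₂⟩ := hE.lt_rows (by simp) (by simp; omega)
    obtain ⟨g, hg⟩ := exists_isRow (hw' 3) (hw' 4) (hw' 5)
    obtain ⟨g', hg'⟩ := exists_isRow (hw' 7) (hw' 8) (hw' 9)
    obtain ⟨h₅, h₆, h₇⟩ := hE.stk (A := fun _ _ => 0) trivial h₁ h₂ hg hg'
    have hr : ∀ i, (![p₁, p₂, p₃, p₄, p₅, 0, 0] : Fin 7 → ℕ) i < bd I := by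
      simp only [Fin.forall_fin_succ, Matrix.cons_val_zero, Matrix.cons_val_succ]
      simp [he, hs.lt_bd, ht.lt_bd, bd_pos, hL.edges.le.trans_lt he.1]
    have hR : Round SetUp I (![p₁, p₂, p₃, p₄, p₅, 0, 0], fun _ _ => 0)
        (update (update ![p₁, p₂, p₃, p₄, p₅, 0, 0] 5 (w 0)) 6 (w 1),
          update (update (fun _ _ => 0) (w 2) g) (w 6) g') := by
      refine ⟨w, hw', ⟨shape_iff.2 ⟨D, hL, hD, hk⟩, hw₀, 0, rfl, ?_⟩, h₁, h₂, g, g', hg, hg', rfl⟩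
      rw [append_eval]
      exact hO
    have hC : Codes I (update (update ![p₁, p₂, p₃, p₄, p₅, 0, 0] 5 (w 0)) 6 (w 1),
        update (update (fun _ _ => 0) (w 2) g) (w 6) g') (D.s, [.ex D.r]) :=
      ⟨by simpa [hw₀] using hs, h₆, h₇, h₅, hR.inRange ⟨hr, fun _ _ => bd_pos I⟩⟩
    obtain ⟨y', hy, hC', h₄⟩ : ∃ y', ReflTransGen (Round Turn I) (update (update
        ![p₁, p₂, p₃, p₄, p₅, 0, 0] 5 (w 0)) 6 (w 1), update (update (fun _ _ => 0) (w 2) g)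
        (w 6) g') y' ∧ Codes I y' (D.t, []) ∧ y'.1 4 = p₅ := by
      have h := reaches_iff.2 hw
      rw [hk] at h
      generalize (D.t, ([] : List Item)) = s' at h
      induction h with
      | refl => exact ⟨_, .refl, hC, rfl⟩
      | tail _ h ih =>
        obtain ⟨y', h₈, h₉, h₁₀⟩ := ih
        obtain ⟨y'', h₁₁, h₁₂, h₁₃⟩ := h₉.turn_complete hL hν h
        exact ⟨y'', h₈.tail h₁₁, h₁₂, h₁₃.trans h₁₀⟩
    exact ⟨_, _, y', hr, hR, hy, hC'.top, (hC'.vertex.same_iff (h₄ ▸ ht)).2 rfl⟩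

/-! ### Instances and their data -/

def forgetFin {n : ℕ} (e : Fin n × ℕ × ℕ × Fin n) : ℕ × ℕ × ℕ × ℕ := (e.1, e.2.1, e.2.2.1, e.2.2.2)

theorem flatMap_encEdge {n : ℕ} (es : List (Fin n × ℕ × ℕ × Fin n)) :
    es.flatMap encEdge = (es.map forgetFin).flatMap encTuple := by
  rw [List.flatMap_map]
  rfl

theorem exists_map_forgetFin {n : ℕ} : ∀ l : List (ℕ × ℕ × ℕ × ℕ),
    (∀ e ∈ l, e.1 < n ∧ e.2.2.2 < n) → ∃ es : List (Fin n × ℕ × ℕ × Fin n), es.map forgetFin = l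
  | [], _ => ⟨[], rfl⟩
  | (u, a, d, v) :: l, h => by
    obtain ⟨h₁, h₂⟩ := List.forall_mem_cons.1 h
    obtain ⟨es, rfl⟩ := exists_map_forgetFin l h₂
    exact ⟨(⟨u, h₁.1⟩, a, d, ⟨v, h₁.2⟩) :: es, rfl⟩

theorem mem_map_forgetFin {n : ℕ} {es : List (Fin n × ℕ × ℕ × Fin n)} {u : Fin n} {a d v : ℕ} :
    (u.1, a, d, v) ∈ es.map forgetFin ↔ ∃ v' : Fin n, v'.1 = v ∧ (u, a, d, v') ∈ es := by
  simp only [List.mem_map, forgetFin, Prod.mk.injEq]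
  constructor
  · rintro ⟨⟨u', a', d', v'⟩, h, h₁, rfl, rfl, rfl⟩
    exact ⟨v', rfl, Fin.ext h₁ ▸ h⟩
  · rintro ⟨v', rfl, h⟩
    exact ⟨_, h, rfl, rfl, rfl, rfl⟩

theorem isDataPath_iff {n : ℕ} {G : DataGraph n} {es : List (Fin n × ℕ × ℕ × Fin n)}
    (h : ∀ e, e ∈ es ↔ e ∈ G.edges) {w : DataWord} : ∀ {u v : Fin n}, G.IsDataPath u w v ↔
      Path (fun V a d V' => (V, a, d, V') ∈ es.map forgetFin) u w v := by
  induction w with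
  | nil =>
    intro u v
    constructor
    · rintro ⟨⟩
      rfl
    · intro h
      rw [Fin.ext h]
      exact .nil _
  | cons s w ih =>
    obtain ⟨a, d⟩ := s
    intro u v
    constructor
    · rintro (_ | ⟨h₁, h₂⟩)
      exact ⟨_, mem_map_forgetFin.2 ⟨_, rfl, (h _).2 h₁⟩, ih.1 h₂⟩
    · rintro ⟨m, h₁, h₂⟩
      obtain ⟨m', rfl, h₃⟩ := mem_map_forgetFin.1 h₁
      exact .cons ((h _).1 h₃) (ih.2 h₂)

/-- Instances and data carry the same information: tuples with vertices in range list the edges of a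
graph, and a functional list is the graph of a valuation. Repetitions in the listings are permitted
on both sides. -/
theorem mem_evalProblem_iff : I ∈ evalProblem ↔
    ∃ p₁ p₂ p₃ p₄ p₅ D ν, Layout I p₁ p₂ p₃ p₄ p₅ D ∧ D.Ok ∧ D.r.size = I.2 ∧
      (∀ y d, (y, d) ∈ D.vs ↔ ν y = some d) ∧ ∃ w ∈ D.r.lang ν, Path D.edge D.s w D.t := by
  constructor
  · rintro ⟨⟨n, G, r, ν, hc, s, t⟩, ⟨es, vs, hes, hvs, hx⟩, hk, w, hw, hp⟩
    have h := seg_input I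
    generalize hq : I.1.length + 1 = q at h
    rw [hx.trans (by rw [flatMap_encEdge] : _ = List.replicate n Sym.vertex ++
      (es.map forgetFin).flatMap encTuple ++ encExpr r ++ vs.flatMap encEntry ++ encNat s ++
      encNat t)] at h
    simp only [seg_append] at h
    subst hq
    obtain ⟨p₅, ⟨p₄, ⟨p₃, ⟨p₂, ⟨p₁, h₁, h₂⟩, h₃⟩, h₄⟩, h₅⟩, h₆⟩ := h
    refine ⟨p₁, p₂, p₃, p₄, p₅, ⟨n, es.map forgetFin, r, vs, s, t⟩, ν, ⟨h₁, h₂, h₃, h₄, h₅, h₆⟩,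
      ⟨?_, s.2, t.2, fun y d d' h h' => ?_, fun y hy => ?_⟩, hk.symm, hvs, w, hw,
      (isDataPath_iff hes).1 hp⟩
    · intro e he
      obtain ⟨e, -, rfl⟩ := List.mem_map.1 he
      exact ⟨e.1.2, e.2.2.2.2⟩
    · dsimp only at h h'
      rw [hvs] at h h'
      exact Option.some.inj (h.symm.trans h')
    · obtain ⟨d, hd⟩ := Option.isSome_iff_exists.1 (hc y hy)
      exact ⟨d, (hvs y d).2 hd⟩
  · rintro ⟨p₁, p₂, p₃, p₄, p₅, ⟨n, es, r, vs, s, t⟩, ν, hL, hD, hk, hν, w, hw, hp⟩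
    obtain ⟨es, rfl⟩ : ∃ es' : List (Fin n × ℕ × ℕ × Fin n), es'.map forgetFin = es :=
      exists_map_forgetFin es hD.edges
    have hes : ∀ e, e ∈ es ↔ e ∈ (DataGraph.mk es.toFinset).edges := by simp
    refine ⟨⟨n, ⟨es.toFinset⟩, r, ν, fun y hy => ?_, ⟨s, hD.src⟩, ⟨t, hD.tgt⟩⟩,
      ⟨es, vs, hes, hν, ?_⟩, hk.symm, w, hw, (isDataPath_iff hes).2 hp⟩
    · obtain ⟨d, hd⟩ := hD.fv y hy
      exact Option.isSome_iff_exists.2 ⟨d, (hν y d).1 hd⟩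
    · rw [flatMap_encEdge]
      refine (seg_input I).word ?_
      simp only [seg_append]
      exact ⟨p₅, ⟨p₄, ⟨p₃, ⟨p₂, ⟨p₁, hL.verts, hL.edges⟩, hL.expr⟩, hL.entries⟩, hL.src⟩, hL.tgt⟩

end Decision

end XNL

theorem mainTheorem8 : XNL.InUniformXNL REWB.evalProblem := by
  obtain ⟨q, hq⟩ := XNL.exists_loop XNL.dfn_setUp XNL.dfn_turn XNL.dfn_done
  obtain ⟨M, f, hf, hM⟩ := XNL.exists_machine q
  exact ⟨M, f, hf, fun x k => ⟨(hM x k).1, (hM x k).2.1.trans ((hq (x, k)).trans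
    (XNL.loop_iff.trans XNL.mem_evalProblem_iff.symm)), (hM x k).2.2⟩⟩
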